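/- A Boolean formula is a finite node-labelled rooted tree; its leaves may carry variables or the constants $0,1$, negations have one child, conjunctions and disjunctions have any finite number of children (an empty conjunction is $1$, an empty disjunction is $0$). The size $|\varphi|$ of a formula is its number of nodes. A tree-shaped circuit is a system of Boolean equations $\mathcal S=(x_i=\varphi_i)_{1\le i\le n}$, $n\ge 1$, where the $\varphi_i$ are Boolean formulas over $x_1,\dots,x_n$ such that the directed graph on $\{x_1,\dots,x_n\}$ with an edge $(x_i,x_j)$ whenever $x_j$ occurs in $\varphi_i$ is a tree with root $x_1$. Its width is the maximal number of occurrences of a variable $x_j$ in a formula $\varphi_i$. To evaluate $\mathcal S$ means to compute the truth value of $x_1$ from a pointer representation of $\mathcal S$, i.e. every $\varphi_i$ is given by the list of its nodes with their labels and the list of its edges, where nodes and variables are named by consecutive binary numbers. Space is the work space of a deterministic Turing machine with a read-only input tape. Theorem. (1) There is a deterministic Turing machine that evaluates any given tree-shaped circuit $\mathcal S=(x_i=\varphi_i)_{1\le i\le n}$ of width $m\ge 2$ in space $O(\log s+\log n\cdot\log m)$, where $s=\max_{1\le i\le n}|\varphi_i|$ and the implied constant is absolute. (2) For every fixed $m\in\mathbb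 N$ there is a deterministic Turing machine that evaluates any given tree-shaped circuit of width at most $m$ in space logarithmic in the length of the input. (3) The following problem is in $\mathsf L$ (deterministic logarithmic space): given two finite edge-labelled rooted trees $T_1,T_2$ as pointer structures (i.e. by the list of their labelled edges, with nodes named by consecutive binary numbers) and nodes $v_1$ of $T_1$ and $v_2$ of $T_2$, are $v_1$ and $v_2$ bisimilar in the disjoint union of $T_1$ and $T_2$? Here in an edge-labelled tree any two nodes are joined by edges of at most one label, and two nodes of an edge-labelled graph are bisimilar if they are related by some relation $R$ such that for all $(u,v)\in R$ and every label $a$: for every edge $u\xrightarrow{a}u'$ there is an edge $v\xrightarrow{a}v'$ with $(u',v')\in R$, and for every edge $v\xrightarrow{a}v'$ there is an edge $u\xrightarrow{a}u'$ with $(u',v')\in R$. -/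

import Mathlib

/-! ### Rooted trees -/

/-- `p` is a path (a node sequence `v₀, …, vₗ` with an edge from each node to the next one,
`l ≥ 0`) from `u` to `v` in the directed graph with edge relation `E`. -/
def IsPathFromTo {V : Type} (E : V → V → Prop) (u v : V) (p : List V) : Prop :=
  p.head? = some u ∧ p.getLast? = some v ∧ p.IsChain E

/-- The directed graph `E` is a tree with root `r`: every node is reached from `r` by exactly one
path. -/
def IsTreeWithRoot {V : Type} (E : V → V → Prop) (r : V) : Prop :=
  ∀ v, ∃! p : List V, IsPathFromTo E r v p

/-- The directed graph `E` is a rooted tree. -/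
def IsRootedTree {V : Type} (E : V → V → Prop) : Prop :=
  ∃ r, IsTreeWithRoot E r

theorem IsPathFromTo.snoc {V : Type} {E : V → V → Prop} {u v w : V} {p : List V}
    (hp : IsPathFromTo E u v p) (h : E v w) : IsPathFromTo E u w (p ++ [w]) := by
  obtain ⟨h1, h2, h3⟩ := hp
  refine ⟨?_, by simp, ?_⟩
  · cases p with
    | nil => simp at h1
    | cons a l => simpa using h1
  · rw [List.isChain_append]
    refine ⟨h3, by simp, ?_⟩
    intro x hx y hy
    rw [h2] at hx
    simp only [Option.mem_def, Option.some.injEq, List.head?_cons] at hx hy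
    subst hx; subst hy; exact h

theorem IsPathFromTo.extend {V : Type} {E : V → V → Prop} {u v w : V} {p : List V}
    (hp : IsPathFromTo E u v p) (h : Relation.TransGen E v w) :
    ∃ q, IsPathFromTo E u w q ∧ p.length < q.length := by
  induction h with
  | single h => exact ⟨_, hp.snoc h, by simp⟩
  | tail _ h ih =>
    obtain ⟨q, hq, hl⟩ := ih
    exact ⟨_, hq.snoc h, by simp; omega⟩

/-- In a finite rooted tree one can do recursion from the leaves to the root. -/
theorem IsTreeWithRoot.wellFounded {V : Type} [Finite V] {E : V → V → Prop} {r : V}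
    (h : IsTreeWithRoot E r) : WellFounded (fun v u => E u v) := by
  have hirr : ∀ v, ¬ Relation.TransGen E v v := by
    intro v hv
    obtain ⟨p, hp, hu⟩ := h v
    obtain ⟨q, hq, hl⟩ := hp.extend hv
    have := hu q hq
    subst this
    exact lt_irrefl _ hl
  let R : V → V → Prop := fun v u => Relation.TransGen E u v
  have : IsTrans V R := ⟨fun _ _ _ h1 h2 => Relation.TransGen.trans h2 h1⟩
  have : Std.Irrefl R := ⟨hirr⟩
  have hwf : WellFounded R := Finite.wellFounded_of_trans_of_irrefl R
  exact Subrelation.wf (fun {_ _} h => Relation.TransGen.single h) hwf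

/-! ### Boolean formulas and tree-shaped circuits -/

/-- The labels of the nodes of a Boolean formula over the variables `x_0, …, x_{n-1}`. -/
inductive GateLabel (n : ℕ) : Type where
  | var (j : Fin n)
  | const (b : Bool)
  | neg
  | conj
  | disj

/-- A Boolean formula over the variables `x_0, …, x_{n-1}`, as a node-labelled rooted tree with node
set `{0, …, size - 1}` whose edges (from a node to its children) are listed, each exactly once and
in any order. Variables and constants label leaves, negations have one child, conjunctions and
disjunctions have any finite number of children. -/
structure BoolFormula (n : ℕ) : Type where
  size : ℕ
  label : Fin size → GateLabel n
  edges : List (Fin size × Fin size)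
  root : Fin size
  nodup : edges.Nodup
  tree : IsTreeWithRoot (fun u v => (u, v) ∈ edges) root
  var_leaf : ∀ u j, label u = .var j → ∀ v, (u, v) ∉ edges
  const_leaf : ∀ u b, label u = .const b → ∀ v, (u, v) ∉ edges
  neg_unary : ∀ u, label u = .neg → ∃! v, (u, v) ∈ edges

/-- The number of occurrences of the variable `x_j` in a formula. -/
noncomputable def BoolFormula.occ {n : ℕ} (φ : BoolFormula n) (j : Fin n) : ℕ :=
  Nat.card {u : Fin φ.size // φ.label u = .var j}

/-- A tree-shaped circuit: a system of equations `x_i = φ_i`, `0 ≤ i < n`, such that the graph on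
the variables with an edge from `x_i` to `x_j` if `x_j` occurs in `φ_i` is a tree whose root is the
first variable. -/
structure TreeCircuit : Type where
  n : ℕ
  pos : 0 < n
  φ : Fin n → BoolFormula n
  tree : IsTreeWithRoot (fun i j => ∃ u, (φ i).label u = .var j) ⟨0, pos⟩

namespace TreeCircuit

/-- The maximal size (number of nodes) of one of the formulas. -/
def maxSize (S : TreeCircuit) : ℕ :=
  Finset.univ.sup fun i => (S.φ i).size

/-- The maximal number of occurrences of a variable in one of the formulas. -/
noncomputable def width (S : TreeCircuit) : ℕ :=
  Finset.univ.sup fun i => Finset.univ.sup fun j => (S.φ i).occ j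

/-- `g` assigns to all nodes of all formulas the truth values prescribed by the labels, where a node
labelled by `x_j` has the value of (the root of) `φ_j`. An empty conjunction is true and an empty
disjunction is false. -/
def IsEvaluation (S : TreeCircuit) (g : (i : Fin S.n) → Fin (S.φ i).size → Bool) : Prop :=
  ∀ i u, match (S.φ i).label u with
    | .var j => g i u = g j (S.φ j).root
    | .const b => g i u = b
    | .neg => ∀ v, (u, v) ∈ (S.φ i).edges → g i u = !(g i v)
    | .conj => g i u = true ↔ ∀ v, (u, v) ∈ (S.φ i).edges → g i v = true
    | .disj => g i u = true ↔ ∃ v, (u, v) ∈ (S.φ i).edges ∧ g i v = true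

/-- `a` is a direct input of the gate `b`. -/
def Input (S : TreeCircuit) (a b : (i : Fin S.n) × Fin (S.φ i).size) : Prop :=
  (∃ i u v, (u, v) ∈ (S.φ i).edges ∧ b = ⟨i, u⟩ ∧ a = ⟨i, v⟩) ∨
    ∃ j, (S.φ b.1).label b.2 = .var j ∧ a = ⟨j, (S.φ j).root⟩

theorem input_wellFounded (S : TreeCircuit) : WellFounded S.Input := by
  have key : ∀ i u, Acc S.Input ⟨i, u⟩ := by
    intro i
    induction i using S.tree.wellFounded.induction with
    | _ i ihi =>
      intro u
      induction u using (S.φ i).tree.wellFounded.induction with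
      | _ u ihu =>
        refine ⟨_, ?_⟩
        rintro a (⟨i', u', v, hv, hb, rfl⟩ | ⟨j, hj, rfl⟩)
        · cases hb
          exact ihu v hv
        · exact ihi j ⟨u, hj⟩ _
  exact ⟨fun ⟨i, u⟩ => key i u⟩

open Classical in
/-- The truth values of the gates of a tree-shaped circuit are well defined. -/
theorem existsUnique_isEvaluation (S : TreeCircuit) : ∃! g, S.IsEvaluation g := by
  let F : (b : (i : Fin S.n) × Fin (S.φ i).size) → ((a : _) → S.Input a b → Bool) → Bool :=
    fun b r => match h : (S.φ b.1).label b.2 with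
      | .var j => r ⟨j, (S.φ j).root⟩ (Or.inr ⟨j, h, rfl⟩)
      | .const c => c
      | .neg => decide (∃ v, ∃ hv : (b.2, v) ∈ (S.φ b.1).edges,
          r ⟨b.1, v⟩ (Or.inl ⟨b.1, b.2, v, hv, rfl, rfl⟩) = false)
      | .conj => decide (∀ v, ∀ hv : (b.2, v) ∈ (S.φ b.1).edges,
          r ⟨b.1, v⟩ (Or.inl ⟨b.1, b.2, v, hv, rfl, rfl⟩) = true)
      | .disj => decide (∃ v, ∃ hv : (b.2, v) ∈ (S.φ b.1).edges,
          r ⟨b.1, v⟩ (Or.inl ⟨b.1, b.2, v, hv, rfl, rfl⟩) = true)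
  let G : (i : Fin S.n) × Fin (S.φ i).size → Bool := S.input_wellFounded.fix F
  have hG : ∀ b, G b = F b (fun a _ => G a) := fun b => S.input_wellFounded.fix_eq F b
  refine ⟨fun i u => G ⟨i, u⟩, ?_, ?_⟩
  · intro i u
    have h := hG ⟨i, u⟩
    simp only [F] at h
    split at h <;> rename_i heq <;> rw [heq] <;> dsimp only
    · exact h
    · exact h
    · intro v hv
      obtain ⟨v', _, hu⟩ := (S.φ i).neg_unary u heq
      have huv : ∀ w, (u, w) ∈ (S.φ i).edges → w = v := fun w hw => (hu w hw).trans (hu v hv).symm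
      rw [h]
      cases hgv : G ⟨i, v⟩
      · simp only [Bool.not_false, decide_eq_true_eq]
        exact ⟨v, hv, hgv⟩
      · simp only [Bool.not_true, decide_eq_false_iff_not]
        rintro ⟨w, hw, hwf⟩
        rw [huv w hw, hgv] at hwf
        cases hwf
    · rw [h]; simp
    · rw [h]; simp
  · intro g hg
    have key : ∀ b : (i : Fin S.n) × Fin (S.φ i).size, g b.1 b.2 = G b := by
      intro b
      induction b using S.input_wellFounded.induction with
      | _ b ih =>
        obtain ⟨i, u⟩ := b
        have hc : ∀ v, (u, v) ∈ (S.φ i).edges → g i v = G ⟨i, v⟩ := fun v hv =>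
          ih ⟨i, v⟩ (Or.inl ⟨i, u, v, hv, rfl, rfl⟩)
        have h := hG ⟨i, u⟩
        have h' := hg i u
        simp only [F] at h
        split at h <;> rename_i heq <;> rw [heq] at h' <;>
          dsimp only at h' <;> rw [h]
        · rename_i j
          rw [h']
          exact ih ⟨j, (S.φ j).root⟩ (Or.inr ⟨j, heq, rfl⟩)
        · exact h'
        · obtain ⟨v, hv, hu⟩ := (S.φ i).neg_unary u heq
          simp only []
          rw [h' v hv, hc v hv]
          cases hgv : G ⟨i, v⟩
          · symm
            simp only [Bool.not_false, decide_eq_true_eq]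
            exact ⟨v, hv, hgv⟩
          · symm
            simp only [Bool.not_true, decide_eq_false_iff_not]
            rintro ⟨w, hw, hwf⟩
            rw [hu w hw, hgv] at hwf
            cases hwf
        · rw [Bool.eq_iff_iff, h', decide_eq_true_eq]
          exact forall₂_congr fun v hv => by rw [hc v hv]
        · rw [Bool.eq_iff_iff, h', decide_eq_true_eq]
          refine exists_congr fun v => ?_
          constructor
          · rintro ⟨hv, h1⟩
            exact ⟨hv, by rw [← hc v hv]; exact h1⟩
          · rintro ⟨hv, h1⟩
            exact ⟨hv, by rw [hc v hv]; exact h1⟩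
    funext i u
    exact key ⟨i, u⟩

/-- The truth value of a tree-shaped circuit, i.e. of its first variable. -/
noncomputable def value (S : TreeCircuit) : Bool :=
  S.existsUnique_isEvaluation.choose ⟨0, S.pos⟩ (S.φ ⟨0, S.pos⟩).root

end TreeCircuit

/-! ### Edge-labelled graphs and bisimulation -/

/-- `R` is a bisimulation on the edge-labelled graph with nodes `V`, labels `A` and labelled edge
relation `E`. -/
def IsBisimulation {V A : Type} (E : V → A → V → Prop) (R : V → V → Prop) : Prop :=
  ∀ u v, R u v →
    (∀ a u', E u a u' → ∃ v', E v a v' ∧ R u' v') ∧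
    (∀ a v', E v a v' → ∃ u', E u a u' ∧ R u' v')

/-- Two nodes are bisimilar if some bisimulation relates them. -/
def Bisimilar {V A : Type} (E : V → A → V → Prop) (u v : V) : Prop :=
  ∃ R, IsBisimulation E R ∧ R u v

/-- The labelled edge relation of the disjoint union of two edge-labelled graphs. -/
def disjointUnionEdge {V W A : Type} (E : V → A → V → Prop) (F : W → A → W → Prop) :
    V ⊕ W → A → V ⊕ W → Prop
  | .inl u, a, .inl v => E u a v
  | .inr u, a, .inr v => F u a v
  | _, _, _ => False

/-- A finite edge-labelled graph as a pointer structure: the node set is `{0, …, size - 1}`, and the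
labelled edges `(u, a, v)` are listed, each exactly once and in any order. Labels are arbitrary
natural numbers. -/
structure PointerGraph : Type where
  size : ℕ
  edges : List (Fin size × ℕ × Fin size)
  nodup : edges.Nodup

namespace PointerGraph

def Edge (G : PointerGraph) (u : Fin G.size) (a : ℕ) (v : Fin G.size) : Prop :=
  (u, a, v) ∈ G.edges

/-- An edge-labelled tree: no two edges with different labels connect the same nodes, and the
underlying unlabelled graph is a rooted tree. -/
def IsTree (G : PointerGraph) : Prop :=
  (∀ u v a b, G.Edge u a v → G.Edge u b v → a = b) ∧
    IsRootedTree fun u v => ∃ a, G.Edge u a v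

end PointerGraph

/-! ### Encoding of inputs as words over a finite alphabet -/

inductive InputSym : Type where
  | bit (b : Bool)
  | comma
  | semicolon
  | hash
  | var
  | const (b : Bool)
  | neg
  | conj
  | disj

/-- Binary encoding of a natural number, least significant bit first. -/
def encodeNat (k : ℕ) : List InputSym :=
  k.bits.map InputSym.bit

def GateLabel.encode {n : ℕ} : GateLabel n → List InputSym
  | .var j => .var :: encodeNat j
  | .const b => [.const b]
  | .neg => [.neg]
  | .conj => [.conj]
  | .disj => [.disj]

/-- Pointer representation of a formula: the list of the nodes with their labels, followed by the
list of the edges. -/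
def BoolFormula.encode {n : ℕ} (φ : BoolFormula n) : List InputSym :=
  (List.finRange φ.size).flatMap (fun (u : Fin φ.size) =>
      encodeNat u ++ [InputSym.comma] ++ (φ.label u).encode ++ [InputSym.semicolon]) ++ [InputSym.hash] ++
    φ.edges.flatMap (fun e =>
      encodeNat e.1 ++ [InputSym.comma] ++ encodeNat e.2 ++ [InputSym.semicolon]) ++ [InputSym.hash]

/-- Pointer representation of a tree-shaped circuit: its formulas, one after the other. -/
def TreeCircuit.encode (S : TreeCircuit) : List InputSym :=
  (List.finRange S.n).flatMap fun i => (S.φ i).encode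

/-- Pointer representation of an edge-labelled graph: the number of nodes, followed by the list of
the labelled edges. -/
def PointerGraph.encode (G : PointerGraph) : List InputSym :=
  encodeNat G.size ++ [InputSym.hash] ++
    G.edges.flatMap (fun e =>
      encodeNat e.1 ++ [InputSym.comma] ++ encodeNat e.2.1 ++ [InputSym.comma] ++
        encodeNat e.2.2 ++ [InputSym.semicolon]) ++ [InputSym.hash]

/-- An instance of the bisimulation problem: two graphs and a node of each of them. -/
def encodeBisimInstance (G₁ G₂ : PointerGraph) (v₁ : Fin G₁.size) (v₂ : Fin G₂.size) : List InputSym :=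
  G₁.encode ++ G₂.encode ++ encodeNat v₁ ++ [InputSym.hash] ++ encodeNat v₂ ++ [InputSym.hash]

/-- The language of the bisimulation problem for trees given as pointer structures. -/
def BisimTrees : Set (List InputSym) :=
  {w | ∃ (G₁ G₂ : PointerGraph) (v₁ : Fin G₁.size) (v₂ : Fin G₂.size),
    w = encodeBisimInstance G₁ G₂ v₁ v₂ ∧ G₁.IsTree ∧ G₂.IsTree ∧
      Bisimilar (disjointUnionEdge G₁.Edge G₂.Edge) (.inl v₁) (.inr v₂)}

/-! ### Space-bounded deterministic Turing machines -/

inductive HeadMove : Type where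
  | left
  | stay
  | right

/-- What the head on the input tape sees: the input word stands between two end markers. -/
inductive InputCell (α : Type) : Type where
  | leftEnd
  | letter (a : α)
  | rightEnd

/-- A deterministic Turing machine with a two-way read-only input tape over the alphabet `α` and
finitely many work tapes. In each step it either halts with an output bit, or it changes its state,
moves its input head, and writes on and moves along its work tapes. -/
structure OfflineTM (α : Type) : Type 1 where
  State : Type
  WorkSym : Type
  finiteState : Finite State
  finiteWorkSym : Finite WorkSym
  tapes : ℕ
  start : State
  blank : WorkSym
  trans : State → InputCell α → (Fin tapes → WorkSym) →
    Bool ⊕ (State × HeadMove × (Fin tapes → WorkSym × HeadMove))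

namespace OfflineTM

variable {α : Type}

/-- The work tapes are infinite to the right, with cells `0, 1, 2, …`. -/
structure Config (M : OfflineTM α) : Type where
  state : M.State
  inputHead : ℕ
  work : Fin M.tapes → ℕ → M.WorkSym
  head : Fin M.tapes → ℕ

/-- The input tape: cell `0` holds the left end marker, cells `1, …, |w|` hold the input word `w`,
and cell `|w| + 1` holds the right end marker. -/
def readInput (w : List α) : ℕ → InputCell α
  | 0 => .leftEnd
  | p + 1 => match w[p]? with
    | some a => .letter a
    | none => .rightEnd

/-- Head movement; a head on cell `0` that is told to move left stays there. -/
def moveHead (p : ℕ) : HeadMove → ℕ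
  | .left => p - 1
  | .stay => p
  | .right => p + 1

def init (M : OfflineTM α) : M.Config where
  state := M.start
  inputHead := 0
  work := fun _ _ => M.blank
  head := fun _ => 0

/-- One step on input `w`: an output bit if the machine halts, otherwise the next configuration. The
input head never leaves the cells `0, …, |w| + 1`. -/
def step (M : OfflineTM α) (w : List α) (c : M.Config) : Bool ⊕ M.Config :=
  match M.trans c.state (readInput w c.inputHead) (fun t => c.work t (c.head t)) with
  | .inl b => .inl b
  | .inr (q, d, act) => .inr
    { state := q
      inputHead := min (moveHead c.inputHead d) (w.length + 1)
      work := fun t => Function.update (c.work t) (c.head t) (act t).1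
      head := fun t => moveHead (c.head t) (act t).2 }

/-- The configuration `c` occurs in the computation on input `w`. -/
def Reaches (M : OfflineTM α) (w : List α) (c : M.Config) : Prop :=
  Relation.ReflTransGen (fun c₁ c₂ => M.step w c₁ = .inr c₂) M.init c

/-- On input `w`, the machine halts with output `b`. -/
def Outputs (M : OfflineTM α) (w : List α) (b : Bool) : Prop :=
  ∃ c, M.Reaches w c ∧ M.step w c = .inl b

/-- On input `w`, the machine visits at most `s` cells of each of its work tapes. -/
def UsesSpaceAtMost (M : OfflineTM α) (w : List α) (s : ℝ) : Prop :=
  ∀ c, M.Reaches w c → ∀ t, (c.head t : ℝ) + 1 ≤ s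

end OfflineTM

/-- The class of languages (over a finite alphabet) that are decided in logarithmic space. -/
def InLogspace {α : Type} (L : Set (List α)) : Prop :=
  ∃ (M : OfflineTM α) (C : ℝ), ∀ w : List α,
    (w ∈ L → M.Outputs w true) ∧ (w ∉ L → M.Outputs w false) ∧
      M.UsesSpaceAtMost w (C * Real.log (w.length + 2))

/-! ### While programs on tapes -/

namespace TapeProg

open OfflineTM

/-! The truth value is found by a depth-first evaluation that remembers almost nothing. The formulas
of a circuit, called blocks, form a tree; the weight of a block is the number of blocks in its
subtree. A child block is heavy if it has at least half of the weight of its parent, and light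
otherwise. A block has at most one heavy child, and a step to a light child more than halves the
weight, so a branch contains at most log n light steps (`Gates.Spec.heavy_unique`,
`Gates.Spec.log_weight_lt`).

Inside a block no stack is needed. A formula is a tree, so the parent of a gate can be recomputed,
and the inputs of a gate are scanned in the order of their numbers, so that after the return from an
input the scan resumes behind it. Before a light child is evaluated, a frame is pushed. It names the
gate that needs the child only by its number among all gates that use this child. These gates are
the occurrences of one variable in one formula, so the number is below the width m and a frame has
O(log m) symbols (`CircuitGates.index_lt`).

A heavy child is at first not evaluated at all. The block is evaluated twice, once for each assumed
value h of its heavy child. If the two results agree, the block has this value. If they differ, the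
value is h xor v₀, where v₀ is the result for h = 0; what remains is to evaluate the heavy child and
to add v₀ to an accumulated bit. Thus a whole chain of heavy blocks needs one frame and a few bits.
When the value of the chain is known, its first block is recomputed from the current block, and this
block and the frame together give the gate to return to. The stack has O(log n · log m) symbols;
beside it there is a fixed number of registers with values polynomial in the length of the input,
i.e. of size O(log s + log n) (`CircuitGates.length_encode_le`). The argument is carried by
`Gates.Spec.gateCorrect`, `Gates.Spec.blockCorrect` and `Gates.Spec.correct`, and is summed up in
`Gates.exists_machine`.

For bisimilarity of trees there is a gate for each pair (u, v), and there are auxiliary gates that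
say that u is matched by a child of v, or v by a child of u, along edges of the same label. The
blocks belong to the pairs, and the block above a pair is that of the pair of parents, since parents
in trees are unique. Each pair is used by at most two gates, so frames have constant size, and there
are polynomially many blocks. Hence the same procedure runs in logarithmic space
(`TreeGates.Encodes.spec`, `TreeGates.Encodes.val_start_iff`).

On the machine side, while programs with a big-step semantics that accounts for space are compiled
to Turing machines (`TapeProg.exists_machine`). The predicate `LS` collects the functions computed
by such programs on registers with polynomially bounded values; its closure properties make it
routine that parents, weights, heavy chains and the syntax of the input are computable.
`StackProg.exists_machine` adds the stack. -/

/-- Symbols on work tapes: `none` is the blank, `some none` is a marker, and `some (some b)` is the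
binary digit `b`. -/
abbrev Sym := Option (Option Bool)

/-- A tape together with the position of its head. -/
structure Tape where
  cells : ℕ → Sym
  pos : ℕ

def Tape.scan (T : Tape) : Sym := T.cells T.pos

/-- Write a symbol and move the head. -/
def Tape.act (T : Tape) (a : Sym) (d : HeadMove) : Tape :=
  ⟨Function.update T.cells T.pos a, moveHead T.pos d⟩

/-- The position of the input head, and the work tapes. -/
structure Mem where
  inp : ℕ
  tape : ℕ → Tape

def Mem.set (σ : Mem) (t : ℕ) (T : Tape) : Mem :=
  { σ with tape := Function.update σ.tape t T }

def Mem.blank : Mem := ⟨0, fun _ => ⟨fun _ => none, 0⟩⟩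

/-- Tests on the scanned input cell, or on the scanned symbols of two work tapes. -/
inductive Test (α : Type) : Type where
  | input (P : InputCell α → Bool)
  | tapes (s t : ℕ) (P : Sym → Sym → Bool)

/-- While programs: `op t s f d` writes on tape `t` the symbol `f a`, where `a` is the symbol scanned
on tape `s`, and then moves the head of tape `t`. -/
inductive Cmd (α : Type) : Type where
  | move (d : HeadMove)
  | op (t s : ℕ) (f : Sym → Sym) (d : HeadMove)
  | seq (a b : Cmd α)
  | ite (c : Test α) (a b : Cmd α)
  | loop (c : Test α) (a : Cmd α)

variable {α : Type}

def Test.eval (w : List α) (σ : Mem) : Test α → Bool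
  | .input P => P (readInput w σ.inp)
  | .tapes s t P => P (σ.tape s).scan (σ.tape t).scan

/-- Big-step semantics; `sp` bounds the number of visited cells on each tape. -/
inductive Exec (w : List α) (sp : ℕ) : Cmd α → Mem → Mem → Prop where
  | move (d : HeadMove) (σ : Mem) :
      Exec w sp (.move d) σ { σ with inp := min (moveHead σ.inp d) (w.length + 1) }
  | op (t s : ℕ) (f : Sym → Sym) (d : HeadMove) (σ : Mem) :
      moveHead (σ.tape t).pos d + 1 ≤ sp →
      Exec w sp (.op t s f d) σ (σ.set t ((σ.tape t).act (f (σ.tape s).scan) d))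
  | seq {a b : Cmd α} {σ σ' σ'' : Mem} :
      Exec w sp a σ σ' → Exec w sp b σ' σ'' → Exec w sp (.seq a b) σ σ''
  | ite_true {c : Test α} {a b : Cmd α} {σ σ' : Mem} :
      c.eval w σ = true → Exec w sp a σ σ' → Exec w sp (.ite c a b) σ σ'
  | ite_false {c : Test α} {a b : Cmd α} {σ σ' : Mem} :
      c.eval w σ = false → Exec w sp b σ σ' → Exec w sp (.ite c a b) σ σ'
  | loop_true {c : Test α} {a : Cmd α} {σ σ' σ'' : Mem} :
      c.eval w σ = true → Exec w sp a σ σ' → Exec w sp (.loop c a) σ' σ'' →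
      Exec w sp (.loop c a) σ σ''
  | loop_false {c : Test α} {a : Cmd α} {σ : Mem} :
      c.eval w σ = false → Exec w sp (.loop c a) σ σ

/-! ### Compilation to Turing machines -/

inductive Instr (α : Type) : Type where
  | move (d : HeadMove)
  | op (t s : ℕ) (f : Sym → Sym) (d : HeadMove)
  | branch (c : Test α) (target : ℕ)
  | jump (target : ℕ)

/-- Code for a program, to be placed at address `o`. -/
def Cmd.compile : Cmd α → ℕ → List (Instr α)
  | .move d, _ => [.move d]
  | .op t s f d, _ => [.op t s f d]
  | .seq a b, o => a.compile o ++ b.compile (o + (a.compile o).length)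
  | .ite c a b, o =>
      let l := (a.compile (o + 1)).length
      let l' := (b.compile (o + 1 + l + 1)).length
      .branch c (o + 1 + l + 1) :: (a.compile (o + 1) ++
        (.jump (o + 1 + l + 1 + l') :: b.compile (o + 1 + l + 1)))
  | .loop c a, o =>
      .branch c (o + 1 + (a.compile (o + 1)).length + 1) :: (a.compile (o + 1) ++ [.jump o])

def Test.Below (T : ℕ) : Test α → Prop
  | .input _ => True
  | .tapes s t _ => s < T ∧ t < T

def Instr.Below (T : ℕ) : Instr α → Prop
  | .op t s _ _ => t < T ∧ s < T
  | .branch c _ => c.Below T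
  | _ => True

theorem Instr.Below.mono {T T' : ℕ} (h : T ≤ T') {i : Instr α} (hi : i.Below T) : i.Below T' := by
  rcases i with d | ⟨t, s, f, d⟩ | ⟨_ | ⟨s, t, P⟩, k⟩ | k <;>
    simp only [Instr.Below, Test.Below] at * <;> omega

theorem Test.exists_below (c : Test α) : ∃ T, c.Below T := by
  rcases c with _ | ⟨s, t, P⟩
  · exact ⟨0, trivial⟩
  · exact ⟨s + t + 1, by simp only [Test.Below]; omega⟩

/-- A program uses finitely many tapes. -/
theorem Cmd.exists_below (c : Cmd α) : ∃ T, ∀ o, ∀ i ∈ c.compile o, i.Below T := by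
  induction c with
  | move d => exact ⟨0, by simp [Cmd.compile, Instr.Below]⟩
  | op t s f d =>
    exact ⟨t + s + 1, by simp only [Cmd.compile, List.mem_singleton, forall_eq, Instr.Below]; omega⟩
  | seq a b iha ihb =>
    obtain ⟨T, hT⟩ := iha
    obtain ⟨T', hT'⟩ := ihb
    refine ⟨max T T', fun o i hi => ?_⟩
    rcases List.mem_append.1 hi with hi | hi
    · exact (hT _ i hi).mono (le_max_left _ _)
    · exact (hT' _ i hi).mono (le_max_right _ _)
  | ite c a b iha ihb =>
    obtain ⟨T, hT⟩ := iha
    obtain ⟨T', hT'⟩ := ihb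
    obtain ⟨T₀, hT₀⟩ := c.exists_below
    refine ⟨max T₀ (max T T'), fun o i hi => ?_⟩
    rcases List.mem_cons.1 hi with rfl | hi
    · exact Instr.Below.mono (le_max_left _ _) (i := .branch c _) hT₀
    rcases List.mem_append.1 hi with hi | hi
    · exact (hT _ i hi).mono (by simp)
    rcases List.mem_cons.1 hi with rfl | hi
    · trivial
    · exact (hT' _ i hi).mono (by simp)
  | loop c a iha =>
    obtain ⟨T, hT⟩ := iha
    obtain ⟨T₀, hT₀⟩ := c.exists_below
    refine ⟨max T₀ T, fun o i hi => ?_⟩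
    rcases List.mem_cons.1 hi with rfl | hi
    · exact Instr.Below.mono (le_max_left _ _) (i := .branch c _) hT₀
    rcases List.mem_append.1 hi with hi | hi
    · exact (hT _ i hi).mono (by simp)
    · obtain rfl := List.mem_singleton.1 hi
      trivial

/-- The symbols scanned on tapes `0, …, T - 1`, extended by blanks. -/
def extend {T : ℕ} (rd : Fin T → Sym) (t : ℕ) : Sym :=
  if h : t < T then rd ⟨t, h⟩ else none

/-- The Turing machine that executes some code and then answers whether tape `out` scans a non-blank
symbol. -/
def machine (code : List (Instr α)) (T out : ℕ) : OfflineTM α where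
  State := Fin (code.length + 1)
  WorkSym := Sym
  finiteState := inferInstance
  finiteWorkSym := inferInstance
  tapes := T
  start := 0
  blank := none
  trans q i rd := match code[q.1]? with
    | none => .inl (decide (extend rd out ≠ none))
    | some (.move d) => .inr (Fin.ofNat _ (q.1 + 1), d, fun t => (rd t, .stay))
    | some (.op t s f d) => .inr (Fin.ofNat _ (q.1 + 1), .stay,
        fun t' => if t'.1 = t then (f (extend rd s), d) else (rd t', .stay))
    | some (.branch c k) =>
        let v := match c with
          | .input P => P i
          | .tapes s t P => P (extend rd s) (extend rd t)
        .inr (Fin.ofNat _ (if v then q.1 + 1 else k), .stay, fun t => (rd t, .stay))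
    | some (.jump k) => .inr (Fin.ofNat _ k, .stay, fun t => (rd t, .stay))

section

variable (code : List (Instr α)) (T out : ℕ)

/-- The state is the program counter. The address `code.length`, where no instruction is found, is
the one at which the machine answers. -/
def config (k : ℕ) (σ : Mem) : (machine code T out).Config where
  state := Fin.ofNat _ k
  inputHead := σ.inp
  work t := (σ.tape t.1).cells
  head t := (σ.tape t.1).pos

/-- One step of the machine, which does not leave the space bound. -/
def SpaceStep (M : OfflineTM α) (w : List α) (sp : ℕ) (c c' : M.Config) : Prop :=
  M.step w c = .inr c' ∧ ((∀ t, c.head t + 1 ≤ sp) → ∀ t, c'.head t + 1 ≤ sp)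

variable {code T out} {w : List α} {sp : ℕ}

theorem SpaceStep.congr {k k' : ℕ} {σ : Mem} {c : (machine code T out).Config}
    (h : SpaceStep _ w sp c (config code T out k σ)) (e : k = k') :
    SpaceStep _ w sp c (config code T out k' σ) := e ▸ h

theorem extend_scan {σ : Mem} {t : ℕ} (h : t < T) :
    extend (fun t' : Fin T => (σ.tape t'.1).cells (σ.tape t'.1).pos) t = (σ.tape t).scan := by
  simp [extend, h, Tape.scan]

theorem config_ext {M : OfflineTM α} {c c' : M.Config} (h1 : c.state = c'.state)
    (h2 : c.inputHead = c'.inputHead) (h3 : ∀ t, c.work t = c'.work t)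
    (h4 : ∀ t, c.head t = c'.head t) : c = c' := by
  obtain ⟨q, i, wk, hd⟩ := c
  obtain ⟨q', i', wk', hd'⟩ := c'
  obtain rfl : q = q' := h1
  obtain rfl : i = i' := h2
  obtain rfl : wk = wk' := funext h3
  obtain rfl : hd = hd' := funext h4
  rfl

/-- The only place where the transition function is unfolded instruction by instruction. The bound
on the input head is needed because the machine truncates its position even when it does not move.
-/
theorem step_eq {k : ℕ} (hk : k < code.length) (hT : ∀ i ∈ code, i.Below T) (σ : Mem)
    (hin : σ.inp ≤ w.length + 1) :
    match code[k] with
    | .move d => SpaceStep _ w sp (config code T out k σ)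
        (config code T out (k + 1) { σ with inp := min (moveHead σ.inp d) (w.length + 1) })
    | .op t s f d => moveHead (σ.tape t).pos d + 1 ≤ sp → SpaceStep _ w sp (config code T out k σ)
        (config code T out (k + 1) (σ.set t ((σ.tape t).act (f (σ.tape s).scan) d)))
    | .branch c j => SpaceStep _ w sp (config code T out k σ)
        (config code T out (if c.eval w σ then k + 1 else j) σ)
    | .jump j => SpaceStep _ w sp (config code T out k σ) (config code T out j σ) := by
  have hk' : (config code T out k σ).state.1 = k := Nat.mod_eq_of_lt (by omega)
  have hget : code[k]? = some code[k] := List.getElem?_eq_getElem hk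
  have hb := hT _ (List.getElem_mem hk)
  generalize code[k] = i at *
  have hmin : min σ.inp (w.length + 1) = σ.inp := min_eq_left hin
  rcases i with d | ⟨t, s, f, d⟩ | ⟨c, j⟩ | j
  · refine ⟨?_, fun h => h⟩
    simp only [OfflineTM.step, machine, hk', hget]
    exact congrArg Sum.inr (config_ext rfl rfl (fun t => by simp [config]) fun t => rfl)
  · intro hsp
    obtain ⟨ht, hs⟩ := hb
    refine ⟨?_, fun h t' => ?_⟩
    · simp only [OfflineTM.step, machine, hk', hget]
      refine congrArg Sum.inr (config_ext rfl hmin (fun t' => ?_) fun t' => ?_)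
      · by_cases h : t'.1 = t
        · subst h; simp [Tape.act, config, Mem.set, extend_scan hs]
        · simp [h, config, Mem.set]
      · by_cases h : t'.1 = t
        · subst h; simp [Tape.act, config, Mem.set]
        · simp [h, config, Mem.set, moveHead]
    · by_cases h' : t'.1 = t
      · simpa [config, Mem.set, h', Tape.act] using hsp
      · simpa [config, Mem.set, h'] using h t'
  · refine ⟨?_, fun h => h⟩
    simp only [OfflineTM.step, machine, hk', hget]
    refine congrArg Sum.inr (config_ext ?_ hmin (fun t => by simp [config]) fun t => rfl)
    rcases c with P | ⟨s, t, P⟩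
    · rfl
    · simp only [config, extend_scan hb.1, extend_scan hb.2, Test.eval]
      rfl
  · refine ⟨?_, fun h => h⟩
    simp only [OfflineTM.step, machine, hk', hget]
    exact congrArg Sum.inr (config_ext rfl hmin (fun t => by simp [config]) fun t => rfl)

theorem Exec.inp_le {c : Cmd α} {σ σ' : Mem} (h : Exec w sp c σ σ') (hin : σ.inp ≤ w.length + 1) :
    σ'.inp ≤ w.length + 1 := by
  induction h with
  | move => exact min_le_right _ _
  | op => exact hin
  | seq _ _ ih1 ih2 => exact ih2 (ih1 hin)
  | ite_true _ _ ih => exact ih hin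
  | ite_false _ _ ih => exact ih hin
  | loop_true _ _ _ ih1 ih2 => exact ih2 (ih1 hin)
  | loop_false => exact hin

/-- Induction on the big-step derivation, with the place of the code inside the whole program left
general, because parts of a command are compiled at shifted addresses. Termination is part of the
derivation, so loops need no measure. -/
theorem Exec.run {c : Cmd α} {σ σ' : Mem} (h : Exec w sp c σ σ') (hin : σ.inp ≤ w.length + 1)
    (hT : ∀ i ∈ code, i.Below T) {l₁ l₂ : List (Instr α)} {o : ℕ} (ho : l₁.length = o)
    (hc : code = l₁ ++ c.compile o ++ l₂) :
    Relation.ReflTransGen (SpaceStep (machine code T out) w sp) (config code T out o σ)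
      (config code T out (o + (c.compile o).length) σ') := by
  have fetch : ∀ {l l' : List (Instr α)} {i : Instr α} {k : ℕ}, code = l ++ i :: l' → l.length = k →
      ∃ hk : k < code.length, code[k] = i := by
    rintro l l' i k rfl rfl; simp
  induction h generalizing o l₁ l₂ with
  | move d σ =>
    obtain ⟨hk, hi⟩ := fetch (l := l₁) (l' := l₂) (by simpa [Cmd.compile] using hc) ho
    have := step_eq (sp := sp) (out := out) hk hT σ hin
    rw [hi] at this
    exact .single this
  | op t s f d σ hsp =>
    obtain ⟨hk, hi⟩ := fetch (l := l₁) (l' := l₂) (by simpa [Cmd.compile] using hc) ho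
    have := step_eq (sp := sp) (out := out) hk hT σ hin
    rw [hi] at this
    exact .single (this hsp)
  | @seq a b σ σ' σ'' h1 h2 ih1 ih2 =>
    simp only [Cmd.compile] at hc ⊢
    refine (ih1 hin ho (l₂ := b.compile (o + (a.compile o).length) ++ l₂) (by simp [hc])).trans ?_
    have := ih2 (h1.inp_le hin) (l₁ := l₁ ++ a.compile o) (l₂ := l₂)
      (o := o + (a.compile o).length) (by simp [ho]) (by simp [hc])
    simpa [add_assoc] using this
  | @ite_true c a b σ σ' hcond h1 ih =>
    simp only [Cmd.compile] at hc ⊢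
    obtain ⟨hk, hi⟩ := fetch (l := l₁) (by rw [hc, List.append_assoc, List.cons_append]) ho
    have s1 := step_eq (sp := sp) (out := out) hk hT σ hin
    rw [hi] at s1
    simp only [hcond, if_true] at s1
    have s2 := ih hin (l₁ := l₁ ++ [Instr.branch c (o + 1 + (a.compile (o + 1)).length + 1)])
      (o := o + 1) (l₂ := _) (by simp [ho]) (by
        rw [hc]; simp only [List.append_assoc, List.cons_append, List.nil_append]; rfl)
    obtain ⟨hk', hi'⟩ := fetch (l := l₁ ++ [Instr.branch c (o + 1 + (a.compile (o + 1)).length + 1)] ++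
      a.compile (o + 1)) (i := .jump (o + 1 + (a.compile (o + 1)).length + 1 +
        (b.compile (o + 1 + (a.compile (o + 1)).length + 1)).length)) (l' := b.compile (o + 1 + (a.compile (o + 1)).length + 1) ++ l₂)
      (by rw [hc]; simp) (k := o + 1 + (a.compile (o + 1)).length) (by simp [ho]; omega)
    have s3 := step_eq (sp := sp) (out := out) hk' hT σ' (h1.inp_le hin)
    rw [hi'] at s3
    refine (Relation.ReflTransGen.head s1 s2).trans (.single ?_)
    exact s3.congr (by simp; omega)
  | @ite_false c a b σ σ' hcond h1 ih =>
    simp only [Cmd.compile] at hc ⊢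
    obtain ⟨hk, hi⟩ := fetch (l := l₁) (by rw [hc, List.append_assoc, List.cons_append]) ho
    have s1 := step_eq (sp := sp) (out := out) hk hT σ hin
    rw [hi] at s1
    simp only [hcond] at s1
    have s2 := ih hin (o := o + 1 + (a.compile (o + 1)).length + 1) (l₂ := l₂)
      (l₁ := l₁ ++ [Instr.branch c (o + 1 + (a.compile (o + 1)).length + 1)] ++ a.compile (o + 1) ++
        [.jump (o + 1 + (a.compile (o + 1)).length + 1 +
          (b.compile (o + 1 + (a.compile (o + 1)).length + 1)).length)])
      (by simp [ho]; omega) (by rw [hc]; simp)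
    have e : o + 1 + (a.compile (o + 1)).length + 1 +
        (b.compile (o + 1 + (a.compile (o + 1)).length + 1)).length =
        o + (Cmd.compile (.ite c a b) o).length := by
      simp only [Cmd.compile, List.length_cons, List.length_append]; omega
    rw [e] at s2
    exact .head s1 s2
  | @loop_true c a σ σ' σ'' hcond h1 h2 ih1 ih2 =>
    -- The remaining rounds start again at address `o`, so the induction hypothesis applies to the
    -- same splitting of the code.
    have s4 := ih2 (h1.inp_le hin) ho hc
    simp only [Cmd.compile] at hc s4 ⊢
    obtain ⟨hk, hi⟩ := fetch (l := l₁) (by rw [hc, List.append_assoc, List.cons_append]) ho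
    have s1 := step_eq (sp := sp) (out := out) hk hT σ hin
    rw [hi] at s1
    simp only [hcond, if_true] at s1
    have s2 := ih1 hin (l₁ := l₁ ++ [Instr.branch c (o + 1 + (a.compile (o + 1)).length + 1)])
      (o := o + 1) (l₂ := _) (by simp [ho]) (by
        rw [hc]; simp only [List.append_assoc, List.cons_append, List.nil_append]; rfl)
    obtain ⟨hk', hi'⟩ := fetch (l := l₁ ++ [Instr.branch c (o + 1 + (a.compile (o + 1)).length + 1)] ++
      a.compile (o + 1)) (i := .jump o) (l' := l₂)
      (by rw [hc]; simp) (k := o + 1 + (a.compile (o + 1)).length) (by simp [ho]; omega)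
    have s3 := step_eq (sp := sp) (out := out) hk' hT σ' (h1.inp_le hin)
    rw [hi'] at s3
    exact (Relation.ReflTransGen.head s1 s2).trans (.head s3 s4)
  | @loop_false c a σ hcond =>
    simp only [Cmd.compile] at hc ⊢
    obtain ⟨hk, hi⟩ := fetch (l := l₁) (by rw [hc, List.append_assoc, List.cons_append]) ho
    have s1 := step_eq (sp := sp) (out := out) hk hT σ hin
    rw [hi] at s1
    simp only [hcond] at s1
    exact .single (s1.congr (by simp; omega))

end

/-- The machine is deterministic, so every configuration reached from `a` lies on the given halting
run, whose steps all respect the bound. -/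
theorem head_le_of_run {M : OfflineTM α} {w : List α} {sp : ℕ} {a z : M.Config} {v : Bool}
    (h : Relation.ReflTransGen (SpaceStep M w sp) a z) (hz : M.step w z = .inl v)
    (ha : ∀ t, a.head t + 1 ≤ sp) (c : M.Config)
    (hc : Relation.ReflTransGen (fun c₁ c₂ => M.step w c₁ = .inr c₂) a c) :
    ∀ t, c.head t + 1 ≤ sp := by
  induction h using Relation.ReflTransGen.head_induction_on with
  | refl =>
    rcases hc.cases_head with rfl | ⟨d, hd, _⟩
    · exact ha
    · rw [hz] at hd; cases hd
  | head h1 _ ih =>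
    rcases hc.cases_head with rfl | ⟨d, hd, hdc⟩
    · exact ha
    · rw [h1.1] at hd
      cases hd
      exact ih (h1.2 ha) hdc

/-- The first `T` tapes contain a marker in cell `0`, and their heads are on cell `1`. -/
def Mem.markedBelow (T : ℕ) : Mem :=
  ⟨0, fun t => if t < T then ⟨Function.update (fun _ => none) 0 (some none), 1⟩
    else ⟨fun _ => none, 0⟩⟩

/-- The marker in cell `0` is what stops a head that searches to the left. All tapes are marked
here, although a machine has only finitely many of them. -/
def Mem.marked : Mem :=
  ⟨0, fun _ => ⟨Function.update (fun _ => none) 0 (some none), 1⟩⟩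

def Cmd.mark : ℕ → Cmd α
  | 0 => .move .stay
  | T + 1 => .seq (Cmd.mark T) (.op T T (fun _ => some none) .right)

theorem exec_mark (w : List α) {sp : ℕ} (hsp : 2 ≤ sp) (T : ℕ) :
    Exec w sp (.mark T) .blank (.markedBelow T) := by
  induction T with
  | zero =>
    have := Exec.move (w := w) (sp := sp) .stay .blank
    simpa [Mem.blank, Mem.markedBelow, moveHead, Cmd.mark] using this
  | succ T ih =>
    have h : (Mem.markedBelow T).tape T = ⟨fun _ => none, 0⟩ := by simp [Mem.markedBelow]
    have := Exec.op (w := w) (sp := sp) T T (fun _ => some none) .right (.markedBelow T)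
      (by rw [h]; exact hsp)
    have e : Mem.markedBelow (T + 1) = (Mem.markedBelow T).set T
        (((Mem.markedBelow T).tape T).act (some none) .right) := ?_
    · rw [e]
      exact Exec.seq ih this
    rw [h]
    refine congrArg (Mem.mk 0) (funext fun t => ?_)
    simp only [Mem.markedBelow, Tape.act, moveHead]
    rcases lt_trichotomy t T with h | rfl | h
    · simp [h, h.ne, h.trans (Nat.lt_succ_self T)]
    · simp
    · simp [h.ne', not_lt.2 h.le, not_lt.2 (Nat.succ_le_of_lt h)]

theorem mark_below {T T' : ℕ} (hT : T ≤ T') (o : ℕ) :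
    ∀ i ∈ (Cmd.mark T : Cmd α).compile o, i.Below T' := by
  induction T with
  | zero => simp [Cmd.mark, Cmd.compile, Instr.Below]
  | succ T ih =>
    intro i hi
    rcases List.mem_append.1 hi with hi | hi
    · exact ih (by omega) i hi
    · obtain rfl := List.mem_singleton.1 hi
      simp only [Instr.Below]; omega

/-- A program that starts with marked tapes can be executed by a Turing machine that answers whether,
in the end, tape `out` scans a non-blank symbol. -/
theorem exists_machine (c : Cmd α) (out : ℕ) : ∃ M : OfflineTM α, ∀ (w : List α) (sp : ℕ) (σ : Mem),
    2 ≤ sp → Exec w sp c .marked σ →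
    M.Outputs w (decide ((σ.tape out).scan ≠ none)) ∧ M.UsesSpaceAtMost w sp := by
  obtain ⟨T₀, hT₀⟩ := c.exists_below
  obtain ⟨T, hT⟩ : ∃ T, T = max T₀ (out + 1) := ⟨_, rfl⟩
  obtain ⟨code, hcode⟩ : ∃ l, l = (Cmd.seq (.mark T) c).compile 0 := ⟨_, rfl⟩
  have hbelow : ∀ i ∈ code, i.Below T := by
    intro i hi
    rw [hcode] at hi
    rcases List.mem_append.1 hi with hi | hi
    · exact mark_below le_rfl _ i hi
    · exact (hT₀ _ i hi).mono (by omega)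
  refine ⟨machine code T out, fun w sp σ hsp h => ?_⟩
  have hrun1 := (exec_mark w hsp T).run (out := out) (by simp [Mem.blank]) hbelow (l₁ := [])
    (l₂ := c.compile (((Cmd.mark T : Cmd α).compile 0).length)) (o := 0) rfl (by simp [hcode, Cmd.compile])
  have hrun2 := h.run (out := out) (by simp [Mem.marked]) hbelow (l₁ := (Cmd.mark T : Cmd α).compile 0)
    (l₂ := []) (o := ((Cmd.mark T : Cmd α).compile 0).length) rfl (by simp [hcode, Cmd.compile])
  -- The two memories differ only on tapes from `T` on, which the machine does not have.
  have hmid : config code T out (0 + ((Cmd.mark T : Cmd α).compile 0).length) (.markedBelow T) =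
      config code T out ((Cmd.mark T : Cmd α).compile 0).length .marked := by
    rw [Nat.zero_add]
    refine config_ext rfl rfl (fun t => ?_) fun t => ?_
    · simp only [config, Mem.markedBelow, Mem.marked, show t.1 < T from t.2, if_true]
      rfl
    · simp [config, Mem.markedBelow, Mem.marked, show t.1 < T from t.2]
  rw [hmid] at hrun1
  have hrun := hrun1.trans hrun2
  have hlen : ((Cmd.mark T : Cmd α).compile 0).length +
      (c.compile ((Cmd.mark T : Cmd α).compile 0).length).length = code.length := by
    simp [hcode, Cmd.compile]
  rw [hlen] at hrun
  have hinit : config code T out 0 .blank = (machine code T out).init := rfl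
  rw [hinit] at hrun
  have hstep : (machine code T out).step w (config code T out code.length σ) =
      .inl (decide ((σ.tape out).scan ≠ none)) := by
    have hk : (config code T out code.length σ).state.1 = code.length := by
      simp [config, Fin.ofNat]
    simp only [OfflineTM.step, machine, hk, List.getElem?_length]
    exact congrArg (fun a : Sym => Sum.inl (decide (a ≠ none)))
      (extend_scan (T := T) (t := out) (σ := σ) (by omega))
  refine ⟨⟨_, hrun.lift id (fun _ _ h => h.1), hstep⟩, fun c' hc' t => ?_⟩
  exact_mod_cast head_le_of_run hrun hstep (fun _ => by simp [OfflineTM.init]; omega) c' hc' t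

end TapeProg

/-! ### Registers and a stack of numbers -/

namespace TapeProg

open OfflineTM

variable {α : Type}

/-- The tape with `l` (in reverse order) to the left of the head, and `r` below and to the right of
the head. -/
def zip (l r : List Sym) : Tape :=
  ⟨fun i => (l.reverse ++ r).getD i none, l.length⟩

theorem zip_scan (l r : List Sym) : (zip l r).scan = r.headD none := by
  cases r <;> simp [zip, Tape.scan, List.getD]

theorem update_getD (l r : List Sym) (b : Sym) :
    Function.update (fun i => (l ++ r).getD i none) l.length b =
      fun i => (l ++ b :: r.tail).getD i none := by
  funext i
  rcases lt_trichotomy i l.length with h | rfl | h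
  · simp [h.ne, List.getD, List.getElem?_append_left h]
  · simp [List.getD]
  · simp only [Function.update_of_ne h.ne', List.getD, List.getElem?_append_right h.le]
    obtain ⟨k, hk⟩ := Nat.exists_eq_add_of_lt h
    rw [show i - l.length = k + 1 by omega]
    cases r <;> simp

theorem zip_act (l r : List Sym) (b : Sym) (d : HeadMove) :
    (zip l r).act b d = ⟨(zip l (b :: r.tail)).cells, moveHead l.length d⟩ := by
  have := update_getD l.reverse r b
  simp only [List.length_reverse] at this
  simp only [zip, Tape.act, this]

theorem zip_right (l r : List Sym) (b : Sym) :
    (zip l r).act b .right = zip (b :: l) r.tail := by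
  rw [zip_act]; simp [zip, moveHead]

theorem zip_stay (l r : List Sym) (b : Sym) : (zip l r).act b .stay = zip l (b :: r.tail) := by
  rw [zip_act]; simp [zip, moveHead]

theorem zip_left (a b : Sym) (l r : List Sym) :
    (zip (a :: l) r).act b .left = zip l (a :: b :: r.tail) := by
  rw [zip_act]; simp [zip, moveHead]

/-- The tape is blank beyond the listed symbols, so the list to the right of the head matters only
up to trailing blanks. -/
theorem zip_none (l r : List Sym) : zip l (r ++ [none]) = zip l r := by
  simp only [zip, Tape.mk.injEq, and_true]
  funext i
  rw [← List.append_assoc]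
  simp only [List.getD]
  rcases lt_trichotomy i (l.reverse ++ r).length with h | h | h
  · rw [List.getElem?_append_left h]
  · subst h; simp
  · rw [List.getElem?_append_right h.le, List.getElem?_eq_none h.le]
    simp

theorem zip_headD (l p r : List Sym) : zip l (p ++ r.headD none :: r.tail) = zip l (p ++ r) := by
  cases r
  · simpa using zip_none l p
  · rfl

namespace Mem

@[simp] theorem set_set (σ : Mem) (t : ℕ) (S T : Tape) : (σ.set t S).set t T = σ.set t T := by
  simp [set]

theorem set_comm (σ : Mem) {s t : ℕ} (h : s ≠ t) (S T : Tape) :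
    (σ.set s S).set t T = (σ.set t T).set s S := by
  simp only [set, Mem.mk.injEq, true_and]
  exact Function.update_comm h S T σ.tape

@[simp] theorem set_tape (σ : Mem) (t : ℕ) (T : Tape) : (σ.set t T).tape t = T := by
  simp [set]

theorem set_tape_ne (σ : Mem) {s t : ℕ} (h : s ≠ t) (T : Tape) : (σ.set t T).tape s = σ.tape s := by
  simp [set, h]

theorem set_self (σ : Mem) {t : ℕ} {T : Tape} (h : σ.tape t = T) : σ.set t T = σ := by
  subst h; simp [set]

end Mem

/-! #### Moving along a tape -/

def mark : Sym := some none

def notMark (a _ : Sym) : Bool := decide (a ≠ mark)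

def notBlank (a _ : Sym) : Bool := decide (a ≠ none)

def goRight (t : ℕ) : Cmd α := .op t t id .right

def goLeft (t : ℕ) : Cmd α := .op t t id .left

def write (t : ℕ) (a : Sym) (d : HeadMove) : Cmd α := .op t t (fun _ => a) d

section

variable {w : List α} {sp : ℕ} {σ : Mem} {t s : ℕ} {l r x y : List Sym}

theorem exec_write_right (h : σ.tape t = zip l r) (a : Sym) (hsp : l.length + 2 ≤ sp) :
    Exec w sp (write t a .right) σ (σ.set t (zip (a :: l) r.tail)) := by
  have := Exec.op (w := w) (sp := sp) t t (fun _ => a) .right σ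
    (by rw [h]; simp [zip, moveHead]; omega)
  rwa [h, zip_right] at this

theorem exec_write_stay (h : σ.tape t = zip l r) (a : Sym) (hsp : l.length + 1 ≤ sp) :
    Exec w sp (write t a .stay) σ (σ.set t (zip l (a :: r.tail))) := by
  have := Exec.op (w := w) (sp := sp) t t (fun _ => a) .stay σ
    (by rw [h]; simp [zip, moveHead]; omega)
  rwa [h, zip_stay] at this

theorem exec_write_left {b : Sym} (h : σ.tape t = zip (b :: l) r) (a : Sym)
    (hsp : l.length + 1 ≤ sp) :
    Exec w sp (write t a .left) σ (σ.set t (zip l (b :: a :: r.tail))) := by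
  have := Exec.op (w := w) (sp := sp) t t (fun _ => a) .left σ
    (by rw [h]; simp [zip, moveHead]; omega)
  rwa [h, zip_left] at this

theorem exec_goLeft {b : Sym} (h : σ.tape t = zip (b :: l) r) (hsp : l.length + 1 ≤ sp) :
    Exec w sp (goLeft t) σ (σ.set t (zip l (b :: r))) := by
  have := Exec.op (w := w) (sp := sp) t t id .left σ
    (by rw [h]; simp [zip, moveHead]; omega)
  rw [h, zip_left, zip_scan] at this
  have e := zip_headD l [b] r
  simp only [List.cons_append, List.nil_append] at e
  rwa [id, e] at this

theorem exec_copy_right (h : σ.tape t = zip l r) {l' r' : List Sym} {a : Sym}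
    (h' : σ.tape s = zip l' (a :: r')) (hsp : l.length + 2 ≤ sp) :
    Exec w sp (.op t s id .right) σ (σ.set t (zip (a :: l) r.tail)) := by
  have := Exec.op (w := w) (sp := sp) t s id .right σ
    (by rw [h]; simp [zip, moveHead]; omega)
  rwa [h, h', zip_right, zip_scan] at this

theorem exec_goRight {a : Sym} (h : σ.tape t = zip l (a :: r)) (hsp : l.length + 2 ≤ sp) :
    Exec w sp (goRight t) σ (σ.set t (zip (a :: l) r)) :=
  exec_copy_right h h hsp

/-- Move left to the next marker. -/
def seekMark (t : ℕ) : Cmd α := .loop (.tapes t t notMark) (goLeft t)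

/-- The loop tests the scanned cell before it moves, which is why a marker under the head has to be
excluded at the beginning. -/
theorem exec_seekMark (hx : ∀ a ∈ x, a ≠ mark) (h : σ.tape t = zip (x ++ mark :: l) r)
    (hr : r.headD none ≠ mark) (hsp : x.length + l.length + 1 ≤ sp) :
    Exec w sp (seekMark t) σ (σ.set t (zip l (mark :: (x.reverse ++ r)))) := by
  induction x generalizing σ r with
  | nil =>
    refine .loop_true ?_ (exec_goLeft h (by simpa using hsp)) (.loop_false ?_)
    · simpa [Test.eval, h, zip_scan, notMark] using hr
    · simp [Test.eval, zip_scan, notMark]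
  | cons a x ih =>
    refine .loop_true ?_ (exec_goLeft h (by simp at hsp ⊢; omega)) ?_
    · simpa [Test.eval, h, zip_scan, notMark] using hr
    · have := ih (σ := σ.set t (zip (x ++ mark :: l) (a :: r))) (r := a :: r)
        (fun b hb => hx b (by simp [hb])) (by simp)
        (by simpa using hx a (by simp)) (by simp at hsp; omega)
      simpa [seekMark] using this

/-- Return to cell `1`. -/
def goHome (t : ℕ) : Cmd α := .seq (seekMark t) (goRight t)

theorem exec_goHome (hx : ∀ a ∈ x, a ≠ mark) (h : σ.tape t = zip (x ++ [mark]) r)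
    (hr : r.headD none ≠ mark) (hsp : x.length + 2 ≤ sp) :
    Exec w sp (goHome t) σ (σ.set t (zip [mark] (x.reverse ++ r))) := by
  refine .seq (exec_seekMark hx h hr (by simp; omega)) ?_
  have := exec_goRight (w := w) (sp := sp) (t := t)
    (σ := σ.set t (zip [] (mark :: (x.reverse ++ r)))) (by simp; rfl) (by simp; omega)
  simpa using this

/-- Move left to the next marker, erasing everything that is passed. -/
def eraseToMark (t : ℕ) : Cmd α :=
  .seq (goLeft t) (.loop (.tapes t t notMark) (write t none .left))

theorem exec_eraseToMark (hx : ∀ a ∈ x, a ≠ mark) (h : σ.tape t = zip (x ++ mark :: l) [])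
    (hsp : x.length + l.length + 1 ≤ sp) :
    Exec w sp (eraseToMark t) σ (σ.set t (zip l [mark])) := by
  -- Loop invariant: the scanned symbol `b` followed by the left part `m` is what has not been
  -- erased yet, and everything to the right of the head is already blank.
  have key : ∀ (y : List Sym) (b : Sym) (m : List Sym) (σ : Mem), (∀ a ∈ y, a ≠ mark) →
      σ.tape t = zip m [b] → b :: m = y ++ mark :: l → y.length + l.length + 1 ≤ sp →
      Exec w sp (.loop (.tapes t t notMark) (write t none .left)) σ (σ.set t (zip l [mark])) := by
    intro y
    induction y with
    | nil =>
      intro b m σ _ h₁ e _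
      simp only [List.nil_append, List.cons.injEq] at e
      obtain ⟨rfl, rfl⟩ := e
      rw [Mem.set_self σ h₁]
      exact .loop_false (by simp [Test.eval, h₁, zip_scan, notMark])
    | cons a y ih =>
      intro b m σ hy h e hsp
      simp only [List.cons_append, List.cons.injEq] at e
      obtain ⟨rfl, rfl⟩ := e
      obtain ⟨c, m', hm⟩ : ∃ c m', y ++ mark :: l = c :: m' := by
        cases y <;> simp
      rw [hm] at h
      have hl : m'.length = y.length + l.length := by
        have := congrArg List.length hm; simp at this; omega
      refine .loop_true ?_ (exec_write_left h none (by simp at hsp; omega)) ?_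
      · simpa [Test.eval, h, zip_scan, notMark] using hy b (by simp)
      · have := ih c m' (σ.set t (zip m' [c])) (fun a ha => hy a (by simp [ha])) (by simp)
          hm.symm (by simp at hsp; omega)
        have e := zip_none m' [c]
        simp only [List.cons_append, List.nil_append] at e
        simpa [e] using this
  obtain ⟨c, m', hm⟩ : ∃ c m', x ++ mark :: l = c :: m' := by
    cases x <;> simp
  rw [hm] at h
  have hl : m'.length = x.length + l.length := by
    have := congrArg List.length hm; simp at this; omega
  refine .seq (exec_goLeft h (by omega)) ?_
  have := key x c m' (σ.set t (zip m' [c])) hx (by simp) hm.symm hsp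
  simpa using this

/-- Copy the rest of tape `s` to the end of tape `t`. -/
def transfer (t s : ℕ) : Cmd α :=
  .loop (.tapes s s notBlank) (.seq (.op t s id .right) (goRight s))

theorem exec_transfer (hst : s ≠ t) (hx : ∀ a ∈ x, a ≠ none) (h : σ.tape t = zip l [])
    (h' : σ.tape s = zip r x) (hl : l.length + x.length + 1 ≤ sp)
    (hr : r.length + x.length + 1 ≤ sp) :
    Exec w sp (transfer t s) σ ((σ.set t (zip (x.reverse ++ l) [])).set s (zip (x.reverse ++ r) [])) := by
  induction x generalizing σ l r with
  | nil =>
    have e : (σ.set t (zip l [])).set s (zip r []) = σ := by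
      rw [Mem.set_self σ h, Mem.set_self σ h']
    simp only [List.reverse_nil, List.nil_append, e]
    exact .loop_false (by simp [Test.eval, h', zip_scan, notBlank])
  | cons a x ih =>
    simp only [List.length_cons] at hl hr
    refine .loop_true ?_ (.seq (exec_copy_right h h' (by omega))
      (exec_goRight (by rw [Mem.set_tape_ne _ hst]; exact h') (by omega))) ?_
    · simpa [Test.eval, h', zip_scan, notBlank] using hx a (by simp)
    · have := ih (σ := (σ.set t (zip (a :: l) [])).set s (zip (a :: r) x)) (l := a :: l) (r := a :: r)
        (fun b hb => hx b (by simp [hb])) (by rw [Mem.set_tape_ne _ hst.symm]; simp) (by simp)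
        (by simp; omega) (by simp; omega)
      rw [Mem.set_comm _ hst, Mem.set_set, Mem.set_comm _ hst.symm, Mem.set_set,
        Mem.set_comm _ hst] at this
      simpa [transfer] using this

end

end TapeProg

namespace TapeProg

open OfflineTM

variable {α : Type}

/-! #### Binary digits -/

def incBits : List Bool → List Bool
  | [] => [true]
  | false :: l => true :: l
  | true :: l => false :: incBits l

theorem bits_succ (n : ℕ) : (n + 1).bits = incBits n.bits := by
  induction n using Nat.binaryRec' with
  | zero => simp [incBits]
  | bit b n h ih =>
    cases b
    · have h0 : n ≠ 0 := fun h0 => by simpa using h h0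
      have e : Nat.bit false n + 1 = Nat.bit true n := by simp [Nat.bit]
      rw [e, Nat.bits_append_bit _ _ (by simp), Nat.bits_append_bit _ _ (by simpa using h0)]
      rfl
    · have e : Nat.bit true n + 1 = Nat.bit false (n + 1) := by simp [Nat.bit]; omega
      rw [e, Nat.bits_append_bit _ _ (by simp), Nat.bits_append_bit _ _ (by simp), ih]
      rfl

theorem bits_injective : Function.Injective Nat.bits := by
  intro m n h
  have : ∀ n : ℕ, n.bits.foldr (fun b k => Nat.bit b k) 0 = n := by
    intro n
    induction n using Nat.binaryRec' with
    | zero => simp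
    | bit b n h ih => rw [Nat.bits_append_bit _ _ h, List.foldr_cons, ih]
  rw [← this m, ← this n, h]

/-- The digits of a number as tape symbols. -/
def digits (n : ℕ) : List Sym := n.bits.map fun b => some (some b)

theorem digits_ne_mark {n : ℕ} : ∀ a ∈ digits n, a ≠ mark := by
  intro a ha
  obtain ⟨b, _, rfl⟩ := List.mem_map.1 ha
  simp [mark]

theorem digits_ne_none {n : ℕ} : ∀ a ∈ digits n, a ≠ none := by
  intro a ha
  obtain ⟨b, _, rfl⟩ := List.mem_map.1 ha
  simp

theorem length_digits (n : ℕ) : (digits n).length = n.size := by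
  simp [digits, Nat.size_eq_bits_len]

theorem digits_zero : digits 0 = [] := by simp [digits]

theorem digits_one : digits 1 = [some (some true)] := by simp [digits]

theorem digits_injective : Function.Injective digits := fun m n h =>
  bits_injective (List.map_injective_iff.2 (fun a b h => by simpa using h) h)

/-- Zero is the only number without digits, so a test for zero inspects a single cell. -/
theorem digits_headD_ne_none (n : ℕ) : (digits n).headD none ≠ none ↔ n ≠ 0 := by
  constructor
  · rintro h rfl
    simp [digits_zero] at h
  · intro h
    cases h' : digits n with
    | nil => exact absurd (digits_injective (h'.trans digits_zero.symm)) h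
    | cons a l => exact digits_ne_none a (by rw [h']; simp)

/-! #### Memory contents -/

/-- The stack contents in reverse order. -/
def stackSyms : List ℕ → List Sym
  | [] => [mark]
  | v :: s => (digits v).reverse ++ mark :: stackSyms s

/-- Tape `0` holds the stack `s`, and tape `r + 1` holds the number `ρ r`. -/
def store (ρ : ℕ → ℕ) (i : ℕ) (s : List ℕ) : Mem :=
  ⟨i, fun t => match t with
    | 0 => zip (stackSyms s) []
    | r + 1 => zip [mark] (digits (ρ r))⟩

theorem store_zero : store (fun _ => 0) 0 [] = .marked := by
  simp only [store, Mem.marked, Mem.mk.injEq, true_and]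
  have h : zip [mark] [] = ⟨Function.update (fun _ => none) 0 (some none), 1⟩ := by
    simp only [zip, Tape.mk.injEq]
    refine ⟨?_, by simp⟩
    funext i
    cases i <;> simp [mark, List.getD]
  funext t
  cases t
  · exact h
  · simpa [digits_zero] using h

section

variable {w : List α} {sp : ℕ} {ρ : ℕ → ℕ} {i : ℕ} {st : List ℕ} {r s : ℕ}

theorem store_reg : (store ρ i st).tape (r + 1) = zip [mark] (digits (ρ r)) := rfl

theorem store_stack : (store ρ i st).tape 0 = zip (stackSyms st) [] := rfl

theorem store_set (v : ℕ) : (store ρ i st).set (r + 1) (zip [mark] (digits v)) =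
    store (Function.update ρ r v) i st := by
  simp only [store, Mem.set, Mem.mk.injEq, true_and]
  funext t
  cases t with
  | zero => simp
  | succ k =>
    by_cases h : k = r
    · subst h; simp
    · simp [h]

theorem store_set_stack (st' : List ℕ) : (store ρ i st).set 0 (zip (stackSyms st') []) =
    store ρ i st' := by
  simp only [store, Mem.set, Mem.mk.injEq, true_and]
  funext t
  cases t <;> simp

/-! #### Basic operations on registers -/

def nonzero (r : ℕ) : Test α := .tapes (r + 1) (r + 1) notBlank

@[simp] theorem eval_nonzero : (nonzero r).eval w (store ρ i st) = decide (ρ r ≠ 0) := by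
  have := digits_headD_ne_none (ρ r)
  simp only [nonzero, Test.eval, store_reg, zip_scan, notBlank]
  exact decide_eq_decide.2 this

def isZero (r : ℕ) : Test α := .tapes (r + 1) (r + 1) fun a b => !notBlank a b

@[simp] theorem eval_isZero : (isZero r).eval w (store ρ i st) = decide (ρ r = 0) := by
  have := eval_nonzero (w := w) (ρ := ρ) (i := i) (st := st) (r := r)
  simp only [nonzero, isZero, Test.eval] at this ⊢
  rw [this]
  simp

def clear (r : ℕ) : Cmd α :=
  .seq (.seq (.loop (.tapes (r + 1) (r + 1) notBlank) (goRight (r + 1))) (eraseToMark (r + 1)))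
    (goRight (r + 1))

theorem exec_seekBlank {σ : Mem} {t : ℕ} {l x : List Sym} (h : σ.tape t = zip l x)
    (hx : ∀ a ∈ x, a ≠ none) (hsp : l.length + x.length + 1 ≤ sp) :
    Exec w sp (.loop (.tapes t t notBlank) (goRight t)) σ (σ.set t (zip (x.reverse ++ l) [])) := by
  induction x generalizing σ l with
  | nil =>
    rw [List.reverse_nil, List.nil_append, Mem.set_self σ h]
    exact .loop_false (by simp [Test.eval, h, zip_scan, notBlank])
  | cons a x ih =>
    simp only [List.length_cons] at hsp
    refine .loop_true ?_ (exec_goRight h (by omega)) ?_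
    · simpa [Test.eval, h, zip_scan, notBlank] using hx a (by simp)
    · simpa using ih (σ := σ.set t (zip (a :: l) x)) (l := a :: l) (by simp)
        (fun b hb => hx b (by simp [hb])) (by simp; omega)

theorem exec_clear (hsp : (ρ r).size + 2 ≤ sp) :
    Exec w sp (clear r) (store ρ i st) (store (Function.update ρ r 0) i st) := by
  have h1 := exec_seekBlank (w := w) (sp := sp) (store_reg (ρ := ρ) (i := i) (st := st) (r := r))
    digits_ne_none (by simp [length_digits]; omega)
  refine .seq (.seq h1 (exec_eraseToMark (x := (digits (ρ r)).reverse) (l := [])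
    (by simpa using digits_ne_mark) (by simp) (by simp [length_digits]; omega))) ?_
  have := exec_goRight (w := w) (sp := sp) (t := r + 1) (l := []) (a := mark) (r := [])
    (σ := (store ρ i st).set (r + 1) (zip [] [mark])) (by simp) (by simp; omega)
  have e := store_set (ρ := ρ) (i := i) (st := st) (r := r) 0
  rw [digits_zero] at e
  rw [Mem.set_set, e] at this
  simpa using this

theorem exec_goHome_digits {σ : Mem} {t n : ℕ} (h : σ.tape t = zip ((digits n).reverse ++ [mark]) [])
    (hsp : n.size + 2 ≤ sp) :
    Exec w sp (goHome t) σ (σ.set t (zip [mark] (digits n))) := by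
  have := exec_goHome (w := w) (sp := sp) (x := (digits n).reverse)
    (by simpa using digits_ne_mark) h (by simp [mark])
    (by simp [length_digits]; omega)
  simpa using this

def copyReg (r s : ℕ) : Cmd α :=
  .seq (clear r) (.seq (transfer (r + 1) (s + 1)) (.seq (goHome (r + 1)) (goHome (s + 1))))

theorem exec_copyReg (h : r ≠ s) (hr : (ρ r).size + 2 ≤ sp) (hs : (ρ s).size + 2 ≤ sp) :
    Exec w sp (copyReg r s) (store ρ i st) (store (Function.update ρ r (ρ s)) i st) := by
  have hrs : r + 1 ≠ s + 1 := by omega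
  refine .seq (exec_clear hr) ?_
  obtain ⟨ρ', hρ'⟩ : ∃ ρ', ρ' = Function.update ρ r 0 := ⟨_, rfl⟩
  have e1 : ρ' r = 0 := by simp [hρ']
  have e2 : ρ' s = ρ s := by simp [hρ', h.symm]
  have e3 : Function.update ρ r (ρ s) = Function.update ρ' r (ρ s) := by simp [hρ']
  rw [← hρ', e3]
  have hx := digits_ne_none (n := ρ s)
  have t1 : (store ρ' i st).tape (r + 1) = zip [mark] [] := by
    rw [store_reg, e1, digits_zero]
  have t2 : (store ρ' i st).tape (s + 1) = zip [mark] (digits (ρ s)) := by rw [store_reg, e2]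
  refine .seq (exec_transfer hrs.symm hx t1 t2 (by simp [length_digits]; omega)
    (by simp [length_digits]; omega)) ?_
  refine .seq (exec_goHome_digits (n := ρ s) (by rw [Mem.set_tape_ne _ hrs]; simp) hs) ?_
  rw [Mem.set_comm _ hrs.symm, Mem.set_set]
  have := exec_goHome_digits (w := w) (sp := sp) (n := ρ s) (t := s + 1)
    (σ := ((store ρ' i st).set (r + 1) (zip [mark] (digits (ρ s)))).set (s + 1)
      (zip ((digits (ρ s)).reverse ++ [mark]) [])) (by simp) hs
  rw [Mem.set_set, store_set,
    Mem.set_self (T := zip [mark] (digits (ρ s))) _ (by simp [store_reg, h.symm, e2])] at this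
  rw [store_set]
  exact this

def isOne (a _ : Sym) : Bool := decide (a = some (some true))

def incReg (r : ℕ) : Cmd α :=
  .seq (.seq (.loop (.tapes (r + 1) (r + 1) isOne) (write (r + 1) (some (some false)) .right))
    (write (r + 1) (some (some true)) .stay)) (goHome (r + 1))

/-- The carry runs through the leading ones and is absorbed by the first zero or by a new digit. The
list `d` holds the digits that the head has passed, the last one first, as they stand to the left of
the head. -/
theorem exec_carry {σ : Mem} {t : ℕ} {l : List Sym} (b : List Bool)
    (h : σ.tape t = zip l (b.map fun b => some (some b))) (hsp : l.length + b.length + 1 ≤ sp) :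
    ∃ d x : List Bool, d.reverse ++ true :: x = incBits b ∧ d.length ≤ b.length ∧
      Exec w sp (.seq (.loop (.tapes t t isOne) (write t (some (some false)) .right))
        (write t (some (some true)) .stay)) σ
        (σ.set t (zip ((d.map fun b => some (some b)) ++ l)
          ((true :: x).map fun b => some (some b)))) := by
  induction b generalizing σ l with
  | nil =>
    refine ⟨[], [], rfl, le_rfl, .seq (.loop_false ?_) ?_⟩
    · simp [Test.eval, h, zip_scan, isOne]
    · exact exec_write_stay h _ (by simpa using hsp)
  | cons a b ih =>
    simp only [List.length_cons] at hsp
    cases a with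
    | false =>
      refine ⟨[], b, rfl, by simp, .seq (.loop_false ?_) ?_⟩
      · simp [Test.eval, h, zip_scan, isOne]
      · simpa using exec_write_stay (w := w) (sp := sp) h (some (some true)) (by omega)
    | true =>
      have h1 := exec_write_right (w := w) (sp := sp) h (some (some false)) (by omega)
      obtain ⟨d, x, e, hd, hex⟩ := ih (l := some (some false) :: l)
        (σ := σ.set t (zip (some (some false) :: l) (b.map fun b => some (some b))))
        (by simp) (by simp; omega)
      refine ⟨d ++ [false], x, by simp [incBits, e], by simpa using hd, ?_⟩
      cases hex with
      | seq h2 h3 =>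
        refine .seq (.loop_true ?_ h1 h2) ?_
        · simp [Test.eval, h, zip_scan, isOne]
        · simpa using h3

theorem exec_incReg (hsp : (ρ r + 1).size + 2 ≤ sp) :
    Exec w sp (incReg r) (store ρ i st) (store (Function.update ρ r (ρ r + 1)) i st) := by
  have hsz : (ρ r).size ≤ (ρ r + 1).size := Nat.size_le_size (Nat.le_succ _)
  obtain ⟨d, x, e, hd, hex⟩ := exec_carry (w := w) (sp := sp) (ρ r).bits
    (store_reg (ρ := ρ) (i := i) (st := st) (r := r))
    (by simp [Nat.size_eq_bits_len]; omega)
  rw [Nat.size_eq_bits_len] at hd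
  refine .seq hex ?_
  have := exec_goHome (w := w) (sp := sp) (t := r + 1) (x := d.map fun b => some (some b))
    (r := ((true :: x).map fun b => some (some b)))
    (σ := (store ρ i st).set (r + 1) (zip ((d.map fun b => some (some b)) ++ [mark])
          ((true :: x).map fun b => some (some b)))) (by
      intro a ha
      obtain ⟨b, _, rfl⟩ := List.mem_map.1 ha
      simp [mark]) (by simp) (by simp [mark])
    (by simp; omega)
  rw [Mem.set_set, ← List.map_reverse, ← List.map_append, e, ← bits_succ] at this
  rwa [← store_set]

def sameDigit (a b : Sym) : Bool := decide (a = b ∧ a ≠ none)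

/-- Both heads advance over the longest common prefix `c`. There the scanned symbols differ unless
both words end at this place, so one final comparison of symbols decides equality of the words. -/
theorem exec_compare {σ : Mem} {t u : ℕ} {l m x y : List Sym} (htu : t ≠ u) (h : σ.tape t = zip l x)
    (h' : σ.tape u = zip m y) (hx : ∀ a ∈ x, a ≠ none) (hy : ∀ a ∈ y, a ≠ none)
    (hl : l.length + x.length + 1 ≤ sp) (hm : m.length + y.length + 1 ≤ sp) :
    ∃ c x' y', x = c ++ x' ∧ y = c ++ y' ∧ (x'.headD none = y'.headD none ↔ x = y) ∧
      Exec w sp (.loop (.tapes t u sameDigit) (.seq (goRight t) (goRight u))) σ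
        ((σ.set t (zip (c.reverse ++ l) x')).set u (zip (c.reverse ++ m) y')) := by
  have halts : ∀ {σ : Mem} {l m x y : List Sym}, σ.tape t = zip l x → σ.tape u = zip m y →
      sameDigit (x.headD none) (y.headD none) = false →
      Exec w sp (.loop (.tapes t u sameDigit) (.seq (goRight t) (goRight u))) σ
        ((σ.set t (zip l x)).set u (zip m y)) := by
    intro σ l m x y h h' hs
    rw [Mem.set_self σ h, Mem.set_self σ h']
    exact .loop_false (by simpa only [Test.eval, h, h', zip_scan] using hs)
  induction x generalizing σ l m y with
  | nil =>
    refine ⟨[], [], y, rfl, rfl, ?_, halts h h' (by simp [sameDigit])⟩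
    cases y with
    | nil => simp
    | cons b y => simpa using (hy b (by simp)).symm
  | cons a x ih =>
    cases y with
    | nil =>
      exact ⟨[], a :: x, [], rfl, rfl, by simpa using hx a (by simp),
        halts h h' (by simp [sameDigit])⟩
    | cons b y =>
      by_cases hab : a = b
      · subst hab
        simp only [List.length_cons] at hl hm
        obtain ⟨c, x', y', rfl, rfl, hiff, hex⟩ := ih (l := a :: l) (m := a :: m) (y := y)
          (σ := (σ.set t (zip (a :: l) x)).set u (zip (a :: m) y))
          (by rw [Mem.set_tape_ne _ htu]; simp) (by simp) (fun b hb => hx b (by simp [hb]))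
          (fun b hb => hy b (by simp [hb])) (by simp; omega) (by simp; omega)
        refine ⟨a :: c, x', y', rfl, rfl, by simpa using hiff, ?_⟩
        refine .loop_true ?_ (.seq (exec_goRight h (by omega)) (exec_goRight
          (by rw [Mem.set_tape_ne _ htu.symm]; exact h') (by omega))) ?_
        · simpa [Test.eval, h, h', zip_scan, sameDigit] using hx a (by simp)
        · rw [Mem.set_comm _ htu.symm, Mem.set_set, Mem.set_comm _ htu, Mem.set_set,
            Mem.set_comm _ htu.symm] at hex
          simpa using hex
      · exact ⟨[], a :: x, b :: y, rfl, rfl, by simp [hab], halts h h' (by simp [sameDigit, hab])⟩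

/-- Put into register `f` whether the registers `r` and `s` are equal. -/
def eqReg (r s f : ℕ) : Cmd α :=
  .seq (clear f) (.seq (.loop (.tapes (r + 1) (s + 1) sameDigit) (.seq (goRight (r + 1)) (goRight (s + 1))))
    (.seq (.ite (.tapes (r + 1) (s + 1) fun a b => decide (a = b))
      (write (f + 1) (some (some true)) .stay) (.move .stay))
      (.seq (goHome (r + 1)) (goHome (s + 1)))))

theorem exec_moveStay {σ : Mem} (h : σ.inp ≤ w.length + 1) : Exec w sp (.move .stay) σ σ := by
  have := Exec.move (w := w) (sp := sp) .stay σ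
  simpa [moveHead, h] using this

theorem exec_eqReg (hrs : r ≠ s) {f : ℕ} (hr : f ≠ r) (hs : f ≠ s) (hi : i ≤ w.length + 1)
    (hspr : (ρ r).size + 2 ≤ sp) (hsps : (ρ s).size + 2 ≤ sp) (hspf : (ρ f).size + 2 ≤ sp) :
    Exec w sp (eqReg r s f) (store ρ i st)
      (store (Function.update ρ f (if ρ r = ρ s then 1 else 0)) i st) := by
  have hrs' : r + 1 ≠ s + 1 := by omega
  obtain ⟨ρ', hρ'⟩ : ∃ ρ', ρ' = Function.update ρ f 0 := ⟨_, rfl⟩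
  refine .seq (exec_clear hspf) ?_
  rw [← hρ']
  have e0 : ρ' f = 0 := by simp [hρ']
  have e1 : ρ r = ρ' r := by simp [hρ', hr.symm]
  have e2 : ρ s = ρ' s := by simp [hρ', hs.symm]
  have e3 : ∀ v, Function.update ρ f v = Function.update ρ' f v := by simp [hρ']
  rw [e3, e1, e2]
  rw [e1] at hspr
  rw [e2] at hsps
  clear e1 e2 e3 hρ' hspf
  obtain ⟨c, x', y', hx, hy, hiff, hex⟩ := exec_compare (w := w) (sp := sp) hrs'
    (store_reg (ρ := ρ') (i := i) (st := st) (r := r)) (store_reg (r := s)) digits_ne_none digits_ne_none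
    (by simp [length_digits]; omega) (by simp [length_digits]; omega)
  refine .seq hex ?_
  rw [digits_injective.eq_iff] at hiff
  have lx := congrArg List.length hx
  have ly := congrArg List.length hy
  simp only [length_digits, List.length_append] at lx ly
  have hc : ∀ a ∈ c, a ≠ mark := fun a ha => digits_ne_mark (n := ρ' r) a (by simp [hx, ha])
  have hx' : x'.headD none ≠ mark := by
    rcases x' with _ | ⟨a, x'⟩
    · simp [mark]
    · exact digits_ne_mark (n := ρ' r) a (by simp [hx])
  have hy' : y'.headD none ≠ mark := by
    rcases y' with _ | ⟨a, y'⟩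
    · simp [mark]
    · exact digits_ne_mark (n := ρ' s) a (by simp [hy])
  -- The return of both heads is treated for all contents that agree with `ρ'` on the two compared
  -- registers, because the flag may have been written in the meantime.
  have home : ∀ ρ₂ : ℕ → ℕ, ρ₂ r = ρ' r → ρ₂ s = ρ' s →
      Exec w sp (.seq (goHome (r + 1)) (goHome (s + 1)))
        (((store ρ₂ i st).set (r + 1) (zip (c.reverse ++ [mark]) x')).set (s + 1)
          (zip (c.reverse ++ [mark]) y')) (store ρ₂ i st) := by
    intro ρ₂ h1 h2
    refine .seq (exec_goHome (x := c.reverse) (by simpa using hc)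
      (by rw [Mem.set_tape_ne _ hrs']; simp) hx' (by simp; omega)) ?_
    have := exec_goHome (w := w) (sp := sp) (x := c.reverse) (t := s + 1) (r := y')
      (σ := ((store ρ₂ i st).set (r + 1) (zip [mark] (digits (ρ₂ r)))).set (s + 1)
        (zip (c.reverse ++ [mark]) y')) (by simpa using hc) (by simp) hy' (by simp; omega)
    rw [Mem.set_set, Mem.set_self _ (store_reg (ρ := ρ₂) (r := r)), List.reverse_reverse, ← hy, ← h2,
      Mem.set_self _ (store_reg (ρ := ρ₂) (r := s))] at this
    rw [Mem.set_comm _ hrs'.symm, Mem.set_set, List.reverse_reverse, ← hx, ← h1,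
      Mem.set_self _ (store_reg (ρ := ρ₂) (r := r))]
    exact this
  have hev : Test.eval w (((store ρ' i st).set (r + 1) (zip (c.reverse ++ [mark]) x')).set (s + 1)
      (zip (c.reverse ++ [mark]) y')) (.tapes (r + 1) (s + 1) fun a b => decide (a = b)) =
      decide (ρ' r = ρ' s) := by
    simp only [Test.eval, Mem.set_tape_ne _ hrs', Mem.set_tape, zip_scan]
    exact decide_eq_decide.2 hiff
  by_cases heq : ρ' r = ρ' s
  · refine .seq (.ite_true (by rw [hev, decide_eq_true heq]) (exec_write_stay (l := [mark]) (r := []) ?_ _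
      (by simp; omega))) ?_
    · rw [Mem.set_tape_ne _ (by omega), Mem.set_tape_ne _ (by omega), store_reg, e0, digits_zero]
    · rw [if_pos heq, Mem.set_comm _ (by omega : s + 1 ≠ f + 1), Mem.set_comm _ (by omega : r + 1 ≠ f + 1)]
      have : some (some true) :: ([] : List Sym).tail = digits 1 := digits_one.symm
      rw [this, store_set]
      exact home _ (by simp [hr.symm]) (by simp [hs.symm])
  · refine .seq (.ite_false (by rw [hev, decide_eq_false heq]) (exec_moveStay hi)) ?_
    rw [if_neg heq, ← e0, Function.update_eq_self]
    exact home _ rfl rfl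

end

end TapeProg

namespace TapeProg

open OfflineTM

variable {α : Type}

section

variable {w : List α} {sp : ℕ} {ρ : ℕ → ℕ} {i : ℕ} {st : List ℕ} {r s : ℕ}

/-! #### Stack operations -/

def pushReg (r : ℕ) : Cmd α :=
  .seq (write 0 mark .right) (.seq (transfer 0 (r + 1)) (goHome (r + 1)))

theorem exec_pushReg (h : (stackSyms (ρ r :: st)).length + 1 ≤ sp) (hr : (ρ r).size + 2 ≤ sp) :
    Exec w sp (pushReg r) (store ρ i st) (store ρ i (ρ r :: st)) := by
  simp only [stackSyms, List.length_append, List.length_reverse, length_digits,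
    List.length_cons] at h
  refine .seq (exec_write_right store_stack _ (by omega)) ?_
  refine .seq (exec_transfer (by simp) (digits_ne_none (n := ρ r)) (by simp; rfl)
    (by rw [Mem.set_tape_ne _ (by simp)]; rfl) (by simp [length_digits]; omega)
    (by simp [length_digits]; omega)) ?_
  have := exec_goHome_digits (w := w) (sp := sp) (n := ρ r) (t := r + 1)
    (σ := (((store ρ i st).set 0 (zip (mark :: stackSyms st) [])).set 0
      (zip ((digits (ρ r)).reverse ++ mark :: stackSyms st) [])).set (r + 1)
      (zip ((digits (ρ r)).reverse ++ [mark]) [])) (by simp) hr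
  rw [Mem.set_set, Mem.set_set, Mem.set_self _ (t := r + 1)
    (T := zip [mark] (digits (ρ r))) (by rw [Mem.set_tape_ne _ (by simp)]; rfl)] at this
  have e := store_set_stack (ρ := ρ) (i := i) (st := st) (ρ r :: st)
  rw [stackSyms] at e
  rw [e] at this
  rw [Mem.set_set, e]
  exact this

/-- The head first goes down to the marker of the top entry, so that the digits are copied in their
proper order; only then are the entry and its marker erased. -/
def popReg (r : ℕ) : Cmd α :=
  .seq (clear r) (.seq (.seq (seekMark 0) (goRight 0)) (.seq (transfer (r + 1) 0)
    (.seq (goHome (r + 1)) (.seq (eraseToMark 0) (write 0 none .stay)))))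

theorem exec_popReg {v : ℕ} (h : (stackSyms (v :: st)).length + 1 ≤ sp) (hr : (ρ r).size + 2 ≤ sp)
    (hv : v.size + 2 ≤ sp) :
    Exec w sp (popReg r) (store ρ i (v :: st)) (store (Function.update ρ r v) i st) := by
  simp only [stackSyms, List.length_append, List.length_reverse, length_digits,
    List.length_cons] at h
  have hr0 : r + 1 ≠ 0 := by simp
  refine .seq (exec_clear hr) ?_
  obtain ⟨ρ', hρ'⟩ : ∃ ρ', ρ' = Function.update ρ r 0 := ⟨_, rfl⟩
  have e1 : ρ' r = 0 := by simp [hρ']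
  have e2 : Function.update ρ r v = Function.update ρ' r v := by simp [hρ']
  rw [← hρ', e2]
  refine .seq (.seq (exec_seekMark (x := (digits v).reverse) (l := stackSyms st) (r := [])
    (by simpa using digits_ne_mark) store_stack (by simp [mark])
    (by simp [length_digits]; omega)) (exec_goRight (by simp; rfl) (by omega))) ?_
  rw [Mem.set_set]
  refine .seq (exec_transfer (t := r + 1) (s := 0) (by simp) (digits_ne_none (n := v)) (l := [mark])
    (r := mark :: stackSyms st)
    (by rw [Mem.set_tape_ne _ hr0, store_reg, e1, digits_zero]) (by simp)
    (by simp [length_digits]; omega) (by simp [length_digits]; omega)) ?_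
  refine .seq (exec_goHome_digits (n := v) (by rw [Mem.set_tape_ne _ hr0]; simp) hv) ?_
  refine .seq (exec_eraseToMark (x := (digits v).reverse) (l := stackSyms st)
    (by simpa using digits_ne_mark) (by rw [Mem.set_tape_ne _ hr0.symm]; simp)
    (by simp [length_digits]; omega)) ?_
  have := exec_write_stay (w := w) (sp := sp) (t := 0) (l := stackSyms st) (r := [mark])
    (σ := (store ρ' i (v :: st)).set 0 (zip (stackSyms st) [mark]) |>.set (r + 1)
      (zip [mark] (digits v))) (by rw [Mem.set_tape_ne _ hr0.symm]; simp) none (by omega)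
  have e3 := zip_none (stackSyms st) []
  simp only [List.nil_append, List.tail_cons] at e3 this
  rw [e3, Mem.set_comm _ hr0, Mem.set_set, store_set_stack, store_set] at this
  convert this using 1
  rw [Mem.set_comm _ hr0.symm, Mem.set_set, Mem.set_comm _ hr0,
    Mem.set_comm _ hr0 (zip ((digits v).reverse ++ [mark]) []) (zip (stackSyms st) [mark]),
    Mem.set_set, Mem.set_set]

end

/-! ### Program logic for registers -/

/-- The registers are bounded by `B`, and the input head is on the input tape. -/
def Ok (w : List α) (B : ℕ) (ρ : ℕ → ℕ) (i : ℕ) : Prop :=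
  (∀ r, ρ r ≤ B) ∧ i ≤ w.length + 1

/-- From register contents `ρ` and input head position `i`, the program `c` terminates in a state that
satisfies `Q`, using registers bounded by `B`, and returns the stack as it was. -/
def Wp (w : List α) (B sp : ℕ) (st : List ℕ) (c : Cmd α) (ρ : ℕ → ℕ) (i : ℕ)
    (Q : (ℕ → ℕ) → ℕ → Prop) : Prop :=
  ∃ ρ' i', Exec w sp c (store ρ i st) (store ρ' i' st) ∧ Ok w B ρ' i' ∧ Q ρ' i'

section

variable {w : List α} {B sp : ℕ} {ρ : ℕ → ℕ} {i : ℕ} {st : List ℕ} {r s : ℕ} {a b : Cmd α}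
  {Q R : (ℕ → ℕ) → ℕ → Prop}

theorem Ok.size (h : Ok w B ρ i) (hB : B.size + 2 ≤ sp) (r : ℕ) : (ρ r).size + 2 ≤ sp :=
  (Nat.add_le_add_right (Nat.size_le_size (h.1 r)) 2).trans hB

theorem Ok.update (h : Ok w B ρ i) {v : ℕ} (hv : v ≤ B) : Ok w B (Function.update ρ r v) i := by
  refine ⟨fun r' => ?_, h.2⟩
  by_cases hr : r' = r
  · subst hr; simpa using hv
  · simpa [hr] using h.1 r'

theorem Wp.mono (h : Wp w B sp st a ρ i Q) (hQ : ∀ ρ' i', Ok w B ρ' i' → Q ρ' i' → R ρ' i') :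
    Wp w B sp st a ρ i R := by
  obtain ⟨ρ', i', h1, h2, h3⟩ := h
  exact ⟨ρ', i', h1, h2, hQ _ _ h2 h3⟩

theorem Wp.seq (h : Wp w B sp st a ρ i Q)
    (hQ : ∀ ρ' i', Ok w B ρ' i' → Q ρ' i' → Wp w B sp st b ρ' i' R) :
    Wp w B sp st (.seq a b) ρ i R := by
  obtain ⟨ρ', i', h1, h2, h3⟩ := h
  obtain ⟨ρ'', i'', h4, h5, h6⟩ := hQ _ _ h2 h3
  exact ⟨ρ'', i'', .seq h1 h4, h5, h6⟩

theorem wp_clear (hB : B.size + 2 ≤ sp) (h : Ok w B ρ i) (hQ : Q (Function.update ρ r 0) i) :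
    Wp w B sp st (clear r) ρ i Q :=
  ⟨_, _, exec_clear (h.size hB r), h.update (Nat.zero_le _), hQ⟩

theorem wp_copyReg (hB : B.size + 2 ≤ sp) (h : Ok w B ρ i) (hrs : r ≠ s)
    (hQ : Q (Function.update ρ r (ρ s)) i) :
    Wp w B sp st (copyReg r s) ρ i Q :=
  ⟨_, _, exec_copyReg hrs (h.size hB r) (h.size hB s), h.update (h.1 s), hQ⟩

theorem wp_incReg (hB : B.size + 2 ≤ sp) (h : Ok w B ρ i) (hr : ρ r + 1 ≤ B)
    (hQ : Q (Function.update ρ r (ρ r + 1)) i) :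
    Wp w B sp st (incReg r) ρ i Q :=
  ⟨_, _, exec_incReg ((Nat.add_le_add_right (Nat.size_le_size hr) 2).trans hB), h.update hr, hQ⟩

theorem wp_eqReg (hB : B.size + 2 ≤ sp) (hB' : 1 ≤ B) (h : Ok w B ρ i) {f : ℕ} (hrs : r ≠ s)
    (hr : f ≠ r) (hs : f ≠ s) (hQ : Q (Function.update ρ f (if ρ r = ρ s then 1 else 0)) i) :
    Wp w B sp st (eqReg r s f) ρ i Q :=
  ⟨_, _, exec_eqReg hrs hr hs h.2 (h.size hB r) (h.size hB s) (h.size hB f),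
    h.update (by split <;> omega), hQ⟩

theorem wp_move (h : Ok w B ρ i) (d : HeadMove) (hQ : Q ρ (min (moveHead i d) (w.length + 1))) :
    Wp w B sp st (.move d) ρ i Q :=
  ⟨_, _, .move d _, ⟨h.1, min_le_right _ _⟩, hQ⟩

theorem wp_ite {c : Test α} (h1 : c.eval w (store ρ i st) = true → Wp w B sp st a ρ i Q)
    (h2 : c.eval w (store ρ i st) = false → Wp w B sp st b ρ i Q) :
    Wp w B sp st (.ite c a b) ρ i Q := by
  cases hc : c.eval w (store ρ i st)
  · obtain ⟨ρ', i', h3, h4, h5⟩ := h2 hc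
    exact ⟨ρ', i', .ite_false hc h3, h4, h5⟩
  · obtain ⟨ρ', i', h3, h4, h5⟩ := h1 hc
    exact ⟨ρ', i', .ite_true hc h3, h4, h5⟩

theorem wp_ite_nonzero (h1 : ρ r ≠ 0 → Wp w B sp st a ρ i Q) (h2 : ρ r = 0 → Wp w B sp st b ρ i Q) :
    Wp w B sp st (.ite (nonzero r) a b) ρ i Q :=
  wp_ite (fun h => h1 (by simpa using h)) (fun h => h2 (by simpa using h))

/-- Total correctness without a variant: the number `M` of rounds is fixed beforehand and the
invariant is indexed by the round. -/
theorem wp_loop {c : Test α} {M : ℕ} (I : ℕ → (ℕ → ℕ) → ℕ → Prop) (h : Ok w B ρ i) (hI : I 0 ρ i)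
    (hexit : ∀ ρ i, Ok w B ρ i → I M ρ i → c.eval w (store ρ i st) = false ∧ Q ρ i)
    (hstep : ∀ k < M, ∀ ρ i, Ok w B ρ i → I k ρ i →
      c.eval w (store ρ i st) = true ∧ Wp w B sp st a ρ i (I (k + 1))) :
    Wp w B sp st (.loop c a) ρ i Q := by
  have key : ∀ j k, k + j = M → ∀ ρ i, Ok w B ρ i → I k ρ i → Wp w B sp st (.loop c a) ρ i Q := by
    intro j
    induction j with
    | zero =>
      rintro k rfl ρ i h hI
      obtain ⟨h1, h2⟩ := hexit ρ i h hI
      exact ⟨ρ, i, .loop_false h1, h, h2⟩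
    | succ j ih =>
      intro k hk ρ i h hI
      obtain ⟨h1, ρ', i', h2, h3, h4⟩ := hstep k (by omega) ρ i h hI
      obtain ⟨ρ'', i'', h5, h6, h7⟩ := ih (k + 1) (by omega) ρ' i' h3 h4
      exact ⟨ρ'', i'', .loop_true h1 h2 h5, h6, h7⟩
  exact key M 0 (by omega) ρ i h hI

/-- Repeat `a` for as often as register `r` says; register `c` counts, and register `f` is used for the
comparison. -/
def forReg (r c f : ℕ) (a : Cmd α) : Cmd α :=
  .seq (clear c) (.seq (eqReg r c f) (.loop (isZero f) (.seq a (.seq (incReg c) (eqReg r c f)))))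

/-- The condition `hmod` says that the invariant does not see the counter `c` and the flag `f`,
which the loop itself rewrites between two rounds. -/
theorem wp_forReg (hB : B.size + 2 ≤ sp) (hB' : 1 ≤ B) (h : Ok w B ρ i) {c f : ℕ} (hrc : r ≠ c)
    (hfr : f ≠ r) (hfc : f ≠ c) (I : ℕ → (ℕ → ℕ) → ℕ → Prop)
    (hmod : ∀ k ρ i u v, I k ρ i → I k (Function.update (Function.update ρ c u) f v) i)
    (hI : I 0 ρ i)
    (hstep : ∀ k < ρ r, ∀ ρ' i', Ok w B ρ' i' → ρ' r = ρ r → ρ' c = k → I k ρ' i' →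
      Wp w B sp st a ρ' i' fun ρ'' i'' => ρ'' r = ρ r ∧ ρ'' c = k ∧ I (k + 1) ρ'' i'')
    (hQ : ∀ ρ' i', ρ' r = ρ r → I (ρ r) ρ' i' → Q ρ' i') :
    Wp w B sp st (forReg r c f a) ρ i Q := by
  obtain ⟨n, hn⟩ : ∃ n, n = ρ r := ⟨_, rfl⟩
  rw [← hn] at hstep hQ
  let J : ℕ → (ℕ → ℕ) → ℕ → Prop := fun k ρ i =>
    ρ r = n ∧ ρ c = k ∧ ρ f = (if n = k then 1 else 0) ∧ I k ρ i
  have hcmp : ∀ k ρ i, Ok w B ρ i → ρ r = n → ρ c = k → I k ρ i →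
      Wp w B sp st (eqReg r c f) ρ i (J k) := by
    intro k ρ i h h1 h2 h3
    refine wp_eqReg hB hB' h hrc hfr hfc ⟨by simpa [hfr.symm] using h1, by simpa [hfc.symm] using h2,
      by simp [h1, h2], ?_⟩
    have := hmod k ρ i (ρ c) (if ρ r = ρ c then 1 else 0) h3
    rwa [Function.update_eq_self] at this
  refine Wp.seq (Q := fun ρ' i' => ρ' r = n ∧ ρ' c = 0 ∧ I 0 ρ' i')
    (wp_clear hB h ⟨by simp [hrc, hn], by simp, ?_⟩) fun ρ₁ i₁ h₁ ⟨e1, e2, e3⟩ =>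
    (hcmp 0 ρ₁ i₁ h₁ e1 e2 e3).seq fun ρ₂ i₂ h₂ hJ => wp_loop (M := n) J h₂ hJ ?_ ?_
  · have := hmod 0 ρ i 0 (ρ f) hI
    rwa [Function.update_comm hfc.symm, Function.update_eq_self] at this
  · rintro ρ i h ⟨h1, h2, h3, h4⟩
    exact ⟨by simp [h3], hQ ρ i h1 h4⟩
  · rintro k hk ρ i h ⟨h1, h2, h3, h4⟩
    refine ⟨by simp [h3, hk.ne'], (hstep k hk ρ i h h1 h2 h4).seq fun ρ' i' h' ⟨e1, e2, e3⟩ => ?_⟩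
    have hle : k + 1 ≤ B := by have := h.1 r; omega
    refine Wp.seq (Q := fun ρ' i' => ρ' r = n ∧ ρ' c = k + 1 ∧ I (k + 1) ρ' i')
      (wp_incReg hB h' (by omega) ⟨by simp [hrc, e1], by simp [e2], ?_⟩) fun ρ₃ i₃ h₃ ⟨q1, q2, q3⟩ =>
      hcmp (k + 1) ρ₃ i₃ h₃ q1 q2 q3
    have := hmod (k + 1) ρ' i' (ρ' c + 1) (ρ' f) e3
    rwa [Function.update_comm hfc.symm, Function.update_eq_self] at this

/-! #### Reading the input -/

def atLeftEnd : InputCell α → Bool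
  | .leftEnd => true
  | _ => false

def atRightEnd : InputCell α → Bool
  | .rightEnd => true
  | _ => false

theorem atLeftEnd_readInput (p : ℕ) : atLeftEnd (readInput w p) = decide (p = 0) := by
  cases p with
  | zero => rfl
  | succ p =>
    simp only [readInput]
    split <;> simp [atLeftEnd]

theorem atRightEnd_readInput (p : ℕ) : atRightEnd (readInput w p) = decide (w.length < p) := by
  cases p with
  | zero => rfl
  | succ p =>
    simp only [readInput]
    rcases lt_or_ge p w.length with h | h
    · simp [List.getElem?_eq_getElem h, atRightEnd]
      exact h
    · simp [List.getElem?_eq_none h, atRightEnd, Nat.lt_succ_of_le h]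

/-- Move the input head to the first letter. -/
def homeInput : Cmd α :=
  .seq (.loop (.input fun a => !atLeftEnd a) (.move .left)) (.move .right)

theorem wp_homeInput (h : Ok w B ρ i) (hQ : Q ρ 1) : Wp w B sp st homeInput ρ i Q := by
  refine Wp.seq (Q := fun ρ' i' => ρ' = ρ ∧ i' = 0)
    (wp_loop (M := i) (fun k ρ' i' => ρ' = ρ ∧ i' + k = i) h ⟨rfl, rfl⟩ ?_ ?_) ?_
  · rintro ρ' i' - ⟨rfl, h2⟩
    have : i' = 0 := by omega
    exact ⟨by simp [Test.eval, store, this, atLeftEnd_readInput], rfl, this⟩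
  · rintro k hk ρ' i' h' ⟨rfl, h2⟩
    refine ⟨by simp [Test.eval, store, atLeftEnd_readInput]; omega, wp_move h' _ ⟨rfl, ?_⟩⟩
    have := h.2
    simp only [moveHead]
    omega
  · rintro ρ' i' h' ⟨rfl, rfl⟩
    exact wp_move h' _ (by simpa [moveHead] using hQ)

/-- Put into register `r` whether the letter at the position in register `r` satisfies `P`. -/
def readReg (r : ℕ) (P : InputCell α → Bool) : Cmd α :=
  .seq homeInput (.seq (forReg r (r + 1) (r + 2) (.move .right))
    (.seq (clear r) (.ite (.input P) (incReg r) (.move .stay))))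

/-- The head starts on cell `1`, which holds letter `0`, and moves right as often as the register
says. It cannot leave the right end marker, hence the truncated position. Registers above `r` serve
as scratch space. -/
theorem wp_readReg (hB : B.size + 2 ≤ sp) (hB' : 1 ≤ B) (h : Ok w B ρ i) (P : InputCell α → Bool)
    (hQ : ∀ ρ' i', (∀ s < r, ρ' s = ρ s) →
      ρ' r = (if P (readInput w (min (ρ r + 1) (w.length + 1))) then 1 else 0) → Q ρ' i') :
    Wp w B sp st (readReg r P) ρ i Q := by
  refine (wp_homeInput (Q := fun ρ' i' => ρ' = ρ ∧ i' = 1) h ⟨rfl, rfl⟩).seq ?_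
  rintro ρ₁ i₁ h₁ ⟨rfl, rfl⟩
  refine (wp_forReg hB hB' h₁ (by simp) (by simp) (by simp)
    (I := fun k ρ' i' => (∀ s < r, ρ' s = ρ₁ s) ∧ i' = min (k + 1) (w.length + 1))
    (Q := fun ρ' i' => (∀ s < r, ρ' s = ρ₁ s) ∧ i' = min (ρ₁ r + 1) (w.length + 1))
    ?_ ⟨fun _ _ => rfl, by simp⟩ ?_ fun ρ' i' _ h => h).seq ?_
  · rintro k ρ' i' u v ⟨h1, h2⟩
    refine ⟨fun s hs => ?_, h2⟩
    rw [Function.update_of_ne (by omega), Function.update_of_ne (by omega), h1 s hs]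
  · rintro k hk ρ' i' h' e1 e2 ⟨h1, h2⟩
    refine wp_move h' _ ⟨e1, e2, h1, ?_⟩
    simp only [moveHead, h2]
    omega
  · rintro ρ₂ i₂ h₂ ⟨h3, h4⟩
    refine (wp_clear (Q := fun ρ' i' => (∀ s < r, ρ' s = ρ₁ s) ∧ ρ' r = 0 ∧
      i' = min (ρ₁ r + 1) (w.length + 1)) hB h₂ ⟨fun s hs => ?_, by simp, h4⟩).seq ?_
    · rw [Function.update_of_ne (by omega), h3 s hs]
    rintro ρ₃ i₃ h₃ ⟨h5, h6, rfl⟩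
    refine wp_ite (fun hP => wp_incReg hB h₃ (by omega) (hQ _ _ (fun s hs => ?_) ?_)) fun hP =>
      wp_move h₃ _ (hQ _ _ h5 ?_)
    · rw [Function.update_of_ne (by omega), h5 s hs]
    · simp only [Test.eval, store] at hP
      rw [Function.update_self, h6, if_pos hP]
    · simp only [Test.eval, store] at hP
      rw [h6, hP]
      rfl

/-- Put the length of the input into register `r`. -/
def lengthReg (r : ℕ) : Cmd α :=
  .seq (clear r) (.seq homeInput
    (.loop (.input fun a => !atRightEnd a) (.seq (.move .right) (incReg r))))

theorem wp_lengthReg (hB : B.size + 2 ≤ sp) (hB' : w.length ≤ B) (h : Ok w B ρ i)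
    (hQ : ∀ ρ' i', (∀ s < r, ρ' s = ρ s) → ρ' r = w.length → Q ρ' i') :
    Wp w B sp st (lengthReg r) ρ i Q := by
  refine (wp_clear (Q := fun ρ' _ => ρ' = Function.update ρ r 0) hB h rfl).seq ?_
  rintro _ i₁ h₁ rfl
  refine (wp_homeInput (Q := fun ρ' i' => ρ' = Function.update ρ r 0 ∧ i' = 1) h₁ ⟨rfl, rfl⟩).seq ?_
  rintro _ _ h₂ ⟨rfl, rfl⟩
  refine wp_loop (M := w.length) (fun k ρ' i' => (∀ s < r, ρ' s = ρ s) ∧ ρ' r = k ∧ i' = k + 1) h₂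
    ⟨fun s hs => by rw [Function.update_of_ne (by omega)], by simp, rfl⟩ ?_ ?_
  · rintro ρ' i' - ⟨h1, h2, rfl⟩
    exact ⟨by simp [Test.eval, store, atRightEnd_readInput], hQ _ _ h1 h2⟩
  · rintro k hk ρ' i' h' ⟨h1, h2, rfl⟩
    refine ⟨by simp [Test.eval, store, atRightEnd_readInput]; omega, ?_⟩
    refine (wp_move (Q := fun ρ'' i' => ρ'' = ρ' ∧ i' = k + 1 + 1) h' _
      ⟨rfl, by simp only [moveHead]; omega⟩).seq ?_
    rintro _ _ h₃ ⟨rfl, rfl⟩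
    refine wp_incReg hB h₃ (by omega) ⟨fun s hs => ?_, by simp [h2], rfl⟩
    rw [Function.update_of_ne (by omega), h1 s hs]

end

end TapeProg

/-! ### Functions that are computable in logarithmic space -/

namespace TapeProg

open OfflineTM

/-- A type whose elements are given by an input word and by the contents of `depth` registers. -/
class Obj (X : Type) where
  depth : ℕ
  vars : X → ℕ → ℕ
  rel : List InputSym → X → Prop

open Obj

instance : Obj ℕ := ⟨1, fun n _ => n, fun _ _ => True⟩

instance : Obj Bool := ⟨1, fun b _ => b.toNat, fun _ _ => True⟩

open Classical in
noncomputable instance : Obj Prop := ⟨1, fun p _ => if p then 1 else 0, fun _ _ => True⟩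

/-- A word occupies no register: it is never copied, and `rel` forces it to be the input itself. -/
instance : Obj (List InputSym) := ⟨0, fun _ _ => 0, fun w x => x = w⟩

instance {X Y : Type} [Obj X] [Obj Y] : Obj (X × Y) :=
  ⟨depth X + depth Y, fun p j => if j < depth X then vars p.1 j else vars p.2 (j - depth X),
    fun w p => rel w p.1 ∧ rel w p.2⟩

section

variable {X Y Z : Type} [Obj X] [Obj Y] [Obj Z]

/-- `N` bounds the length of the input and the values of the variables. -/
def Bounds (w : List InputSym) (x : X) (N : ℕ) : Prop :=
  rel w x ∧ w.length + 2 ≤ N ∧ ∀ j < depth X, vars x j ≤ N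

def PolyBdd (f : X → ℕ) : Prop :=
  ∃ K, ∀ w x N, Bounds w x N → f x ≤ N ^ K

/-- `prog args b` reads the variables from the registers `args j < b`, preserves the registers below
`b`, and writes the result to the register `b`. -/
def Computes (K : ℕ) (prog : (ℕ → ℕ) → ℕ → Cmd InputSym) (f : X → ℕ) : Prop :=
  ∀ w x N, Bounds w x N → ∀ B sp, N ^ K ≤ B → B.size + 2 ≤ sp → ∀ args b,
    (∀ j < depth X, args j < b) → ∀ ρ i st, Ok w B ρ i →
    (∀ j < depth X, ρ (args j) = vars x j) →
    Wp w B sp st (prog args b) ρ i fun ρ' _ => (∀ r < b, ρ' r = ρ r) ∧ ρ' b = f x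

/-- The polynomial bound on the values keeps all registers of logarithmic size; it is what makes the
notion stable under composition. -/
def RegComp (f : X → ℕ) : Prop :=
  PolyBdd f ∧ ∃ K prog, Computes K prog f

theorem Bounds.two_le {w : List InputSym} {x : X} {N : ℕ} (h : Bounds w x N) : 2 ≤ N := by
  have := h.2.1; omega

theorem Bounds.pow_le {w : List InputSym} {x : X} {N K K' : ℕ} (h : Bounds w x N) (hK : K ≤ K') :
    N ^ K ≤ N ^ K' :=
  Nat.pow_le_pow_right (by have := h.two_le; omega) hK

theorem Computes.mono {K K' : ℕ} {prog : (ℕ → ℕ) → ℕ → Cmd InputSym} {f : X → ℕ}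
    (h : Computes K prog f) (hK : K ≤ K') : Computes K' prog f :=
  fun w x N hN B sp hB => h w x N hN B sp ((hN.pow_le hK).trans hB)

theorem PolyBdd.const (n : ℕ) : PolyBdd (fun _ : X => n) :=
  ⟨n, fun _ _ _ h => (Nat.lt_two_pow_self).le.trans (Nat.pow_le_pow_left h.two_le n)⟩

theorem PolyBdd.mono {f g : X → ℕ} (hg : PolyBdd g) (h : ∀ x, f x ≤ g x) : PolyBdd f := by
  obtain ⟨K, hK⟩ := hg
  exact ⟨K, fun w x N hN => (h x).trans (hK w x N hN)⟩

theorem PolyBdd.mul {f g : X → ℕ} (hf : PolyBdd f) (hg : PolyBdd g) :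
    PolyBdd (fun x => f x * g x) := by
  obtain ⟨K, hK⟩ := hf
  obtain ⟨K', hK'⟩ := hg
  exact ⟨K + K', fun w x N hN => (Nat.mul_le_mul (hK w x N hN) (hK' w x N hN)).trans
    (pow_add N K K').ge⟩

theorem PolyBdd.add {f g : X → ℕ} (hf : PolyBdd f) (hg : PolyBdd g) :
    PolyBdd (fun x => f x + g x) := by
  obtain ⟨K, hK⟩ := hf
  obtain ⟨K', hK'⟩ := hg
  refine ⟨max K K' + 1, fun w x N hN => ?_⟩
  have h1 := (hK w x N hN).trans (hN.pow_le (le_max_left K K'))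
  have h2 := (hK' w x N hN).trans (hN.pow_le (le_max_right K K'))
  have h3 := Nat.mul_le_mul_left (N ^ max K K') hN.two_le
  rw [pow_succ]
  dsimp only
  omega

theorem RegComp.var {j : ℕ} (hj : j < depth X) : RegComp (fun x : X => vars x j) := by
  refine ⟨⟨1, fun w x N h => by simpa using h.2.2 j hj⟩, 0, fun args b => copyReg b (args j), ?_⟩
  intro w x N hN B sp hB hsp args b hargs ρ i st hok hρ
  have := hargs j hj
  refine wp_copyReg hsp hok (by omega) ⟨fun r hr => ?_, by simp [hρ j hj]⟩
  rw [Function.update_of_ne (by omega)]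

theorem RegComp.zero : RegComp (fun _ : X => 0) := by
  refine ⟨.const 0, 0, fun _ b => clear b, ?_⟩
  intro w x N hN B sp hB hsp args b hargs ρ i st hok hρ
  refine wp_clear hsp hok ⟨fun r hr => ?_, by simp⟩
  rw [Function.update_of_ne (by omega)]

theorem RegComp.succ {f : X → ℕ} (hf : RegComp f) : RegComp (fun x => f x + 1) := by
  have hb := hf.1.add (.const 1)
  obtain ⟨K₁, hK₁⟩ := hb
  obtain ⟨_, K, pf, hp⟩ := hf
  refine ⟨⟨K₁, hK₁⟩, max K K₁, fun args b => .seq (pf args b) (incReg b), ?_⟩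
  intro w x N hN B sp hB hsp args b hargs ρ i st hok hρ
  refine ((hp.mono (le_max_left K K₁)) w x N hN B sp hB hsp args b hargs ρ i st hok hρ).seq ?_
  rintro ρ' i' hok' ⟨h1, h2⟩
  have h3 := (hK₁ w x N hN).trans ((hN.pow_le (le_max_right K K₁)).trans hB)
  refine wp_incReg hsp hok' (by rw [h2]; exact h3) ⟨fun r hr => ?_, by simp [h2]⟩
  rw [Function.update_of_ne (by omega), h1 r hr]

theorem RegComp.const (n : ℕ) : RegComp (fun _ : X => n) := by
  induction n with
  | zero => exact .zero
  | succ n ih => exact ih.succ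

theorem RegComp.ite {c f g : X → ℕ} (hc : RegComp c) (hf : RegComp f) (hg : RegComp g) :
    RegComp (fun x => if c x ≠ 0 then f x else g x) := by
  refine ⟨(hf.1.add hg.1).mono fun x => by split <;> omega, ?_⟩
  obtain ⟨-, Kc, pc, hpc⟩ := hc
  obtain ⟨-, Kf, pf, hpf⟩ := hf
  obtain ⟨-, Kg, pg, hpg⟩ := hg
  refine ⟨max Kc (max Kf Kg), fun args b => .seq (pc args b) (.ite (nonzero b) (pf args b) (pg args b)), ?_⟩
  intro w x N hN B sp hB hsp args b hargs ρ i st hok hρ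
  refine ((hpc.mono (by simp)) w x N hN B sp hB hsp args b hargs ρ i st hok hρ).seq ?_
  rintro ρ' i' hok' ⟨h1, h2⟩
  have hρ' : ∀ j < depth X, ρ' (args j) = vars x j := fun j hj => by
    rw [h1 _ (hargs j hj), hρ j hj]
  refine wp_ite_nonzero (fun h => ?_) (fun h => ?_)
  · refine ((hpf.mono (by simp)) w x N hN B sp hB hsp args b hargs ρ' i' st hok' hρ').mono ?_
    rintro ρ'' i'' _ ⟨h3, h4⟩
    exact ⟨fun r hr => by rw [h3 r hr, h1 r hr], by dsimp only; rw [h4, if_pos (by rwa [← h2])]⟩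
  · refine ((hpg.mono (by simp)) w x N hN B sp hB hsp args b hargs ρ' i' st hok' hρ').mono ?_
    rintro ρ'' i'' _ ⟨h3, h4⟩
    exact ⟨fun r hr => by rw [h3 r hr, h1 r hr], by dsimp only; rw [h4, if_neg (by rw [← h2]; simpa using h)]⟩

theorem Bounds.one_le {w : List InputSym} {x : X} {N : ℕ} (h : Bounds w x N) {K B : ℕ}
    (hB : N ^ K ≤ B) : 1 ≤ B :=
  (Nat.one_le_pow _ _ (by have := h.two_le; omega)).trans hB

theorem RegComp.eq {f g : X → ℕ} (hf : RegComp f) (hg : RegComp g) :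
    RegComp (fun x => if f x = g x then 1 else 0) := by
  refine ⟨(PolyBdd.const 1).mono fun x => by split <;> omega, ?_⟩
  obtain ⟨-, Kf, pf, hpf⟩ := hf
  obtain ⟨-, Kg, pg, hpg⟩ := hg
  refine ⟨max Kf Kg, fun args b => .seq (pf args b) (.seq (pg args (b + 1))
    (.seq (eqReg b (b + 1) (b + 2)) (copyReg b (b + 2)))), ?_⟩
  intro w x N hN B sp hB hsp args b hargs ρ i st hok hρ
  refine ((hpf.mono (by simp)) w x N hN B sp hB hsp args b hargs ρ i st hok hρ).seq ?_
  rintro ρ₁ i₁ hok₁ ⟨h1, h2⟩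
  refine ((hpg.mono (by simp)) w x N hN B sp hB hsp args (b + 1)
    (fun j hj => (hargs j hj).trans (by simp)) ρ₁ i₁ st hok₁
    fun j hj => by rw [h1 _ (hargs j hj), hρ j hj]).seq ?_
  rintro ρ₂ i₂ hok₂ ⟨h3, h4⟩
  refine (wp_eqReg (Q := fun ρ' _ => (∀ r < b, ρ' r = ρ r) ∧
    ρ' (b + 2) = if f x = g x then 1 else 0) hsp (hN.one_le hB) hok₂ (by simp) (by simp) (by simp)
    ⟨fun r hr => ?_, ?_⟩).seq ?_
  · rw [Function.update_of_ne (by omega), h3 r (by omega), h1 r hr]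
  · rw [Function.update_self, h3 b (by simp), h2, h4]
  · rintro ρ₃ i₃ hok₃ ⟨h5, h6⟩
    refine wp_copyReg hsp hok₃ (by simp) ⟨fun r hr => ?_, by simp [h6]⟩
    rw [Function.update_of_ne (by omega), h5 r hr]

theorem RegComp.length {f : X → List InputSym} (hf : ∀ w x, rel w x → rel w (f x)) :
    RegComp (fun x => (f x).length) := by
  have hf' : ∀ w x, rel w x → f x = w := hf
  refine ⟨⟨1, fun w x N hN => ?_⟩, 1, fun _ b => lengthReg b, ?_⟩
  · have := hN.2.1
    dsimp only
    rw [hf' w x hN.1, pow_one]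
    omega
  · intro w x N hN B sp hB hsp args b hargs ρ i st hok hρ
    have := hN.2.1
    exact wp_lengthReg hsp (by rw [pow_one] at hB; omega) hok fun ρ' i' h1 h2 =>
      ⟨h1, by dsimp only; rw [h2, hf' w x hN.1]⟩

open Classical in
theorem RegComp.read {f : X → List InputSym} (hf : ∀ w x, rel w x → rel w (f x)) {p : X → ℕ}
    (hp : RegComp p) (a : InputSym) :
    RegComp (fun x => if (f x)[p x]? = some a then 1 else 0) := by
  have hf' : ∀ w x, rel w x → f x = w := hf
  refine ⟨(PolyBdd.const 1).mono fun x => by split <;> omega, ?_⟩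
  obtain ⟨-, Kp, pp, hpp⟩ := hp
  refine ⟨Kp, fun args b => .seq (pp args b) (readReg b fun c => decide (c = .letter a)), ?_⟩
  intro w x N hN B sp hB hsp args b hargs ρ i st hok hρ
  refine (hpp w x N hN B sp hB hsp args b hargs ρ i st hok hρ).seq ?_
  rintro ρ₁ i₁ hok₁ ⟨h1, h2⟩
  refine wp_readReg hsp (hN.one_le hB) hok₁ _ fun ρ' i' h3 h4 =>
    ⟨fun r hr => by rw [h3 r hr, h1 r hr], ?_⟩
  dsimp only
  rw [h4, h2, hf' w x hN.1, Nat.add_min_add_right]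
  congr 1
  simp only [readInput, eq_iff_iff]
  rcases lt_or_ge (p x) w.length with h | h
  · simp [min_eq_left h.le, List.getElem?_eq_getElem h]
  · simp [min_eq_right h, List.getElem?_eq_none h]

/-- The components are computed one after the other into consecutive registers, each program leaving
the registers below its own untouched. A common exponent serves for the values and for the programs.
-/
theorem exists_tuple (n : ℕ) (f : ℕ → X → ℕ) (hf : ∀ j < n, RegComp (f j)) :
    ∃ K, ∃ prog : (ℕ → ℕ) → ℕ → Cmd InputSym, ∀ w x N, Bounds w x N →
      (∀ j < n, f j x ≤ N ^ K) ∧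
      ∀ B sp, N ^ K ≤ B → B.size + 2 ≤ sp → ∀ args b, (∀ j < depth X, args j < b) →
        ∀ ρ i st, Ok w B ρ i → (∀ j < depth X, ρ (args j) = vars x j) →
        Wp w B sp st (prog args b) ρ i fun ρ' _ => (∀ r < b, ρ' r = ρ r) ∧
          ∀ j < n, ρ' (b + j) = f j x := by
  induction n with
  | zero =>
    refine ⟨0, fun _ _ => .move .stay, fun w x N hN => ⟨by simp, ?_⟩⟩
    intro B sp hB hsp args b hargs ρ i st hok hρ
    exact wp_move hok _ ⟨fun _ _ => rfl, by simp⟩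
  | succ n ih =>
    obtain ⟨K, pt, hpt⟩ := ih fun j hj => hf j (by omega)
    obtain ⟨⟨K', hK'⟩, Kf, pf, hpf⟩ := hf n (by simp)
    refine ⟨max K (max K' Kf), fun args b => .seq (pt args b) (pf args (b + n)),
      fun w x N hN => ⟨fun j hj => ?_, ?_⟩⟩
    · rcases Nat.lt_succ_iff_lt_or_eq.1 hj with hj | rfl
      · exact ((hpt w x N hN).1 j hj).trans (hN.pow_le (by simp))
      · exact (hK' w x N hN).trans (hN.pow_le (by simp))
    · intro B sp hB hsp args b hargs ρ i st hok hρ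
      refine ((hpt w x N hN).2 B sp ((hN.pow_le (by simp)).trans hB) hsp args b hargs ρ i st hok
        hρ).seq ?_
      rintro ρ₁ i₁ hok₁ ⟨h1, h2⟩
      refine (hpf w x N hN B sp ((hN.pow_le (by simp)).trans hB) hsp args (b + n)
        (fun j hj => (hargs j hj).trans_le (by simp)) ρ₁ i₁ st hok₁
        fun j hj => by rw [h1 _ (hargs j hj), hρ j hj]).mono ?_
      rintro ρ₂ i₂ _ ⟨h3, h4⟩
      refine ⟨fun r hr => by rw [h3 r (by omega), h1 r hr], fun j hj => ?_⟩
      rcases Nat.lt_succ_iff_lt_or_eq.1 hj with hj | rfl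
      · rw [h3 _ (by omega), h2 j hj]
      · exact h4

/-- The function `f` preserves the input word, and each of its components is computable. -/
@[fun_prop]
def LS (f : X → Y) : Prop :=
  (∀ w x, rel w x → rel w (f x)) ∧ ∀ j < depth Y, RegComp fun x => vars (f x) j

/-- The intermediate values are kept in registers. They are polynomially bounded in `N`, so the
program for `g` is run with a power of `N` in the role of `N`, and the exponents multiply. -/
theorem RegComp.comp {g : Y → ℕ} {f : X → Y} (hg : RegComp g) (hf : LS f) :
    RegComp (fun x => g (f x)) := by
  obtain ⟨hrel, hf⟩ := hf
  obtain ⟨K, pt, hpt⟩ := exists_tuple (depth Y) (fun j x => vars (f x) j) hf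
  obtain ⟨⟨K', hK'⟩, Kg, pg, hpg⟩ := hg
  -- The exponent is `K + 1` rather than `K` because the power also has to dominate `N` itself.
  have hbd : ∀ w x N, Bounds w x N → Bounds w (f x) (N ^ (K + 1)) := fun w x N hN =>
    ⟨hrel w x hN.1, hN.2.1.trans (Nat.le_self_pow (by simp) N),
      fun j hj => ((hpt w x N hN).1 j hj).trans (hN.pow_le (by simp))⟩
  refine ⟨⟨(K + 1) * K', fun w x N hN => ?_⟩, max K ((K + 1) * Kg),
    fun args b => .seq (pt args b) (.seq (pg (fun j => b + j) (b + depth Y + 1))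
      (copyReg b (b + depth Y + 1))), ?_⟩
  · rw [pow_mul]
    exact hK' w (f x) _ (hbd w x N hN)
  · intro w x N hN B sp hB hsp args b hargs ρ i st hok hρ
    refine ((hpt w x N hN).2 B sp ((hN.pow_le (by simp)).trans hB) hsp args b hargs ρ i st hok
        hρ).seq ?_
    rintro ρ₁ i₁ hok₁ ⟨h1, h2⟩
    refine (hpg w (f x) _ (hbd w x N hN) B sp
      (by rw [← pow_mul]; exact (hN.pow_le (by simp)).trans hB) hsp (fun j => b + j)
      (b + depth Y + 1) (fun j hj => by omega) ρ₁ i₁ st hok₁ h2).seq ?_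
    rintro ρ₂ i₂ hok₂ ⟨h3, h4⟩
    refine wp_copyReg hsp hok₂ (by omega) ⟨fun r hr => ?_, by simp [h4]⟩
    rw [Function.update_of_ne (by omega), h3 r (by omega), h1 r hr]

end

end TapeProg

/-! ### Bounded recursion and the closure properties of logarithmic space -/

namespace TapeProg

open OfflineTM Obj

/-- `loopN n a f` is the result of `n` steps `(k, acc) ↦ f k acc`, starting with `a`. -/
def loopN (n a : ℕ) (f : ℕ → ℕ → ℕ) : ℕ :=
  Nat.rec a f n

theorem loopN_zero (a : ℕ) (f : ℕ → ℕ → ℕ) : loopN 0 a f = a := rfl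

theorem loopN_succ (n a : ℕ) (f : ℕ → ℕ → ℕ) : loopN (n + 1) a f = f n (loopN n a f) := rfl

section

variable {X Y Z : Type} [Obj X] [Obj Y] [Obj Z]

theorem RegComp.congr {f g : X → ℕ} (hf : RegComp f) (h : ∀ x, f x = g x) : RegComp g :=
  funext h ▸ hf

/-- A bound on all intermediate values is indispensable: without it, repeated squaring would leave
the polynomially bounded functions. -/
theorem RegComp.loop {n a : X → ℕ} {f : X → ℕ → ℕ → ℕ} (hn : RegComp n) (ha : RegComp a)
    (hf : RegComp fun p : (X × ℕ) × ℕ => f p.1.1 p.1.2 p.2) {bnd : X → ℕ} (hb : PolyBdd bnd)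
    (hle : ∀ x, ∀ k ≤ n x, loopN k (a x) (f x) ≤ bnd x) :
    RegComp (fun x => loopN (n x) (a x) (f x)) := by
  refine ⟨hb.mono fun x => hle x _ le_rfl, ?_⟩
  obtain ⟨⟨Kn, hKn⟩, K₁, pn, hpn⟩ := hn
  obtain ⟨-, K₂, pa, hpa⟩ := ha
  obtain ⟨-, K₃, pf, hpf⟩ := hf
  obtain ⟨Kb, hKb⟩ := hb
  -- The body reads the parameters where they are, the round from the counter `b + 2`, and the
  -- accumulator from `b`.
  let args' : (ℕ → ℕ) → ℕ → ℕ → ℕ := fun args b j =>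
    if j < depth X then args j else if j = depth X then b + 2 else b
  obtain ⟨K, hK⟩ : ∃ K, K = K₁ + K₂ + (Kb + Kn + 1) * K₃ + (Kb + Kn + 1) := ⟨_, rfl⟩
  refine ⟨K, fun args b => .seq (pa args b) (.seq (pn args (b + 1))
    (forReg (b + 1) (b + 2) (b + 3) (.seq (pf (args' args b) (b + 4)) (copyReg b (b + 4))))), ?_⟩
  intro w x N hN B sp hB hsp args b hargs ρ i st hok hρ
  refine (hpa.mono (by omega) w x N hN B sp hB hsp args b hargs ρ i st hok hρ).seq ?_
  rintro ρ₁ i₁ hok₁ ⟨h1, h2⟩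
  refine (hpn.mono (by omega) w x N hN B sp hB hsp args (b + 1)
    (fun j hj => (hargs j hj).trans (by simp)) ρ₁ i₁ st hok₁
    fun j hj => by rw [h1 _ (hargs j hj), hρ j hj]).seq ?_
  rintro ρ₂ i₂ hok₂ ⟨h3, h4⟩
  refine wp_forReg hsp (hN.one_le hB) hok₂ (by simp) (by simp) (by simp)
    (I := fun k ρ' _ => (∀ r < b, ρ' r = ρ r) ∧ ρ' b = loopN k (a x) (f x)) ?_ ?_ ?_ ?_
  · rintro k ρ' i' u v ⟨h5, h6⟩
    refine ⟨fun r hr => ?_, ?_⟩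
    · rw [Function.update_of_ne (by omega), Function.update_of_ne (by omega), h5 r hr]
    · rw [Function.update_of_ne (by omega), Function.update_of_ne (by omega), h6]
  · exact ⟨fun r hr => by rw [h3 r (by omega), h1 r hr], by rw [h3 b (by simp), h2]; rfl⟩
  · rintro k hk ρ' i' hok' e1 e2 ⟨h5, h6⟩
    rw [h4] at hk
    -- A single power of `N` has to dominate the parameters, the counter and the accumulator.
    have hbd : Bounds w ((x, k), loopN k (a x) (f x)) (N ^ (Kb + Kn + 1)) := by
      refine ⟨⟨⟨hN.1, trivial⟩, trivial⟩, hN.2.1.trans (Nat.le_self_pow (by simp) N), fun j hj => ?_⟩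
      have l1 := (hKn w x N hN).trans (hN.pow_le (show Kn ≤ Kb + Kn + 1 by omega))
      have l2 := (hKb w x N hN).trans (hN.pow_le (show Kb ≤ Kb + Kn + 1 by omega))
      have l3 := hle x k hk.le
      simp only [vars]
      split_ifs with h7 h8
      · exact (hN.2.2 j h8).trans (Nat.le_self_pow (by simp) N)
      · omega
      · omega
    refine (hpf w _ _ hbd B sp (by rw [← pow_mul]; exact (hN.pow_le (by omega)).trans hB) hsp
      (args' args b) (b + 4) (fun j hj => ?_) ρ' i' st hok' fun j hj => ?_).seq ?_
    · simp only [args']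
      split_ifs with h7
      · exact (hargs j h7).trans (by simp)
      · omega
      · omega
    · simp only [args', vars, depth] at hj ⊢
      by_cases h7 : j < depth X
      · rw [if_pos h7, if_pos (by omega), if_pos h7, h5 _ (hargs j h7), hρ j h7]
      · by_cases h8 : j = depth X
        · rw [if_neg h7, if_pos h8, if_pos (by omega), if_neg h7, e2]
        · rw [if_neg h7, if_neg h8, if_neg (by omega), h6]
    rintro ρ₄ i₄ hok₄ ⟨h7, h8⟩
    refine wp_copyReg hsp hok₄ (by simp) ⟨?_, ?_, fun r hr => ?_, ?_⟩
    · rw [Function.update_of_ne (by omega), h7 _ (by omega), e1]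
    · rw [Function.update_of_ne (by omega), h7 _ (by omega), e2]
    · rw [Function.update_of_ne (by omega), h7 _ (by omega), h5 r hr]
    · rw [Function.update_self, h8]
      rfl
  · rintro ρ' i' e1 ⟨h5, h6⟩
    exact ⟨h5, by rw [h6, h4]⟩

theorem LS.reg {f : X → ℕ} (h : LS f) : RegComp f := h.2 0 Nat.one_pos

theorem RegComp.ls {f : X → ℕ} (h : RegComp f) : LS f := ⟨fun _ _ _ => trivial, fun _ _ => h⟩

open Classical in
theorem LS.ind {p : X → Prop} (h : LS p) : RegComp (fun x => if p x then 1 else 0) := h.2 0 Nat.one_pos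

open Classical in
theorem LS.of_ind {p : X → Prop} (h : RegComp (fun x => if p x then 1 else 0)) : LS p :=
  ⟨fun _ _ _ => trivial, fun _ _ => h⟩

theorem LS.toNat {f : X → Bool} (h : LS f) : RegComp (fun x => (f x).toNat) := h.2 0 Nat.one_pos

theorem LS.of_toNat {f : X → Bool} (h : RegComp (fun x => (f x).toNat)) : LS f :=
  ⟨fun _ _ _ => trivial, fun _ _ => h⟩

@[fun_prop]
theorem LS.id : LS (fun x : X => x) := ⟨fun _ _ h => h, fun _ hj => RegComp.var hj⟩

@[fun_prop]
theorem LS.const_nat (n : ℕ) : LS (fun _ : X => n) := (RegComp.const n).ls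

@[fun_prop]
theorem LS.comp {f : Y → Z} {g : X → Y} (hf : LS f) (hg : LS g) : LS (fun x => f (g x)) :=
  ⟨fun w x h => hf.1 w _ (hg.1 w x h), fun j hj => (hf.2 j hj).comp hg⟩

@[fun_prop]
theorem LS.prodMk {f : X → Y} {g : X → Z} (hf : LS f) (hg : LS g) : LS (fun x => (f x, g x)) := by
  refine ⟨fun w x h => ⟨hf.1 w x h, hg.1 w x h⟩, fun j hj => ?_⟩
  simp only [vars, depth] at hj ⊢
  by_cases h : j < depth Y
  · simpa only [h, if_true] using hf.2 j h
  · simpa only [h, if_false] using hg.2 (j - depth Y) (by omega)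

theorem LS.fst' : LS (fun p : Y × Z => p.1) := by
  refine ⟨fun w x h => h.1, fun j hj => (RegComp.var (X := Y × Z) (j := j) ?_).congr fun p => ?_⟩
  · exact hj.trans_le (Nat.le_add_right _ _)
  · simp only [vars, hj, if_true]

theorem LS.snd' : LS (fun p : Y × Z => p.2) := by
  refine ⟨fun w x h => h.2, fun j hj => (RegComp.var (X := Y × Z) (j := depth Y + j) ?_).congr fun p => ?_⟩
  · exact Nat.add_lt_add_left hj _
  · simp [vars]

@[fun_prop]
theorem LS.fst {f : X → Y × Z} (hf : LS f) : LS (fun x => (f x).1) := LS.fst'.comp hf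

@[fun_prop]
theorem LS.snd {f : X → Y × Z} (hf : LS f) : LS (fun x => (f x).2) := LS.snd'.comp hf

@[fun_prop]
theorem LS.ite {c : X → Prop} [∀ x, Decidable (c x)] {f g : X → Y} (hc : LS c) (hf : LS f)
    (hg : LS g) : LS (fun x => if c x then f x else g x) := by
  refine ⟨fun w x h => ?_, fun j hj => ?_⟩
  · dsimp only
    split
    · exact hf.1 w x h
    · exact hg.1 w x h
  · refine (RegComp.ite hc.ind (hf.2 j hj) (hg.2 j hj)).congr fun x => ?_
    by_cases h : c x <;> simp [h]

@[fun_prop]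
theorem LS.and {p q : X → Prop} (hp : LS p) (hq : LS q) : LS (fun x => p x ∧ q x) := by
  classical
  exact .of_ind ((RegComp.ite hp.ind hq.ind .zero).congr fun x => by
    by_cases h : p x <;> simp [h])

@[fun_prop]
theorem LS.not {p : X → Prop} (hp : LS p) : LS (fun x => ¬ p x) := by
  classical
  exact .of_ind ((RegComp.ite hp.ind .zero (RegComp.const 1)).congr fun x => by
    by_cases h : p x <;> simp [h])

theorem LS.congr_prop {p q : X → Prop} (hp : LS p) (h : ∀ x, p x ↔ q x) : LS q :=
  (funext fun x => propext (h x) : p = q) ▸ hp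

@[fun_prop]
theorem LS.or {p q : X → Prop} (hp : LS p) (hq : LS q) : LS (fun x => p x ∨ q x) :=
  (hp.not.and hq.not).not.congr_prop fun x => by tauto

@[fun_prop]
theorem LS.imp {p q : X → Prop} (hp : LS p) (hq : LS q) : LS (fun x => p x → q x) :=
  (hp.and hq.not).not.congr_prop fun x => by tauto

@[fun_prop]
theorem LS.iff {p q : X → Prop} (hp : LS p) (hq : LS q) : LS (fun x => p x ↔ q x) :=
  ((hp.imp hq).and (hq.imp hp)).congr_prop fun x => by tauto

@[fun_prop]
theorem LS.eq_nat {f g : X → ℕ} (hf : LS f) (hg : LS g) : LS (fun x => f x = g x) :=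
  .of_ind ((hf.reg.eq hg.reg).congr fun x => by simp)

@[fun_prop]
theorem LS.coe_bool {f : X → Bool} (hf : LS f) : LS (fun x => f x = true) :=
  .of_ind (hf.toNat.congr fun x => by cases f x <;> simp)

@[fun_prop]
theorem LS.decide {p : X → Prop} [∀ x, Decidable (p x)] (hp : LS p) :
    LS (fun x => decide (p x)) :=
  .of_toNat (hp.ind.congr fun x => by by_cases h : p x <;> simp [h])

@[fun_prop]
theorem LS.eq_bool {f g : X → Bool} (hf : LS f) (hg : LS g) : LS (fun x => f x = g x) :=
  (hf.coe_bool.iff hg.coe_bool).congr_prop fun x => by cases f x <;> cases g x <;> simp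

@[fun_prop]
theorem LS.not_bool {f : X → Bool} (hf : LS f) : LS (fun x => !f x) :=
  .of_toNat ((RegComp.ite hf.toNat .zero (RegComp.const 1)).congr fun x => by cases f x <;> simp)

@[fun_prop]
theorem LS.xor {f g : X → Bool} (hf : LS f) (hg : LS g) : LS (fun x => Bool.xor (f x) (g x)) :=
  .of_toNat ((RegComp.ite hf.toNat hg.not_bool.toNat hg.toNat).congr fun x => by
    cases f x <;> cases g x <;> simp)

@[fun_prop]
theorem LS.toNat_bool {f : X → Bool} (hf : LS f) : LS (fun x => (f x).toNat) := hf.toNat.ls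

/-- The letter `a` is at position `p` of the word `w`. -/
def At (a : InputSym) (w : List InputSym) (p : ℕ) : Prop := w[p]? = some a

@[fun_prop]
theorem LS.at {a : InputSym} {f : X → List InputSym} {p : X → ℕ} (hf : LS f) (hp : LS p) :
    LS (fun x => At a (f x) (p x)) := by
  classical
  exact .of_ind ((RegComp.read hf.1 hp.reg a).congr fun x => by simp only [At]; congr)

@[fun_prop]
theorem LS.length {f : X → List InputSym} (hf : LS f) : LS (fun x => (f x).length) :=
  (RegComp.length hf.1).ls

/-! #### Arithmetic -/

theorem LS.loopN {n a : X → ℕ} {f : X → ℕ → ℕ → ℕ} (hn : LS n) (ha : LS a)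
    (hf : LS fun p : (X × ℕ) × ℕ => f p.1.1 p.1.2 p.2) {bnd : X → ℕ} (hb : PolyBdd bnd)
    (hle : ∀ x, ∀ k ≤ n x, loopN k (a x) (f x) ≤ bnd x) :
    LS (fun x => TapeProg.loopN (n x) (a x) (f x)) :=
  (RegComp.loop hn.reg ha.reg hf.reg hb hle).ls

theorem LS.congr_nat {f g : X → ℕ} (hf : LS f) (h : ∀ x, f x = g x) : LS g := funext h ▸ hf

theorem LS.bdd {f : X → ℕ} (hf : LS f) : PolyBdd f := hf.reg.1

@[fun_prop]
theorem LS.add {f g : X → ℕ} (hf : LS f) (hg : LS g) : LS (fun x => f x + g x) := by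
  have h : ∀ a n, TapeProg.loopN n a (fun _ acc => acc + 1) = a + n := by
    intro a n
    induction n with
    | zero => rfl
    | succ n ih => rw [loopN_succ, ih]; rfl
  refine (LS.loopN hg hf (f := fun _ _ acc => acc + 1) ?_ (hf.bdd.add hg.bdd) fun x k hk => ?_).congr_nat
    fun x => h (f x) (g x)
  · exact (LS.snd LS.id).reg.succ.ls
  · rw [h]; omega

@[fun_prop]
theorem LS.mul {f g : X → ℕ} (hf : LS f) (hg : LS g) : LS (fun x => f x * g x) := by
  have h : ∀ a n, TapeProg.loopN n 0 (fun _ acc => acc + a) = a * n := by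
    intro a n
    induction n with
    | zero => rfl
    | succ n ih => rw [loopN_succ, ih]; rfl
  refine (LS.loopN hg (LS.const_nat 0) (f := fun x _ acc => acc + f x) ?_ (hf.bdd.mul hg.bdd)
    fun x k hk => ?_).congr_nat fun x => h (f x) (g x)
  · fun_prop
  · rw [h]; exact Nat.mul_le_mul_left _ hk

/-- There is no decrement instruction. A loop that overwrites the accumulator with its counter ends
with the last value of the counter, and with `0` if there was no round. -/
theorem LS.pred {f : X → ℕ} (hf : LS f) : LS (fun x => f x - 1) := by
  have h : ∀ n, TapeProg.loopN n 0 (fun k _ => k) = n - 1 := by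
    intro n
    cases n <;> rfl
  refine (LS.loopN hf (LS.const_nat 0) (f := fun _ k _ => k) ?_ hf.bdd
    fun x k hk => ?_).congr_nat fun x => h (f x)
  · fun_prop
  · rw [h]; omega

@[fun_prop]
theorem LS.sub {f g : X → ℕ} (hf : LS f) (hg : LS g) : LS (fun x => f x - g x) := by
  have h : ∀ a n, TapeProg.loopN n a (fun _ acc => acc - 1) = a - n := by
    intro a n
    induction n with
    | zero => rfl
    | succ n ih => rw [loopN_succ, ih]; rfl
  refine (LS.loopN hg hf (f := fun _ _ acc => acc - 1) ?_ hf.bdd fun x k hk => ?_).congr_nat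
    fun x => h (f x) (g x)
  · exact LS.pred (LS.snd LS.id)
  · rw [h]; omega

@[fun_prop]
theorem LS.le {f g : X → ℕ} (hf : LS f) (hg : LS g) : LS (fun x => f x ≤ g x) :=
  ((hf.sub hg).eq_nat (LS.const_nat 0)).congr_prop fun _ => Nat.sub_eq_zero_iff_le

@[fun_prop]
theorem LS.lt {f g : X → ℕ} (hf : LS f) (hg : LS g) : LS (fun x => f x < g x) :=
  (hg.le hf).not.congr_prop fun _ => not_le

@[fun_prop]
theorem LS.ne {f g : X → ℕ} (hf : LS f) (hg : LS g) : LS (fun x => f x ≠ g x) :=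
  (hf.eq_nat hg).not

/-! #### Bounded search -/

def exB (b : ℕ) (p : ℕ → Prop) : Prop := ∃ i < b, p i

def allB (b : ℕ) (p : ℕ → Prop) : Prop := ∀ i < b, p i

open Classical in
/-- The number of `i < b` that satisfy `p`. -/
noncomputable def countB (b : ℕ) (p : ℕ → Prop) : ℕ := Nat.count p b

open Classical in
/-- The least `i < b` that satisfies `p`, or `b` if there is none. -/
noncomputable def leastB (b : ℕ) (p : ℕ → Prop) : ℕ :=
  if h : ∃ i, i < b ∧ p i then Nat.find h else b

theorem leastB_le (b : ℕ) (p : ℕ → Prop) : leastB b p ≤ b := by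
  classical
  unfold leastB
  split_ifs with h
  · exact (Nat.find_spec h).1.le
  · exact le_rfl

theorem leastB_lt {b : ℕ} {p : ℕ → Prop} {i : ℕ} (hi : i < b) (hp : p i) : leastB b p < b := by
  classical
  have h : ∃ i, i < b ∧ p i := ⟨i, hi, hp⟩
  simp only [leastB, dif_pos h]
  exact (Nat.find_spec h).1

theorem leastB_spec {b : ℕ} {p : ℕ → Prop} (h : leastB b p < b) : p (leastB b p) := by
  classical
  unfold leastB at h ⊢
  split_ifs at h ⊢ with h'
  · exact (Nat.find_spec h').2
  · exact absurd h (lt_irrefl b)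

theorem not_of_lt_leastB {b : ℕ} {p : ℕ → Prop} {i : ℕ} (h : i < leastB b p) : ¬ p i := by
  classical
  intro hp
  have hib : i < b := h.trans_le (leastB_le b p)
  have h' : ∃ i, i < b ∧ p i := ⟨i, hib, hp⟩
  simp only [leastB, dif_pos h'] at h
  exact Nat.find_min h' h ⟨hib, hp⟩

theorem leastB_succ (b : ℕ) (p : ℕ → Prop) [Decidable (leastB b p = b ∧ ¬ p b)] :
    leastB (b + 1) p = if leastB b p = b ∧ ¬ p b then b + 1 else leastB b p := by
  split_ifs with h
  · refine (leastB_le _ _).antisymm (not_lt.1 fun hlt => ?_)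
    have hs := leastB_spec hlt
    rcases Nat.lt_succ_iff_lt_or_eq.1 hlt with hlt | heq
    · have := leastB_lt hlt hs
      omega
    · rw [heq] at hs
      exact h.2 hs
  · rcases (leastB_le b p).lt_or_eq with hlt | heq
    · have h1 := leastB_lt (p := p) (hlt.trans (Nat.lt_succ_self b)) (leastB_spec hlt)
      refine le_antisymm (not_lt.1 fun hl => not_of_lt_leastB hl (leastB_spec hlt))
        (not_lt.1 fun hl => not_of_lt_leastB hl (leastB_spec h1))
    · have hb : p b := by by_contra hb; exact h ⟨heq, hb⟩
      have h1 := leastB_lt (p := p) (show b < b + 1 by omega) hb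
      rw [heq]
      refine le_antisymm (by omega) (not_lt.1 fun hl => ?_)
      have := leastB_lt hl (leastB_spec h1)
      omega

section

variable {b : X → ℕ} {p : X → ℕ → Prop}

@[fun_prop]
theorem LS.countB (hb : LS b) (hp : LS fun q : X × ℕ => p q.1 q.2) :
    LS (fun x => countB (b x) (p x)) := by
  classical
  have h : ∀ (p : ℕ → Prop) n, TapeProg.loopN n 0 (fun k acc => if p k then acc + 1 else acc) =
      TapeProg.countB n p := by
    intro p n
    induction n with
    | zero => simp [TapeProg.countB, loopN_zero]
    | succ n ih =>
      rw [loopN_succ, ih]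
      simp only [TapeProg.countB, Nat.count_succ]
      split <;> rfl
  refine (LS.loopN hb (LS.const_nat 0) (f := fun x k acc => if p x k then acc + 1 else acc) ?_ hb.bdd
    fun x k hk => ?_).congr_nat fun x => h (p x) (b x)
  · have := hp.comp (LS.fst (LS.id (X := (X × ℕ) × ℕ)))
    fun_prop
  · rw [h]
    exact (Nat.count_le _).trans hk

@[fun_prop]
theorem LS.exB (hb : LS b) (hp : LS fun q : X × ℕ => p q.1 q.2) : LS (fun x => exB (b x) (p x)) := by
  classical
  refine ((LS.countB hb hp).eq_nat (LS.const_nat 0)).not.congr_prop fun x => ?_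
  simp only [TapeProg.countB, TapeProg.exB, Nat.count_eq_card_filter_range, Finset.card_eq_zero,
    Finset.filter_eq_empty_iff, Finset.mem_range]
  push Not
  rfl

@[fun_prop]
theorem LS.allB (hb : LS b) (hp : LS fun q : X × ℕ => p q.1 q.2) : LS (fun x => allB (b x) (p x)) :=
  (LS.exB hb (p := fun x i => ¬ p x i) hp.not).not.congr_prop fun x => by
    simp [TapeProg.exB, TapeProg.allB]

@[fun_prop]
theorem LS.leastB (hb : LS b) (hp : LS fun q : X × ℕ => p q.1 q.2) :
    LS (fun x => leastB (b x) (p x)) := by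
  classical
  -- The accumulator keeps pace with the counter until a witness is found, and is frozen from then
  -- on.
  have h : ∀ (p : ℕ → Prop) n, TapeProg.loopN n 0
      (fun k acc => if acc = k ∧ ¬ p k then k + 1 else acc) = TapeProg.leastB n p := by
    intro p n
    induction n with
    | zero => exact (Nat.le_zero.1 (leastB_le 0 p)).symm
    | succ n ih => rw [loopN_succ, ih, leastB_succ]
  refine (LS.loopN hb (LS.const_nat 0) (f := fun x k acc => if acc = k ∧ ¬ p x k then k + 1 else acc)
    ?_ hb.bdd fun x k hk => ?_).congr_nat fun x => h (p x) (b x)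
  · have := hp.comp (LS.fst (LS.id (X := (X × ℕ) × ℕ)))
    fun_prop
  · rw [h]
    exact (leastB_le _ _).trans hk

end

@[fun_prop]
theorem LS.div {f g : X → ℕ} (hf : LS f) (hg : LS g) : LS (fun x => f x / g x) := by
  classical
  -- The quotient is the least `q` with `f x < (q + 1) * g x`, and `q ≤ f x`. A zero divisor is
  -- split off because no `q` exists then and the quotient is `0` by convention.
  have h : LS fun x => if g x = 0 then 0 else TapeProg.leastB (f x + 1) fun q => f x < (q + 1) * g x := by
    fun_prop
  refine h.congr_nat fun x => ?_
  split_ifs with h0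
  · simp [h0]
  · have hpos := Nat.pos_of_ne_zero h0
    have hs : f x < (f x / g x + 1) * g x := by
      rw [mul_comm]; exact Nat.lt_mul_div_succ _ hpos
    have hlt := leastB_lt (b := f x + 1) (p := fun q => f x < (q + 1) * g x)
      (Nat.lt_succ_of_le (Nat.div_le_self (f x) (g x))) hs
    refine le_antisymm (not_lt.1 fun hl => not_of_lt_leastB hl hs) ?_
    exact Nat.lt_succ_iff.1 ((Nat.div_lt_iff_lt_mul hpos).2 (leastB_spec hlt))

@[fun_prop]
theorem LS.mod {f g : X → ℕ} (hf : LS f) (hg : LS g) : LS (fun x => f x % g x) := by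
  have h : LS fun x => f x - g x * (f x / g x) := by fun_prop
  exact h.congr_nat fun x => (Nat.mod_eq_sub (f x) (g x)).symm

theorem loopN_iterate (n a : ℕ) (f : ℕ → ℕ) : loopN n a (fun _ y => f y) = f^[n] a := by
  induction n with
  | zero => rfl
  | succ n ih => rw [loopN_succ, ih, Function.iterate_succ_apply']

theorem LS.iterate {n a : X → ℕ} {f : X → ℕ → ℕ} (hn : LS n) (ha : LS a)
    (hf : LS fun p : X × ℕ => f p.1 p.2) {bnd : X → ℕ} (hb : LS bnd)
    (hle : ∀ x k, (f x)^[k] (a x) ≤ bnd x) : LS (fun x => (f x)^[n x] (a x)) := by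
  refine (LS.loopN hn ha (f := fun x _ y => f x y) ?_ hb.bdd fun x k _ => ?_).congr_nat
    fun x => loopN_iterate _ _ _
  · exact hf.comp (g := fun p : (X × ℕ) × ℕ => (p.1.1, p.2)) (by fun_prop)
  · rw [loopN_iterate]; exact hle x k

end

end TapeProg

/-! ### Iteration with a stack -/

namespace TapeProg

open OfflineTM Obj

/-- A computation on states `Y` with a stack of numbers: a state may push a number, or may pop a number
on which the next state then depends. -/
structure StackProg (Y : Type) where
  init : List InputSym → Y
  halt : List InputSym → Y → Prop
  out : List InputSym → Y → Prop
  push : List InputSym → Y → Prop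
  pop : List InputSym → Y → Prop
  pushed : List InputSym → Y → ℕ
  next : List InputSym → Y → ℕ → Y

namespace StackProg

variable {Y : Type} [Obj Y] (P : StackProg Y)

inductive Step (w : List InputSym) : Y × List ℕ → Y × List ℕ → Prop where
  | push {y : Y} {st : List ℕ} : ¬ P.halt w y → P.push w y →
      Step w (y, st) (P.next w y 0, P.pushed w y :: st)
  | pop {y : Y} {v : ℕ} {st : List ℕ} : ¬ P.halt w y → ¬ P.push w y → P.pop w y →
      Step w (y, v :: st) (P.next w y v, st)
  | plain {y : Y} {st : List ℕ} : ¬ P.halt w y → ¬ P.push w y → ¬ P.pop w y →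
      Step w (y, st) (P.next w y 0, st)

def Within (N H : ℕ) (c : Y × List ℕ) : Prop :=
  (∀ j < depth Y, vars c.1 j ≤ N) ∧ (∀ v ∈ c.2, v ≤ N) ∧ (stackSyms c.2).length ≤ H

/-- The bounds are demanded of every configuration after the first; for the first one they are
assumed separately. -/
def Run (w : List InputSym) (N H : ℕ) : Y × List ℕ → Y × List ℕ → Prop :=
  Relation.ReflTransGen fun c c' => P.Step w c c' ∧ Within N H c'

structure Logspace : Prop where
  init : LS P.init
  halt : LS fun p : List InputSym × Y => P.halt p.1 p.2
  out : LS fun p : List InputSym × Y => P.out p.1 p.2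
  push : LS fun p : List InputSym × Y => P.push p.1 p.2
  pop : LS fun p : List InputSym × Y => P.pop p.1 p.2
  pushed : LS fun p : List InputSym × Y => P.pushed p.1 p.2
  next : LS fun p : List InputSym × Y × ℕ => P.next p.1 p.2.1 p.2.2

end StackProg

/-- Copy `n` registers, starting with register `b`, to the first registers. -/
def copyAll (b : ℕ) : ℕ → Cmd InputSym
  | 0 => .move .stay
  | n + 1 => .seq (copyAll b n) (copyReg n (b + n))

theorem wp_copyAll {w : List InputSym} {B sp : ℕ} {ρ : ℕ → ℕ} {i : ℕ} {st : List ℕ} {b n : ℕ}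
    (hB : B.size + 2 ≤ sp) (h : Ok w B ρ i) (hn : n ≤ b) :
    Wp w B sp st (copyAll b n) ρ i fun ρ' _ => (∀ j < n, ρ' j = ρ (b + j)) ∧
      ∀ j, n ≤ j → ρ' j = ρ j := by
  induction n with
  | zero => exact wp_move h _ ⟨by simp, fun _ _ => rfl⟩
  | succ n ih =>
    refine (ih (by omega)).seq ?_
    rintro ρ' i' h' ⟨h1, h2⟩
    refine wp_copyReg hB h' (by omega) ⟨fun j hj => ?_, fun j hj => ?_⟩
    · rcases Nat.lt_succ_iff_lt_or_eq.1 hj with hj | rfl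
      · rw [Function.update_of_ne hj.ne, h1 j hj]
      · rw [Function.update_self, h2 _ (by omega)]
    · rw [Function.update_of_ne (by omega), h2 j (by omega)]

-- With `d = depth Y` and `b = d + 1`, the registers below `d` hold the state, register `d` holds
-- the number taken from the stack, and results appear from `b` on. Each round of the main loop
-- simulates one step. Neither the machine nor `K` depends on `N` or `H`, which only enter the space
-- bound.
open Classical in
theorem StackProg.exists_machine {Y : Type} [Obj Y] (hY : ∀ w (y : Y), rel w y) (P : StackProg Y)
    (hP : P.Logspace) : ∃ (M : OfflineTM InputSym) (K : ℕ), ∀ (w : List InputSym) (N H : ℕ)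
      (c : Y × List ℕ), w.length + 2 ≤ N → Within N H (P.init w, []) →
      P.Run w N H (P.init w, []) c → P.halt w c.1 →
      M.Outputs w (decide (P.out w c.1)) ∧
        M.UsesSpaceAtMost w ((N ^ K).size + H + 2 : ℕ) := by
  obtain ⟨-, K₁, ph, hph⟩ := hP.halt.ind
  obtain ⟨-, K₂, po, hpo⟩ := hP.out.ind
  obtain ⟨-, K₃, pu, hpu⟩ := hP.push.ind
  obtain ⟨-, K₄, pp, hpp⟩ := hP.pop.ind
  obtain ⟨-, K₅, pv, hpv⟩ := hP.pushed.reg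
  obtain ⟨K₆, pi, hpi⟩ := exists_tuple (depth Y) (fun j w => vars (P.init w) j) hP.init.2
  obtain ⟨K₇, pn, hpn⟩ := exists_tuple (depth Y)
    (fun j (p : List InputSym × Y × ℕ) => vars (P.next p.1 p.2.1 p.2.2) j) hP.next.2
  obtain ⟨K, hK⟩ : ∃ K, K = K₁ + K₂ + K₃ + K₄ + K₅ + K₆ + K₇ + 1 := ⟨_, rfl⟩
  obtain ⟨d, hd⟩ : ∃ d, d = depth Y := ⟨_, rfl⟩
  obtain ⟨b, hb⟩ : ∃ b, b = d + 1 := ⟨_, rfl⟩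
  -- Afterwards register `d` contains the popped number, or `0` if nothing was popped; this is the
  -- last argument of the transition function.
  let upd : Cmd InputSym := .ite (nonzero b)
    (.seq (pv id b) (.seq (pushReg b) (clear d)))
    (.seq (pp id b) (.ite (nonzero b) (popReg d) (clear d)))
  -- The new state is computed above the old one and copied down only when all its components are
  -- known. The halting test comes last, so that register `b` controls the loop.
  let body : Cmd InputSym := .seq (.seq (pu id b) upd) (.seq (.seq (pn id b) (copyAll b d)) (ph id b))
  obtain ⟨M, hM⟩ := TapeProg.exists_machine (.seq (.seq (.seq (pi id b) (copyAll b d)) (ph id b))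
    (.seq (.loop (isZero b) body) (po id b))) (b + 1)
  refine ⟨M, K, fun w N H c hN hwi hrun hhalt => ?_⟩
  obtain ⟨sp, hsp⟩ : ∃ sp, sp = (N ^ K).size + H + 2 := ⟨_, rfl⟩
  obtain ⟨B, hB⟩ : ∃ B, B = N ^ K := ⟨_, rfl⟩
  have hBs : B.size + 2 ≤ sp := by rw [hB]; omega
  have hpow : ∀ K', K' ≤ K → N ^ K' ≤ B := fun K' h => by
    rw [hB]; exact Nat.pow_le_pow_right (by omega) h
  have hNB : N ≤ B := by simpa using hpow 1 (by omega)
  have hbd : ∀ (y : Y) (st : List ℕ), Within N H (y, st) →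
      Bounds w ((w, y) : List InputSym × Y) N := fun y st h =>
    ⟨⟨rfl, hY w y⟩, hN, fun j hj => by
      have : j < depth Y := by simpa [depth] using hj
      simpa [vars, depth] using h.1 j this⟩
  have hbd' : ∀ (y : Y) (st : List ℕ) (v : ℕ), Within N H (y, st) → v ≤ N →
      Bounds w ((w, y, v) : List InputSym × Y × ℕ) N := fun y st v h hv =>
    ⟨⟨rfl, hY w y, trivial⟩, hN, fun j hj => by
      have : j < depth Y + 1 := by simpa [depth] using hj
      by_cases hj' : j < depth Y
      · simpa [vars, depth, hj'] using h.1 j hj'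
      · simpa [vars, depth, hj'] using hv⟩
  have hdep : depth (List InputSym × Y) = d := by rw [hd]; exact Nat.zero_add _
  have hdep' : depth (List InputSym × Y × ℕ) = d + 1 := by rw [hd]; exact Nat.zero_add _
  have hv1 : ∀ y j, vars ((w, y) : List InputSym × Y) j = vars y j := fun y j => by
    simp [vars, depth]
  -- running a program on the registers that hold a state
  have run1 : ∀ {K' : ℕ} {prog : (ℕ → ℕ) → ℕ → Cmd InputSym} {f : List InputSym × Y → ℕ},
      Computes K' prog f → K' ≤ K → ∀ y st ρ i, Within N H (y, st) → Ok w B ρ i →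
      (∀ j < d, ρ j = vars y j) → Wp w B sp st (prog id b) ρ i fun ρ' _ =>
        (∀ r < b, ρ' r = ρ r) ∧ ρ' b = f (w, y) := by
    intro K' prog f hp hK' y st ρ i hw hok hρ
    refine hp w (w, y) N (hbd y st hw) B sp (hpow _ hK') hBs id b (fun j hj => ?_) ρ i st hok
      fun j hj => ?_
    · rw [hdep] at hj; simp only [id]; omega
    · rw [hdep] at hj; rw [hv1]; exact hρ j hj
  have hstep : ∀ y st y' st' ρ i, P.Step w (y, st) (y', st') → Within N H (y, st) →
      Within N H (y', st') → Ok w B ρ i → (∀ j < d, ρ j = vars y j) →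
      ∃ ρ' i', Exec w sp body (store ρ i st) (store ρ' i' st') ∧ Ok w B ρ' i' ∧
        (∀ j < d, ρ' j = vars y' j) ∧ ρ' b = if P.halt w y' then 1 else 0 := by
    intro y st y' st' ρ i hs hw hw' hok hρ
    obtain ⟨ρ₁, i₁, hex₁, hok₁, hρ₁, hρb₁⟩ := run1 hpu (by omega) y st ρ i hw hok hρ
    have hρ₁' : ∀ j < d, ρ₁ j = vars y j := fun j hj => by rw [hρ₁ j (by omega), hρ j hj]
    have hmid : ∃ v ρ₂ i₂, v ≤ N ∧ y' = P.next w y v ∧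
        Exec w sp upd (store ρ₁ i₁ st) (store ρ₂ i₂ st') ∧ Ok w B ρ₂ i₂ ∧
        (∀ j < d, ρ₂ j = vars y j) ∧ ρ₂ d = v := by
      have hclear : ∀ ρ i st, Ok w B ρ i → (∀ j < d, ρ j = vars y j) → ∃ ρ₂ i₂,
          Exec w sp (clear d) (store ρ i st) (store ρ₂ i₂ st) ∧ Ok w B ρ₂ i₂ ∧
          (∀ j < d, ρ₂ j = vars y j) ∧ ρ₂ d = 0 := by
        intro ρ i st hok hρ
        refine ⟨_, _, exec_clear (hok.size hBs d), hok.update (Nat.zero_le _), fun j hj => ?_,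
          by simp⟩
        rw [Function.update_of_ne hj.ne, hρ j hj]
      cases hs with
      | push hh hpush =>
        obtain ⟨ρ₂, i₂, hex₂, hok₂, hρ₂, hρb₂⟩ := run1 hpv (by omega) y st ρ₁ i₁ hw hok₁ hρ₁'
        have hst := hw'.2.2
        have e : ρ₂ b = P.pushed w y := hρb₂
        obtain ⟨ρ₃, i₃, hex₃, hok₃, hρ₃, hρd₃⟩ := hclear ρ₂ i₂ (P.pushed w y :: st) hok₂
          fun j hj => by rw [hρ₂ j (by omega), hρ₁' j hj]
        refine ⟨0, ρ₃, i₃, Nat.zero_le _, rfl, .ite_true ?_ (.seq hex₂ (.seq ?_ hex₃)), hok₃, hρ₃,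
          hρd₃⟩
        · simp [hρb₁, hpush]
        · rw [← e] at hst ⊢
          exact exec_pushReg (by simp only at hst; omega) (hok₂.size hBs b)
      | @pop _ v _ hh hpush hpop =>
        obtain ⟨ρ₂, i₂, hex₂, hok₂, hρ₂, hρb₂⟩ := run1 hpp (by omega) y (v :: st') ρ₁ i₁ hw hok₁ hρ₁'
        have hst := hw.2.2
        have hv : v ≤ N := hw.2.1 v (by simp)
        refine ⟨v, Function.update ρ₂ d v, i₂, hv, rfl, .ite_false ?_ (.seq hex₂ (.ite_true ?_ ?_)),
          hok₂.update (hv.trans hNB), fun j hj => ?_, by simp⟩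
        · simp [hρb₁, hpush]
        · simp [hρb₂, hpop]
        · exact exec_popReg (by simp only at hst; omega) (hok₂.size hBs d)
            ((Nat.add_le_add_right (Nat.size_le_size (hv.trans hNB)) 2).trans hBs)
        · rw [Function.update_of_ne hj.ne, hρ₂ j (by omega), hρ₁' j hj]
      | plain hh hpush hpop =>
        obtain ⟨ρ₂, i₂, hex₂, hok₂, hρ₂, hρb₂⟩ := run1 hpp (by omega) y st ρ₁ i₁ hw hok₁ hρ₁'
        obtain ⟨ρ₃, i₃, hex₃, hok₃, hρ₃, hρd₃⟩ := hclear ρ₂ i₂ st hok₂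
          fun j hj => by rw [hρ₂ j (by omega), hρ₁' j hj]
        refine ⟨0, ρ₃, i₃, Nat.zero_le _, rfl, .ite_false ?_ (.seq hex₂ (.ite_false ?_ hex₃)), hok₃,
          hρ₃, hρd₃⟩
        · simp [hρb₁, hpush]
        · simp [hρb₂, hpop]
    obtain ⟨v, ρ₂, i₂, hv, rfl, hex₂, hok₂, hρ₂, hρd₂⟩ := hmid
    obtain ⟨ρ₃, i₃, hex₃, hok₃, hρ₃, hρb₃⟩ := (hpn w (w, y, v) N (hbd' y st v hw hv)).2 B sp
      (hpow _ (by omega)) hBs id b (fun j hj => by rw [hdep'] at hj; simp only [id]; omega) ρ₂ i₂ st'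
      hok₂ (fun j hj => by
        rw [hdep'] at hj
        by_cases hj' : j < depth Y
        · simpa [vars, depth, hj'] using hρ₂ j (by omega)
        · have : j = d := by omega
          subst this
          simpa [vars, depth, hd] using hρd₂)
    obtain ⟨ρ₄, i₄, hex₄, hok₄, hρ₄, -⟩ := wp_copyAll (st := st') (b := b) (n := d) hBs hok₃ (by omega)
    have hρ₄' : ∀ j < d, ρ₄ j = vars (P.next w y v) j := fun j hj => by
      rw [hρ₄ j hj, hρb₃ j (by omega)]
    obtain ⟨ρ₅, i₅, hex₅, hok₅, hρ₅, hρb₅⟩ := run1 hph (by omega) _ st' ρ₄ i₄ hw' hok₄ hρ₄'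
    exact ⟨ρ₅, i₅, .seq (.seq hex₁ hex₂) (.seq (.seq hex₃ hex₄) hex₅), hok₅,
      fun j hj => by rw [hρ₅ j (by omega), hρ₄' j hj], hρb₅⟩
  have hloop : ∀ c₀, P.Run w N H c₀ c → Within N H c₀ → ∀ ρ i, Ok w B ρ i →
      (∀ j < d, ρ j = vars c₀.1 j) → (ρ b = if P.halt w c₀.1 then 1 else 0) →
      ∃ ρ' i', Exec w sp (.loop (isZero b) body) (store ρ i c₀.2) (store ρ' i' c.2) ∧ Ok w B ρ' i' ∧
        Within N H c ∧ ∀ j < d, ρ' j = vars c.1 j := by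
    intro c₀ hr
    induction hr using Relation.ReflTransGen.head_induction_on with
    | refl =>
      intro hw ρ i hok hρ hρb
      exact ⟨ρ, i, .loop_false (by simp [hρb, hhalt]), hok, hw, hρ⟩
    | @head c₀ c₁ h1 _ ih =>
      intro hw ρ i hok hρ hρb
      obtain ⟨y, st⟩ := c₀
      obtain ⟨y', st'⟩ := c₁
      obtain ⟨ρ', i', hex, hok', hρ', hρb'⟩ := hstep y st y' st' ρ i h1.1 hw h1.2 hok hρ
      obtain ⟨ρ'', i'', hex', hok'', hwc, hρ''⟩ := ih h1.2 ρ' i' hok' hρ' hρb'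
      refine ⟨ρ'', i'', .loop_true ?_ hex hex', hok'', hwc, hρ''⟩
      have hh : ¬ P.halt w y := by cases h1.1 <;> assumption
      simp [hρb, hh]
  have hok₀ : Ok w B (fun _ => 0) 0 := ⟨fun _ => Nat.zero_le _, Nat.zero_le _⟩
  obtain ⟨ρ₁, i₁, hex₁, hok₁, -, hρb₁⟩ := (hpi w w N ⟨rfl, hN, fun j hj => absurd hj (Nat.not_lt_zero j)⟩).2
    B sp (hpow _ (by omega)) hBs id b (fun j hj => absurd hj (Nat.not_lt_zero j)) (fun _ => 0) 0 []
    hok₀ (fun j hj => absurd hj (Nat.not_lt_zero j))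
  obtain ⟨ρ₂, i₂, hex₂, hok₂, hρ₂, -⟩ := wp_copyAll (st := []) (b := b) (n := d) hBs hok₁ (by omega)
  have hρ₂' : ∀ j < d, ρ₂ j = vars (P.init w) j := fun j hj => by
    rw [hρ₂ j hj, hρb₁ j (by omega)]
  obtain ⟨ρ₃, i₃, hex₃, hok₃, hρ₃, hρb₃⟩ := run1 hph (by omega) _ [] ρ₂ i₂ hwi hok₂ hρ₂'
  obtain ⟨ρ₄, i₄, hex₄, hok₄, hwc, hρ₄⟩ := hloop _ hrun hwi ρ₃ i₃ hok₃
    (fun j hj => by rw [hρ₃ j (by omega), hρ₂' j hj]) hρb₃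
  obtain ⟨ρ₅, i₅, hex₅, -, -, hρb₅⟩ := run1 hpo (by omega) c.1 c.2 ρ₄ i₄ hwc hok₄ hρ₄
  have hfin := hM w sp (store ρ₅ i₅ c.2) (by omega)
    (by rw [← store_zero]; exact .seq (.seq (.seq hex₁ hex₂) hex₃) (.seq hex₄ hex₅))
  have hout : ((store ρ₅ i₅ c.2).tape (b + 1)).scan ≠ none ↔ P.out w c.1 := by
    rw [store_reg, zip_scan, digits_headD_ne_none, hρb₅]
    simp
  rw [← hsp, ← decide_eq_decide.2 hout]
  convert hfin

end TapeProg

/-! ### Systems of gates divided into blocks -/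

namespace TapeProg

open OfflineTM Obj

/-- Gates that depend on an input word. The relation `In w p c` says that `c` is an input of the gate
`p`. The gates are divided into blocks, whose roots are selected by `Root`. The gate `g` has the value
`B w g` if some input has the value `A w g`, and otherwise the negation of it. -/
structure Gates where
  bound : List InputSym → ℕ
  In : List InputSym → ℕ → ℕ → Prop
  Root : List InputSym → ℕ → Prop
  A : List InputSym → ℕ → Bool
  B : List InputSym → ℕ → Bool
  start : List InputSym → ℕ
  Valid : List InputSym → Prop

namespace Gates

variable (D : Gates)

class Logspace (D : Gates) : Prop where
  bound : LS D.bound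
  In : LS fun q : List InputSym × ℕ × ℕ => D.In q.1 q.2.1 q.2.2
  Root : LS fun q : List InputSym × ℕ => D.Root q.1 q.2
  A : LS fun q : List InputSym × ℕ => D.A q.1 q.2
  B : LS fun q : List InputSym × ℕ => D.B q.1 q.2
  start : LS D.start
  Valid : LS D.Valid

/-- Inside a block the parent will be unique. A block root may be an input of several gates; then
any of them will do, because all of them lie in the same block. The value `D.bound w` means that
there is none. -/
noncomputable def parent (w : List InputSym) (g : ℕ) : ℕ := leastB (D.bound w) fun p => D.In w p g

open Classical in
noncomputable def blockStep (w : List InputSym) (g : ℕ) : ℕ := if D.Root w g then g else D.parent w g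

/-- The root of the block that contains a gate. -/
noncomputable def blockRoot (w : List InputSym) (g : ℕ) : ℕ := (D.blockStep w)^[D.bound w] g

/-- The root of the block above a given block. -/
noncomputable def parentBlock (w : List InputSym) (g : ℕ) : ℕ := D.blockRoot w (D.parent w g)

/-- The number of blocks below a given block. -/
noncomputable def weight (w : List InputSym) (g : ℕ) : ℕ :=
  countB (D.bound w) fun r => D.Root w r ∧ exB (D.bound w) fun t => (D.parentBlock w)^[t] r = g

/-- At least half of the weight of the parent block lies below a heavy block. The start is excluded
so that it is the top of its own chain; returning to that chain is how the end of the evaluation is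
recognized. -/
def Heavy (w : List InputSym) (g : ℕ) : Prop :=
  D.Root w g ∧ g ≠ D.start w ∧ D.weight w (D.parentBlock w g) ≤ 2 * D.weight w g

open Classical in
noncomputable def topStep (w : List InputSym) (g : ℕ) : ℕ :=
  if D.Heavy w g then D.parentBlock w g else g

/-- The first block of the chain of heavy blocks that contains a given block. -/
noncomputable def top (w : List InputSym) (g : ℕ) : ℕ := (D.topStep w)^[D.bound w] g

noncomputable def heavyChild (w : List InputSym) (g : ℕ) : ℕ :=
  leastB (D.bound w) fun c => D.Heavy w c ∧ D.parentBlock w c = g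

noncomputable def nextInput (w : List InputSym) (g i : ℕ) : ℕ := leastB (D.bound w) fun c => i ≤ c ∧ D.In w g c

/-- The number of gates before `p` with input `c`. -/
noncomputable def index (w : List InputSym) (p c : ℕ) : ℕ := countB p fun p' => D.In w p' c

/-- Inverse of `index`: it recovers a gate from the small number that is stored in a stack frame and
from the input that has just been evaluated. -/
noncomputable def nthParent (w : List InputSym) (k c : ℕ) : ℕ :=
  leastB (D.bound w) fun p => D.In w p c ∧ D.index w p c = k

theorem parent_le (w : List InputSym) (g : ℕ) : D.parent w g ≤ D.bound w := leastB_le _ _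

/-- Supplies the bound on all iterates that is required by `LS.iterate` for the walks up the tree.
-/
theorem iterate_le_max {f : ℕ → ℕ} {b : ℕ} (h : ∀ x, f x ≤ max x b) (k x : ℕ) :
    f^[k] x ≤ max x b := by
  induction k with
  | zero => simp
  | succ k ih =>
    rw [Function.iterate_succ_apply']
    exact (h _).trans (max_le ih (le_max_right _ _))

theorem blockStep_le (w : List InputSym) (g : ℕ) : D.blockStep w g ≤ max g (D.bound w) := by
  unfold blockStep
  split
  · exact le_max_left _ _
  · exact (D.parent_le w g).trans (le_max_right _ _)

theorem blockRoot_le (w : List InputSym) (g : ℕ) : D.blockRoot w g ≤ max g (D.bound w) :=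
  iterate_le_max (D.blockStep_le w) _ _

theorem parentBlock_le (w : List InputSym) (g : ℕ) : D.parentBlock w g ≤ D.bound w :=
  (D.blockRoot_le w _).trans (max_le (D.parent_le w g) le_rfl)

theorem topStep_le (w : List InputSym) (g : ℕ) : D.topStep w g ≤ max g (D.bound w) := by
  unfold topStep
  split
  · exact (D.parentBlock_le w g).trans (le_max_right _ _)
  · exact le_max_left _ _

/-! #### Computability in logarithmic space -/

section

variable {D : Gates} [D.Logspace] {X : Type} [Obj X] {w : X → List InputSym} {f g : X → ℕ}

@[fun_prop]
theorem ls_bound (hw : LS w) : LS fun x => D.bound (w x) := Logspace.bound.comp hw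

@[fun_prop]
theorem ls_in (hw : LS w) (hf : LS f) (hg : LS g) : LS fun x => D.In (w x) (f x) (g x) :=
  Logspace.In.comp (hw.prodMk (hf.prodMk hg))

@[fun_prop]
theorem ls_root (hw : LS w) (hf : LS f) : LS fun x => D.Root (w x) (f x) :=
  Logspace.Root.comp (hw.prodMk hf)

@[fun_prop]
theorem ls_a (hw : LS w) (hf : LS f) : LS fun x => D.A (w x) (f x) :=
  Logspace.A.comp (hw.prodMk hf)

@[fun_prop]
theorem ls_b (hw : LS w) (hf : LS f) : LS fun x => D.B (w x) (f x) :=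
  Logspace.B.comp (hw.prodMk hf)

@[fun_prop]
theorem ls_start (hw : LS w) : LS fun x => D.start (w x) := Logspace.start.comp hw

@[fun_prop]
theorem ls_valid (hw : LS w) : LS fun x => D.Valid (w x) := Logspace.Valid.comp hw

@[fun_prop]
theorem ls_parent (hw : LS w) (hf : LS f) : LS fun x => D.parent (w x) (f x) := by
  unfold parent; fun_prop

@[fun_prop]
theorem ls_blockStep (hw : LS w) (hf : LS f) : LS fun x => D.blockStep (w x) (f x) := by
  unfold blockStep; fun_prop

@[fun_prop]
theorem ls_blockRoot (hw : LS w) (hf : LS f) : LS fun x => D.blockRoot (w x) (f x) :=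
  LS.iterate (bnd := fun x => f x + D.bound (w x)) (f := fun x => D.blockStep (w x)) (by fun_prop) hf
    (by fun_prop) (by fun_prop)
    fun x k => (iterate_le_max (D.blockStep_le (w x)) k (f x)).trans (max_le (by omega) (by omega))

@[fun_prop]
theorem ls_parentBlock (hw : LS w) (hf : LS f) : LS fun x => D.parentBlock (w x) (f x) := by
  unfold parentBlock; fun_prop

@[fun_prop]
theorem ls_iterate_parentBlock (hw : LS w) (hf : LS f) (hg : LS g) :
    LS fun x => (D.parentBlock (w x))^[g x] (f x) :=
  LS.iterate (bnd := fun x => f x + D.bound (w x)) (f := fun x => D.parentBlock (w x)) hg hf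
    (by fun_prop) (by fun_prop)
    fun x k => (iterate_le_max (fun y => (D.parentBlock_le (w x) y).trans (le_max_right _ _))
      k (f x)).trans (max_le (by omega) (by omega))

@[fun_prop]
theorem ls_weight (hw : LS w) (hf : LS f) : LS fun x => D.weight (w x) (f x) := by
  unfold weight; fun_prop

@[fun_prop]
theorem ls_heavy (hw : LS w) (hf : LS f) : LS fun x => D.Heavy (w x) (f x) := by
  unfold Heavy; fun_prop

@[fun_prop]
theorem ls_topStep (hw : LS w) (hf : LS f) : LS fun x => D.topStep (w x) (f x) := by
  unfold topStep; fun_prop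

@[fun_prop]
theorem ls_top (hw : LS w) (hf : LS f) : LS fun x => D.top (w x) (f x) :=
  LS.iterate (bnd := fun x => f x + D.bound (w x)) (f := fun x => D.topStep (w x)) (by fun_prop) hf
    (by fun_prop) (by fun_prop)
    fun x k => (iterate_le_max (D.topStep_le (w x)) k (f x)).trans (max_le (by omega) (by omega))

@[fun_prop]
theorem ls_heavyChild (hw : LS w) (hf : LS f) : LS fun x => D.heavyChild (w x) (f x) := by
  unfold heavyChild; fun_prop

@[fun_prop]
theorem ls_nextInput (hw : LS w) (hf : LS f) (hg : LS g) :
    LS fun x => D.nextInput (w x) (f x) (g x) := by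
  unfold nextInput; fun_prop

@[fun_prop]
theorem ls_index (hw : LS w) (hf : LS f) (hg : LS g) :
    LS fun x => D.index (w x) (f x) (g x) := by
  unfold index; fun_prop

@[fun_prop]
theorem ls_nthParent (hw : LS w) (hf : LS f) (hg : LS g) :
    LS fun x => D.nthParent (w x) (f x) (g x) := by
  unfold nthParent; fun_prop

end

/-! #### The evaluation procedure -/

/-- `(up, g, i, v, h, r, s)`: if `up` does not hold, the inputs of the gate `g` from `i` on are still to
be evaluated; if `up` holds, the gate `g` has been evaluated to `v`. This happens under the assumption
that the heavy block directly below the present block has the value `h`. If `h` holds, then `r` is the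
value of the present block under the opposite assumption. The value of the first block of the present
chain of heavy blocks is the sum of `s` and of the value of the present block. -/
abbrev EvalState := Bool × ℕ × ℕ × Bool × Bool × Bool × Bool

-- Lazy evaluation: an input of value `A` settles the gate, and otherwise the scan goes on behind
-- the input `c`.
open Classical in
noncomputable def climb (w : List InputSym) (p c : ℕ) (v h r s : Bool) : EvalState :=
  if v = D.A w p then (true, p, 0, D.B w p, h, r, s) else (false, p, c + 1, false, h, r, s)

-- The cases: no input is left, so none had the value `A`; the input lies in the same block; it is
-- the heavy block, whose value is replaced by the assumption `h`; it is a light block, which starts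
-- afresh because its caller has been saved on the stack.
open Classical in
noncomputable def descend (w : List InputSym) (g c : ℕ) (h r s : Bool) : EvalState :=
  if c = D.bound w then (true, g, 0, !D.B w g, h, r, s)
  else if ¬ D.Root w c then (false, c, 0, false, h, r, s)
  else if D.Heavy w c then D.climb w g c h h r s
  else (false, c, 0, false, false, false, false)

-- Inside a block the parent gate resumes. At a block root, the first result is kept in `r` and the
-- block is repeated with the opposite assumption. If both results agree, the value of the chain is
-- known and the frame `e`, together with the top of the chain, leads back to the caller. If they
-- differ, the block is the xor of `r` and its heavy child, so `s` absorbs `r` and the heavy child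
-- is evaluated in place, without a new frame.
open Classical in
noncomputable def ascend (w : List InputSym) (g : ℕ) (v h r s : Bool) (e : ℕ) : EvalState :=
  if ¬ D.Root w g then D.climb w (D.parent w g) g v h r s
  else if ¬ h then (false, g, 0, false, true, v, s)
  else if v = r then
    D.climb w (D.nthParent w (e / 8) (D.top w g)) (D.top w g) (v ^^ s) (decide (e / 4 % 2 = 1))
      (decide (e / 2 % 2 = 1)) (decide (e % 2 = 1))
  else (false, D.heavyChild w g, 0, false, false, false, s ^^ r)

-- A frame packs the number of the calling gate with the three bits of the suspended block. The
-- called block is not stored: on return it is recomputed as the top of the chain.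
open Classical in
noncomputable def evaluator : StackProg EvalState where
  -- For invalid inputs no bound on `D.start w` is assumed, so gate `0` is a safe default; such a
  -- computation halts at once.
  init w := (false, if D.Valid w then D.start w else 0, 0, false, false, false, false)
  halt w y := match y with
    | (u, g, _, v, h, r, _) => ¬ D.Valid w ∨ u ∧ D.Root w g ∧ h ∧ v = r ∧ D.top w g = D.start w
  out w y := match y with
    | (_, _, _, v, _, _, s) => D.Valid w ∧ (v ^^ s)
  push w y := match y with
    | (u, g, i, _, _, _, _) => ¬ u ∧ D.nextInput w g i ≠ D.bound w ∧ D.Root w (D.nextInput w g i) ∧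
      ¬ D.Heavy w (D.nextInput w g i)
  pop w y := match y with
    | (u, g, _, v, h, r, _) => u ∧ D.Root w g ∧ h ∧ v = r
  pushed w y := match y with
    | (_, g, i, _, h, r, s) => 8 * D.index w g (D.nextInput w g i) + 4 * h.toNat + 2 * r.toNat + s.toNat
  next w y e := match y with
    | (u, g, i, v, h, r, s) =>
      if u then D.ascend w g v h r s e else D.descend w g (D.nextInput w g i) h r s

section

variable {D : Gates} [D.Logspace] {X : Type} [Obj X] {w : X → List InputSym} {f g e : X → ℕ}
  {v h r s : X → Bool}

@[fun_prop]
theorem ls_climb (hw : LS w) (hf : LS f) (hg : LS g) (hv : LS v) (hh : LS h) (hr : LS r) (hs : LS s) :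
    LS fun x => D.climb (w x) (f x) (g x) (v x) (h x) (r x) (s x) := by
  unfold climb; fun_prop

@[fun_prop]
theorem ls_descend (hw : LS w) (hf : LS f) (hg : LS g) (hh : LS h) (hr : LS r) (hs : LS s) :
    LS fun x => D.descend (w x) (f x) (g x) (h x) (r x) (s x) := by
  unfold descend; fun_prop

@[fun_prop]
theorem ls_ascend (hw : LS w) (hf : LS f) (hv : LS v) (hh : LS h) (hr : LS r) (hs : LS s) (he : LS e) :
    LS fun x => D.ascend (w x) (f x) (v x) (h x) (r x) (s x) (e x) := by
  unfold ascend; fun_prop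

theorem evaluator_logspace : D.evaluator.Logspace where
  init := by unfold evaluator; fun_prop
  halt := by unfold evaluator; dsimp only; fun_prop
  out := by unfold evaluator; dsimp only; fun_prop
  push := by unfold evaluator; dsimp only; fun_prop
  pop := by unfold evaluator; dsimp only; fun_prop
  pushed := by unfold evaluator; dsimp only; fun_prop
  next := by unfold evaluator; dsimp only; fun_prop

end

end Gates

end TapeProg

/-! ### Ranks, blocks, weights and heavy chains -/

namespace TapeProg

open OfflineTM Obj

theorem countB_le (n : ℕ) (p : ℕ → Prop) : countB n p ≤ n := by
  classical
  unfold countB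
  exact Nat.count_le _

theorem countB_le_countB {n : ℕ} {p q : ℕ → Prop} (h : ∀ i < n, p i → q i) :
    countB n p ≤ countB n q := by
  classical
  simp only [countB, Nat.count_eq_card_filter_range]
  refine Finset.card_le_card fun i => ?_
  simp only [Finset.mem_filter, Finset.mem_range]
  exact fun hi => ⟨hi.1, h i hi.1 hi.2⟩

theorem countB_lt_countB {n : ℕ} {p q : ℕ → Prop} (h : ∀ i < n, p i → q i) {j : ℕ} (hj : j < n)
    (hp : ¬ p j) (hq : q j) : countB n p < countB n q := by
  classical
  simp only [countB, Nat.count_eq_card_filter_range]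
  refine Finset.card_lt_card (Finset.ssubset_iff_of_subset ?_ |>.2 ⟨j, ?_, ?_⟩)
  · intro i
    simp only [Finset.mem_filter, Finset.mem_range]
    exact fun hi => ⟨hi.1, h i hi.1 hi.2⟩
  · simp [hj, hq]
  · simp [hp]

theorem countB_add_countB_lt {n : ℕ} {p p' q : ℕ → Prop} (h : ∀ i < n, p i → q i)
    (h' : ∀ i < n, p' i → q i) (hd : ∀ i, p i → ¬ p' i) {j : ℕ} (hj : j < n)
    (hp : ¬ p j) (hp' : ¬ p' j) (hq : q j) : countB n p + countB n p' < countB n q := by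
  classical
  have : countB n p + countB n p' = countB n fun i => p i ∨ p' i := by
    simp only [countB, Nat.count_eq_card_filter_range]
    rw [← Finset.card_union_of_disjoint (Finset.disjoint_filter.2 fun i _ => hd i)]
    congr 1
    ext i
    simp only [Finset.mem_union, Finset.mem_filter]
    tauto
  rw [this]
  exact countB_lt_countB (fun i hi hi' => hi'.elim (h i hi) (h' i hi)) hj (by tauto) hq

/-- The number of numbers less than `b` that are strictly below `x` in the transitive closure of `R`. -/
noncomputable def rankIn (b : ℕ) (R : ℕ → ℕ → Prop) (x : ℕ) : ℕ := countB b fun c => Relation.TransGen R c x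

theorem rankIn_lt_rankIn {b : ℕ} {R : ℕ → ℕ → Prop} (hR : WellFounded R) {c p : ℕ} (h : R c p)
    (hc : c < b) : rankIn b R c < rankIn b R p :=
  countB_lt_countB (fun _ _ hi => hi.tail h) hc (fun h => hR.transGen.irrefl.irrefl c h) (.single h)

theorem rankIn_lt {b : ℕ} {R : ℕ → ℕ → Prop} (hR : WellFounded R) (hb : 0 < b)
    (hlt : ∀ c p, R c p → p < b) (x : ℕ) : rankIn b R x < b := by
  classical
  by_cases hg : x < b
  · have h := countB_lt_countB (n := b) (q := fun _ => True)
      (p := fun c => Relation.TransGen R c x) (fun _ _ _ => trivial) hg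
      (fun h => hR.transGen.irrefl.irrefl x h) trivial
    exact h.trans_le (countB_le _ _)
  · refine lt_of_eq_of_lt ?_ hb
    simp only [rankIn, countB, Nat.count_eq_card_filter_range, Finset.card_eq_zero,
      Finset.filter_eq_empty_iff]
    intro c _ h
    obtain ⟨_, _, h⟩ := Relation.TransGen.tail'_iff.1 h
    exact hg (hlt _ _ h)

/-- As long as the walk goes on, the rank grows in every step, so it must have stopped after `b`
steps. The middle alternative allows a last step to a default value, where the rank need not grow.
-/
theorem iterate_fixed {f rank : ℕ → ℕ} {b : ℕ} (hr : ∀ x, rank x < b)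
    (h : ∀ x, f x = x ∨ f (f x) = f x ∨ rank x < rank (f x)) (x : ℕ) : f (f^[b] x) = f^[b] x := by
  have key : ∀ k, f (f^[k] x) = f^[k] x ∨ k + rank x ≤ rank (f^[k] x) := by
    intro k
    induction k with
    | zero => exact Or.inr (by simp)
    | succ k ih =>
      rw [Function.iterate_succ_apply']
      rcases ih with ih | ih
      · exact Or.inl (by rw [ih, ih])
      · rcases h (f^[k] x) with h | h | h
        · exact Or.inl (by rw [h, h])
        · exact Or.inl h
        · exact Or.inr (by omega)
  rcases key b with h | h
  · exact h
  · have := hr (f^[b] x)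
    omega

theorem iterate_apply_of_fixed {f : ℕ → ℕ} {b : ℕ} (h : ∀ x, f (f^[b] x) = f^[b] x) (x : ℕ) :
    f^[b] (f x) = f^[b] x := by
  rw [← Function.iterate_succ_apply, Function.iterate_succ_apply', h]

namespace Gates

/-- The assumptions on the gates of a fixed input under which the evaluation is correct. -/
structure Spec (D : Gates) (w : List InputSym) (val : ℕ → Bool) : Prop where
  in_lt : ∀ p c, D.In w p c → p < D.bound w ∧ c < D.bound w
  root_lt : ∀ c, D.Root w c → c < D.bound w
  start_root : D.Root w (D.start w)
  wf : WellFounded fun c p => D.In w p c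
  parent_unique : ∀ p p' c, ¬ D.Root w c → D.In w p c → D.In w p' c → p = p'
  -- A gate that has inputs is a root or is itself used. Hence the way up through parents cannot get
  -- lost before it meets a block root.
  root_or_in : ∀ p c, D.In w p c → D.Root w p ∨ ∃ q, D.In w q p
  -- The map `blk` numbers the blocks. Its second property, that all gates using a given block root
  -- lie in one block, makes the blocks a forest.
  block : ∃ blk : ℕ → ℕ, (∀ p c, D.In w p c → ¬ D.Root w c → blk c = blk p) ∧
    (∀ p p' c, D.Root w c → D.In w p c → D.In w p' c → blk p = blk p') ∧
    ∀ r r', D.Root w r → D.Root w r' → blk r = blk r' → r = r'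
  val_eq : ∀ g, val g = D.B w g ↔ ∃ c, D.In w g c ∧ val c = D.A w g

/-- The number of gates strictly below a gate. -/
noncomputable def rank (D : Gates) (w : List InputSym) (g : ℕ) : ℕ :=
  rankIn (D.bound w) (fun c p => D.In w p c) g

theorem exists_val {D : Gates} {w : List InputSym} (h : WellFounded fun c p => D.In w p c) :
    ∃ val : ℕ → Bool, ∀ g, val g = D.B w g ↔ ∃ c, D.In w g c ∧ val c = D.A w g := by
  classical
  let F : (g : ℕ) → ((c : ℕ) → D.In w g c → Bool) → Bool := fun g r =>
    if ∃ c, ∃ hc : D.In w g c, r c hc = D.A w g then D.B w g else !D.B w g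
  refine ⟨h.fix F, fun g => ?_⟩
  have hF : h.fix F g = F g fun c _ => h.fix F c := h.fix_eq F g
  have : (∃ c, ∃ _ : D.In w g c, h.fix F c = D.A w g) ↔ ∃ c, D.In w g c ∧ h.fix F c = D.A w g := by
    simp
  rw [hF]
  simp only [F]
  rw [this]
  split
  · rename_i h1
    exact ⟨fun _ => h1, fun _ => rfl⟩
  · rename_i h1
    exact ⟨fun h2 => absurd h2 (by simp), fun h2 => absurd h2 h1⟩

namespace Spec

variable {D : Gates} {w : List InputSym} {val : ℕ → Bool}

theorem rank_lt (hD : D.Spec w val) {p c : ℕ} (h : D.In w p c) : D.rank w c < D.rank w p :=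
  rankIn_lt_rankIn hD.wf h (hD.in_lt p c h).2

theorem rank_lt_bound (hD : D.Spec w val) (g : ℕ) : D.rank w g < D.bound w :=
  rankIn_lt hD.wf ((Nat.zero_le _).trans_lt (hD.root_lt _ hD.start_root)) (fun _ _ h => (hD.in_lt _ _ h).1) g

theorem parent_eq_bound (hD : D.Spec w val) : D.parent w (D.bound w) = D.bound w := by
  refine (D.parent_le w _).antisymm (not_lt.1 fun h => ?_)
  exact lt_irrefl _ (hD.in_lt _ _ (leastB_spec (p := fun p => D.In w p _) h)).2

theorem in_parent (g : ℕ) (h : D.parent w g ≠ D.bound w) : D.In w (D.parent w g) g :=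
  leastB_spec (lt_of_le_of_ne (D.parent_le w g) h)

theorem in_parent_of_in (hD : D.Spec w val) {p c : ℕ} (h : D.In w p c) : D.In w (D.parent w c) c :=
  leastB_spec (p := fun p => D.In w p c) (leastB_lt (hD.in_lt p c h).1 h)

theorem not_root_bound (hD : D.Spec w val) : ¬ D.Root w (D.bound w) := fun h =>
  lt_irrefl _ (hD.root_lt _ h)

theorem blockStep_bound (hD : D.Spec w val) : D.blockStep w (D.bound w) = D.bound w := by
  rw [blockStep, if_neg hD.not_root_bound, hD.parent_eq_bound]

theorem blockStep_blockRoot (hD : D.Spec w val) (g : ℕ) :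
    D.blockStep w (D.blockRoot w g) = D.blockRoot w g := by
  refine iterate_fixed (rank := D.rank w) hD.rank_lt_bound (fun x => ?_) g
  by_cases hx : D.Root w x
  · exact Or.inl (if_pos hx)
  · by_cases hp : D.parent w x = D.bound w
    · have : D.blockStep w x = D.bound w := by rw [blockStep, if_neg hx, hp]
      rw [this]
      exact Or.inr (Or.inl hD.blockStep_bound)
    · have : D.blockStep w x = D.parent w x := if_neg hx
      rw [this]
      exact Or.inr (Or.inr (hD.rank_lt (in_parent x hp)))

theorem blockRoot_of_root {g : ℕ} (h : D.Root w g) : D.blockRoot w g = g := by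
  have : D.blockStep w g = g := if_pos h
  exact Function.iterate_fixed this _

theorem blockRoot_bound (hD : D.Spec w val) : D.blockRoot w (D.bound w) = D.bound w :=
  Function.iterate_fixed hD.blockStep_bound _

theorem blockRoot_of_in (hD : D.Spec w val) {p c : ℕ} (h : D.In w p c) (hc : ¬ D.Root w c) :
    D.blockRoot w c = D.blockRoot w p := by
  have : D.blockStep w c = p := by
    rw [blockStep, if_neg hc]
    exact hD.parent_unique _ _ c hc (hD.in_parent_of_in h) h
  rw [← this]
  exact (iterate_apply_of_fixed hD.blockStep_blockRoot c).symm

theorem root_blockRoot (hD : D.Spec w val) {g : ℕ} (h : D.blockRoot w g ≠ D.bound w) :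
    D.Root w (D.blockRoot w g) := by
  by_contra hr
  have h1 := hD.blockStep_blockRoot g
  rw [blockStep, if_neg hr] at h1
  have h2 := hD.rank_lt (in_parent (D.blockRoot w g) (by rwa [h1]))
  rw [h1] at h2
  exact lt_irrefl _ h2

/-- On the way up from `p` every gate is again a root or an input of some gate, so the default value
is never reached. The number `blk` is constant on this way. -/
theorem root_blockRoot_of_in (hD : D.Spec w val) {blk : ℕ → ℕ}
    (hb : ∀ p c, D.In w p c → ¬ D.Root w c → blk c = blk p) {p c : ℕ} (h : D.In w p c) :
    D.Root w (D.blockRoot w p) ∧ blk (D.blockRoot w p) = blk p := by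
  have key : ∀ k, (D.Root w ((D.blockStep w)^[k] p) ∨ ∃ q, D.In w q ((D.blockStep w)^[k] p)) ∧
      blk ((D.blockStep w)^[k] p) = blk p := by
    intro k
    induction k with
    | zero => exact ⟨hD.root_or_in _ _ h, rfl⟩
    | succ k ih =>
      rw [Function.iterate_succ_apply']
      by_cases hx : D.Root w ((D.blockStep w)^[k] p)
      · rw [blockStep, if_pos hx]
        exact ih
      · obtain ⟨q, hq⟩ := ih.1.resolve_left hx
        have hq' := hD.in_parent_of_in hq
        rw [blockStep, if_neg hx]
        exact ⟨hD.root_or_in _ _ hq', (hb _ _ hq' hx).symm.trans ih.2⟩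
  obtain ⟨h1, h2⟩ := key (D.bound w)
  refine ⟨hD.root_blockRoot fun hb => ?_, h2⟩
  rw [blockRoot] at hb
  rw [hb] at h1
  rcases h1 with h1 | ⟨q, h1⟩
  · exact hD.not_root_bound h1
  · exact lt_irrefl _ (hD.in_lt _ _ h1).2

/-- Makes the parent block independent of the chosen parent: both walks end in roots with the same
block number, and there `blk` is injective. -/
theorem blockRoot_eq (hD : D.Spec w val) {p p' c : ℕ} (hc : D.Root w c) (h : D.In w p c)
    (h' : D.In w p' c) : D.blockRoot w p = D.blockRoot w p' := by
  obtain ⟨blk, h1, h2, h3⟩ := hD.block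
  obtain ⟨h4, h5⟩ := hD.root_blockRoot_of_in h1 h
  obtain ⟨h6, h7⟩ := hD.root_blockRoot_of_in h1 h'
  exact h3 _ _ h4 h6 (by rw [h5, h7, h2 p p' c hc h h'])

theorem rank_le_rank_blockRoot (hD : D.Spec w val) {g : ℕ} (h : D.blockRoot w g ≠ D.bound w) :
    D.rank w g ≤ D.rank w (D.blockRoot w g) := by
  have key : ∀ k, (D.blockStep w)^[k] g ≠ D.bound w → D.rank w g ≤ D.rank w ((D.blockStep w)^[k] g) := by
    intro k
    induction k with
    | zero => intro _; exact le_rfl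
    | succ k ih =>
      rw [Function.iterate_succ_apply']
      intro hk
      have hk' : (D.blockStep w)^[k] g ≠ D.bound w := fun h => hk (by rw [h, hD.blockStep_bound])
      refine (ih hk').trans ?_
      by_cases hx : D.Root w ((D.blockStep w)^[k] g)
      · rw [blockStep, if_pos hx]
      · rw [blockStep, if_neg hx] at hk ⊢
        exact (hD.rank_lt (in_parent _ hk)).le
  exact key _ h

theorem parentBlock_bound (hD : D.Spec w val) : D.parentBlock w (D.bound w) = D.bound w := by
  rw [parentBlock, hD.parent_eq_bound, hD.blockRoot_bound]

theorem parentBlock_of_in (hD : D.Spec w val) {p c : ℕ} (h : D.In w p c) (hc : D.Root w c) :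
    D.parentBlock w c = D.blockRoot w p :=
  hD.blockRoot_eq hc (hD.in_parent_of_in h) h

theorem rank_lt_parentBlock (hD : D.Spec w val) {g : ℕ} (h : D.parentBlock w g ≠ D.bound w) :
    D.rank w g < D.rank w (D.parentBlock w g) := by
  have hp : D.parent w g ≠ D.bound w := fun hp => h (by rw [parentBlock, hp, hD.blockRoot_bound])
  exact (hD.rank_lt (in_parent g hp)).trans_le (hD.rank_le_rank_blockRoot h)

theorem root_parentBlock (hD : D.Spec w val) {g : ℕ} (h : D.parentBlock w g ≠ D.bound w) :
    D.Root w (D.parentBlock w g) := hD.root_blockRoot h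

theorem rank_iterate_parentBlock (hD : D.Spec w val) {g t : ℕ}
    (h : (D.parentBlock w)^[t] g ≠ D.bound w) :
    D.rank w g + t ≤ D.rank w ((D.parentBlock w)^[t] g) := by
  induction t with
  | zero => exact le_rfl
  | succ t ih =>
    rw [Function.iterate_succ_apply'] at h ⊢
    have h' : (D.parentBlock w)^[t] g ≠ D.bound w := fun h' => h (by rw [h', hD.parentBlock_bound])
    have := ih h'
    have := hD.rank_lt_parentBlock h
    omega

/-- The bound on the number of steps can be dropped, because the rank grows with each step up and
stays below `D.bound w`. -/
theorem weight_eq (hD : D.Spec w val) {g : ℕ} (hg : g ≠ D.bound w) :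
    D.weight w g = countB (D.bound w) fun r => D.Root w r ∧ ∃ t, (D.parentBlock w)^[t] r = g := by
  rw [weight]
  congr 1
  funext r
  refine propext (and_congr_right fun _ => ⟨fun ⟨t, _, h⟩ => ⟨t, h⟩, fun ⟨t, h⟩ => ⟨t, ?_, h⟩⟩)
  have := hD.rank_iterate_parentBlock (t := t) (g := r) (by rwa [h])
  have := hD.rank_lt_bound ((D.parentBlock w)^[t] r)
  omega

theorem weight_pos (hD : D.Spec w val) {g : ℕ} (hg : D.Root w g) : 0 < D.weight w g := by
  have hlt := hD.root_lt g hg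
  rw [hD.weight_eq hlt.ne]
  exact (Nat.zero_le _).trans_lt (countB_lt_countB (p := fun _ => False) (by simp) hlt (by simp)
    ⟨hg, 0, rfl⟩)

theorem weight_le (hD : D.Spec w val) {c g : ℕ} (h : D.parentBlock w c = g) (hg : g ≠ D.bound w) :
    D.weight w c ≤ D.weight w g := by
  have hc : c ≠ D.bound w := fun hc => hg (by rw [← h, hc, hD.parentBlock_bound])
  rw [hD.weight_eq hg, hD.weight_eq hc]
  refine countB_le_countB ?_
  rintro r - ⟨hr, t, ht⟩
  exact ⟨hr, t + 1, by rw [Function.iterate_succ_apply', ht, h]⟩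

/-- The subtrees of different children are disjoint, and neither contains the parent, which is
counted in its own weight. -/
theorem weight_add_weight_lt (hD : D.Spec w val) {c c' g : ℕ} (h : D.parentBlock w c = g)
    (h' : D.parentBlock w c' = g) (hg : g ≠ D.bound w) (hne : c ≠ c') :
    D.weight w c + D.weight w c' < D.weight w g := by
  have hc : c ≠ D.bound w := fun hc => hg (by rw [← h, hc, hD.parentBlock_bound])
  have hc' : c' ≠ D.bound w := fun hc => hg (by rw [← h', hc, hD.parentBlock_bound])
  rw [hD.weight_eq hg, hD.weight_eq hc, hD.weight_eq hc']
  have hrg : D.Root w g := h ▸ hD.root_parentBlock (by rwa [h])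
  have hself : ∀ c, D.parentBlock w c = g → ∀ t, (D.parentBlock w)^[t] g ≠ c := by
    intro c h t ht
    have hcb : c ≠ D.bound w := fun hc => hg (by rw [← h, hc, hD.parentBlock_bound])
    have h1 := hD.rank_iterate_parentBlock (t := t) (g := g) (by rwa [ht])
    have h2 := hD.rank_lt_parentBlock (g := c) (by rwa [h])
    rw [ht] at h1
    rw [h] at h2
    omega
  -- A block below both children would put one child below the other by a way that passes through
  -- `g`; but the rank strictly grows on the way up.
  have hdis : ∀ r c c' t t', D.parentBlock w c = g → D.parentBlock w c' = g → c ≠ c' → t ≤ t' →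
      (D.parentBlock w)^[t] r = c → (D.parentBlock w)^[t'] r = c' → False := by
    intro r c c' t t' h h' hne hle ht ht'
    obtain ⟨s, rfl⟩ := Nat.exists_eq_add_of_le' hle
    rw [Function.iterate_add_apply, ht] at ht'
    cases s with
    | zero => exact hne ht'
    | succ s =>
      rw [Function.iterate_succ_apply, h] at ht'
      exact hself c' h' s ht'
  refine countB_add_countB_lt ?_ ?_ ?_ (hD.root_lt g hrg) ?_ ?_ ⟨hrg, 0, rfl⟩
  · rintro r - ⟨hr, t, ht⟩
    exact ⟨hr, t + 1, by rw [Function.iterate_succ_apply', ht, h]⟩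
  · rintro r - ⟨hr, t, ht⟩
    exact ⟨hr, t + 1, by rw [Function.iterate_succ_apply', ht, h']⟩
  · rintro r ⟨-, t, ht⟩ ⟨-, t', ht'⟩
    rcases le_total t t' with hle | hle
    · exact hdis r c c' t t' h h' hne hle ht ht'
    · exact hdis r c' c t' t h' h hne.symm hle ht' ht
  · rintro ⟨-, t, ht⟩
    exact hself c h t ht
  · rintro ⟨-, t, ht⟩
    exact hself c' h' t ht

/-- Two heavy children would together have at least the weight of the parent, against the strict
inequality of `weight_add_weight_lt`. -/
theorem heavy_unique (hD : D.Spec w val) {c c' : ℕ} (hc : D.Heavy w c) (hc' : D.Heavy w c')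
    (h : D.parentBlock w c = D.parentBlock w c') (hb : D.parentBlock w c ≠ D.bound w) : c = c' := by
  by_contra hne
  have h1 := hD.weight_add_weight_lt rfl h.symm hb hne
  have h2 := hc.2.2
  have h3 := hc'.2.2
  rw [← h] at h3
  omega

/-- A light child has less than half of the weight of its parent; this is what limits the number of
frames on the stack. -/
theorem log_weight_lt (hD : D.Spec w val) {c : ℕ} (hc : D.Root w c) (hl : ¬ D.Heavy w c)
    (hs : c ≠ D.start w) :
    Nat.log 2 (D.weight w c) + 1 ≤ Nat.log 2 (D.weight w (D.parentBlock w c)) := by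
  have h : 2 * D.weight w c < D.weight w (D.parentBlock w c) := by
    by_contra h
    exact hl ⟨hc, hs, not_lt.1 h⟩
  have hp := hD.weight_pos hc
  rw [← Nat.log_mul_base (by norm_num) hp.ne']
  exact Nat.log_mono_right (by omega)

theorem topStep_top (hD : D.Spec w val) (g : ℕ) : D.topStep w (D.top w g) = D.top w g := by
  refine iterate_fixed (rank := D.rank w) hD.rank_lt_bound (fun x => ?_) g
  by_cases hx : D.Heavy w x
  · have e : D.topStep w x = D.parentBlock w x := if_pos hx
    by_cases hp : D.parentBlock w x = D.bound w
    · rw [e, hp]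
      exact Or.inr (Or.inl (if_neg fun h => hD.not_root_bound h.1))
    · rw [e]
      exact Or.inr (Or.inr (hD.rank_lt_parentBlock hp))
  · exact Or.inl (if_neg hx)

/-- All blocks of a heavy chain have the same top, so the first block of the chain need not be
remembered. -/
theorem top_of_heavy (hD : D.Spec w val) {g : ℕ} (hg : D.Heavy w g) :
    D.top w g = D.top w (D.parentBlock w g) := by
  have : D.topStep w g = D.parentBlock w g := if_pos hg
  rw [← this]
  exact (iterate_apply_of_fixed hD.topStep_top g).symm

theorem top_of_not_heavy {g : ℕ} (hg : ¬ D.Heavy w g) : D.top w g = g :=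
  Function.iterate_fixed (f := D.topStep w) (if_neg hg) _

theorem nthParent_index (hD : D.Spec w val) {p c : ℕ} (h : D.In w p c) :
    D.nthParent w (D.index w p c) c = p := by
  have hp := (hD.in_lt p c h).1
  have hlt := leastB_lt (b := D.bound w) (p := fun q => D.In w q c ∧ D.index w q c = D.index w p c)
    hp ⟨h, rfl⟩
  obtain ⟨h1, h2⟩ := leastB_spec hlt
  classical
  simp only [index, countB] at h2
  exact Nat.count_injective (p := fun q => D.In w q c) h1 h h2

end Spec

end Gates

end TapeProg

/-! ### Correctness of the evaluation procedure -/

namespace TapeProg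

open OfflineTM Obj

namespace Gates

abbrev scanning (g i : ℕ) (h r s : Bool) : EvalState := (false, g, i, false, h, r, s)

abbrev evaluated (g : ℕ) (v h r s : Bool) : EvalState := (true, g, 0, v, h, r, s)

theorem within_evalState {N H : ℕ} {u v h r s : Bool} {g i : ℕ} {st : List ℕ} (h1 : 1 ≤ N) (hg : g ≤ N)
    (hi : i ≤ N) (hst : ∀ e ∈ st, e ≤ N) (hl : (stackSyms st).length ≤ H) :
    StackProg.Within N H (((u, g, i, v, h, r, s) : EvalState), st) := by
  refine ⟨fun j hj => ?_, hst, hl⟩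
  have hb : ∀ b : Bool, b.toNat ≤ N := fun b => (Bool.toNat_le b).trans h1
  have hj' : j < 7 := hj
  interval_cases j
  · exact hb u
  · exact hg
  · exact hi
  · exact hb v
  · exact hb h
  · exact hb r
  · exact hb s

theorem length_stackSyms_cons (e : ℕ) (st : List ℕ) :
    (stackSyms (e :: st)).length = e.size + 1 + (stackSyms st).length := by
  simp [stackSyms, length_digits]; omega

theorem frame_decode (k : ℕ) (h r s : Bool) : (8 * k + 4 * h.toNat + 2 * r.toNat + s.toNat) / 8 = k ∧
    decide ((8 * k + 4 * h.toNat + 2 * r.toNat + s.toNat) / 4 % 2 = 1) = h ∧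
    decide ((8 * k + 4 * h.toNat + 2 * r.toNat + s.toNat) / 2 % 2 = 1) = r ∧
    decide ((8 * k + 4 * h.toNat + 2 * r.toNat + s.toNat) % 2 = 1) = s := by
  refine ⟨?_, ?_, ?_, ?_⟩ <;> cases h <;> cases r <;> cases s <;> simp <;> omega

theorem bool_eq_of_iff {v v' b : Bool} (h : v = b ↔ v' = b) : v = v' := by
  cases v <;> cases v' <;> cases b <;> simp_all

/-- A Boolean function of one variable that is not constant is the xor of the variable with its
value at `false`. -/
theorem xor_xor_eq_ite : ∀ a s v₀ v₁ : Bool, v₁ ≠ v₀ →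
    (a ^^ (s ^^ v₀)) = ((if a = true then v₁ else v₀) ^^ s) := by decide

/-- A bound on the size of the stack symbols, and the room that is left on the stack. -/
structure Room (N H : ℕ) (st : List ℕ) (k : ℕ) : Prop where
  le : ∀ e ∈ st, e ≤ N
  length : (stackSyms st).length + k ≤ H

namespace Spec

variable {D : Gates} {w : List InputSym} {val : ℕ → Bool} {N H F : ℕ}

theorem run_single {c c' : EvalState × List ℕ} (h : D.evaluator.Step w c c')
    (h' : StackProg.Within N H c') : D.evaluator.Run w N H c c' := .single ⟨h, h'⟩

theorem run_push (hv : D.Valid w) {g i : ℕ} {v h r s : Bool} {st : List ℕ}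
    (hb : D.nextInput w g i ≠ D.bound w) (hr : D.Root w (D.nextInput w g i))
    (hh : ¬ D.Heavy w (D.nextInput w g i))
    (hw : StackProg.Within N H (scanning (D.nextInput w g i) 0 false false false,
      (8 * D.index w g (D.nextInput w g i) + 4 * h.toNat + 2 * r.toNat + s.toNat) :: st)) :
    D.evaluator.Run w N H ((false, g, i, v, h, r, s), st)
      (scanning (D.nextInput w g i) 0 false false false,
        (8 * D.index w g (D.nextInput w g i) + 4 * h.toNat + 2 * r.toNat + s.toNat) :: st) := by
  have := StackProg.Step.push (P := D.evaluator) (w := w) (y := (false, g, i, v, h, r, s)) (st := st)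
    (by simp [evaluator, hv]) (by simp [evaluator, hb, hr, hh])
  simp only [evaluator, descend, Bool.false_eq_true, if_false, if_neg hb, hr, not_true_eq_false,
    if_neg hh] at this
  exact run_single this hw

theorem run_descend (hv : D.Valid w) {g i : ℕ} {v h r s : Bool} {st : List ℕ}
    (hp : D.nextInput w g i ≠ D.bound w → D.Root w (D.nextInput w g i) →
      D.Heavy w (D.nextInput w g i))
    (hw : StackProg.Within N H (D.descend w g (D.nextInput w g i) h r s, st)) :
    D.evaluator.Run w N H ((false, g, i, v, h, r, s), st)
      (D.descend w g (D.nextInput w g i) h r s, st) := by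
  have := StackProg.Step.plain (P := D.evaluator) (w := w) (y := (false, g, i, v, h, r, s)) (st := st)
    (by simp [evaluator, hv]) (by simpa [evaluator] using hp) (by simp [evaluator])
  simp only [evaluator, Bool.false_eq_true, if_false] at this
  exact run_single this hw

theorem run_ascend (hv : D.Valid w) {g i : ℕ} {v h r s : Bool} {st : List ℕ}
    (hp : D.Root w g → h = true → v ≠ r)
    (hw : StackProg.Within N H (D.ascend w g v h r s 0, st)) :
    D.evaluator.Run w N H ((true, g, i, v, h, r, s), st) (D.ascend w g v h r s 0, st) := by
  have := StackProg.Step.plain (P := D.evaluator) (w := w) (y := (true, g, i, v, h, r, s)) (st := st)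
    (by simp only [evaluator, hv]; tauto) (by simp [evaluator]) (by simp only [evaluator]; tauto)
  simp only [evaluator, if_true] at this
  exact run_single this hw

theorem run_pop (hv : D.Valid w) {g i e : ℕ} {v s : Bool} {st : List ℕ}
    (hr : D.Root w g) (ht : D.top w g ≠ D.start w)
    (hw : StackProg.Within N H (D.ascend w g v true v s e, st)) :
    D.evaluator.Run w N H ((true, g, i, v, true, v, s), e :: st) (D.ascend w g v true v s e, st) := by
  have := StackProg.Step.pop (P := D.evaluator) (w := w) (y := (true, g, i, v, true, v, s)) (st := st)
    (v := e) (by simp only [evaluator, hv]; tauto) (by simp [evaluator])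
    (by simp only [evaluator, hr]; tauto)
  simp only [evaluator, if_true] at this
  exact run_single this hw

/-- The evaluation of the gate `g` is correct if the assumption on the heavy block below is. -/
def GateCorrect (D : Gates) (w : List InputSym) (val : ℕ → Bool) (N H F g : ℕ) : Prop :=
  ∀ (st : List ℕ) (h r s : Bool), Room N H st (F * Nat.log 2 (D.weight w (D.blockRoot w g))) →
    ∃ v, D.evaluator.Run w N H (scanning g 0 h r s, st) (evaluated g v h r s, st) ∧
      ((∀ c, D.Heavy w c → D.parentBlock w c = D.blockRoot w g → val c = h) → v = val g)

/-- The run may end at another block `g'` further down the heavy chain; what it keeps is the xor of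
value and accumulated bit. The final state, with `h` true and `r` equal to the value, signals that
the two results agree. -/
def BlockCorrect (D : Gates) (w : List InputSym) (val : ℕ → Bool) (N H F g : ℕ) : Prop :=
  ∀ (st : List ℕ) (s : Bool), Room N H st (F * Nat.log 2 (D.weight w g)) →
    ∃ g' v' s', D.evaluator.Run w N H (scanning g 0 false false s, st) (evaluated g' v' true v' s', st) ∧
      D.Root w g' ∧ D.top w g' = D.top w g ∧ (v' ^^ s') = (val g ^^ s)

/-- A call of a light block costs one frame of at most `F` symbols, and exactly this room is gained
because the logarithm of the weight drops by at least one. The assumption on the heavy child is used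
only where its value is replaced by `h`. -/
theorem gateCorrect (hD : D.Spec w val) (hv : D.Valid w) (hN : 8 * D.bound w + 8 ≤ N)
    (hF : ∀ p c, D.Root w c → D.In w p c → (8 * D.index w p c + 7).size + 1 ≤ F) {g : ℕ}
    (hg : D.rank w g ≤ D.rank w (D.start w)) (hlt : g < D.bound w)
    (ihg : ∀ c, D.In w g c → ¬ D.Root w c → GateCorrect D w val N H F c)
    (ihb : ∀ c, D.In w g c → D.Root w c → BlockCorrect D w val N H F c) :
    GateCorrect D w val N H F g := by
  intro st h r s hroom
  have hin : ∀ {g' i' : ℕ} {u' v' h' r' s' : Bool}, g' ≤ D.bound w → i' ≤ D.bound w + 1 →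
      StackProg.Within N H (((u', g', i', v', h', r', s') : EvalState), st) := fun h1 h2 =>
    within_evalState (by omega) (by omega) (by omega) hroom.le (by have := hroom.length; omega)
  have hclimb : ∀ {c : ℕ} {v h r s : Bool}, c < D.bound w →
      StackProg.Within N H (D.climb w g c v h r s, st) := by
    intro c v h r s hc
    unfold climb
    split
    · exact hin hlt.le (by omega)
    · exact hin hlt.le (by omega)
  obtain ⟨hyp, hhyp⟩ : ∃ hyp, hyp = ∀ c, D.Heavy w c → D.parentBlock w c = D.blockRoot w g →
    val c = h := ⟨_, rfl⟩
  -- Induction on the numbers that are still to be scanned; the value found is correct relative to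
  -- the inputs from `i` on.
  have key : ∀ n i, D.bound w ≤ i + n → ∃ v, D.evaluator.Run w N H (scanning g i h r s, st)
      (evaluated g v h r s, st) ∧
      (hyp → (v = D.B w g ↔ ∃ c, i ≤ c ∧ D.In w g c ∧ val c = D.A w g)) := by
    intro n
    induction n with
    | zero =>
      intro i hi
      have hc : D.nextInput w g i = D.bound w := by
        refine (leastB_le _ _).antisymm (not_lt.1 fun h => ?_)
        have := leastB_spec (p := fun c => i ≤ c ∧ D.In w g c) h
        have := this.1
        omega
      have e : D.descend w g (D.nextInput w g i) h r s = evaluated g (!D.B w g) h r s := if_pos hc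
      refine ⟨!D.B w g, e ▸ run_descend hv (fun h => absurd hc h) (e ▸ hin hlt.le (by omega)),
        fun _ => ?_⟩
      simp only [Bool.not_eq_eq_eq_not, Bool.eq_not_self, false_iff, not_exists, not_and]
      intro c hic hgc
      have := (hD.in_lt g c hgc).2
      omega
    | succ n ih =>
      intro i hi
      obtain ⟨c, hc⟩ : ∃ c, c = D.nextInput w g i := ⟨_, rfl⟩
      by_cases hcb : c = D.bound w
      · have e : D.descend w g (D.nextInput w g i) h r s = evaluated g (!D.B w g) h r s :=
          if_pos (hc ▸ hcb)
        refine ⟨!D.B w g, e ▸ run_descend hv (fun h => absurd (hc ▸ hcb) h) (e ▸ hin hlt.le (by omega)),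
          fun _ => ?_⟩
        simp only [Bool.not_eq_eq_eq_not, Bool.eq_not_self, false_iff, not_exists, not_and]
        intro c' hic hgc _
        have h1 := leastB_lt (b := D.bound w) (p := fun c => i ≤ c ∧ D.In w g c)
          (hD.in_lt g c' hgc).2 ⟨hic, hgc⟩
        exact h1.ne (hc.symm.trans hcb)
      · have hclt : c < D.bound w := lt_of_le_of_ne (hc ▸ leastB_le _ _) hcb
        obtain ⟨hic, hgc⟩ : i ≤ c ∧ D.In w g c := by
          rw [hc] at hclt ⊢
          exact leastB_spec (p := fun c => i ≤ c ∧ D.In w g c) hclt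
        have hleast : ∀ c', i ≤ c' → D.In w g c' → c ≤ c' := fun c' h1 h2 => by
          by_contra hlt
          exact not_of_lt_leastB (p := fun c => i ≤ c ∧ D.In w g c) (b := D.bound w)
            (i := c') (by rw [hc] at hlt; exact not_le.1 hlt) ⟨h1, h2⟩
        -- continuing with the value of the input
        have hcont : ∀ u, (hyp → u = val c) → ∃ v,
            D.evaluator.Run w N H (D.climb w g c u h r s, st) (evaluated g v h r s, st) ∧
            (hyp → (v = D.B w g ↔ ∃ c, i ≤ c ∧ D.In w g c ∧ val c = D.A w g)) := by
          intro u hu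
          by_cases hua : u = D.A w g
          · have e : D.climb w g c u h r s = evaluated g (D.B w g) h r s := if_pos hua
            refine ⟨_, e ▸ .refl, fun hy => ⟨fun _ => ⟨c, hic, hgc, ?_⟩, fun _ => rfl⟩⟩
            rw [← hu hy, hua]
          · have e : D.climb w g c u h r s = scanning g (c + 1) h r s := if_neg hua
            obtain ⟨v, hv1, hv2⟩ := ih (c + 1) (by omega)
            refine ⟨v, e ▸ hv1, fun hy => (hv2 hy).trans ⟨?_, ?_⟩⟩
            · rintro ⟨c', h1, h2⟩
              exact ⟨c', by omega, h2⟩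
            · rintro ⟨c', h1, h2, h3⟩
              refine ⟨c', Nat.lt_of_le_of_ne (hleast c' h1 h2) ?_, h2, h3⟩
              rintro rfl
              exact hua ((hu hy).trans h3)
        by_cases hrc : D.Root w c
        · have hpb := hD.parentBlock_of_in hgc hrc
          by_cases hh : D.Heavy w c
          · have e : D.descend w g (D.nextInput w g i) h r s = D.climb w g c h h r s := by
              rw [← hc, descend, if_neg hcb, if_neg (not_not.2 hrc), if_pos hh]
            obtain ⟨v, hv1, hv2⟩ := hcont h (fun hy => by
              rw [hhyp] at hy
              exact (hy c hh hpb).symm)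
            refine ⟨v, ?_, hv2⟩
            have h1 := run_descend (N := N) (H := H) hv (g := g) (i := i) (v := false) (h := h)
              (r := r) (s := s) (st := st) (fun _ _ => hc ▸ hh) (by rw [e]; exact hclimb hclt)
            rw [e] at h1
            exact h1.trans hv1
          · have hcs : c ≠ D.start w := by
              rintro rfl
              have := hD.rank_lt hgc
              omega
            have hlog := hD.log_weight_lt hrc hh hcs
            rw [hpb] at hlog
            have hk := hF g c hrc hgc
            have hkb : D.index w g c ≤ g := countB_le _ _
            obtain ⟨e, he⟩ : ∃ e, e = 8 * D.index w g c + 4 * h.toNat + 2 * r.toNat + s.toNat := ⟨_, rfl⟩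
            have he7 : e ≤ 8 * D.index w g c + 7 := by
              have := Bool.toNat_le h
              have := Bool.toNat_le r
              have := Bool.toNat_le s
              omega
            -- One frame is traded for one unit of the logarithm of the weight.
            have hroom' : Room N H (e :: st) (F * Nat.log 2 (D.weight w c)) := by
              refine ⟨fun x hx => ?_, ?_⟩
              · rcases List.mem_cons.1 hx with rfl | hx
                · omega
                · exact hroom.le x hx
              · rw [length_stackSyms_cons]
                have h1 := hroom.length
                have h2 := Nat.mul_le_mul_left F hlog
                have h3 := Nat.size_le_size he7
                rw [Nat.mul_add, Nat.mul_one] at h2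
                omega
            have h1 := run_push (N := N) (H := H) hv (g := g) (i := i) (v := false) (h := h) (r := r)
              (s := s) (st := st) (hc ▸ hcb) (hc ▸ hrc) (hc ▸ hh) (by
                rw [← hc, ← he]
                exact within_evalState (by omega) (by omega) (by omega) hroom'.le
                  (by have := hroom'.length; omega))
            rw [← hc, ← he] at h1
            obtain ⟨g', v', s', h2, hrg', htop, hval⟩ := ihb c hgc hrc (e :: st) false hroom'
            rw [top_of_not_heavy hh] at htop
            rw [Bool.xor_false] at hval
            -- The run ended somewhere in the chain of `c`, whose top is `c` since `c` is light. The
            -- frame then gives back the calling gate and the three bits.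
            have ea : D.ascend w g' v' true v' s' e = D.climb w g c (val c) h r s := by
              obtain ⟨d1, d2, d3, d4⟩ := frame_decode (D.index w g c) h r s
              rw [ascend, if_neg (not_not.2 hrg'), if_neg (by simp), if_pos rfl, htop, he, d1, d2, d3, d4,
                hD.nthParent_index hgc, hval]
            have h3 := run_pop (N := N) (H := H) hv (g := g') (i := 0) (e := e) (v := v') (s := s')
              (st := st) hrg' (htop ▸ hcs) (by rw [ea]; exact hclimb hclt)
            rw [ea] at h3
            obtain ⟨v, hv1, hv2⟩ := hcont (val c) (fun _ => rfl)
            exact ⟨v, ((h1.trans h2).trans h3).trans hv1, hv2⟩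
        · have hbr := hD.blockRoot_of_in hgc hrc
          have e : D.descend w g (D.nextInput w g i) h r s = scanning c 0 h r s := by
            rw [← hc, descend, if_neg hcb, if_pos hrc]
          have h1 := run_descend (N := N) (H := H) hv (g := g) (i := i) (v := false) (h := h) (r := r)
            (s := s) (st := st) (fun _ h => absurd h (hc ▸ hrc))
            (by rw [e]; exact hin hclt.le (by omega))
          rw [e] at h1
          obtain ⟨u, h2, hu⟩ := ihg c hgc hrc st h r s (by rw [hbr]; exact hroom)
          rw [hbr, ← hhyp] at hu
          have hpar : D.parent w c = g := hD.parent_unique _ _ c hrc (hD.in_parent_of_in hgc) hgc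
          have ea : D.ascend w c u h r s 0 = D.climb w g c u h r s := by
            rw [ascend, if_pos hrc, hpar]
          have h3 := run_ascend (N := N) (H := H) hv (g := c) (i := 0) (v := u) (h := h) (r := r)
            (s := s) (st := st) (fun h => absurd h hrc) (by rw [ea]; exact hclimb hclt)
          rw [ea] at h3
          obtain ⟨v, hv1, hv2⟩ := hcont u hu
          exact ⟨v, ((h1.trans h2).trans h3).trans hv1, hv2⟩
  obtain ⟨v, hv1, hv2⟩ := key (D.bound w) 0 (by omega)
  refine ⟨v, hv1, fun hy => ?_⟩
  refine bool_eq_of_iff ((hv2 (hhyp ▸ hy)).trans (Iff.trans ?_ (hD.val_eq g).symm))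
  simp

/-- Two evaluations of the root gate tabulate the block as a function of the value of its heavy
child. A constant function ends the run; otherwise the heavy child takes over with the same stack.
-/
theorem blockCorrect (hD : D.Spec w val) (hv : D.Valid w) (hN : 8 * D.bound w + 8 ≤ N) {g : ℕ}
    (hr : D.Root w g) (hA : GateCorrect D w val N H F g)
    (ih : ∀ c, D.Heavy w c → D.parentBlock w c = g → BlockCorrect D w val N H F c) :
    BlockCorrect D w val N H F g := by
  intro st s hroom
  have hlt := hD.root_lt g hr
  have hbr : D.blockRoot w g = g := blockRoot_of_root hr
  have hin : ∀ {g' i' : ℕ} {u' v' h' r' s' : Bool}, g' ≤ D.bound w → i' ≤ D.bound w + 1 →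
      StackProg.Within N H (((u', g', i', v', h', r', s') : EvalState), st) := fun h1 h2 =>
    within_evalState (by omega) (by omega) (by omega) hroom.le (by have := hroom.length; omega)
  obtain ⟨v₀, h0, hv0⟩ := hA st false false s (by rwa [hbr])
  have ea : D.ascend w g v₀ false false s 0 = scanning g 0 true v₀ s := by
    rw [ascend, if_neg (not_not.2 hr), if_pos (by simp)]
  have h1 := run_ascend (N := N) (H := H) hv (g := g) (i := 0) (v := v₀) (h := false) (r := false)
    (s := s) (st := st) (by simp) (by rw [ea]; exact hin hlt.le (by omega))
  rw [ea] at h1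
  obtain ⟨v₁, h2, hv1⟩ := hA st true v₀ s (by rwa [hbr])
  rw [hbr] at hv0 hv1
  have h012 := (h0.trans h1).trans h2
  have huniq : ∀ c c', D.Heavy w c → D.parentBlock w c = g → D.Heavy w c' →
      D.parentBlock w c' = g → c = c' := fun c c' h1 h2 h3 h4 =>
    hD.heavy_unique h1 h3 (h2.trans h4.symm) (by rw [h2]; exact hlt.ne)
  by_cases he : ∃ c, D.Heavy w c ∧ D.parentBlock w c = g
  · obtain ⟨c, hc, hcg⟩ := he
    have hval : (if val c then v₁ else v₀) = val g := by
      by_cases hb : val c = true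
      · rw [if_pos hb]
        exact hv1 fun c' h1 h2 => by rw [huniq c' c h1 h2 hc hcg, hb]
      · rw [if_neg hb]
        exact hv0 fun c' h1 h2 => by rw [huniq c' c h1 h2 hc hcg]; simpa using hb
    by_cases hvv : v₁ = v₀
    · subst hvv
      rw [ite_self] at hval
      exact ⟨g, v₁, s, h012, hr, rfl, by rw [hval]⟩
    · have hhc : D.heavyChild w g = c := by
        have hl := leastB_lt (b := D.bound w) (p := fun c => D.Heavy w c ∧ D.parentBlock w c = g)
          (hD.root_lt c hc.1) ⟨hc, hcg⟩
        obtain ⟨h3, h4⟩ := leastB_spec hl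
        exact huniq _ _ h3 h4 hc hcg
      have eb : D.ascend w g v₁ true v₀ s 0 = scanning c 0 false false (s ^^ v₀) := by
        rw [ascend, if_neg (not_not.2 hr), if_neg (by simp), if_neg hvv, hhc]
      have h3 := run_ascend (N := N) (H := H) hv (g := g) (i := 0) (v := v₁) (h := true) (r := v₀)
        (s := s) (st := st) (fun _ _ => hvv)
        (by rw [eb]; exact hin (hD.root_lt c hc.1).le (by omega))
      rw [eb] at h3
      -- No frame is pushed here, so the weight of the heavy child need only not exceed that of `g`.
      obtain ⟨g', v', s', h4, hr', ht', hv'⟩ := ih c hc hcg st (s ^^ v₀) ⟨hroom.le, by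
        have := hD.weight_le hcg hlt.ne
        have := Nat.mul_le_mul_left F (Nat.log_mono_right (b := 2) this)
        have := hroom.length
        omega⟩
      refine ⟨g', v', s', (h012.trans h3).trans h4, hr', ?_, ?_⟩
      · rw [ht', hD.top_of_heavy hc, hcg]
      · rw [hv', ← hval]
        exact xor_xor_eq_ite _ _ _ _ hvv
  -- Without a heavy child the assumption is vacuous, so both results are the correct value and the
  -- evaluation cannot go on to a default child.
  · have hv0' := hv0 fun c h1 h2 => absurd ⟨c, h1, h2⟩ he
    have hv1' := hv1 fun c h1 h2 => absurd ⟨c, h1, h2⟩ he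
    subst hv0' hv1'
    exact ⟨g, _, s, h012, hr, rfl, rfl⟩

/-- Induction on the rank for gates and blocks together: a gate relies on inputs of smaller rank, a
block on its root gate and on its heavy child, which has smaller rank although it need not be an
input of the root. -/
theorem correct (hD : D.Spec w val) (hv : D.Valid w) (hN : 8 * D.bound w + 8 ≤ N)
    (hF : ∀ p c, D.Root w c → D.In w p c → (8 * D.index w p c + 7).size + 1 ≤ F) (n : ℕ) :
    ∀ g, D.rank w g ≤ n → n ≤ D.rank w (D.start w) → g < D.bound w → D.Root w (D.blockRoot w g) →
      GateCorrect D w val N H F g ∧ (D.Root w g → BlockCorrect D w val N H F g) := by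
  induction n with
  | zero =>
    intro g hg hn hlt hr
    have h1 : GateCorrect D w val N H F g := hD.gateCorrect hv hN hF (hg.trans hn) hlt
      (fun c hc => absurd (hD.rank_lt hc) (by omega)) (fun c hc => absurd (hD.rank_lt hc) (by omega))
    refine ⟨h1, fun hrg => hD.blockCorrect hv hN hrg h1 fun c _ hcg => ?_⟩
    have := hD.rank_lt_parentBlock (g := c) (by rw [hcg]; exact hlt.ne)
    rw [hcg] at this
    omega
  | succ n ih =>
    intro g hg hn hlt hr
    have h1 : GateCorrect D w val N H F g := by
      refine hD.gateCorrect hv hN hF (hg.trans hn) hlt (fun c hc hrc => ?_) (fun c hc hrc => ?_)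
      · have := hD.rank_lt hc
        exact (ih c (by omega) (by omega) (hD.in_lt g c hc).2
          (by rwa [hD.blockRoot_of_in hc hrc])).1
      · have := hD.rank_lt hc
        exact (ih c (by omega) (by omega) (hD.in_lt g c hc).2
          (by rwa [blockRoot_of_root hrc])).2 hrc
    refine ⟨h1, fun hrg => hD.blockCorrect hv hN hrg h1 fun c hc hcg => ?_⟩
    have := hD.rank_lt_parentBlock (g := c) (by rw [hcg]; exact hlt.ne)
    rw [hcg] at this
    exact (ih c (by omega) (by omega) (hD.root_lt c hc.1) (by rw [blockRoot_of_root hc.1]; exact hc.1)).2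
      hc.1

theorem exists_run (hD : D.Spec w val) (hv : D.Valid w) (hN : 8 * D.bound w + 8 ≤ N)
    (hF : ∀ p c, D.Root w c → D.In w p c → (8 * D.index w p c + 7).size + 1 ≤ F)
    (hH : F * Nat.log 2 (countB (D.bound w) (D.Root w)) + 1 ≤ H) :
    ∃ c, D.evaluator.Run w N H (D.evaluator.init w, []) c ∧ D.evaluator.halt w c.1 ∧
      (D.evaluator.out w c.1 ↔ val (D.start w) = true) := by
  have hr := hD.start_root
  obtain ⟨g', v', s', h1, h2, h3, h4⟩ := (hD.correct (F := F) (H := H) hv hN hF (D.rank w (D.start w))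
    (D.start w) le_rfl le_rfl (hD.root_lt _ hr) (by rwa [blockRoot_of_root hr])).2 hr [] false
    ⟨by simp, by
      have h1 : D.weight w (D.start w) ≤ countB (D.bound w) (D.Root w) :=
        countB_le_countB fun _ _ h => h.1
      have := Nat.mul_le_mul_left F (Nat.log_mono_right (b := 2) h1)
      simp only [stackSyms, List.length_cons, List.length_nil]
      omega⟩
  have hi : D.evaluator.init w = scanning (D.start w) 0 false false false := by
    simp only [evaluator, if_pos hv]
  rw [Bool.xor_false] at h4
  refine ⟨_, hi ▸ h1, ?_, ?_⟩
  · simp only [evaluator, h2, h3, top_of_not_heavy (D := D) (g := D.start w) fun h => h.2.1 rfl]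
    tauto
  · simp only [evaluator, h4, hv, true_and]

end Spec

open Classical in
/-- The value of the start gate can be computed with a stack of logarithmically many frames. -/
theorem exists_machine (D : Gates) [D.Logspace] : ∃ (M : OfflineTM InputSym) (K : ℕ), ∀ w N,
    w.length + 2 ≤ N →
    (¬ D.Valid w → M.Outputs w false ∧ M.UsesSpaceAtMost w ((N ^ K).size + 3 : ℕ)) ∧
    (D.Valid w → 8 * D.bound w + 8 ≤ N → ∀ val, D.Spec w val → ∀ F,
      (∀ p c, D.Root w c → D.In w p c → (8 * D.index w p c + 7).size + 1 ≤ F) →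
      M.Outputs w (val (D.start w)) ∧ M.UsesSpaceAtMost w
        ((N ^ K).size + F * Nat.log 2 (countB (D.bound w) (D.Root w)) + 3 : ℕ)) := by
  obtain ⟨M, K, hM⟩ := StackProg.exists_machine (fun _ _ => by simp [rel]) D.evaluator
    evaluator_logspace
  refine ⟨M, K, fun w N hN => ⟨fun hv => ?_, fun hv hNb val hD F hF => ?_⟩⟩
  · have hi : D.evaluator.init w = scanning 0 0 false false false := by
      simp only [evaluator, if_neg hv]
    have h := hM w N 1 (D.evaluator.init w, []) hN
      (hi ▸ within_evalState (by omega) (Nat.zero_le _) (Nat.zero_le _) (by simp) (by simp [stackSyms]))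
      .refl (by simp [evaluator, hv])
    have ho : ¬ D.evaluator.out w (D.evaluator.init w) := by simp [evaluator, hv]
    rw [decide_eq_false ho] at h
    exact h
  · obtain ⟨c, h1, h2, h3⟩ := hD.exists_run hv hNb hF le_rfl
    have hi : D.evaluator.init w = scanning (D.start w) 0 false false false := by
      simp only [evaluator, if_pos hv]
    have hs := hD.root_lt _ hD.start_root
    have h := hM w N _ c hN (hi ▸ within_evalState (by omega) (by omega) (Nat.zero_le _) (by simp)
      (by simp [stackSyms])) h1 h2
    have ho : decide (D.evaluator.out w c.1) = val (D.start w) := by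
      rw [Bool.eq_iff_iff, decide_eq_true_iff, h3]
    rw [ho] at h
    refine ⟨h.1, ?_⟩
    convert h.2 using 2
    omega

end Gates

end TapeProg

/-! ### Words as sequences of sections of records -/

namespace TapeProg

open OfflineTM Obj

section

variable {X : Type} [Obj X]

theorem div_two_iterate (k u : ℕ) : (fun u => u / 2)^[k] u = u / 2 ^ k := by
  induction k generalizing u with
  | zero => simp
  | succ k ih => rw [Function.iterate_succ_apply, ih, Nat.div_div_eq_div_mul, pow_succ']

@[fun_prop]
-- The power of two itself may be exponentially large, so the quotient is computed by repeated
-- halving.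
theorem LS.div_two_pow {f g : X → ℕ} (hf : LS f) (hg : LS g) : LS fun x => f x / 2 ^ g x :=
  (LS.iterate (f := fun _ u => u / 2) hg hf (by fun_prop) hf fun x k => by
    rw [div_two_iterate]; exact Nat.div_le_self _ _).congr_nat fun x => div_two_iterate _ _

@[fun_prop]
theorem LS.testBit {f g : X → ℕ} (hf : LS f) (hg : LS g) : LS fun x => (f x).testBit (g x) := by
  simp only [Nat.testBit_eq_decide_div_mod_eq]
  fun_prop

@[fun_prop]
theorem LS.size {f : X → ℕ} (hf : LS f) : LS fun x => (f x).size := by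
  have h : LS fun x => TapeProg.leastB (f x) fun k => f x / 2 ^ k = 0 := by fun_prop
  refine h.congr_nat fun x => ?_
  have key : ∀ k, f x / 2 ^ k = 0 ↔ (f x).size ≤ k := fun k => by
    rw [Nat.size_le, Nat.div_eq_zero_iff]
    simp
  have hle : (f x).size ≤ f x := Nat.size_le.2 Nat.lt_two_pow_self
  refine le_antisymm (not_lt.1 fun hlt => not_of_lt_leastB hlt ((key _).2 le_rfl)) ?_
  rcases (leastB_le (f x) fun k => f x / 2 ^ k = 0).lt_or_eq with hlt | heq
  · exact (key _).1 (leastB_spec hlt)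
  · rwa [heq]

/-- The binary encoding of `u` stands at position `p`. -/
def NumAt (w : List InputSym) (p u : ℕ) : Prop :=
  allB u.size fun k =>
    (u.testBit k = true → At (.bit true) w (p + k)) ∧ (¬ u.testBit k = true → At (.bit false) w (p + k))

@[fun_prop]
theorem ls_numAt {w : X → List InputSym} {p u : X → ℕ} (hw : LS w) (hp : LS p) (hu : LS u) :
    LS fun x => NumAt (w x) (p x) (u x) := by
  unfold NumAt; fun_prop

def LineStart (w : List InputSym) (p : ℕ) : Prop :=
  p = 0 ∨ At .semicolon w (p - 1) ∨ At .hash w (p - 1)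

/-- The number of occurrences of `hash` before position `p`. -/
noncomputable def hashes (w : List InputSym) (p : ℕ) : ℕ := countB p fun i => At .hash w i

@[fun_prop]
theorem ls_lineStart {w : X → List InputSym} {p : X → ℕ} (hw : LS w) (hp : LS p) :
    LS fun x => LineStart (w x) (p x) := by
  unfold LineStart; fun_prop

@[fun_prop]
theorem ls_hashes {w : X → List InputSym} {p : X → ℕ} (hw : LS w) (hp : LS p) :
    LS fun x => hashes (w x) (p x) := by
  unfold hashes; fun_prop

end

theorem length_encodeNat (u : ℕ) : (encodeNat u).length = u.size := by
  rw [encodeNat, List.length_map, Nat.size_eq_bits_len]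

theorem append_prefix_iff {α : Type} (l r x : List α) :
    l ++ r <+: x ↔ l <+: x ∧ r <+: x.drop l.length := by
  induction l generalizing x with
  | nil => simp
  | cons a l ih =>
    cases x with
    | nil => simp
    | cons b x => simp [List.cons_prefix_cons, ih, and_assoc]

/-- Together with the next lemmas, this turns the presence of a pattern at a position into
conditions on single letters, which are decidable in logarithmic space. -/
theorem append_prefix_drop (l r w : List InputSym) (p : ℕ) :
    l ++ r <+: w.drop p ↔ l <+: w.drop p ∧ r <+: w.drop (p + l.length) := by
  rw [append_prefix_iff, List.drop_drop]

theorem cons_prefix_drop (a : InputSym) (r w : List InputSym) (p : ℕ) :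
    a :: r <+: w.drop p ↔ At a w p ∧ r <+: w.drop (p + 1) := by
  rw [← List.singleton_append, append_prefix_drop, List.length_singleton]
  refine and_congr_left fun _ => ?_
  unfold At
  rw [← List.head?_drop]
  cases w.drop p with
  | nil => simp
  | cons b x => simp [List.cons_prefix_cons, eq_comm]

theorem encodeNat_prefix_drop (u : ℕ) (w : List InputSym) (p : ℕ) :
    encodeNat u <+: w.drop p ↔ NumAt w p u := by
  rw [List.prefix_iff_getElem?]
  unfold NumAt allB
  refine ⟨fun h k hk => ?_, fun h k hk => ?_⟩
  · have h1 := h k (by rwa [length_encodeNat])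
    have hk' : k < u.bits.length := by rwa [Nat.size_eq_bits_len] 
    rw [List.getElem?_drop] at h1
    have h2 : u.testBit k = u.bits[k] := by
      rw [Nat.testBit_eq_inth, List.getI_eq_getElem _ hk']
    simp only [encodeNat, List.getElem_map, ← h2] at h1
    unfold At
    cases hb : u.testBit k <;> simp_all
  · rw [length_encodeNat] at hk
    have h1 := h k hk
    have hk' : k < u.bits.length := by rwa [Nat.size_eq_bits_len]
    have h2 : u.testBit k = u.bits[k] := by
      rw [Nat.testBit_eq_inth, List.getI_eq_getElem _ hk']
    rw [List.getElem?_drop]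
    simp only [encodeNat, List.getElem_map, ← h2]
    unfold At at h1
    cases hb : u.testBit k <;> simp_all

theorem encodeNat_append_prefix_drop (u : ℕ) (r w : List InputSym) (p : ℕ) :
    encodeNat u ++ r <+: w.drop p ↔ NumAt w p u ∧ r <+: w.drop (p + u.size) := by
  rw [append_prefix_drop, encodeNat_prefix_drop, length_encodeNat]

/-- A line is read at position `p` after `k` occurrences of `hash`. -/
def LineAt (w : List InputSym) (k p : ℕ) (l : List InputSym) : Prop :=
  LineStart w p ∧ hashes w p = k ∧ l <+: w.drop p

/-- A word without terminators. -/
def Clean (b : List InputSym) : Prop := ∀ a ∈ b, a ≠ .semicolon ∧ a ≠ .hash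

def IsTerminator (a : InputSym) : Prop := a = .semicolon ∨ a = .hash

theorem Clean.append {b c : List InputSym} (hb : Clean b) (hc : Clean c) : Clean (b ++ c) := fun a ha =>
  (List.mem_append.1 ha).elim (hb a) (hc a)

theorem Clean.cons {a : InputSym} {c : List InputSym} (ha : ¬ IsTerminator a) (hc : Clean c) :
    Clean (a :: c) := fun x hx => by
  rcases List.mem_cons.1 hx with rfl | hx
  · exact ⟨fun h => ha (Or.inl h), fun h => ha (Or.inr h)⟩
  · exact hc x hx

theorem clean_nil : Clean [] := fun _ h => absurd h List.not_mem_nil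

theorem clean_encodeNat (u : ℕ) : Clean (encodeNat u) := fun a ha => by
  obtain ⟨b, -, rfl⟩ := List.mem_map.1 ha
  simp

/-- A clean word contains no terminator, so a line is read unambiguously up to its first terminator.
-/
theorem prefix_line_iff {b b' w : List InputSym} {t t' : InputSym} (hb : Clean b) (hb' : Clean b')
    (ht : IsTerminator t) (ht' : IsTerminator t') : b' ++ [t'] <+: b ++ t :: w ↔ b' = b ∧ t' = t := by
  induction b generalizing b' with
  | nil =>
    cases b' with
    | nil => simp
    | cons a' b' =>
      simp only [List.cons_append, List.nil_append, List.cons_prefix_cons, reduceCtorEq, false_and,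
        iff_false, not_and]
      rintro rfl
      have := hb' a' (by simp)
      rcases ht with rfl | rfl <;> simp_all
  | cons a b ih =>
    cases b' with
    | nil =>
      simp only [List.cons_append, List.nil_append, List.cons_prefix_cons, reduceCtorEq, false_and,
        iff_false, not_and]
      rintro rfl
      have := hb t' (by simp)
      rcases ht' with rfl | rfl <;> simp_all
    | cons a' b' =>
      rw [List.cons_append, List.cons_append, List.cons_prefix_cons,
        ih (fun x hx => hb x (List.mem_cons_of_mem _ hx)) fun x hx => hb' x (List.mem_cons_of_mem _ hx)]
      simp [and_assoc]

theorem at_append_right (a : InputSym) (b w : List InputSym) (p : ℕ) :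
    At a (b ++ w) (b.length + p) ↔ At a w p := by
  unfold At
  rw [List.getElem?_append_right (by omega), Nat.add_sub_cancel_left]

theorem Clean.not_at {a : InputSym} {b w : List InputSym} (hb : Clean b) (ha : IsTerminator a) {p : ℕ}
    (hp : p < b.length) : ¬ At a (b ++ w) p := by
  unfold At
  rw [List.getElem?_append_left hp, List.getElem?_eq_getElem hp]
  intro h
  have := hb _ (List.getElem_mem hp)
  rw [Option.some.inj h] at this
  rcases ha with rfl | rfl <;> simp_all

theorem countB_add (n m : ℕ) (p : ℕ → Prop) : countB (n + m) p = countB n p + countB m fun i => p (n + i) := by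
  classical
  simp only [countB]
  rw [Nat.count_add]

theorem countB_congr {n : ℕ} {p q : ℕ → Prop} (h : ∀ i < n, p i ↔ q i) : countB n p = countB n q :=
  le_antisymm (countB_le_countB fun i hi => (h i hi).1) (countB_le_countB fun i hi => (h i hi).2)

theorem countB_eq_zero {n : ℕ} {p : ℕ → Prop} (h : ∀ i < n, ¬ p i) : countB n p = 0 := by
  classical
  simp only [countB, Nat.count_eq_card_filter_range, Finset.card_eq_zero, Finset.filter_eq_empty_iff,
    Finset.mem_range]
  exact fun i => h i

open Classical in
theorem hashes_line {b w : List InputSym} {t : InputSym} (hb : Clean b) (p : ℕ) :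
    hashes (b ++ t :: w) (b.length + 1 + p) = hashes w p + if t = .hash then 1 else 0 := by
  have e : b ++ t :: w = (b ++ [t]) ++ w := by simp
  have hl : (b ++ [t]).length = b.length + 1 := by simp
  have h1 : countB b.length (fun i => At .hash (b ++ t :: w) i) = 0 :=
    countB_eq_zero fun i hi => hb.not_at (Or.inr rfl) hi
  have h2 : countB 1 (fun i => At .hash (b ++ t :: w) (b.length + i)) = if t = .hash then 1 else 0 := by
    simp only [countB, Nat.count_succ, Nat.count_zero, zero_add]
    refine if_congr ?_ rfl rfl
    rw [at_append_right]
    simp [At]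
  have h3 : countB p (fun i => At .hash (b ++ t :: w) (b.length + 1 + i)) = hashes w p :=
    countB_congr fun i _ => by rw [e, ← hl, at_append_right]
  unfold hashes
  rw [countB_add, countB_add, h1, h2, h3, zero_add, add_comm]
  rfl

theorem hashes_zero (w : List InputSym) : hashes w 0 = 0 := countB_eq_zero (by simp)

-- Splits off the first line. No line starts strictly inside it, and behind it everything is shifted
-- by its length, with one more `hash` counted if that was its terminator.
open Classical in
theorem lineAt_line {b b' w : List InputSym} {t t' : InputSym} (hb : Clean b) (hb' : Clean b')
    (ht : IsTerminator t) (ht' : IsTerminator t') (k p : ℕ) :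
    LineAt (b ++ t :: w) k p (b' ++ [t']) ↔ (p = 0 ∧ k = 0 ∧ b' = b ∧ t' = t) ∨
      ∃ p' k', p = b.length + 1 + p' ∧ k = k' + (if t = .hash then 1 else 0) ∧
        LineAt w k' p' (b' ++ [t']) := by
  have e : b ++ t :: w = (b ++ [t]) ++ w := by simp
  have hl : (b ++ [t]).length = b.length + 1 := by simp
  have hdrop : ∀ p', (b ++ t :: w).drop (b.length + 1 + p') = w.drop p' := fun p' => by
    rw [e, ← hl, List.drop_append]
    simp
  have hstart : ∀ p', LineStart (b ++ t :: w) (b.length + 1 + p') ↔ LineStart w p' := by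
    intro p'
    unfold LineStart
    cases p' with
    | zero =>
      rw [show b.length + 1 + 0 - 1 = b.length + 0 by omega, at_append_right, at_append_right]
      simp only [true_or, iff_true]
      right
      rcases ht with rfl | rfl <;> simp [At]
    | succ p' =>
      rw [show b.length + 1 + (p' + 1) - 1 = (b ++ [t]).length + p' by rw [hl]; omega, e, at_append_right,
        at_append_right]
      simp
  rcases Nat.eq_zero_or_pos p with rfl | hp
  · have h1 : LineAt (b ++ t :: w) k 0 (b' ++ [t']) ↔ k = 0 ∧ b' = b ∧ t' = t := by
      rw [LineAt, hashes_zero, List.drop_zero, prefix_line_iff hb hb' ht ht']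
      simp [LineStart, eq_comm]
    rw [h1]
    refine ⟨fun h => Or.inl ⟨rfl, h⟩, ?_⟩
    rintro (⟨-, h⟩ | ⟨p', k', h, -⟩)
    · exact h
    · omega
  · by_cases hpb : p < b.length + 1
    · refine iff_of_false ?_ ?_
      · rintro ⟨(rfl | h | h), -, -⟩
        · omega
        · exact hb.not_at (Or.inl rfl) (by omega) h
        · exact hb.not_at (Or.inr rfl) (by omega) h
      · rintro (⟨h, -⟩ | ⟨p', k', h, -⟩) <;> omega
    · obtain ⟨p', rfl⟩ := Nat.exists_eq_add_of_le (not_lt.1 hpb)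
      rw [LineAt, hstart, hashes_line hb, hdrop]
      constructor
      · rintro ⟨h1, h2, h3⟩
        exact Or.inr ⟨p', _, rfl, h2.symm, h1, rfl, h3⟩
      · rintro (⟨h, -⟩ | ⟨p'', k', h1, h2, h3, h4, h5⟩)
        · omega
        · have : p' = p'' := by omega
          subst this
          exact ⟨h3, by rw [h4, h2], h5⟩

/-- The word that consists of the given sections, each of which has a list of records, terminated by
`semicolon`, and a last part, terminated by `hash`. -/
def joinSections (s : List (List (List InputSym) × List InputSym)) : List InputSym :=
  s.flatMap fun x => x.1.flatMap (fun b => b ++ [.semicolon]) ++ x.2 ++ [.hash]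

def CleanSections (s : List (List (List InputSym) × List InputSym)) : Prop :=
  ∀ x ∈ s, (∀ b ∈ x.1, Clean b) ∧ Clean x.2

theorem joinSections_nil_cons (l : List InputSym) (s : List (List (List InputSym) × List InputSym)) :
    joinSections (([], l) :: s) = l ++ .hash :: joinSections s := by
  simp [joinSections]

theorem joinSections_cons_cons (b : List InputSym) (r : List (List InputSym)) (l : List InputSym)
    (s : List (List (List InputSym) × List InputSym)) :
    joinSections ((b :: r, l) :: s) = b ++ .semicolon :: joinSections ((r, l) :: s) := by
  simp [joinSections]

theorem not_lineAt_nil {k p : ℕ} {b : List InputSym} {t : InputSym} : ¬ LineAt [] k p (b ++ [t]) := by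
  rintro ⟨-, -, h⟩
  simp at h

/-- Induction on the sections and, within it, on the records of the first section. Here `pos k j` is
where record `j` of section `k` begins; by injectivity, equal records at different places are told
apart. -/
theorem exists_pos_of_sections {s : List (List (List InputSym) × List InputSym)} (hs : CleanSections s) :
    ∃ pos : ℕ → ℕ → ℕ, (∀ k, Function.Injective (pos k)) ∧ ∀ k p b, Clean b →
      (LineAt (joinSections s) k p (b ++ [.semicolon]) ↔
        ∃ x j, s[k]? = some x ∧ x.1[j]? = some b ∧ p = pos k j) := by
  induction s with
  | nil =>
    refine ⟨fun _ j => j, fun _ => Function.injective_id, fun k p b _ => ?_⟩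
    simp only [List.getElem?_nil, reduceCtorEq, false_and, exists_false, iff_false]
    exact not_lineAt_nil
  | cons x s ih =>
    obtain ⟨r, l⟩ := x
    have hl : Clean l := (hs (r, l) (by simp)).2
    induction r with
    | nil =>
      obtain ⟨pos, h1, h2⟩ := ih fun y hy => hs y (List.mem_cons_of_mem _ hy)
      refine ⟨fun k j => l.length + 1 + pos (k - 1) j, fun k i j hij => h1 (k - 1) (by simpa using hij),
        fun k p b hb => ?_⟩
      rw [joinSections_nil_cons, lineAt_line hl hb (Or.inr rfl) (Or.inl rfl)]
      simp only [reduceCtorEq, and_false, false_or, if_true]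
      cases k with
      | zero => simp
      | succ k =>
        simp only [List.getElem?_cons_succ, Nat.add_sub_cancel, Nat.add_right_cancel_iff]
        constructor
        · rintro ⟨p', k', rfl, rfl, h⟩
          obtain ⟨x, j, h3, h4, rfl⟩ := (h2 _ _ _ hb).1 h
          exact ⟨x, j, h3, h4, rfl⟩
        · rintro ⟨x, j, h3, h4, rfl⟩
          exact ⟨_, _, rfl, rfl, (h2 _ _ _ hb).2 ⟨x, j, h3, h4, rfl⟩⟩
    | cons c r ihr =>
      have hc : Clean c := (hs (c :: r, l) (by simp)).1 c (by simp)
      obtain ⟨pos, h1, h2⟩ := ihr (fun y hy => by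
        rcases List.mem_cons.1 hy with rfl | hy
        · exact ⟨fun b hb => (hs (c :: r, l) (by simp)).1 b (List.mem_cons_of_mem _ hb), hl⟩
        · exact hs y (List.mem_cons_of_mem _ hy))
      refine ⟨fun k j => if k = 0 then (if j = 0 then 0 else c.length + 1 + pos 0 (j - 1)) else
        c.length + 1 + pos k j, fun k i j hij => ?_, fun k p b hb => ?_⟩
      · simp only at hij
        by_cases hk : k = 0
        · rw [if_pos hk, if_pos hk] at hij
          split_ifs at hij with h3 h4
          · omega
          · omega
          · omega
          · have := h1 0 (show pos 0 (i - 1) = pos 0 (j - 1) by omega)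
            omega
        · rw [if_neg hk, if_neg hk] at hij
          exact h1 k (by omega)
      · rw [joinSections_cons_cons, lineAt_line hc hb (Or.inl rfl) (Or.inl rfl)]
        simp only [reduceCtorEq, if_false, add_zero, and_true]
        cases k with
        | zero =>
          simp only [List.getElem?_cons_zero, Option.some.injEq, if_true, true_and]
          constructor
          · rintro (⟨rfl, rfl⟩ | ⟨p', k', rfl, rfl, h⟩)
            · exact ⟨_, 0, rfl, by simp⟩
            · obtain ⟨x, j, h3, h4, rfl⟩ := (h2 _ _ _ hb).1 h
              refine ⟨_, j + 1, rfl, ?_, by simp⟩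
              simp only [List.getElem?_cons_zero, Option.some.injEq] at h3
              subst h3
              simpa using h4
          · rintro ⟨x, j, rfl, h4, rfl⟩
            cases j with
            | zero => exact Or.inl ⟨by simp, by simpa using h4.symm⟩
            | succ j =>
              refine Or.inr ⟨pos 0 j, 0, by simp, rfl, (h2 _ _ _ hb).2 ⟨(r, l), j, rfl, ?_, rfl⟩⟩
              simpa using h4
        | succ k =>
          simp only [List.getElem?_cons_succ, Nat.add_eq_zero_iff, one_ne_zero, and_false, if_false,
            false_and, false_or]
          constructor
          · rintro ⟨p', k', rfl, rfl, h⟩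
            obtain ⟨x, j, h3, h4, rfl⟩ := (h2 _ _ _ hb).1 h
            exact ⟨x, j, by simpa using h3, h4, rfl⟩
          · rintro ⟨x, j, h3, h4, rfl⟩
            exact ⟨_, _, rfl, rfl, (h2 _ _ _ hb).2 ⟨x, j, by simpa using h3, h4, rfl⟩⟩

theorem exists_lineAt_hash {s : List (List (List InputSym) × List InputSym)} (hs : CleanSections s)
    {k : ℕ} {b : List InputSym} (hb : Clean b) :
    (∃ p, LineAt (joinSections s) k p (b ++ [.hash])) ↔ ∃ r, s[k]? = some (r, b) := by
  induction s generalizing k with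
  | nil =>
    simp only [List.getElem?_nil, reduceCtorEq, exists_false, iff_false, not_exists]
    exact fun p => not_lineAt_nil
  | cons x s ih =>
    obtain ⟨r, l⟩ := x
    have hl : Clean l := (hs (r, l) (by simp)).2
    induction r with
    | nil =>
      have ih := fun k => @ih (fun y hy => hs y (List.mem_cons_of_mem _ hy)) k
      simp only [joinSections_nil_cons, lineAt_line hl hb (Or.inr rfl) (Or.inr rfl)]
      cases k with
      | zero =>
        simp only [List.getElem?_cons_zero, Option.some.injEq, Prod.mk.injEq]
        constructor
        · rintro ⟨p, (⟨-, -, rfl, -⟩ | ⟨p', k', -, h, -⟩)⟩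
          · exact ⟨[], rfl, rfl⟩
          · simp at h
        · rintro ⟨r, -, rfl⟩
          exact ⟨0, Or.inl (by simp)⟩
      | succ k =>
        rw [List.getElem?_cons_succ, ← ih]
        constructor
        · rintro ⟨p, (⟨-, h, -⟩ | ⟨p', k', -, h, h'⟩)⟩
          · simp at h
          · simp only [if_true, Nat.add_right_cancel_iff] at h
            subst h
            exact ⟨p', h'⟩
        · rintro ⟨p, h⟩
          exact ⟨_, Or.inr ⟨p, k, rfl, by simp, h⟩⟩
    | cons c r ihr =>
      have hc : Clean c := (hs (c :: r, l) (by simp)).1 c (by simp)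
      have h1 := ihr (fun y hy => by
        rcases List.mem_cons.1 hy with rfl | hy
        · exact ⟨fun b hb => (hs (c :: r, l) (by simp)).1 b (List.mem_cons_of_mem _ hb), hl⟩
        · exact hs y (List.mem_cons_of_mem _ hy))
      have h2 : (∃ r', ((c :: r, l) :: s)[k]? = some (r', b)) ↔ ∃ r', ((r, l) :: s)[k]? = some (r', b) := by
        cases k <;> simp
      rw [h2]
      refine Iff.trans ?_ h1
      simp only [joinSections_cons_cons, lineAt_line hc hb (Or.inl rfl) (Or.inr rfl), reduceCtorEq,
        and_false, false_or, if_false, add_zero]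
      constructor
      · rintro ⟨p, p', k', -, rfl, h⟩
        exact ⟨p', h⟩
      · rintro ⟨p, h⟩
        exact ⟨_, p, k, rfl, rfl, h⟩

theorem hashes_joinSections {s : List (List (List InputSym) × List InputSym)} (hs : CleanSections s) :
    hashes (joinSections s) (joinSections s).length = s.length := by
  induction s with
  | nil => exact hashes_zero _
  | cons x s ih =>
    obtain ⟨r, l⟩ := x
    have hl : Clean l := (hs (r, l) (by simp)).2
    induction r with
    | nil =>
      have h := hashes_line (t := .hash) (w := joinSections s) hl (joinSections s).length
      rw [joinSections_nil_cons, List.length_append, List.length_cons, List.length_cons,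
        show l.length + ((joinSections s).length + 1) = l.length + 1 + (joinSections s).length by omega, h,
        ih fun y hy => hs y (List.mem_cons_of_mem _ hy)]
      simp
    | cons c r ihr =>
      have hc : Clean c := (hs (c :: r, l) (by simp)).1 c (by simp)
      have h := hashes_line (t := .semicolon) (w := joinSections ((r, l) :: s)) hc
        (joinSections ((r, l) :: s)).length
      rw [joinSections_cons_cons, List.length_append, List.length_cons, List.length_cons,
        show c.length + ((joinSections ((r, l) :: s)).length + 1) =
          c.length + 1 + (joinSections ((r, l) :: s)).length by omega, h, ihr (fun y hy => by
        rcases List.mem_cons.1 hy with rfl | hy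
        · exact ⟨fun b hb => (hs (c :: r, l) (by simp)).1 b (List.mem_cons_of_mem _ hb), hl⟩
        · exact hs y (List.mem_cons_of_mem _ hy))]
      simp

/-- The word is parsed from its end: a new first letter opens a section, opens a record, or
lengthens the first line. -/
theorem exists_joinSections {w : List InputSym} (h : w = [] ∨ w.getLast? = some .hash) :
    ∃ s, CleanSections s ∧ w = joinSections s := by
  induction w with
  | nil => exact ⟨[], fun _ h => absurd h List.not_mem_nil, rfl⟩
  | cons a w ih =>
    have h' : w = [] ∨ w.getLast? = some .hash := by
      rcases h with h | h
      · simp at h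
      · cases w with
        | nil => exact Or.inl rfl
        | cons b w => exact Or.inr (by simpa using h)
    obtain ⟨s, hs, rfl⟩ := ih h'
    by_cases ha : a = .hash
    · subst ha
      refine ⟨([], []) :: s, fun y hy => ?_, by rw [joinSections_nil_cons]; rfl⟩
      rcases List.mem_cons.1 hy with rfl | hy
      · exact ⟨fun _ h => absurd h List.not_mem_nil, clean_nil⟩
      · exact hs y hy
    · cases s with
      | nil =>
        exfalso
        rcases h with h | h
        · simp at h
        · exact ha (by simpa [joinSections] using h)
      | cons x s =>
        obtain ⟨r, l⟩ := x
        obtain ⟨hr, hl⟩ := hs (r, l) (by simp)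
        have hs' : CleanSections s := fun y hy => hs y (List.mem_cons_of_mem _ hy)
        by_cases ha' : a = .semicolon
        · subst ha'
          refine ⟨([] :: r, l) :: s, fun y hy => ?_, by rw [joinSections_cons_cons]; rfl⟩
          rcases List.mem_cons.1 hy with rfl | hy
          · refine ⟨fun b hb => ?_, hl⟩
            rcases List.mem_cons.1 hb with rfl | hb
            · exact clean_nil
            · exact hr b hb
          · exact hs' y hy
        · have hat : ¬ IsTerminator a := fun h => h.elim ha' ha
          cases r with
          | nil =>
            refine ⟨([], a :: l) :: s, fun y hy => ?_, by simp [joinSections_nil_cons]⟩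
            rcases List.mem_cons.1 hy with rfl | hy
            · exact ⟨fun _ h => absurd h List.not_mem_nil, hl.cons hat⟩
            · exact hs' y hy
          | cons b r =>
            refine ⟨((a :: b) :: r, l) :: s, fun y hy => ?_, by simp [joinSections_cons_cons]⟩
            rcases List.mem_cons.1 hy with rfl | hy
            · refine ⟨fun c hc => ?_, hl⟩
              rcases List.mem_cons.1 hc with rfl | hc
              · exact (hr b (by simp)).cons hat
              · exact hr c (List.mem_cons_of_mem _ hc)
            · exact hs' y hy

end TapeProg

/-! ### Trees -/

namespace TapeProg

section

variable {V : Type} {E : V → V → Prop} {r : V}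

theorem isPathFromTo_singleton (u : V) : IsPathFromTo E u u [u] := by simp [IsPathFromTo]

theorem not_edge_root (h : IsTreeWithRoot E r) (u : V) : ¬ E u r := by
  intro hu
  obtain ⟨p, hp, -⟩ := h u
  have h1 := (h r).unique (hp.snoc hu) (isPathFromTo_singleton r)
  have h2 := hp.1
  cases p with
  | nil => simp at h2
  | cons a l => simp at h1

theorem parent_unique (h : IsTreeWithRoot E r) {u u' v : V} (hu : E u v) (hu' : E u' v) : u = u' := by
  obtain ⟨p, hp, -⟩ := h u
  obtain ⟨p', hp', -⟩ := h u'
  have h1 := (h v).unique (hp.snoc hu) (hp'.snoc hu')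
  have h2 := hp.2.1
  rw [List.append_cancel_right h1, hp'.2.1] at h2
  exact (Option.some.inj h2).symm

theorem reflTransGen_of_isPathFromTo {u v : V} {p : List V} (h : IsPathFromTo E u v p) :
    Relation.ReflTransGen E u v := by
  induction p generalizing u with
  | nil => simp [IsPathFromTo] at h
  | cons a q ih =>
    obtain ⟨h1, h2, h3⟩ := h
    have ha : a = u := by simpa using h1
    subst ha
    cases q with
    | nil =>
      have : a = v := by simpa using h2
      exact this ▸ .refl
    | cons b q =>
      rw [List.isChain_cons_cons] at h3
      exact .head h3.1 (ih ⟨rfl, by simpa using h2, h3.2⟩)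

theorem reflTransGen_root (h : IsTreeWithRoot E r) (v : V) : Relation.ReflTransGen E r v :=
  reflTransGen_of_isPathFromTo (h v).exists.choose_spec

theorem exists_parent (h : IsTreeWithRoot E r) {v : V} (hv : v ≠ r) : ∃ u, E u v := by
  rcases Relation.ReflTransGen.cases_tail (reflTransGen_root h v) with h | ⟨u, -, h⟩
  · exact absurd h hv
  · exact ⟨u, h⟩

/-- Two paths from the root to the same node are compared from their ends: parents are unique and
the root has none, so they agree backwards and have the same length. -/
theorem isTreeWithRoot_of_reflTransGen (h1 : ∀ u u' v, E u v → E u' v → u = u') (h2 : ∀ u, ¬ E u r)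
    (h3 : ∀ v, Relation.ReflTransGen E r v) : IsTreeWithRoot E r := by
  have huniq : ∀ (p p' : List V) (v : V), IsPathFromTo E r v p → IsPathFromTo E r v p' → p = p' := by
    intro p
    induction p using List.reverseRecOn with
    | nil => intro _ _ h; simp [IsPathFromTo] at h
    | append_singleton q a ih =>
      intro p' v hp hp'
      induction p' using List.reverseRecOn with
      | nil => simp [IsPathFromTo] at hp'
      | append_singleton q' a' _ =>
        have ha : a = v := by simpa using hp.2.1
        have ha' : a' = v := by simpa using hp'.2.1
        subst ha ha'
        have key : ∀ (q : List V) (b : V), IsPathFromTo E r b (q ++ [b]) → (q = [] ∧ b = r) ∨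
            ∃ c, IsPathFromTo E r c q ∧ E c b := by
          intro q b hq
          rcases List.eq_nil_or_concat q with rfl | ⟨l, c, rfl⟩
          · exact Or.inl ⟨rfl, by simpa using hq.1⟩
          · have h3 := hq.2.2
            rw [List.concat_eq_append] at h3 hq ⊢
            rw [List.isChain_append] at h3
            refine Or.inr ⟨c, ⟨?_, by simp, h3.1⟩, h3.2.2 c (by simp) b (by simp)⟩
            have := hq.1
            cases l <;> simpa using this
        rcases key q a' hp with ⟨rfl, rfl⟩ | ⟨c, hc, hca⟩
        · rcases key q' a' hp' with ⟨rfl, -⟩ | ⟨c, -, hca⟩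
          · rfl
          · exact absurd hca (h2 c)
        · rcases key q' a' hp' with ⟨rfl, rfl⟩ | ⟨c', hc', hca'⟩
          · exact absurd hca (h2 c)
          · obtain rfl := h1 _ _ _ hca hca'
            rw [ih q' c hc hc']
  intro v
  have hex : ∃ p, IsPathFromTo E r v p := by
    induction h3 v with
    | refl => exact ⟨_, isPathFromTo_singleton r⟩
    | tail _ h ih => exact ⟨_, ih.choose_spec.snoc h⟩
  obtain ⟨p, hp⟩ := hex
  exact ⟨p, hp, fun q hq => huniq q p v hq hp⟩

end

end TapeProg

/-! ### Tree-shaped circuits as systems of gates -/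

namespace TapeProg

open OfflineTM Obj

theorem encodeNat_injective {u v : ℕ} (h : encodeNat u = encodeNat v) : u = v :=
  bits_injective (List.map_injective_iff.2 (fun a b h => by simpa using h) h)

theorem append_cons_inj {α : Type} {c : α} {l l' r r' : List α} (hl : c ∉ l) (hl' : c ∉ l') :
    l ++ c :: r = l' ++ c :: r' ↔ l = l' ∧ r = r' := by
  refine ⟨fun h => ?_, by rintro ⟨rfl, rfl⟩; rfl⟩
  induction l generalizing l' with
  | nil =>
    cases l' with
    | nil => simpa using h
    | cons a l' => exact absurd (by rw [(List.cons.inj h).1]; exact List.mem_cons_self) hl'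
  | cons a l ih =>
    cases l' with
    | nil => exact absurd (by rw [← (List.cons.inj h).1]; exact List.mem_cons_self) hl
    | cons a' l' =>
      simp only [List.cons_append, List.cons.injEq] at h
      obtain ⟨rfl, h⟩ := h
      obtain ⟨rfl, rfl⟩ := ih (fun h => hl (List.mem_cons_of_mem _ h))
        (fun h => hl' (List.mem_cons_of_mem _ h)) h
      exact ⟨rfl, rfl⟩

theorem comma_notMem_encodeNat (n : ℕ) : InputSym.comma ∉ encodeNat n := fun h => by
  obtain ⟨b, -, h⟩ := List.mem_map.1 h
  simp at h

theorem encodeNat_comma_inj {u v : ℕ} {r r' : List InputSym} :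
    encodeNat u ++ .comma :: r = encodeNat v ++ .comma :: r' ↔ u = v ∧ r = r' := by
  rw [append_cons_inj (comma_notMem_encodeNat u) (comma_notMem_encodeNat v)]
  exact and_congr_left fun _ => ⟨encodeNat_injective, fun h => by rw [h]⟩

theorem nil_prefix_iff (w : List InputSym) : [] <+: w ↔ True := by simp

theorem exB_lineAt {w : List InputSym} {k : ℕ} {l : List InputSym} (hl : l ≠ []) :
    exB w.length (fun p => LineAt w k p l) ↔ ∃ p, LineAt w k p l := by
  refine ⟨fun ⟨p, _, h⟩ => ⟨p, h⟩, fun ⟨p, h⟩ => ⟨p, ?_, h⟩⟩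
  have h1 := h.2.2.length_le
  have h2 := List.length_pos_iff.2 hl
  rw [List.length_drop] at h1
  omega

theorem exists_lineAt_semicolon {s : List (List (List InputSym) × List InputSym)} (hs : CleanSections s)
    {k : ℕ} {b : List InputSym} (hb : Clean b) :
    (∃ p, LineAt (joinSections s) k p (b ++ [.semicolon])) ↔ ∃ x, s[k]? = some x ∧ b ∈ x.1 := by
  obtain ⟨pos, -, h⟩ := exists_pos_of_sections hs
  simp only [h k _ b hb, List.mem_iff_getElem?]
  constructor
  · rintro ⟨p, x, j, h1, h2, -⟩
    exact ⟨x, h1, j, h2⟩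
  · rintro ⟨x, h1, j, h2⟩
    exact ⟨_, x, j, h1, h2, rfl⟩

namespace CircuitGates

/-- In the formula `i`, the node `u` has the label `a`. -/
def HasLabel (a : InputSym) (w : List InputSym) (i u : ℕ) : Prop :=
  exB w.length fun p => LineAt w (2 * i) p (encodeNat u ++ .comma :: ([a] ++ [.semicolon]))

def HasVar (w : List InputSym) (i u j : ℕ) : Prop :=
  exB w.length fun p => LineAt w (2 * i) p (encodeNat u ++ .comma :: (.var :: (encodeNat j ++ [.semicolon])))

/-- Each formula `i` is encoded by two sections, `2 * i` for its nodes and `2 * i + 1` for its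
edges. -/
def HasEdge (w : List InputSym) (i u v : ℕ) : Prop :=
  exB w.length fun p => LineAt w (2 * i + 1) p (encodeNat u ++ .comma :: (encodeNat v ++ [.semicolon]))

def IsNode (w : List InputSym) (i u : ℕ) : Prop :=
  HasLabel (.const true) w i u ∨ HasLabel (.const false) w i u ∨ HasLabel .neg w i u ∨
    HasLabel .conj w i u ∨ HasLabel .disj w i u ∨ exB (w.length + 1) (HasVar w i u)

def IsRoot (w : List InputSym) (i u : ℕ) : Prop :=
  IsNode w i u ∧ ¬ exB (w.length + 1) fun x => HasEdge w i x u

section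

variable {X : Type} [Obj X] {w : X → List InputSym} {i u j : X → ℕ}

@[fun_prop]
theorem ls_hasLabel (a : InputSym) (hw : LS w) (hi : LS i) (hu : LS u) :
    LS fun x => HasLabel a (w x) (i x) (u x) := by
  simp only [HasLabel, LineAt, encodeNat_append_prefix_drop, cons_prefix_drop, List.cons_append,
    List.nil_append, nil_prefix_iff]
  fun_prop

@[fun_prop]
theorem ls_hasVar (hw : LS w) (hi : LS i) (hu : LS u) (hj : LS j) :
    LS fun x => HasVar (w x) (i x) (u x) (j x) := by
  simp only [HasVar, LineAt, encodeNat_append_prefix_drop, cons_prefix_drop, nil_prefix_iff]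
  fun_prop

@[fun_prop]
theorem ls_hasEdge (hw : LS w) (hi : LS i) (hu : LS u) (hj : LS j) :
    LS fun x => HasEdge (w x) (i x) (u x) (j x) := by
  simp only [HasEdge, LineAt, encodeNat_append_prefix_drop, cons_prefix_drop, nil_prefix_iff]
  fun_prop

@[fun_prop]
theorem ls_isNode (hw : LS w) (hi : LS i) (hu : LS u) : LS fun x => IsNode (w x) (i x) (u x) := by
  unfold IsNode; fun_prop

@[fun_prop]
theorem ls_isRoot (hw : LS w) (hi : LS i) (hu : LS u) : LS fun x => IsRoot (w x) (i x) (u x) := by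
  unfold IsRoot; fun_prop

end

open Classical in
/-- The gate `(i, u)`, i.e. the node `u` of the formula `i`, has the number `i * (|w| + 1) + u`. -/
noncomputable def gates : Gates where
  bound w := (w.length + 1) * (w.length + 1)
  In w p c :=
    (c / (w.length + 1) = p / (w.length + 1) ∧
      HasEdge w (p / (w.length + 1)) (p % (w.length + 1)) (c % (w.length + 1))) ∨
    HasVar w (p / (w.length + 1)) (p % (w.length + 1)) (c / (w.length + 1)) ∧
      IsRoot w (c / (w.length + 1)) (c % (w.length + 1))
  Root w g := IsRoot w (g / (w.length + 1)) (g % (w.length + 1))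
  -- A disjunction, or an occurrence of a variable, is true if some input is true; a negation is
  -- false if some input is true; a conjunction is false if some input is false. Constants have no
  -- inputs and take the negation of `B`.
  A w g := decide (¬ HasLabel .conj w (g / (w.length + 1)) (g % (w.length + 1)))
  B w g := decide (HasLabel .disj w (g / (w.length + 1)) (g % (w.length + 1)) ∨
    HasLabel (.const false) w (g / (w.length + 1)) (g % (w.length + 1)) ∨
    exB (w.length + 1) fun j => HasVar w (g / (w.length + 1)) (g % (w.length + 1)) j)
  -- The gates of formula `0` are numbered by their nodes alone, and this formula has a single root.
  start w := leastB (w.length + 1) fun g => IsRoot w 0 g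
  Valid _ := True

instance : gates.Logspace where
  bound := by unfold gates; fun_prop
  In := by unfold gates; dsimp only; fun_prop
  Root := by unfold gates; dsimp only; fun_prop
  A := by unfold gates; dsimp only; fun_prop
  B := by unfold gates; dsimp only; fun_prop
  start := by unfold gates; dsimp only; fun_prop
  Valid := by unfold gates; dsimp only; fun_prop

/-! #### The encoding of a circuit -/

def nodeRecords {n : ℕ} (φ : BoolFormula n) : List (List InputSym) :=
  (List.finRange φ.size).map fun u : Fin φ.size => encodeNat u ++ .comma :: (φ.label u).encode

def edgeRecords {n : ℕ} (φ : BoolFormula n) : List (List InputSym) :=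
  φ.edges.map fun e => encodeNat e.1 ++ .comma :: encodeNat e.2

def circuitSections (S : TreeCircuit) : List (List (List InputSym) × List InputSym) :=
  (List.finRange S.n).flatMap fun i => [(nodeRecords (S.φ i), []), (edgeRecords (S.φ i), [])]

theorem encode_eq (S : TreeCircuit) : S.encode = joinSections (circuitSections S) := by
  simp only [TreeCircuit.encode, joinSections, circuitSections, List.flatMap_assoc]
  congr 1
  funext i
  simp [BoolFormula.encode, nodeRecords, edgeRecords, List.flatMap_map, List.append_assoc]

theorem clean_label {n : ℕ} (l : GateLabel n) : Clean l.encode := by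
  cases l with
  | var j => exact (clean_encodeNat _).cons (by simp [IsTerminator])
  | const b => exact clean_nil.cons (by simp [IsTerminator])
  | neg => exact clean_nil.cons (by simp [IsTerminator])
  | conj => exact clean_nil.cons (by simp [IsTerminator])
  | disj => exact clean_nil.cons (by simp [IsTerminator])

theorem cleanSections (S : TreeCircuit) : CleanSections (circuitSections S) := by
  intro x hx
  obtain ⟨i, -, hx⟩ := List.mem_flatMap.1 hx
  simp only [List.mem_cons, List.not_mem_nil, or_false] at hx
  rcases hx with rfl | rfl
  · refine ⟨fun b hb => ?_, clean_nil⟩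
    obtain ⟨u, -, rfl⟩ := List.mem_map.1 hb
    exact (clean_encodeNat _).append ((clean_label _).cons (by simp [IsTerminator]))
  · refine ⟨fun b hb => ?_, clean_nil⟩
    obtain ⟨u, -, rfl⟩ := List.mem_map.1 hb
    exact (clean_encodeNat _).append ((clean_encodeNat _).cons (by simp [IsTerminator]))

theorem getElem?_flatMap_pair {α β : Type} (f g : α → β) (l : List α) (i : ℕ) :
    (l.flatMap fun x => [f x, g x])[2 * i]? = l[i]?.map f ∧
      (l.flatMap fun x => [f x, g x])[2 * i + 1]? = l[i]?.map g := by
  induction l generalizing i with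
  | nil => simp
  | cons a l ih =>
    cases i with
    | zero => simp
    | succ i =>
      simp only [List.flatMap_cons, List.cons_append, List.nil_append, Nat.mul_succ]
      simpa using ih i

theorem getElem?_finRange_eq_some {n i : ℕ} {j : Fin n} :
    (List.finRange n)[i]? = some j ↔ i = j := by
  rw [List.getElem?_eq_some_iff]
  simp only [List.getElem_finRange, List.length_finRange]
  constructor
  · rintro ⟨h, rfl⟩; rfl
  · rintro rfl
    exact ⟨j.2, rfl⟩

variable (S : TreeCircuit)

theorem record_node {i : ℕ} {b : List InputSym} (hb : Clean b) :
    exB S.encode.length (fun p => LineAt S.encode (2 * i) p (b ++ [.semicolon])) ↔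
      ∃ (i' : Fin S.n) (u : Fin (S.φ i').size), i = i' ∧
        b = encodeNat u ++ .comma :: ((S.φ i').label u).encode := by
  rw [exB_lineAt (by simp), encode_eq, exists_lineAt_semicolon (cleanSections S) hb]
  simp only [circuitSections, (getElem?_flatMap_pair _ _ _ i).1, Option.map_eq_some_iff,
    getElem?_finRange_eq_some]
  constructor
  · rintro ⟨_, ⟨i', h, rfl⟩, hb⟩
    obtain ⟨u, -, rfl⟩ := List.mem_map.1 hb
    exact ⟨i', u, h, rfl⟩
  · rintro ⟨i', u, h, rfl⟩
    exact ⟨_, ⟨i', h, rfl⟩, List.mem_map.2 ⟨u, List.mem_finRange u, rfl⟩⟩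

theorem hasLabel_iff {a : InputSym} (ha : ¬ IsTerminator a) {i u : ℕ} : HasLabel a S.encode i u ↔
    ∃ (i' : Fin S.n) (u' : Fin (S.φ i').size), i = i' ∧ u = u' ∧ ((S.φ i').label u').encode = [a] := by
  rw [HasLabel, show encodeNat u ++ .comma :: ([a] ++ [.semicolon]) =
    (encodeNat u ++ .comma :: [a]) ++ [.semicolon] by simp]
  rw [record_node S ((clean_encodeNat u).append ((clean_nil.cons ha).cons (by simp [IsTerminator])))]
  simp only [encodeNat_comma_inj]
  exact exists_congr fun i' => exists_congr fun u' => and_congr_right fun _ => and_congr_right fun _ => eq_comm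

theorem hasVar_iff {i u j : ℕ} : HasVar S.encode i u j ↔ ∃ (i' : Fin S.n) (u' : Fin (S.φ i').size)
    (j' : Fin S.n), i = i' ∧ u = u' ∧ j = j' ∧ (S.φ i').label u' = .var j' := by
  rw [HasVar, show encodeNat u ++ .comma :: (.var :: (encodeNat j ++ [.semicolon])) =
    (encodeNat u ++ .comma :: (.var :: encodeNat j)) ++ [.semicolon] by simp]
  rw [record_node S ((clean_encodeNat u).append
    (((clean_encodeNat j).cons (by simp [IsTerminator])).cons (by simp [IsTerminator])))]
  simp only [encodeNat_comma_inj]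
  refine exists_congr fun i' => exists_congr fun u' => ⟨?_, ?_⟩
  · rintro ⟨h1, h2, h3⟩
    cases hl : (S.φ i').label u' with
    | var j' =>
      rw [hl] at h3
      simp only [GateLabel.encode, List.cons.injEq, true_and] at h3
      exact ⟨j', h1, h2, encodeNat_injective h3, rfl⟩
    | _ => simp [hl, GateLabel.encode] at h3
  · rintro ⟨j', h1, h2, rfl, h4⟩
    exact ⟨h1, h2, by rw [h4]; rfl⟩

theorem hasEdge_iff {i u v : ℕ} : HasEdge S.encode i u v ↔ ∃ (i' : Fin S.n)
    (u' v' : Fin (S.φ i').size), i = i' ∧ u = u' ∧ v = v' ∧ (u', v') ∈ (S.φ i').edges := by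
  rw [HasEdge, show encodeNat u ++ .comma :: (encodeNat v ++ [.semicolon]) =
    (encodeNat u ++ .comma :: encodeNat v) ++ [.semicolon] by simp]
  rw [exB_lineAt (by simp), encode_eq, exists_lineAt_semicolon (cleanSections S)
    ((clean_encodeNat u).append ((clean_encodeNat v).cons (by simp [IsTerminator])))]
  simp only [circuitSections, (getElem?_flatMap_pair _ _ _ i).2, Option.map_eq_some_iff,
    getElem?_finRange_eq_some]
  constructor
  · rintro ⟨_, ⟨i', h, rfl⟩, hb⟩
    obtain ⟨⟨u', v'⟩, h1, h2⟩ := List.mem_map.1 hb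
    obtain ⟨h3, h4⟩ := encodeNat_comma_inj.1 h2
    exact ⟨i', u', v', h, h3.symm, (encodeNat_injective h4).symm, h1⟩
  · rintro ⟨i', u', v', h, rfl, rfl, h1⟩
    exact ⟨_, ⟨i', h, rfl⟩, List.mem_map.2 ⟨_, h1, rfl⟩⟩

theorem length_le_flatMap {α β : Type} (f : α → List β) {l : List α} {a : α} (ha : a ∈ l) :
    (f a).length ≤ (l.flatMap f).length := by
  rw [List.length_flatMap]
  exact List.le_sum_of_mem (List.mem_map.2 ⟨a, ha, rfl⟩)

theorem length_le_joinSections (s : List (List (List InputSym) × List InputSym)) :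
    s.length ≤ (joinSections s).length := by
  unfold joinSections
  rw [List.length_flatMap]
  refine (List.length_map (f := fun x : List (List InputSym) × List InputSym =>
    (x.1.flatMap (fun b => b ++ [InputSym.semicolon]) ++ x.2 ++ [InputSym.hash]).length)).symm.le.trans ?_
  refine List.length_le_sum_of_one_le _ fun i hi => ?_
  obtain ⟨x, -, rfl⟩ := List.mem_map.1 hi
  rw [List.length_append, List.length_singleton]
  omega

theorem card_records_le {x : List (List InputSym) × List InputSym}
    {s : List (List (List InputSym) × List InputSym)} (hx : x ∈ s) : x.1.length < (joinSections s).length := by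
  have h1 : x.1.length ≤ (x.1.flatMap fun b => b ++ [InputSym.semicolon]).length := by
    rw [List.length_flatMap]
    refine (List.length_map (f := fun b => (b ++ [InputSym.semicolon]).length)).symm.le.trans ?_
    refine List.length_le_sum_of_one_le _ fun i hi => ?_
    obtain ⟨x, -, rfl⟩ := List.mem_map.1 hi
    simp
  have h3 := length_le_flatMap (fun x : List (List InputSym) × List InputSym =>
    x.1.flatMap (fun b => b ++ [InputSym.semicolon]) ++ x.2 ++ [InputSym.hash]) hx
  simp only [List.length_append, List.length_singleton] at h3
  unfold joinSections
  omega

/-- Every formula contributes two sections and hence two letters `hash`. This keeps the numbers of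
variables below the base of the pairing of formulas and nodes. -/
theorem two_mul_n_le : 2 * S.n ≤ S.encode.length := by
  rw [encode_eq]
  refine le_trans (le_of_eq ?_) (length_le_joinSections _)
  simp [circuitSections, List.length_flatMap, mul_comm]

theorem size_le (i : Fin S.n) : (S.φ i).size < S.encode.length := by
  rw [encode_eq]
  refine lt_of_eq_of_lt ?_ (card_records_le (x := (nodeRecords (S.φ i), []))
    (List.mem_flatMap.2 ⟨i, List.mem_finRange i, by simp⟩))
  simp [nodeRecords]

theorem isNode_iff {i u : ℕ} : IsNode S.encode i u ↔
    ∃ (i' : Fin S.n) (u' : Fin (S.φ i').size), i = i' ∧ u = u' := by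
  constructor
  · rintro (h | h | h | h | h | ⟨j, -, h⟩)
    iterate 5
      obtain ⟨i', u', h1, h2, -⟩ := (hasLabel_iff S (by simp [IsTerminator])).1 h
      exact ⟨i', u', h1, h2⟩
    obtain ⟨i', u', -, h1, h2, -⟩ := (hasVar_iff S).1 h
    exact ⟨i', u', h1, h2⟩
  · rintro ⟨i', u', rfl, rfl⟩
    unfold IsNode
    cases hl : (S.φ i').label u' with
    | var j =>
      refine Or.inr (Or.inr (Or.inr (Or.inr (Or.inr ⟨j, ?_, ?_⟩))))
      · have := two_mul_n_le S
        omega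
      · exact (hasVar_iff S).2 ⟨i', u', j, rfl, rfl, rfl, hl⟩
    | const b =>
      have h := (hasLabel_iff S (a := .const b) (by simp [IsTerminator])).2
        ⟨i', u', rfl, rfl, by rw [hl]; rfl⟩
      cases b <;> tauto
    | neg =>
      have h := (hasLabel_iff S (a := .neg) (by simp [IsTerminator])).2
        ⟨i', u', rfl, rfl, by rw [hl]; rfl⟩
      tauto
    | conj =>
      have h := (hasLabel_iff S (a := .conj) (by simp [IsTerminator])).2
        ⟨i', u', rfl, rfl, by rw [hl]; rfl⟩
      tauto
    | disj =>
      have h := (hasLabel_iff S (a := .disj) (by simp [IsTerminator])).2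
        ⟨i', u', rfl, rfl, by rw [hl]; rfl⟩
      tauto

theorem isRoot_iff {i u : ℕ} : IsRoot S.encode i u ↔ ∃ i' : Fin S.n, i = i' ∧ u = (S.φ i').root := by
  unfold IsRoot
  rw [isNode_iff]
  constructor
  · rintro ⟨⟨i', u', rfl, rfl⟩, h⟩
    refine ⟨i', rfl, ?_⟩
    by_contra hne
    obtain ⟨v, hv⟩ := exists_parent (S.φ i').tree (v := u') fun h => hne (by rw [h])
    have := size_le S i'
    exact h ⟨v, by omega, (hasEdge_iff S).2 ⟨i', v, u', rfl, rfl, rfl, hv⟩⟩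
  · rintro ⟨i', rfl, rfl⟩
    refine ⟨⟨i', _, rfl, rfl⟩, ?_⟩
    rintro ⟨x, -, h⟩
    obtain ⟨i'', u', v', h1, -, h3, h4⟩ := (hasEdge_iff S).1 h
    obtain rfl := Fin.ext h1
    obtain rfl := Fin.ext h3
    exact not_edge_root (S.φ i').tree u' h4

end CircuitGates

end TapeProg

/-! ### The gates of an encoded circuit -/

namespace TapeProg

open OfflineTM Obj

namespace CircuitGates

variable (S : TreeCircuit)

/-- The number of the gate `(i, u)`. -/
def gateNum (i : Fin S.n) (u : Fin (S.φ i).size) : ℕ := i * (S.encode.length + 1) + u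

theorem gateNum_div (i : Fin S.n) (u : Fin (S.φ i).size) : gateNum S i u / (S.encode.length + 1) = i := by
  have := size_le S i
  rw [gateNum, Nat.mul_comm, Nat.mul_add_div (by omega), Nat.div_eq_of_lt (by omega), add_zero]

theorem gateNum_mod (i : Fin S.n) (u : Fin (S.φ i).size) : gateNum S i u % (S.encode.length + 1) = u := by
  have := size_le S i
  rw [gateNum, Nat.mul_comm, Nat.mul_add_mod, Nat.mod_eq_of_lt (by omega)]

theorem gateNum_lt (i : Fin S.n) (u : Fin (S.φ i).size) : gateNum S i u < gates.bound S.encode := by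
  have h1 := size_le S i
  have h2 := two_mul_n_le S
  have h3 := i.2
  have h4 : (i : ℕ) + 1 ≤ S.encode.length + 1 := by omega
  have h5 := Nat.mul_le_mul_right (S.encode.length + 1) h4
  rw [Nat.add_mul, Nat.one_mul] at h5
  change _ < (S.encode.length + 1) * (S.encode.length + 1)
  unfold gateNum
  omega

theorem gateNum_eq_iff {x i u : ℕ} (hu : u < S.encode.length + 1) : x = i * (S.encode.length + 1) + u ↔
    x / (S.encode.length + 1) = i ∧ x % (S.encode.length + 1) = u := by
  constructor
  · rintro rfl
    constructor
    · rw [Nat.mul_comm, Nat.mul_add_div (by omega), Nat.div_eq_of_lt (by omega), add_zero]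
    · rw [Nat.mul_comm, Nat.mul_add_mod, Nat.mod_eq_of_lt (by omega)]
  · rintro ⟨rfl, rfl⟩
    rw [Nat.mul_comm]
    exact (Nat.div_add_mod _ _).symm

theorem eq_gateNum_iff {x : ℕ} {i : Fin S.n} {u : Fin (S.φ i).size} : x = gateNum S i u ↔
    x / (S.encode.length + 1) = i ∧ x % (S.encode.length + 1) = u := by
  have h1 := size_le S i
  exact gateNum_eq_iff S (by omega)

theorem in_iff {p c : ℕ} : gates.In S.encode p c ↔ ∃ (i : Fin S.n) (u : Fin (S.φ i).size),
    p = gateNum S i u ∧ ((∃ v, (u, v) ∈ (S.φ i).edges ∧ c = gateNum S i v) ∨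
      ∃ j, (S.φ i).label u = .var j ∧ c = gateNum S j (S.φ j).root) := by
  simp only [gates, hasEdge_iff, hasVar_iff, isRoot_iff, eq_gateNum_iff]
  constructor
  · rintro (⟨h, i, u, v, h1, h2, h3, h4⟩ | ⟨⟨i, u, j, h1, h2, h3, h4⟩, j', h5, h6⟩)
    · exact ⟨i, u, ⟨h1, h2⟩, Or.inl ⟨v, h4, h.trans h1, h3⟩⟩
    · obtain rfl : j = j' := Fin.ext (h3.symm.trans h5)
      exact ⟨i, u, ⟨h1, h2⟩, Or.inr ⟨j, h4, h5, h6⟩⟩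
  · rintro ⟨i, u, ⟨h1, h2⟩, (⟨v, h3, h4, h5⟩ | ⟨j, h3, h4, h5⟩)⟩
    · exact Or.inl ⟨h4.trans h1.symm, i, u, v, h1, h2, h5, h3⟩
    · exact Or.inr ⟨⟨i, u, j, h1, h2, h4, h3⟩, j, h4, h5⟩

theorem gateNum_inj {i i' : Fin S.n} {u : Fin (S.φ i).size} {u' : Fin (S.φ i').size}
    (h : gateNum S i u = gateNum S i' u') : (⟨i, u⟩ : (i : Fin S.n) × Fin (S.φ i).size) = ⟨i', u'⟩ := by
  obtain ⟨h1, h2⟩ := (eq_gateNum_iff S).1 h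
  rw [gateNum_div] at h1
  rw [gateNum_mod] at h2
  obtain rfl := Fin.ext h1
  obtain rfl := Fin.ext h2
  rfl

theorem in_gateNum_iff {i : Fin S.n} {u : Fin (S.φ i).size} {c : ℕ} : gates.In S.encode (gateNum S i u) c ↔
    (∃ v, (u, v) ∈ (S.φ i).edges ∧ c = gateNum S i v) ∨
      ∃ j, (S.φ i).label u = .var j ∧ c = gateNum S j (S.φ j).root := by
  rw [in_iff]
  constructor
  · rintro ⟨i', u', h, h'⟩
    cases gateNum_inj S h
    exact h'
  · exact fun h => ⟨i, u, rfl, h⟩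

theorem root_iff {c : ℕ} : gates.Root S.encode c ↔ ∃ j, c = gateNum S j (S.φ j).root := by
  simp only [gates, isRoot_iff, eq_gateNum_iff]

theorem start_eq : gates.start S.encode = gateNum S ⟨0, S.pos⟩ (S.φ ⟨0, S.pos⟩).root := by
  have h0 : gateNum S ⟨0, S.pos⟩ (S.φ ⟨0, S.pos⟩).root = (S.φ ⟨0, S.pos⟩).root := by simp [gateNum]
  have h1 := size_le S ⟨0, S.pos⟩
  rw [h0]
  have h2 : IsRoot S.encode 0 (S.φ ⟨0, S.pos⟩).root := (isRoot_iff S).2 ⟨⟨0, S.pos⟩, rfl, rfl⟩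
  have h3 := leastB_lt (b := S.encode.length + 1) (p := fun g => IsRoot S.encode 0 g) (by omega) h2
  obtain ⟨i, h4, h5⟩ := (isRoot_iff S).1 (leastB_spec h3)
  obtain rfl : i = ⟨0, S.pos⟩ := Fin.ext h4.symm
  exact h5

theorem wellFounded_in : WellFounded fun c p => gates.In S.encode p c := by
  have key : ∀ b : (i : Fin S.n) × Fin (S.φ i).size,
      Acc (fun c p => gates.In S.encode p c) (gateNum S b.1 b.2) := by
    intro b
    induction b using S.input_wellFounded.induction with
    | _ b ih =>
      refine ⟨_, fun c hc => ?_⟩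
      rcases (in_gateNum_iff S).1 hc with ⟨v, hv, rfl⟩ | ⟨j, hj, rfl⟩
      · exact ih ⟨b.1, v⟩ (Or.inl ⟨b.1, b.2, v, hv, rfl, rfl⟩)
      · exact ih ⟨j, _⟩ (Or.inr ⟨j, hj, rfl⟩)
  refine ⟨fun x => ⟨_, fun c hc => ?_⟩⟩
  obtain ⟨i, u, rfl, (⟨v, hv, rfl⟩ | ⟨j, hj, rfl⟩)⟩ := (in_iff S).1 hc
  · exact key ⟨i, v⟩
  · exact key ⟨j, _⟩

/-- The blocks are the formulas, so `blk` is the number of the formula. Unique parents inside a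
block come from the trees of the formulas; that a formula is used by one block only comes from the
tree of the circuit. -/
theorem spec {val : ℕ → Bool}
    (hval : ∀ g, val g = gates.B S.encode g ↔ ∃ c, gates.In S.encode g c ∧ val c = gates.A S.encode g) :
    gates.Spec S.encode val where
  in_lt p c h := by
    obtain ⟨i, u, rfl, (⟨v, hv, rfl⟩ | ⟨j, hj, rfl⟩)⟩ := (in_iff S).1 h
    · exact ⟨gateNum_lt S _ _, gateNum_lt S _ _⟩
    · exact ⟨gateNum_lt S _ _, gateNum_lt S _ _⟩
  root_lt c h := by
    obtain ⟨j, rfl⟩ := (root_iff S).1 h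
    exact gateNum_lt S _ _
  start_root := (root_iff S).2 ⟨_, start_eq S⟩
  wf := wellFounded_in S
  parent_unique p p' c hc h h' := by
    rw [root_iff] at hc
    obtain ⟨i, u, rfl, (⟨v, hv, rfl⟩ | ⟨j, hj, rfl⟩)⟩ := (in_iff S).1 h
    · obtain ⟨i', u', rfl, (⟨v', hv', he⟩ | ⟨j, hj, he⟩)⟩ := (in_iff S).1 h'
      · cases gateNum_inj S he
        rw [parent_unique (S.φ i).tree hv hv']
      · exact absurd ⟨j, he⟩ hc
    · exact absurd ⟨j, rfl⟩ hc
  root_or_in p c h := by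
    obtain ⟨i, u, rfl, -⟩ := (in_iff S).1 h
    by_cases hu : u = (S.φ i).root
    · exact Or.inl ((root_iff S).2 ⟨i, by rw [hu]⟩)
    · obtain ⟨v, hv⟩ := exists_parent (S.φ i).tree hu
      exact Or.inr ⟨_, (in_gateNum_iff S).2 (Or.inl ⟨u, hv, rfl⟩)⟩
  block := by
    refine ⟨fun g => g / (S.encode.length + 1), fun p c h hc => ?_, fun p p' c hc h h' => ?_,
      fun r r' hr hr' h => ?_⟩
    · obtain ⟨i, u, rfl, (⟨v, hv, rfl⟩ | ⟨j, hj, rfl⟩)⟩ := (in_iff S).1 h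
      · simp only [gateNum_div]
      · exact absurd ((root_iff S).2 ⟨j, rfl⟩) hc
    · obtain ⟨k, rfl⟩ := (root_iff S).1 hc
      have key : ∀ p, gates.In S.encode p (gateNum S k (S.φ k).root) →
          ∃ (i : Fin S.n) (u : Fin (S.φ i).size), p = gateNum S i u ∧ (S.φ i).label u = .var k := by
        intro p h
        obtain ⟨i, u, rfl, (⟨v, hv, he⟩ | ⟨j, hj, he⟩)⟩ := (in_iff S).1 h
        · cases gateNum_inj S he
          exact absurd hv (not_edge_root (S.φ _).tree u)
        · cases gateNum_inj S he
          exact ⟨i, u, rfl, hj⟩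
      obtain ⟨i, u, rfl, hu⟩ := key p h
      obtain ⟨i', u', rfl, hu'⟩ := key p' h'
      simp only [gateNum_div]
      rw [parent_unique S.tree ⟨u, hu⟩ ⟨u', hu'⟩]
    · obtain ⟨j, rfl⟩ := (root_iff S).1 hr
      obtain ⟨j', rfl⟩ := (root_iff S).1 hr'
      simp only [gateNum_div] at h
      obtain rfl := Fin.ext h
      rfl
  val_eq := hval

theorem hasLabel_gateNum {a : InputSym} (ha : ¬ IsTerminator a) {i : Fin S.n} {u : Fin (S.φ i).size} :
    HasLabel a S.encode i u ↔ ((S.φ i).label u).encode = [a] := by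
  rw [hasLabel_iff S ha]
  constructor
  · rintro ⟨i', u', h1, h2, h3⟩
    obtain rfl := Fin.ext h1
    obtain rfl := Fin.ext h2
    exact h3
  · exact fun h => ⟨i, u, rfl, rfl, h⟩

theorem a_gateNum (i : Fin S.n) (u : Fin (S.φ i).size) :
    gates.A S.encode (gateNum S i u) = true ↔ (S.φ i).label u ≠ .conj := by
  simp only [gates, gateNum_div, gateNum_mod, decide_eq_true_eq,
    hasLabel_gateNum S (a := .conj) (by simp [IsTerminator])]
  cases (S.φ i).label u <;> simp [GateLabel.encode]

theorem b_gateNum (i : Fin S.n) (u : Fin (S.φ i).size) : gates.B S.encode (gateNum S i u) = true ↔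
    (S.φ i).label u = .disj ∨ (S.φ i).label u = .const false ∨ ∃ j, (S.φ i).label u = .var j := by
  have h : exB (S.encode.length + 1) (fun j => HasVar S.encode i u j) ↔ ∃ j, (S.φ i).label u = .var j := by
    constructor
    · rintro ⟨j, -, h⟩
      obtain ⟨i', u', j', h1, h2, h3, h4⟩ := (hasVar_iff S).1 h
      obtain rfl := Fin.ext h1
      obtain rfl := Fin.ext h2
      exact ⟨j', h4⟩
    · rintro ⟨j, h⟩
      have := two_mul_n_le S
      exact ⟨j, by omega, (hasVar_iff S).2 ⟨i, u, j, rfl, rfl, rfl, h⟩⟩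
  simp only [gates, gateNum_div, gateNum_mod, decide_eq_true_eq, h,
    hasLabel_gateNum S (a := .disj) (by simp [IsTerminator]),
    hasLabel_gateNum S (a := .const false) (by simp [IsTerminator])]
  cases (S.φ i).label u <;> simp [GateLabel.encode]

theorem isEvaluation {val : ℕ → Bool}
    (hval : ∀ g, val g = gates.B S.encode g ↔ ∃ c, gates.In S.encode g c ∧ val c = gates.A S.encode g) :
    S.IsEvaluation fun i u => val (gateNum S i u) := by
  intro i u
  have h := hval (gateNum S i u)
  have hA := a_gateNum S i u
  have hB := b_gateNum S i u
  simp only [in_gateNum_iff] at h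
  cases hl : (S.φ i).label u with
  | var j =>
    simp only [hl] at h hA hB ⊢
    have hB' : gates.B S.encode (gateNum S i u) = true := hB.2 (Or.inr (Or.inr ⟨j, rfl⟩))
    have hA' : gates.A S.encode (gateNum S i u) = true := hA.2 (by simp)
    rw [hA', hB'] at h
    rw [Bool.eq_iff_iff, h]
    constructor
    · rintro ⟨c, (⟨v, hv, -⟩ | ⟨j', hj, rfl⟩), hc⟩
      · exact absurd hv ((S.φ i).var_leaf u j hl v)
      · cases hj
        exact hc
    · exact fun hc => ⟨_, Or.inr ⟨j, rfl, rfl⟩, hc⟩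
  | const b =>
    simp only [hl] at h hB ⊢
    have h' : ¬ val (gateNum S i u) = gates.B S.encode (gateNum S i u) := by
      rw [h]
      rintro ⟨c, (⟨v, hv, -⟩ | ⟨j, hj, -⟩), -⟩
      · exact (S.φ i).const_leaf u b hl v hv
      · cases hj
    generalize val (gateNum S i u) = x at h' ⊢
    generalize gates.B S.encode (gateNum S i u) = y at h' hB
    clear h hA hval hl
    cases b <;> cases x <;> cases y <;> simp_all
  | neg =>
    intro v hv
    simp only [hl] at h hA hB
    have hB' : gates.B S.encode (gateNum S i u) = false := by
      rw [← Bool.not_eq_true, hB]; simp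
    have hA' : gates.A S.encode (gateNum S i u) = true := hA.2 (by simp)
    rw [hA', hB'] at h
    have h' : (val (gateNum S i u) = false) ↔ val (gateNum S i v) = true := by
      rw [h]
      constructor
      · rintro ⟨c, (⟨v', hv', rfl⟩ | ⟨j, hj, -⟩), hc⟩
        · rwa [((S.φ i).neg_unary u hl).unique hv hv']
        · cases hj
      · exact fun hc => ⟨_, Or.inl ⟨v, hv, rfl⟩, hc⟩
    cases hx : val (gateNum S i u) <;> cases hy : val (gateNum S i v) <;> simp_all
  | conj =>
    simp only [hl] at h hA hB ⊢
    have hB' : gates.B S.encode (gateNum S i u) = false := by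
      rw [← Bool.not_eq_true, hB]; simp
    have hA' : gates.A S.encode (gateNum S i u) = false := by
      rw [← Bool.not_eq_true, hA]; simp
    rw [hA', hB'] at h
    rw [← not_iff_not, Bool.not_eq_true, h]
    push Not
    constructor
    · rintro ⟨c, (⟨v', hv', rfl⟩ | ⟨j, hj, -⟩), hc⟩
      · exact ⟨v', hv', by simp [hc]⟩
      · cases hj
    · rintro ⟨v, hv, hc⟩
      exact ⟨_, Or.inl ⟨v, hv, rfl⟩, by simpa using hc⟩
  | disj =>
    simp only [hl] at h hA hB ⊢
    have hB' : gates.B S.encode (gateNum S i u) = true := hB.2 (by simp)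
    have hA' : gates.A S.encode (gateNum S i u) = true := hA.2 (by simp)
    rw [hA', hB'] at h
    rw [h]
    constructor
    · rintro ⟨c, (⟨v', hv', rfl⟩ | ⟨j, hj, -⟩), hc⟩
      · exact ⟨v', hv', hc⟩
      · cases hj
    · rintro ⟨v, hv, hc⟩
      exact ⟨_, Or.inl ⟨v, hv, rfl⟩, hc⟩

theorem val_start {val : ℕ → Bool}
    (hval : ∀ g, val g = gates.B S.encode g ↔ ∃ c, gates.In S.encode g c ∧ val c = gates.A S.encode g) :
    val (gates.start S.encode) = S.value := by
  rw [start_eq, TreeCircuit.value, ← S.existsUnique_isEvaluation.choose_spec.2 _ (isEvaluation S hval)]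

theorem card_root_le : countB (gates.bound S.encode) (gates.Root S.encode) ≤ S.n := by
  classical
  simp only [countB, Nat.count_eq_card_filter_range]
  refine (Finset.card_le_card (t := Finset.univ.image fun j => gateNum S j (S.φ j).root) fun g hg => ?_).trans
    (Finset.card_image_le.trans (by simp))
  obtain ⟨j, rfl⟩ := (root_iff S).1 (Finset.mem_filter.1 hg).2
  exact Finset.mem_image_of_mem _ (Finset.mem_univ j)

/-- All gates with the root of a given formula as input are occurrences of its variable in one
formula. The gate `p` is one of them and is not counted by its own index, which makes the inequality
strict. -/
theorem index_lt {p c : ℕ} (hc : gates.Root S.encode c) (h : gates.In S.encode p c) :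
    gates.index S.encode p c < S.width := by
  classical
  obtain ⟨k, rfl⟩ := (root_iff S).1 hc
  have key : ∀ p, gates.In S.encode p (gateNum S k (S.φ k).root) →
      ∃ (i : Fin S.n) (u : Fin (S.φ i).size), p = gateNum S i u ∧ (S.φ i).label u = .var k := by
    intro p h
    obtain ⟨i, u, rfl, (⟨v, hv, he⟩ | ⟨j, hj, he⟩)⟩ := (in_iff S).1 h
    · cases gateNum_inj S he
      exact absurd hv (not_edge_root (S.φ _).tree u)
    · cases gateNum_inj S he
      exact ⟨i, u, rfl, hj⟩
  obtain ⟨i, u, rfl, hu⟩ := key p h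
  have h1 : gates.index S.encode (gateNum S i u) (gateNum S k (S.φ k).root) <
      countB (gateNum S i u + 1) fun p => gates.In S.encode p (gateNum S k (S.φ k).root) := by
    rw [countB_add]
    refine Nat.lt_add_of_pos_right ((Nat.zero_le _).trans_lt
      (countB_lt_countB (p := fun _ => False) (j := 0) (by simp) (by simp) (by simp) h))
  refine h1.trans_le (le_trans ?_ ((Finset.le_sup (f := fun j => (S.φ i).occ j) (Finset.mem_univ k)).trans
    (Finset.le_sup (f := fun i => Finset.univ.sup fun j => (S.φ i).occ j) (Finset.mem_univ i))))
  simp only [countB, Nat.count_eq_card_filter_range, BoolFormula.occ, Nat.card_eq_fintype_card]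
  refine (Finset.card_le_card (t := Finset.univ.image fun x : {u // (S.φ i).label u = .var k} =>
    gateNum S i x.1) fun g hg => ?_).trans (Finset.card_image_le.trans (by simp))
  obtain ⟨i', u', rfl, hu'⟩ := key g (Finset.mem_filter.1 hg).2
  have hi := parent_unique S.tree ⟨u', hu'⟩ ⟨u, hu⟩
  subst hi
  exact Finset.mem_image_of_mem _ (Finset.mem_univ (⟨u', hu'⟩ : {u // (S.φ i').label u = .var k}))

end CircuitGates

end TapeProg

/-! ### Evaluation of tree-shaped circuits -/

namespace TapeProg

open OfflineTM

theorem _root_.OfflineTM.UsesSpaceAtMost.mono {α : Type} {M : OfflineTM α} {w : List α} {s s' : ℝ}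
    (h : M.UsesSpaceAtMost w s) (hs : s ≤ s') : M.UsesSpaceAtMost w s' := fun c hc t => (h c hc t).trans hs

theorem half_le_log_two : 1 / 2 ≤ Real.log 2 := by
  have := Real.log_two_gt_d9
  linarith

theorem natLog_two_le (n : ℕ) : (Nat.log 2 n : ℝ) ≤ 2 * Real.log n := by
  have h := Real.natLog_le_logb n 2
  rw [Real.logb] at h
  have h2 := half_le_log_two
  have hn : 0 ≤ Real.log n := Real.log_natCast_nonneg n
  refine h.trans ?_
  push_cast
  rw [div_le_iff₀ (by linarith)]
  nlinarith

theorem size_le_log (n : ℕ) : (n.size : ℝ) ≤ 2 * Real.log n + 1 := by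
  have h : n.size ≤ Nat.log 2 n + 1 := Nat.size_le.2 (Nat.lt_pow_succ_log_self (by norm_num) n)
  have h' : (n.size : ℝ) ≤ Nat.log 2 n + 1 := by exact_mod_cast h
  have := natLog_two_le n
  linarith

theorem half_le_log {x : ℝ} (hx : 2 ≤ x) : 1 / 2 ≤ Real.log x :=
  half_le_log_two.trans (Real.log_le_log (by norm_num) hx)

/-- The base is `8` times the number of gates plus `8`, which bounds the gate numbers as well as the
frames with their three extra bits. -/
theorem size_pow_le (l K : ℕ) :
    (((8 * ((l + 1) * (l + 1)) + 8) ^ K).size : ℝ) ≤ 12 * K * Real.log (l + 2) + 1 := by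
  have h1 : 8 * ((l + 1) * (l + 1)) + 8 ≤ (l + 2) ^ 6 := by
    have h2 : 2 ^ 4 ≤ (l + 2) ^ 4 := Nat.pow_le_pow_left (by omega) 4
    calc 8 * ((l + 1) * (l + 1)) + 8 ≤ 2 ^ 4 * (l + 2) ^ 2 := by nlinarith
      _ ≤ (l + 2) ^ 4 * (l + 2) ^ 2 := Nat.mul_le_mul_right _ h2
      _ = (l + 2) ^ 6 := by ring
  have h3 := size_le_log ((8 * ((l + 1) * (l + 1)) + 8) ^ K)
  have h4 : Real.log ((8 * ((l + 1) * (l + 1)) + 8 : ℕ) : ℝ) ≤ 6 * Real.log (l + 2) := by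
    have h5 : ((8 * ((l + 1) * (l + 1)) + 8 : ℕ) : ℝ) ≤ ((l + 2 : ℝ)) ^ 6 := by exact_mod_cast h1
    refine (Real.log_le_log (by positivity) h5).trans ?_
    rw [Real.log_pow]
    norm_num
  rw [Nat.cast_pow, Real.log_pow] at h3
  have h5 := mul_le_mul_of_nonneg_left h4 (Nat.cast_nonneg (α := ℝ) K)
  linarith

namespace CircuitGates

/-- Common source of the first two statements: for one machine, the space is logarithmic in the
length of the input up to a stack of `O(log n)` frames of `O(log m)` symbols. -/
theorem exists_machine : ∃ (M : OfflineTM InputSym) (K : ℕ), ∀ S : TreeCircuit,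
    M.Outputs S.encode S.value ∧ M.UsesSpaceAtMost S.encode
      (12 * K * Real.log (S.encode.length + 2) + ((8 * S.width).size + 1) * (2 * Real.log S.n) + 4) := by
  obtain ⟨M, K, hM⟩ := Gates.exists_machine gates
  refine ⟨M, K, fun S => ?_⟩
  obtain ⟨val, hval⟩ := Gates.exists_val (D := gates) (wellFounded_in S)
  have h := (hM S.encode (8 * ((S.encode.length + 1) * (S.encode.length + 1)) + 8) (by nlinarith)).2 trivial
    le_rfl val (spec S hval) ((8 * S.width).size + 1) (fun p c hc hp => by
      have := index_lt S hc hp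
      exact Nat.add_le_add_right (Nat.size_le_size (by omega)) 1)
  rw [val_start S hval] at h
  refine ⟨h.1, h.2.mono ?_⟩
  have h1 := size_pow_le S.encode.length K
  have h2 : (Nat.log 2 (countB (gates.bound S.encode) (gates.Root S.encode)) : ℝ) ≤ 2 * Real.log S.n :=
    le_trans (by exact_mod_cast Nat.log_mono_right (card_root_le S)) (natLog_two_le S.n)
  have h3 := mul_le_mul_of_nonneg_left h2 (show (0 : ℝ) ≤ (8 * S.width).size + 1 by positivity)
  push_cast at h1 h3 ⊢
  linarith

theorem length_label_le {n : ℕ} (l : GateLabel n) : l.encode.length ≤ n + 1 := by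
  cases l with
  | var j =>
    have h1 : (j : ℕ).size ≤ j := Nat.size_le.2 Nat.lt_two_pow_self
    have := j.2
    simp only [GateLabel.encode, List.length_cons, length_encodeNat]
    omega
  | _ => simp [GateLabel.encode]

theorem length_flatMap_le {α β : Type} (f : α → List β) (l : List α) {b : ℕ}
    (h : ∀ a ∈ l, (f a).length ≤ b) : (l.flatMap f).length ≤ l.length * b := by
  rw [List.length_flatMap]
  refine (List.sum_le_card_nsmul _ b fun x hx => ?_).trans (by simp)
  obtain ⟨a, ha, rfl⟩ := List.mem_map.1 hx
  exact h a ha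

theorem length_encode_formula_le {n : ℕ} (φ : BoolFormula n) :
    φ.encode.length ≤ φ.size * (φ.size + n + 3) + φ.size * φ.size * (2 * φ.size + 2) + 2 := by
  have hs : ∀ u : Fin φ.size, (u : ℕ).size ≤ φ.size := fun u =>
    (Nat.size_le.2 Nat.lt_two_pow_self : (u : ℕ).size ≤ u).trans u.2.le
  have h1 := length_flatMap_le (fun u : Fin φ.size =>
    encodeNat u ++ [InputSym.comma] ++ (φ.label u).encode ++ [InputSym.semicolon]) (List.finRange φ.size)
    (b := φ.size + n + 3) (fun u _ => by
      have := hs u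
      have := length_label_le (φ.label u)
      simp only [List.length_append, length_encodeNat, List.length_singleton]
      omega)
  have h2 := length_flatMap_le (fun e : Fin φ.size × Fin φ.size =>
    encodeNat e.1 ++ [InputSym.comma] ++ encodeNat e.2 ++ [InputSym.semicolon]) φ.edges
    (b := 2 * φ.size + 2) (fun e _ => by
      have := hs e.1
      have := hs e.2
      simp only [List.length_append, length_encodeNat, List.length_singleton]
      omega)
  have h3 : φ.edges.length ≤ φ.size * φ.size := by
    simpa using φ.nodup.length_le_card
  have h4 := Nat.mul_le_mul_right (2 * φ.size + 2) h3
  rw [List.length_finRange] at h1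
  simp only [BoolFormula.encode, List.length_append, List.length_singleton] at h1 h2 ⊢
  omega

/-- Edges are listed without repetition, so the encoding is polynomial in the number and the size of
the formulas. Therefore the logarithm of its length is absorbed by that of `S.maxSize` and of `S.n`.
-/
theorem length_encode_le (S : TreeCircuit) (hs : 2 ≤ S.maxSize) :
    S.encode.length + 2 ≤ S.n ^ 2 * S.maxSize ^ 8 := by
  have h1 := length_flatMap_le (fun i => (S.φ i).encode) (List.finRange S.n)
    (b := S.maxSize * (S.maxSize + S.n + 3) + S.maxSize * S.maxSize * (2 * S.maxSize + 2) + 2) (fun i _ => by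
      have h : (S.φ i).size ≤ S.maxSize := Finset.le_sup (f := fun i => (S.φ i).size) (Finset.mem_univ i)
      refine (length_encode_formula_le (S.φ i)).trans ?_
      gcongr)
  rw [List.length_finRange] at h1
  change S.encode.length ≤ _ at h1
  have hn := S.pos
  obtain ⟨s, hs'⟩ : ∃ s, s = S.maxSize := ⟨_, rfl⟩
  obtain ⟨n, hn'⟩ : ∃ n, n = S.n := ⟨_, rfl⟩
  rw [← hs'] at h1 hs
  rw [← hn'] at h1 hn
  rw [← hs', ← hn']
  have h2 : 1 ≤ s ^ 3 := Nat.one_le_pow _ _ (by omega)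
  have h3 : s ≤ s ^ 3 := Nat.le_self_pow (by norm_num) s
  have h4 : s * s ≤ s ^ 3 := by nlinarith
  have h5 : 2 ^ 5 * s ^ 3 ≤ s ^ 5 * s ^ 3 := Nat.mul_le_mul_right _ (Nat.pow_le_pow_left hs 5)
  have h6 : n ≤ n * n := Nat.le_mul_self n
  have h7 : s * (s + n + 3) + s * s * (2 * s + 2) + 2 ≤ n * (12 * s ^ 3) := by
    have e : s * (s + n + 3) + s * s * (2 * s + 2) + 2 = n * s + (2 * s ^ 3 + 3 * (s * s) + 3 * s + 2) := by
      ring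
    have h8 : n * s ≤ n * s ^ 3 := Nat.mul_le_mul_left n h3
    have h9 : 1 * (2 * s ^ 3 + 3 * (s * s) + 3 * s + 2) ≤ n * (11 * s ^ 3) :=
      Nat.mul_le_mul hn (by omega)
    rw [e]
    linarith
  have h8 := Nat.mul_le_mul_left n h7
  have h9 : 1 * 1 ≤ n * n * s ^ 3 := Nat.mul_le_mul (Nat.mul_le_mul hn hn) h2
  calc S.encode.length + 2 ≤ n * (n * (12 * s ^ 3)) + 2 := by
        have := h1.trans h8
        exact Nat.add_le_add_right this 2
    _ ≤ n * n * (2 ^ 5 * s ^ 3) := by nlinarith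
    _ ≤ n * n * (s ^ 5 * s ^ 3) := Nat.mul_le_mul_left _ h5
    _ = n ^ 2 * s ^ 8 := by ring

theorem width_le_maxSize (S : TreeCircuit) : S.width ≤ S.maxSize := by
  refine Finset.sup_le fun i _ => Finset.sup_le fun j _ => ?_
  refine le_trans ?_ (Finset.le_sup (f := fun i => (S.φ i).size) (Finset.mem_univ i))
  rw [BoolFormula.occ]
  exact (Finite.card_subtype_le _).trans (by simp)

end CircuitGates

theorem exists_machine_treeCircuit : ∃ (M : OfflineTM InputSym) (C : ℝ), ∀ S : TreeCircuit, 2 ≤ S.width →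
    M.Outputs S.encode S.value ∧ M.UsesSpaceAtMost S.encode
      (C * (Real.log S.maxSize + Real.log S.n * Real.log S.width)) := by
  obtain ⟨M, K, hM⟩ := CircuitGates.exists_machine
  -- The factor `96 * K` is `12 * K` times the exponent `8` in `length_encode_le`. The stack
  -- accounts for `40`, and the additive `4` is absorbed since the logarithm of `S.maxSize` is at
  -- least `1 / 2`.
  refine ⟨M, 96 * K + 48, fun S hw => ⟨(hM S).1, (hM S).2.mono ?_⟩⟩
  have hws := CircuitGates.width_le_maxSize S
  have hl := CircuitGates.length_encode_le S (hw.trans hws)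
  have hn0 : (0 : ℝ) < S.n := by exact_mod_cast S.pos
  have hs2 : (2 : ℝ) ≤ S.maxSize := by exact_mod_cast hw.trans hws
  have hm2 : (2 : ℝ) ≤ S.width := by exact_mod_cast hw
  have h1 : Real.log (S.encode.length + 2) ≤ 2 * Real.log S.n + 8 * Real.log S.maxSize := by
    have h : (S.encode.length + 2 : ℝ) ≤ S.n ^ 2 * S.maxSize ^ 8 := by exact_mod_cast hl
    refine (Real.log_le_log (by positivity) h).trans ?_
    rw [Real.log_mul (by positivity) (by positivity), Real.log_pow, Real.log_pow]
    norm_num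
  have h2 : ((8 * S.width).size : ℝ) + 1 ≤ 20 * Real.log S.width := by
    have h := size_le_log (8 * S.width)
    push_cast at h
    rw [show (8 : ℝ) = 2 ^ 3 by norm_num, Real.log_mul (by norm_num) (by positivity), Real.log_pow] at h
    have h3 : Real.log 2 ≤ Real.log S.width := Real.log_le_log (by norm_num) hm2
    have h4 := half_le_log_two
    push_cast at h
    linarith
  have hls := half_le_log hs2
  have hlm := half_le_log hm2
  have hln : 0 ≤ Real.log S.n := Real.log_natCast_nonneg _
  -- Here width at least `2` matters: it lets the product of the logarithms dominate the logarithm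
  -- of `S.n`.
  have hp : Real.log S.n ≤ 2 * (Real.log S.n * Real.log S.width) := by nlinarith
  have h3 := mul_le_mul_of_nonneg_right h2 (show 0 ≤ 2 * Real.log S.n by linarith)
  have hK : (0 : ℝ) ≤ K := Nat.cast_nonneg K
  have h4 := mul_le_mul_of_nonneg_left h1 (show 0 ≤ 12 * (K : ℝ) by positivity)
  have h5 := mul_le_mul_of_nonneg_left hp (show 0 ≤ 24 * (K : ℝ) by positivity)
  have h6 : 0 ≤ (K : ℝ) * (Real.log S.n * Real.log S.width) := by positivity
  have h7 : 0 ≤ Real.log S.n * Real.log S.width := by positivity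
  nlinarith

theorem exists_machine_treeCircuit_of_width_le (m : ℕ) : ∃ (M : OfflineTM InputSym) (C : ℝ),
    ∀ S : TreeCircuit, S.width ≤ m → M.Outputs S.encode S.value ∧
      M.UsesSpaceAtMost S.encode (C * Real.log (S.encode.length + 2)) := by
  obtain ⟨M, K, hM⟩ := CircuitGates.exists_machine
  refine ⟨M, 12 * K + 2 * ((8 * m).size + 1) + 8, fun S hw => ⟨(hM S).1, (hM S).2.mono ?_⟩⟩
  have hn0 : (0 : ℝ) < S.n := by exact_mod_cast S.pos
  have h1 : Real.log S.n ≤ Real.log (S.encode.length + 2) := by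
    refine Real.log_le_log hn0 ?_
    have := CircuitGates.two_mul_n_le S
    exact_mod_cast (show S.n ≤ S.encode.length + 2 by omega)
  have h2 : ((8 * S.width).size : ℝ) + 1 ≤ (8 * m).size + 1 := by
    exact_mod_cast Nat.add_le_add_right (Nat.size_le_size (Nat.mul_le_mul_left 8 hw)) 1
  have h3 : 1 / 2 ≤ Real.log (S.encode.length + 2) :=
    half_le_log (by have := Nat.cast_nonneg (α := ℝ) S.encode.length; linarith)
  have hln : 0 ≤ Real.log S.n := Real.log_natCast_nonneg _
  have h4 := mul_le_mul h2 (mul_le_mul_of_nonneg_left h1 zero_le_two) (by positivity) (by positivity)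
  linarith

end TapeProg

/-! ### Pairs of trees as systems of gates -/

namespace TapeProg

open OfflineTM Obj

/-! #### Labels -/

/-- The binary encoding of some number of size `l` stands at position `q`. -/
def LabelAt (w : List InputSym) (q l : ℕ) : Prop :=
  (allB l fun i => At (.bit true) w (q + i) ∨ At (.bit false) w (q + i)) ∧
    (l = 0 ∨ At (.bit true) w (q + (l - 1)))

/-- Labels may be exponentially large in the length of the input and then do not fit into a
register. They are compared bit by bit at their positions in the input. -/
def SameWord (w : List InputSym) (q q' l : ℕ) : Prop :=
  allB l fun i => At (.bit true) w (q + i) ↔ At (.bit true) w (q' + i)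

theorem exists_bits_eq {l : List Bool} (h : l = [] ∨ l.getLast? = some true) : ∃ a : ℕ, a.bits = l := by
  induction l with
  | nil => exact ⟨0, by simp⟩
  | cons b l ih =>
    have h := h.resolve_left (by simp)
    cases l with
    | nil =>
      have : b = true := by simpa using h
      exact ⟨1, by simp [this]⟩
    | cons c l =>
      obtain ⟨a, ha⟩ := ih (Or.inr (by simpa using h))
      refine ⟨Nat.bit b a, ?_⟩
      rw [Nat.bits_append_bit a b fun h0 => ?_, ha]
      rw [h0] at ha
      simp at ha

theorem numAt_iff {w : List InputSym} {p u : ℕ} : NumAt w p u ↔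
    ∀ i < u.size, At (.bit (u.testBit i)) w (p + i) := by
  unfold NumAt allB
  refine forall₂_congr fun i _ => ?_
  cases hb : u.testBit i <;> simp [hb]

theorem labelAt_iff {w : List InputSym} {q l : ℕ} : LabelAt w q l ↔ ∃ a : ℕ, a.size = l ∧ NumAt w q a := by
  constructor
  · rintro ⟨h1, h2⟩
    classical
    obtain ⟨a, ha⟩ := exists_bits_eq (l := (List.range l).map fun i => decide (At (.bit true) w (q + i))) (by
      rcases Nat.eq_zero_or_pos l with rfl | hl
      · exact Or.inl rfl
      · refine Or.inr ?_
        rw [List.getLast?_map, List.getLast?_range, if_neg hl.ne']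
        simpa using h2.resolve_left hl.ne')
    have hl : a.size = l := by rw [← Nat.size_eq_bits_len, ha]; simp
    refine ⟨a, hl, numAt_iff.2 fun i hi => ?_⟩
    have hb : a.testBit i = decide (At (.bit true) w (q + i)) := by
      rw [Nat.testBit_eq_inth, List.getI_eq_getElem _ (by rwa [Nat.size_eq_bits_len])]
      simp [ha]
    by_cases ht : At (.bit true) w (q + i)
    · rw [hb, decide_eq_true ht]
      exact ht
    · rw [hb, decide_eq_false ht]
      exact (h1 i (hl ▸ hi)).resolve_left ht
  · rintro ⟨a, rfl, h⟩
    rw [numAt_iff] at h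
    refine ⟨fun i hi => ?_, ?_⟩
    · have := h i hi
      cases hb : a.testBit i <;> rw [hb] at this
      · exact Or.inr this
      · exact Or.inl this
    · rcases Nat.eq_zero_or_pos a.size with h0 | h0
      · exact Or.inl h0
      · refine Or.inr ?_
        have h1 := h (a.size - 1) (by omega)
        have h2 : a.testBit (a.size - 1) = true := by
          have h3 : 2 ^ (a.size - 1) ≤ a := Nat.lt_size.1 (by omega)
          have h4 : a < 2 ^ (a.size - 1 + 1) := by
            rw [Nat.sub_add_cancel h0]
            exact Nat.lt_size_self a
          exact Nat.testBit_of_two_pow_le_and_two_pow_add_one_gt h3 h4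
        rwa [h2] at h1

theorem at_unique {a b : InputSym} {w : List InputSym} {p : ℕ} (h : At a w p) (h' : At b w p) : a = b :=
  Option.some.inj (h.symm.trans h')

theorem sameWord_iff {w : List InputSym} {q q' a a' : ℕ} (h : NumAt w q a) (h' : NumAt w q' a')
    (hs : a.size = a'.size) : SameWord w q q' a.size ↔ a = a' := by
  rw [numAt_iff] at h h'
  have key : ∀ {a q : ℕ}, (∀ i < a.size, At (.bit (a.testBit i)) w (q + i)) → ∀ i < a.size,
      (At (.bit true) w (q + i) ↔ a.testBit i = true) := by
    intro a q h i hi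
    refine ⟨fun ht => ?_, fun ht => ht ▸ h i hi⟩
    have := at_unique (h i hi) ht
    simpa using this
  constructor
  · intro hw
    refine Nat.eq_of_testBit_eq fun i => ?_
    by_cases hi : i < a.size
    · have h1 : At (.bit true) w (q + i) ↔ At (.bit true) w (q' + i) := hw i hi
      rw [key h i hi, key h' i (hs ▸ hi)] at h1
      exact Bool.eq_iff_iff.2 h1
    · have h1 : ∀ b : ℕ, b.size ≤ i → b.testBit i = false := fun b hb =>
        Nat.testBit_lt_two_pow (Nat.size_le.1 hb)
      rw [h1 a (by omega), h1 a' (by omega)]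
  · rintro rfl i hi
    rw [key h i hi, key h' i hi]

/-! #### Edges -/

def edgeWord (u a v : ℕ) : List InputSym :=
  encodeNat u ++ .comma :: (encodeNat a ++ .comma :: encodeNat v)

theorem clean_edgeWord (u a v : ℕ) : Clean (edgeWord u a v) :=
  (clean_encodeNat u).append (((clean_encodeNat a).append ((clean_encodeNat v).cons
    (by simp [IsTerminator]))).cons (by simp [IsTerminator]))

theorem edgeWord_inj {u a v u' a' v' : ℕ} : edgeWord u a v = edgeWord u' a' v' ↔ u = u' ∧ a = a' ∧ v = v' := by
  unfold edgeWord
  rw [encodeNat_comma_inj, encodeNat_comma_inj]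
  refine and_congr_right fun _ => and_congr_right fun _ => ⟨encodeNat_injective, fun h => by rw [h]⟩

namespace TreeGates

/-- An edge from `u` to `v` with a label of size `l` is listed at position `p` of section `k`. -/
def EdgeAt (k : ℕ) (w : List InputSym) (p l u v : ℕ) : Prop :=
  LineStart w p ∧ hashes w p = k ∧ NumAt w p u ∧ At .comma w (p + u.size) ∧ LabelAt w (p + u.size + 1) l ∧
    At .comma w (p + u.size + 1 + l) ∧ NumAt w (p + u.size + 1 + l + 1) v ∧
    At .semicolon w (p + u.size + 1 + l + 1 + v.size)

def Edge (k : ℕ) (w : List InputSym) (u v : ℕ) : Prop :=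
  exB w.length fun p => exB w.length fun l => EdgeAt k w p l u v

/-- The edges that lead to `u` in the first tree and to `v` in the second tree have the same label. -/
def SameLabel (w : List InputSym) (u v : ℕ) : Prop :=
  exB w.length fun p => exB w.length fun p' => exB w.length fun l =>
    exB (w.length + 1) fun u' => exB (w.length + 1) fun v' =>
      EdgeAt 1 w p l u' u ∧ EdgeAt 3 w p' l v' v ∧ SameWord w (p + u'.size + 1) (p' + v'.size + 1) l

noncomputable def parent (k : ℕ) (w : List InputSym) (v : ℕ) : ℕ :=
  leastB (w.length + 1) fun u => Edge k w u v

open Classical in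
noncomputable def parentStep (k : ℕ) (w : List InputSym) (v : ℕ) : ℕ :=
  if parent k w v = w.length + 1 then v else parent k w v

/-- No two edges lead to the same node. -/
def UniqueTargets (k : ℕ) (w : List InputSym) : Prop :=
  allB w.length fun p => allB w.length fun p' => allB w.length fun l => allB w.length fun l' =>
    allB (w.length + 1) fun u => allB (w.length + 1) fun u' => allB (w.length + 1) fun v =>
      EdgeAt k w p l u v → EdgeAt k w p' l' u' v → p = p'

/-- Every node below `n` is reached from one root. -/
def Rooted (k : ℕ) (w : List InputSym) (n : ℕ) : Prop :=
  exB n fun r => parent k w r = w.length + 1 ∧ allB n fun v => (parentStep k w)^[w.length + 1] v = r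

def NumLine (k : ℕ) (w : List InputSym) (p n : ℕ) : Prop := LineAt w k p (encodeNat n ++ [.hash])

/-- A line that consists of `hash` alone closes the section. -/
def EdgeLine (k : ℕ) (w : List InputSym) (p n : ℕ) : Prop :=
  At .hash w p ∨ exB w.length fun l => exB n fun u => exB n fun v => EdgeAt k w p l u v

def LinesValid (w : List InputSym) (n₁ n₂ v₁ v₂ : ℕ) : Prop :=
  allB w.length fun p => LineStart w p →
    (hashes w p = 0 → NumLine 0 w p n₁) ∧ (hashes w p = 1 → EdgeLine 1 w p n₁) ∧
    (hashes w p = 2 → NumLine 2 w p n₂) ∧ (hashes w p = 3 → EdgeLine 3 w p n₂) ∧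
    (hashes w p = 4 → NumLine 4 w p v₁) ∧ (hashes w p = 5 → NumLine 5 w p v₂)

/-- The word is an instance of the bisimulation problem for trees. -/
def Valid (w : List InputSym) : Prop :=
  hashes w w.length = 6 ∧ At .hash w (w.length - 1) ∧
    exB (w.length + 1) fun n₁ => exB (w.length + 1) fun n₂ => exB n₁ fun v₁ => exB n₂ fun v₂ =>
      LinesValid w n₁ n₂ v₁ v₂ ∧ UniqueTargets 1 w ∧ UniqueTargets 3 w ∧ Rooted 1 w n₁ ∧ Rooted 3 w n₂

noncomputable def startNode (k : ℕ) (w : List InputSym) : ℕ :=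
  leastB (w.length + 1) fun v => exB w.length fun p => NumLine k w p v

theorem parentStep_le (k : ℕ) (w : List InputSym) (v : ℕ) : parentStep k w v ≤ max v (w.length + 1) := by
  unfold parentStep
  split
  · exact le_max_left _ _
  · exact (leastB_le _ _).trans (le_max_right _ _)

section

variable {X : Type} [Obj X] {w : X → List InputSym} {p q l u v n n' v' : X → ℕ} (k : ℕ)

@[fun_prop]
theorem ls_labelAt (hw : LS w) (hp : LS p) (hl : LS l) : LS fun x => LabelAt (w x) (p x) (l x) := by
  unfold LabelAt; fun_prop

@[fun_prop]
theorem ls_sameWord (hw : LS w) (hp : LS p) (hq : LS q) (hl : LS l) :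
    LS fun x => SameWord (w x) (p x) (q x) (l x) := by
  unfold SameWord; fun_prop

@[fun_prop]
theorem ls_edgeAt (hw : LS w) (hp : LS p) (hl : LS l) (hu : LS u) (hv : LS v) :
    LS fun x => EdgeAt k (w x) (p x) (l x) (u x) (v x) := by
  unfold EdgeAt; fun_prop

@[fun_prop]
theorem ls_edge (hw : LS w) (hu : LS u) (hv : LS v) : LS fun x => Edge k (w x) (u x) (v x) := by
  unfold Edge; fun_prop

@[fun_prop]
theorem ls_sameLabel (hw : LS w) (hu : LS u) (hv : LS v) : LS fun x => SameLabel (w x) (u x) (v x) := by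
  unfold SameLabel; fun_prop

@[fun_prop]
theorem ls_parent (hw : LS w) (hv : LS v) : LS fun x => parent k (w x) (v x) := by
  unfold parent; fun_prop

@[fun_prop]
theorem ls_parentStep (hw : LS w) (hv : LS v) : LS fun x => parentStep k (w x) (v x) := by
  unfold parentStep; fun_prop

@[fun_prop]
theorem ls_iterate_parentStep (hw : LS w) (hv : LS v) (hn : LS n) :
    LS fun x => (parentStep k (w x))^[n x] (v x) :=
  LS.iterate (bnd := fun x => v x + ((w x).length + 1)) (f := fun x => parentStep k (w x)) hn hv
    (by fun_prop) (by fun_prop)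
    fun x i => (Gates.iterate_le_max (parentStep_le k (w x)) i (v x)).trans (max_le (by omega) (by omega))

@[fun_prop]
theorem ls_uniqueTargets (hw : LS w) : LS fun x => UniqueTargets k (w x) := by
  unfold UniqueTargets; fun_prop

@[fun_prop]
theorem ls_rooted (hw : LS w) (hn : LS n) : LS fun x => Rooted k (w x) (n x) := by
  unfold Rooted; fun_prop

@[fun_prop]
theorem ls_numLine (hw : LS w) (hp : LS p) (hn : LS n) : LS fun x => NumLine k (w x) (p x) (n x) := by
  simp only [NumLine, LineAt, encodeNat_append_prefix_drop, cons_prefix_drop, nil_prefix_iff]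
  fun_prop

@[fun_prop]
theorem ls_edgeLine (hw : LS w) (hp : LS p) (hn : LS n) : LS fun x => EdgeLine k (w x) (p x) (n x) := by
  unfold EdgeLine; fun_prop

@[fun_prop]
theorem ls_linesValid (hw : LS w) (hn : LS n) (hn' : LS n') (hv : LS v) (hv' : LS v') :
    LS fun x => LinesValid (w x) (n x) (n' x) (v x) (v' x) := by
  unfold LinesValid; fun_prop

@[fun_prop]
theorem ls_valid (hw : LS w) : LS fun x => Valid (w x) := by
  unfold Valid; fun_prop

@[fun_prop]
theorem ls_startNode (hw : LS w) : LS fun x => startNode k (w x) := by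
  unfold startNode; fun_prop

end

open Classical in
/-- The gate `(0, u, v)` is true if the nodes `u` and `v` are bisimilar. The gate `(1, u, v)` is true if
`u` is bisimilar to a child of `v` that is reached by an edge of the same label, and the gate
`(2, u, v)` is true if `v` is bisimilar to such a child of `u`. -/
noncomputable def gates : Gates where
  bound w := 3 * ((w.length + 1) * (w.length + 1))
  In w p c :=
    p / (w.length + 1) / (w.length + 1) = 0 ∧ c / (w.length + 1) / (w.length + 1) = 1 ∧
      c % (w.length + 1) = p % (w.length + 1) ∧
      Edge 1 w (p / (w.length + 1) % (w.length + 1)) (c / (w.length + 1) % (w.length + 1)) ∨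
    p / (w.length + 1) / (w.length + 1) = 0 ∧ c / (w.length + 1) / (w.length + 1) = 2 ∧
      c / (w.length + 1) % (w.length + 1) = p / (w.length + 1) % (w.length + 1) ∧
      Edge 3 w (p % (w.length + 1)) (c % (w.length + 1)) ∨
    p / (w.length + 1) / (w.length + 1) = 1 ∧ c / (w.length + 1) / (w.length + 1) = 0 ∧
      c / (w.length + 1) % (w.length + 1) = p / (w.length + 1) % (w.length + 1) ∧
      Edge 3 w (p % (w.length + 1)) (c % (w.length + 1)) ∧
      SameLabel w (c / (w.length + 1) % (w.length + 1)) (c % (w.length + 1)) ∨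
    p / (w.length + 1) / (w.length + 1) = 2 ∧ c / (w.length + 1) / (w.length + 1) = 0 ∧
      c % (w.length + 1) = p % (w.length + 1) ∧
      Edge 1 w (p / (w.length + 1) % (w.length + 1)) (c / (w.length + 1) % (w.length + 1)) ∧
      SameLabel w (c / (w.length + 1) % (w.length + 1)) (c % (w.length + 1))
  -- The block of the pair `(u, v)` contains `(0, u, v)`, the gates `(1, u', v)` for the children
  -- `u'` of `u`, and the gates `(2, u, v')` for the children `v'` of `v`.
  Root w g := g / (w.length + 1) / (w.length + 1) = 0
  -- Gates of kind `0` are conjunctions and those of kinds `1` and `2` are disjunctions.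
  A w g := decide (g / (w.length + 1) / (w.length + 1) ≠ 0)
  B w g := decide (g / (w.length + 1) / (w.length + 1) ≠ 0)
  start w := startNode 4 w * (w.length + 1) + startNode 5 w
  Valid := Valid

instance : gates.Logspace where
  bound := by unfold gates; fun_prop
  In := by unfold gates; dsimp only; fun_prop
  Root := by unfold gates; dsimp only; fun_prop
  A := by unfold gates; dsimp only; fun_prop
  B := by unfold gates; dsimp only; fun_prop
  start := by unfold gates; fun_prop
  Valid := by unfold gates; fun_prop

theorem edgeAt_iff {k : ℕ} {w : List InputSym} {p l u v : ℕ} : EdgeAt k w p l u v ↔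
    ∃ a : ℕ, a.size = l ∧ LineAt w k p (edgeWord u a v ++ [.semicolon]) := by
  simp only [EdgeAt, LineAt, edgeWord, List.append_assoc, List.cons_append, encodeNat_append_prefix_drop,
    cons_prefix_drop, nil_prefix_iff, labelAt_iff, and_true]
  constructor
  · rintro ⟨h1, h2, h3, h4, ⟨a, rfl, h5⟩, h6, h7, h8⟩
    exact ⟨a, rfl, h1, h2, h3, h4, h5, h6, h7, h8⟩
  · rintro ⟨a, rfl, h1, h2, h3, h4, h5, h6, h7, h8⟩
    exact ⟨h1, h2, h3, h4, ⟨a, rfl, h5⟩, h6, h7, h8⟩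

end TreeGates

end TapeProg

/-! ### Sections that list the edges of a graph -/

namespace TapeProg

open OfflineTM Obj

theorem lineAt_unique {w : List InputSym} {k k' p : ℕ} {b b' : List InputSym} {t t' : InputSym}
    (h : LineAt w k p (b ++ [t])) (h' : LineAt w k' p (b' ++ [t'])) (hb : Clean b) (hb' : Clean b')
    (ht : IsTerminator t) (ht' : IsTerminator t') : b = b' ∧ t = t' := by
  obtain ⟨x, hx⟩ := h'.2.2
  have h1 := h.2.2
  rw [← hx, List.append_assoc, List.singleton_append, prefix_line_iff hb' hb ht' ht] at h1
  exact h1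

namespace TreeGates

/-- The section `k` of `w` lists the edges in `E`. -/
def HasSection (k : ℕ) (w : List InputSym) (E : List (ℕ × ℕ × ℕ)) : Prop :=
  ∃ pos : ℕ → ℕ, Function.Injective pos ∧ ∀ p u a v,
    LineAt w k p (edgeWord u a v ++ [.semicolon]) ↔ ∃ j, E[j]? = some (u, a, v) ∧ p = pos j

theorem hasSection_joinSections {s : List (List (List InputSym) × List InputSym)} (hs : CleanSections s)
    {k : ℕ} {E : List (ℕ × ℕ × ℕ)} {l : List InputSym}
    (h : s[k]? = some (E.map fun e => edgeWord e.1 e.2.1 e.2.2, l)) : HasSection k (joinSections s) E := by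
  obtain ⟨pos, h1, h2⟩ := exists_pos_of_sections hs
  refine ⟨pos k, h1 k, fun p u a v => ?_⟩
  rw [h2 k p _ (clean_edgeWord u a v), h]
  simp only [Option.some.injEq]
  constructor
  · rintro ⟨_, j, rfl, h3, rfl⟩
    rw [List.getElem?_map, Option.map_eq_some_iff] at h3
    obtain ⟨⟨u', a', v'⟩, h4, h5⟩ := h3
    obtain ⟨rfl, rfl, rfl⟩ := edgeWord_inj.1 h5
    exact ⟨j, h4, rfl⟩
  · rintro ⟨j, h3, rfl⟩
    exact ⟨_, j, rfl, by simp [h3], rfl⟩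

theorem length_of_lineAt {w : List InputSym} {k p u a v : ℕ}
    (h : LineAt w k p (edgeWord u a v ++ [.semicolon])) : p < w.length ∧ a.size < w.length := by
  have h1 := h.2.2.length_le
  simp only [edgeWord, List.length_append, List.length_cons, length_encodeNat, List.length_drop,
    List.length_nil] at h1
  omega

theorem numAt_of_lineAt {w : List InputSym} {k p u a v : ℕ}
    (h : LineAt w k p (edgeWord u a v ++ [.semicolon])) : NumAt w (p + u.size + 1) a := by
  have h1 := h.2.2
  simp only [edgeWord, List.append_assoc, List.cons_append, encodeNat_append_prefix_drop,
    cons_prefix_drop] at h1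
  exact h1.2.2.1

/-- List positions are compared, not edges. Thus repeated edges are excluded too, and absence of
duplicates, uniqueness of parents and uniqueness of labels follow together. -/
def TargetsUnique (E : List (ℕ × ℕ × ℕ)) : Prop :=
  ∀ (i j : ℕ) (e e' : ℕ × ℕ × ℕ), E[i]? = some e → E[j]? = some e' → e.2.2 = e'.2.2 → i = j

theorem TargetsUnique.eq {E : List (ℕ × ℕ × ℕ)} (h : TargetsUnique E) {u a u' a' v : ℕ}
    (h1 : (u, a, v) ∈ E) (h2 : (u', a', v) ∈ E) : u = u' ∧ a = a' := by
  obtain ⟨i, hi⟩ := List.mem_iff_getElem?.1 h1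
  obtain ⟨j, hj⟩ := List.mem_iff_getElem?.1 h2
  obtain rfl := h i j _ _ hi hj rfl
  rw [hi] at hj
  simpa using hj

section

variable {k : ℕ} {w : List InputSym} {E : List (ℕ × ℕ × ℕ)}

theorem edge_iff (hE : HasSection k w E) {u v : ℕ} : Edge k w u v ↔ ∃ a, (u, a, v) ∈ E := by
  obtain ⟨pos, -, h⟩ := hE
  constructor
  · rintro ⟨p, -, l, -, h1⟩
    obtain ⟨a, -, h2⟩ := edgeAt_iff.1 h1
    obtain ⟨j, h3, -⟩ := (h _ _ _ _).1 h2
    exact ⟨a, List.mem_iff_getElem?.2 ⟨j, h3⟩⟩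
  · rintro ⟨a, ha⟩
    obtain ⟨j, hj⟩ := List.mem_iff_getElem?.1 ha
    have h1 := (h _ _ _ _).2 ⟨j, hj, rfl⟩
    obtain ⟨h2, h3⟩ := length_of_lineAt h1
    exact ⟨_, h2, _, h3, edgeAt_iff.2 ⟨a, rfl, h1⟩⟩

theorem uniqueTargets_iff (hE : HasSection k w E)
    (hb : ∀ e ∈ E, e.1 < w.length + 1 ∧ e.2.2 < w.length + 1) : UniqueTargets k w ↔ TargetsUnique E := by
  obtain ⟨pos, hpos, h⟩ := hE
  constructor
  · rintro hu i j ⟨u, a, v⟩ ⟨u', a', v'⟩ hi hj (rfl : v = v')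
    have h1 := (h _ _ _ _).2 ⟨i, hi, rfl⟩
    have h2 := (h _ _ _ _).2 ⟨j, hj, rfl⟩
    obtain ⟨hb1, hb2⟩ := hb _ (List.mem_iff_getElem?.2 ⟨i, hi⟩)
    obtain ⟨hb3, hb4⟩ := hb _ (List.mem_iff_getElem?.2 ⟨j, hj⟩)
    exact hpos (hu _ (length_of_lineAt h1).1 _ (length_of_lineAt h2).1 _ (length_of_lineAt h1).2 _
      (length_of_lineAt h2).2 u hb1 u' hb3 v hb2 (edgeAt_iff.2 ⟨a, rfl, h1⟩) (edgeAt_iff.2 ⟨a', rfl, h2⟩))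
  · rintro hu p - p' - l - l' - u - u' - v - h1 h2
    obtain ⟨a, -, h1⟩ := edgeAt_iff.1 h1
    obtain ⟨a', -, h2⟩ := edgeAt_iff.1 h2
    obtain ⟨i, hi, rfl⟩ := (h _ _ _ _).1 h1
    obtain ⟨j, hj, rfl⟩ := (h _ _ _ _).1 h2
    rw [hu i j _ _ hi hj rfl]

theorem sameLabel_iff {E' : List (ℕ × ℕ × ℕ)} (hE : HasSection 1 w E) (hE' : HasSection 3 w E')
    (hb : ∀ e ∈ E, e.1 < w.length + 1) (hb' : ∀ e ∈ E', e.1 < w.length + 1) {u v : ℕ} :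
    SameLabel w u v ↔ ∃ u' v' a, (u', a, u) ∈ E ∧ (v', a, v) ∈ E' := by
  obtain ⟨pos, -, h⟩ := hE
  obtain ⟨pos', -, h'⟩ := hE'
  constructor
  · rintro ⟨p, -, p', -, l, -, u', -, v', -, h1, h2, h3⟩
    obtain ⟨a, rfl, h5⟩ := edgeAt_iff.1 h1
    obtain ⟨a', h4, h6⟩ := edgeAt_iff.1 h2
    obtain rfl := (sameWord_iff (numAt_of_lineAt h5) (numAt_of_lineAt h6) h4.symm).1 h3
    obtain ⟨i, hi, -⟩ := (h _ _ _ _).1 h5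
    obtain ⟨j, hj, -⟩ := (h' _ _ _ _).1 h6
    exact ⟨u', v', a, List.mem_iff_getElem?.2 ⟨i, hi⟩, List.mem_iff_getElem?.2 ⟨j, hj⟩⟩
  · rintro ⟨u', v', a, h1, h2⟩
    obtain ⟨i, hi⟩ := List.mem_iff_getElem?.1 h1
    obtain ⟨j, hj⟩ := List.mem_iff_getElem?.1 h2
    have h3 := (h _ _ _ _).2 ⟨i, hi, rfl⟩
    have h4 := (h' _ _ _ _).2 ⟨j, hj, rfl⟩
    exact ⟨_, (length_of_lineAt h3).1, _, (length_of_lineAt h4).1, _, (length_of_lineAt h3).2, u', hb _ h1,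
      v', hb' _ h2, edgeAt_iff.2 ⟨a, rfl, h3⟩, edgeAt_iff.2 ⟨a, rfl, h4⟩,
      (sameWord_iff (numAt_of_lineAt h3) (numAt_of_lineAt h4) rfl).2 rfl⟩

end

/-! #### Pointer graphs -/

def natEdges (G : PointerGraph) : List (ℕ × ℕ × ℕ) := G.edges.map fun e => ((e.1 : ℕ), e.2.1, (e.2.2 : ℕ))

variable {G : PointerGraph}

theorem mem_natEdges {u a v : ℕ} : (u, a, v) ∈ natEdges G ↔
    ∃ u' v' : Fin G.size, G.Edge u' a v' ∧ u = u' ∧ v = v' := by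
  simp only [natEdges, List.mem_map, Prod.mk.injEq, Prod.exists, PointerGraph.Edge]
  constructor
  · rintro ⟨u', a', v', h, rfl, rfl, rfl⟩
    exact ⟨u', v', h, rfl, rfl⟩
  · rintro ⟨u', v', h, rfl, rfl⟩
    exact ⟨u', a, v', h, rfl, rfl, rfl⟩

theorem natEdges_lt {e : ℕ × ℕ × ℕ} (he : e ∈ natEdges G) : e.1 < G.size ∧ e.2.2 < G.size := by
  obtain ⟨x, -, rfl⟩ := List.mem_map.1 he
  exact ⟨x.1.2, x.2.2.2⟩

theorem targetsUnique_of_isTree (h : G.IsTree) : TargetsUnique (natEdges G) := by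
  obtain ⟨h1, r, h2⟩ := h
  intro i j e e' hi hj hee
  simp only [natEdges, List.getElem?_map, Option.map_eq_some_iff] at hi hj
  obtain ⟨⟨u, a, v⟩, hi, rfl⟩ := hi
  obtain ⟨⟨u', a', v'⟩, hj, rfl⟩ := hj
  obtain rfl : v = v' := Fin.ext hee
  have m1 : G.Edge u a v := List.mem_iff_getElem?.2 ⟨i, hi⟩
  have m2 : G.Edge u' a' v := List.mem_iff_getElem?.2 ⟨j, hj⟩
  obtain rfl := parent_unique h2 ⟨a, m1⟩ ⟨a', m2⟩
  obtain rfl := h1 _ _ _ _ m1 m2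
  obtain ⟨hi1, hi2⟩ := List.getElem?_eq_some_iff.1 hi
  obtain ⟨hj1, hj2⟩ := List.getElem?_eq_some_iff.1 hj
  exact (G.nodup.getElem_inj_iff).1 (hi2.trans hj2.symm)

/-- Every node but the root is the target of a listed edge. So node numbers are bounded by the
length of the input, although the number of nodes is only written in binary. -/
theorem size_le_of_isTree (h : G.IsTree) : G.size ≤ G.edges.length + 1 := by
  classical
  obtain ⟨-, r, h2⟩ := h
  have h3 : (Finset.univ : Finset (Fin G.size)) ⊆ insert r (G.edges.map fun e => e.2.2).toFinset := by
    intro v _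
    by_cases hv : v = r
    · simp [hv]
    · obtain ⟨u, a, h⟩ := exists_parent h2 hv
      exact Finset.mem_insert_of_mem (List.mem_toFinset.2 (List.mem_map.2 ⟨_, h, rfl⟩))
  have h4 := (Finset.card_le_card h3).trans (Finset.card_insert_le _ _)
  have h5 := List.toFinset_card_le (G.edges.map fun e => e.2.2)
  rw [List.length_map] at h5
  rw [Finset.card_univ, Fintype.card_fin] at h4
  omega

section

variable {k : ℕ} {w : List InputSym}

theorem edge_natEdges_iff (hE : HasSection k w (natEdges G)) {u v : ℕ} : Edge k w u v ↔
    ∃ u' v' : Fin G.size, (∃ a, G.Edge u' a v') ∧ u = u' ∧ v = v' := by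
  rw [edge_iff hE]
  simp only [mem_natEdges]
  constructor
  · rintro ⟨a, u', v', h1, h2⟩
    exact ⟨u', v', ⟨a, h1⟩, h2⟩
  · rintro ⟨u', v', ⟨a, h1⟩, h2⟩
    exact ⟨a, u', v', h1, h2⟩

theorem edge_parent (hE : HasSection k w (natEdges G)) (hn : G.size ≤ w.length) {u v : ℕ}
    (h : Edge k w u v) : Edge k w (parent k w v) v ∧ parent k w v ≠ w.length + 1 := by
  have hu : u < w.length + 1 := by
    obtain ⟨u', v', -, rfl, -⟩ := (edge_natEdges_iff hE).1 h
    omega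
  have h1 := leastB_lt (b := w.length + 1) (p := fun u => Edge k w u v) hu h
  exact ⟨leastB_spec h1, h1.ne⟩

theorem edge_parent_of_ne {v : ℕ} (h : parent k w v ≠ w.length + 1) : Edge k w (parent k w v) v :=
  leastB_spec (p := fun u => Edge k w u v) (lt_of_le_of_ne (leastB_le _ _) h)

theorem wellFounded_edge (hE : HasSection k w (natEdges G)) (h : G.IsTree) :
    WellFounded fun c p => Edge k w p c := by
  obtain ⟨-, r, h2⟩ := h
  have key : ∀ u : Fin G.size, Acc (fun c p => Edge k w p c) u := by
    intro u
    induction u using h2.wellFounded.induction with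
    | _ u ih =>
      refine ⟨_, fun c hc => ?_⟩
      obtain ⟨u', v', h3, h4, rfl⟩ := (edge_natEdges_iff hE).1 hc
      obtain rfl := Fin.ext h4
      exact ih v' h3
  refine ⟨fun x => ⟨_, fun c hc => ?_⟩⟩
  obtain ⟨u', v', h3, h4, rfl⟩ := (edge_natEdges_iff hE).1 hc
  exact key v'

/-- The way up raises the rank in the edge relation until it meets a node without a parent, and the
root is the only such node. -/
theorem rooted_of_isTree (hE : HasSection k w (natEdges G)) (hn : G.size ≤ w.length) (h : G.IsTree) :
    Rooted k w G.size := by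
  have hwf := wellFounded_edge hE h
  have hlt : ∀ c p, Edge k w p c → p < w.length + 1 ∧ c < w.length + 1 := by
    intro c p hp
    obtain ⟨u', v', -, rfl, rfl⟩ := (edge_natEdges_iff hE).1 hp
    omega
  obtain ⟨-, r, h2⟩ := h
  have hroot : ∀ v : Fin G.size, parent k w v = w.length + 1 ↔ v = r := by
    intro v
    constructor
    · intro hp
      by_contra hv
      obtain ⟨u, a, hu⟩ := exists_parent h2 hv
      exact (edge_parent hE hn ((edge_natEdges_iff hE).2 ⟨u, v, ⟨a, hu⟩, rfl, rfl⟩)).2 hp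
    · rintro rfl
      by_contra hp
      obtain ⟨u', v', h3, -, h4⟩ := (edge_natEdges_iff hE).1 (edge_parent_of_ne hp)
      obtain rfl := Fin.ext h4
      exact not_edge_root h2 u' h3
  refine ⟨r, r.2, (hroot r).2 rfl, fun v hv => ?_⟩
  have hx : ∀ j, (parentStep k w)^[j] v < G.size := by
    intro j
    induction j with
    | zero => exact hv
    | succ j ih =>
      rw [Function.iterate_succ_apply', parentStep]
      split
      · exact ih
      · rename_i hp
        obtain ⟨u', v', -, h4, -⟩ := (edge_natEdges_iff hE).1 (edge_parent_of_ne hp)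
        omega
  have hfix := iterate_fixed (f := parentStep k w) (rank := rankIn (w.length + 1) fun c p => Edge k w p c)
    (b := w.length + 1) (rankIn_lt hwf (by omega) fun c p hp => (hlt c p hp).1) (fun x => by
      by_cases hp : parent k w x = w.length + 1
      · exact Or.inl (if_pos hp)
      · have e : parentStep k w x = parent k w x := if_neg hp
        rw [e]
        have := edge_parent_of_ne hp
        exact Or.inr (Or.inr (rankIn_lt_rankIn hwf this (hlt _ _ this).2))) v
  have hxl := hx (w.length + 1)
  beta_reduce
  generalize (parentStep k w)^[w.length + 1] v = x at hfix hxl ⊢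
  have hp : parent k w x = w.length + 1 := by
    by_contra hp
    have e : parentStep k w x = parent k w x := if_neg hp
    have h3 := edge_parent_of_ne hp
    rw [← e, hfix] at h3
    exact hwf.irrefl.irrefl _ h3
  exact congrArg Fin.val ((hroot ⟨x, hxl⟩).1 hp)

/-- The way up from a node to `r`, read backwards, is a path from `r`. Uniqueness of targets gives
the uniqueness of parents and of labels. -/
theorem isTree_of_rooted (hE : HasSection k w (natEdges G)) (hn : G.size ≤ w.length)
    (hu : TargetsUnique (natEdges G)) (h : Rooted k w G.size) : G.IsTree := by
  obtain ⟨r, hr, h1, h2⟩ := h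
  refine ⟨fun u v a b ha hb => (hu.eq (mem_natEdges.2 ⟨u, v, ha, rfl, rfl⟩)
    (mem_natEdges.2 ⟨u, v, hb, rfl, rfl⟩)).2, ⟨r, hr⟩, ?_⟩
  refine isTreeWithRoot_of_reflTransGen ?_ ?_ ?_
  · rintro u u' v ⟨a, ha⟩ ⟨b, hb⟩
    exact Fin.ext (hu.eq (mem_natEdges.2 ⟨u, v, ha, rfl, rfl⟩) (mem_natEdges.2 ⟨u', v, hb, rfl, rfl⟩)).1
  · intro u hu
    exact (edge_parent hE hn ((edge_natEdges_iff hE).2 ⟨u, ⟨r, hr⟩, hu, rfl, rfl⟩)).2 h1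
  · intro v
    have key : ∀ j, ∃ x : Fin G.size, (parentStep k w)^[j] v = x ∧
        Relation.ReflTransGen (fun u v => ∃ a, G.Edge u a v) x v := by
      intro j
      induction j with
      | zero => exact ⟨v, rfl, .refl⟩
      | succ j ih =>
        obtain ⟨x, hx, hxv⟩ := ih
        rw [Function.iterate_succ_apply', hx, parentStep]
        split
        · exact ⟨x, rfl, hxv⟩
        · rename_i hp
          obtain ⟨u', v', h3, h4, h5⟩ := (edge_natEdges_iff hE).1 (edge_parent_of_ne hp)
          obtain rfl := Fin.ext h5
          exact ⟨u', h4, .head h3 hxv⟩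
    obtain ⟨x, hx, hxv⟩ := key (w.length + 1)
    have h3 : (parentStep k w)^[w.length + 1] v = r := h2 v v.2
    obtain rfl : x = ⟨r, hr⟩ := Fin.ext (hx.symm.trans h3)
    exact hxv

end

end TreeGates

end TapeProg

/-! ### Recognition of the instances of the bisimulation problem -/

namespace TapeProg

open OfflineTM Obj

theorem exists_line {x : List InputSym} {a : InputSym} (ha : IsTerminator a) (h : a ∈ x) :
    ∃ b t, Clean b ∧ IsTerminator t ∧ b ++ [t] <+: x := by
  induction x with
  | nil => exact absurd h List.not_mem_nil
  | cons c x ih =>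
    by_cases hc : IsTerminator c
    · exact ⟨[], c, clean_nil, hc, by simp⟩
    · have hax : a ∈ x := by
        rcases List.mem_cons.1 h with rfl | h
        · exact absurd ha hc
        · exact h
      obtain ⟨b, t, h1, h2, h3⟩ := ih hax
      exact ⟨c :: b, t, h1.cons hc, h2, by simpa [List.cons_prefix_cons] using h3⟩

namespace TreeGates

def instanceSections (n₁ : ℕ) (E₁ : List (ℕ × ℕ × ℕ)) (n₂ : ℕ) (E₂ : List (ℕ × ℕ × ℕ)) (v₁ v₂ : ℕ) :
    List (List (List InputSym) × List InputSym) :=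
  [([], encodeNat n₁), (E₁.map fun e => edgeWord e.1 e.2.1 e.2.2, []), ([], encodeNat n₂),
    (E₂.map fun e => edgeWord e.1 e.2.1 e.2.2, []), ([], encodeNat v₁), ([], encodeNat v₂)]

theorem encodeBisimInstance_eq (G₁ G₂ : PointerGraph) (v₁ : Fin G₁.size) (v₂ : Fin G₂.size) :
    encodeBisimInstance G₁ G₂ v₁ v₂ =
      joinSections (instanceSections G₁.size (natEdges G₁) G₂.size (natEdges G₂) v₁ v₂) := by
  simp [encodeBisimInstance, PointerGraph.encode, joinSections, instanceSections, natEdges, edgeWord,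
    List.flatMap_map, List.map_map]

theorem cleanSections_instance (n₁ : ℕ) (E₁ : List (ℕ × ℕ × ℕ)) (n₂ : ℕ) (E₂ : List (ℕ × ℕ × ℕ))
    (v₁ v₂ : ℕ) : CleanSections (instanceSections n₁ E₁ n₂ E₂ v₁ v₂) := by
  have h0 : ∀ n, (∀ b ∈ ([] : List (List InputSym)), Clean b) ∧ Clean (encodeNat n) := fun n =>
    ⟨fun _ h => absurd h List.not_mem_nil, clean_encodeNat n⟩
  have h1 : ∀ E : List (ℕ × ℕ × ℕ), (∀ b ∈ (E.map fun e => edgeWord e.1 e.2.1 e.2.2), Clean b) := by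
    intro E b hb
    obtain ⟨e, -, rfl⟩ := List.mem_map.1 hb
    exact clean_edgeWord _ _ _
  intro x hx
  simp only [instanceSections, List.mem_cons, List.not_mem_nil, or_false] at hx
  rcases hx with rfl | rfl | rfl | rfl | rfl | rfl
  · exact h0 _
  · exact ⟨h1 _, clean_nil⟩
  · exact h0 _
  · exact ⟨h1 _, clean_nil⟩
  · exact h0 _
  · exact h0 _

theorem at_hash_last {s : List (List (List InputSym) × List InputSym)} (hs : s ≠ []) :
    (joinSections s).getLast? = some .hash := by
  rcases List.eq_nil_or_concat s with rfl | ⟨l, x, rfl⟩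
  · exact absurd rfl hs
  · simp [joinSections]

theorem natEdges_length (G : PointerGraph) : (natEdges G).length = G.edges.length := by
  simp [natEdges]

/-- The facts about the encoding of an instance that are used in the analysis of the gates. -/
structure Encodes (w : List InputSym) (G₁ G₂ : PointerGraph) (v₁ : Fin G₁.size) (v₂ : Fin G₂.size) :
    Prop where
  section₁ : HasSection 1 w (natEdges G₁)
  section₂ : HasSection 3 w (natEdges G₂)
  le₁ : G₁.size ≤ w.length
  le₂ : G₂.size ≤ w.length
  start₁ : startNode 4 w = v₁
  start₂ : startNode 5 w = v₂

theorem numLine_iff {s : List (List (List InputSym) × List InputSym)} (hs : CleanSections s) {k n : ℕ} :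
    (exB (joinSections s).length fun p => NumLine k (joinSections s) p n) ↔ ∃ r, s[k]? = some (r, encodeNat n) := by
  unfold NumLine
  rw [exB_lineAt (by simp), exists_lineAt_hash hs (clean_encodeNat n)]

theorem startNode_eq {s : List (List (List InputSym) × List InputSym)} (hs : CleanSections s) {k n : ℕ}
    {r : List (List InputSym)} (h : s[k]? = some (r, encodeNat n)) (hn : n ≤ (joinSections s).length) :
    startNode k (joinSections s) = n := by
  have h1 := leastB_lt (b := (joinSections s).length + 1) (i := n)
    (p := fun v => exB (joinSections s).length fun p => NumLine k (joinSections s) p v)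
    (by omega) ((numLine_iff hs).2 ⟨r, h⟩)
  obtain ⟨r', h2⟩ := (numLine_iff hs).1 (leastB_spec h1)
  rw [h] at h2
  simp only [Option.some.injEq, Prod.mk.injEq] at h2
  exact (encodeNat_injective h2.2).symm

theorem encodes {G₁ G₂ : PointerGraph} {v₁ : Fin G₁.size} {v₂ : Fin G₂.size} (h₁ : G₁.IsTree)
    (h₂ : G₂.IsTree) : Encodes (encodeBisimInstance G₁ G₂ v₁ v₂) G₁ G₂ v₁ v₂ := by
  have hc := cleanSections_instance G₁.size (natEdges G₁) G₂.size (natEdges G₂) v₁ v₂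
  have e := encodeBisimInstance_eq G₁ G₂ v₁ v₂
  have l₁ : G₁.size ≤ (encodeBisimInstance G₁ G₂ v₁ v₂).length := by
    have h3 := size_le_of_isTree h₁
    have h4 := CircuitGates.card_records_le (s := instanceSections G₁.size (natEdges G₁) G₂.size
      (natEdges G₂) v₁ v₂) (x := ((natEdges G₁).map fun e => edgeWord e.1 e.2.1 e.2.2, [])) (by
        simp [instanceSections])
    rw [← e] at h4
    simp only [List.length_map, natEdges_length] at h4
    omega
  have l₂ : G₂.size ≤ (encodeBisimInstance G₁ G₂ v₁ v₂).length := by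
    have h3 := size_le_of_isTree h₂
    have h4 := CircuitGates.card_records_le (s := instanceSections G₁.size (natEdges G₁) G₂.size
      (natEdges G₂) v₁ v₂) (x := ((natEdges G₂).map fun e => edgeWord e.1 e.2.1 e.2.2, [])) (by
        simp [instanceSections])
    rw [← e] at h4
    simp only [List.length_map, natEdges_length] at h4
    omega
  refine ⟨?_, ?_, l₁, l₂, ?_, ?_⟩
  · rw [e]
    exact hasSection_joinSections hc (l := []) rfl
  · rw [e]
    exact hasSection_joinSections hc (l := []) rfl
  · rw [e] at l₁ ⊢
    exact startNode_eq hc (r := []) rfl (v₁.2.le.trans l₁)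
  · rw [e] at l₂ ⊢
    exact startNode_eq hc (r := []) rfl (v₂.2.le.trans l₂)

/-- Every line start begins a clean line with a terminator, and the number of its section determines
whether it is a number, an edge, or the end of a list of edges. -/
theorem valid_of_isTree {G₁ G₂ : PointerGraph} {v₁ : Fin G₁.size} {v₂ : Fin G₂.size} (h₁ : G₁.IsTree)
    (h₂ : G₂.IsTree) : Valid (encodeBisimInstance G₁ G₂ v₁ v₂) := by
  obtain ⟨s₁, s₂, l₁, l₂, -, -⟩ := encodes (v₁ := v₁) (v₂ := v₂) h₁ h₂
  have hc := cleanSections_instance G₁.size (natEdges G₁) G₂.size (natEdges G₂) v₁ v₂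
  have e := encodeBisimInstance_eq G₁ G₂ v₁ v₂
  have hlast : (encodeBisimInstance G₁ G₂ v₁ v₂).getLast? = some .hash := by
    rw [e]; exact at_hash_last (by simp [instanceSections])
  have hedge : ∀ (G : PointerGraph) (k : ℕ), G.size ≤ (encodeBisimInstance G₁ G₂ v₁ v₂).length →
      (instanceSections G₁.size (natEdges G₁) G₂.size (natEdges G₂) v₁ v₂)[k]? =
        some ((natEdges G).map fun e => edgeWord e.1 e.2.1 e.2.2, []) →
      ∀ p b t, LineAt (encodeBisimInstance G₁ G₂ v₁ v₂) k p (b ++ [t]) → Clean b → IsTerminator t →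
      EdgeLine k (encodeBisimInstance G₁ G₂ v₁ v₂) p G.size := by
    intro G k _ hk p b t hl hb ht
    rcases ht with rfl | rfl
    · have h3 := hl
      have h4 := (exists_lineAt_semicolon hc hb).1 ⟨p, e ▸ hl⟩
      rw [hk] at h4
      obtain ⟨x, h4, h5⟩ := h4
      obtain rfl := Option.some.inj h4
      obtain ⟨⟨u, a, v⟩, h6, rfl⟩ := List.mem_map.1 h5
      obtain ⟨hu, hv⟩ := natEdges_lt h6
      exact Or.inr ⟨_, (length_of_lineAt h3).2, u, hu, v, hv, edgeAt_iff.2 ⟨a, rfl, h3⟩⟩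
    · obtain ⟨r, h4⟩ := (exists_lineAt_hash hc hb).1 ⟨p, e ▸ hl⟩
      rw [hk] at h4
      simp only [Option.some.injEq, Prod.mk.injEq] at h4
      obtain ⟨-, rfl⟩ := h4
      exact Or.inl ((cons_prefix_drop _ _ _ _).1 hl.2.2).1
  have hnum : ∀ (k n : ℕ), (instanceSections G₁.size (natEdges G₁) G₂.size (natEdges G₂) v₁ v₂)[k]? =
        some ([], encodeNat n) →
      ∀ p b t, LineAt (encodeBisimInstance G₁ G₂ v₁ v₂) k p (b ++ [t]) → Clean b → IsTerminator t →
      NumLine k (encodeBisimInstance G₁ G₂ v₁ v₂) p n := by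
    intro k n hk p b t hl hb ht
    rcases ht with rfl | rfl
    · have h4 := (exists_lineAt_semicolon hc hb).1 ⟨p, e ▸ hl⟩
      rw [hk] at h4
      obtain ⟨x, h4, h5⟩ := h4
      obtain rfl := Option.some.inj h4
      exact absurd h5 List.not_mem_nil
    · obtain ⟨r, h4⟩ := (exists_lineAt_hash hc hb).1 ⟨p, e ▸ hl⟩
      rw [hk] at h4
      simp only [Option.some.injEq, Prod.mk.injEq] at h4
      obtain ⟨-, rfl⟩ := h4
      exact hl
  have hbd : ∀ {G : PointerGraph}, G.size ≤ (encodeBisimInstance G₁ G₂ v₁ v₂).length → ∀ e ∈ natEdges G,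
      e.1 < (encodeBisimInstance G₁ G₂ v₁ v₂).length + 1 ∧
      e.2.2 < (encodeBisimInstance G₁ G₂ v₁ v₂).length + 1 := fun hG e he =>
    ⟨(natEdges_lt he).1.trans_le (by omega), (natEdges_lt he).2.trans_le (by omega)⟩
  refine ⟨?_, ?_, G₁.size, by omega, G₂.size, by omega, v₁, v₁.2, v₂, v₂.2, ?_,
    (uniqueTargets_iff s₁ (hbd l₁)).2 (targetsUnique_of_isTree h₁),
    (uniqueTargets_iff s₂ (hbd l₂)).2 (targetsUnique_of_isTree h₂),
    rooted_of_isTree s₁ l₁ h₁, rooted_of_isTree s₂ l₂ h₂⟩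
  · rw [e, hashes_joinSections hc]
    rfl
  · rw [List.getLast?_eq_getElem?] at hlast
    exact hlast
  · intro p hp hstart
    obtain ⟨b, t, hb, ht, hpre⟩ := exists_line (x := (encodeBisimInstance G₁ G₂ v₁ v₂).drop p) (Or.inr rfl)
      (by
        have h3 : ((encodeBisimInstance G₁ G₂ v₁ v₂).drop p).getLast? = some .hash := by
          rw [List.getLast?_drop, if_neg (by omega), hlast]
        exact List.mem_of_getLast? h3)
    refine ⟨fun hk => ?_, fun hk => ?_, fun hk => ?_, fun hk => ?_, fun hk => ?_, fun hk => ?_⟩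
    · exact hnum 0 _ rfl p b t ⟨hstart, hk, hpre⟩ hb ht
    · exact hedge G₁ 1 l₁ rfl p b t ⟨hstart, hk, hpre⟩ hb ht
    · exact hnum 2 _ rfl p b t ⟨hstart, hk, hpre⟩ hb ht
    · exact hedge G₂ 3 l₂ rfl p b t ⟨hstart, hk, hpre⟩ hb ht
    · exact hnum 4 _ rfl p b t ⟨hstart, hk, hpre⟩ hb ht
    · exact hnum 5 _ rfl p b t ⟨hstart, hk, hpre⟩ hb ht

theorem exists_map_eq {α β : Type} {f : α → β} {P : α → Prop} {l : List β} (h : ∀ b ∈ l, ∃ a, P a ∧ f a = b) :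
    ∃ l' : List α, (∀ a ∈ l', P a) ∧ l'.map f = l := by
  induction l with
  | nil => exact ⟨[], by simp, rfl⟩
  | cons b l ih =>
    obtain ⟨l', h1, rfl⟩ := ih fun b hb => h b (List.mem_cons_of_mem _ hb)
    obtain ⟨a, ha, rfl⟩ := h b (by simp)
    exact ⟨a :: l', by simpa using ⟨ha, h1⟩, rfl⟩

/-- A position determines the line that starts there. So all lines of the section end in `hash`,
which leaves no room for records. -/
theorem section_of_numLine {s : List (List (List InputSym) × List InputSym)} (hs : CleanSections s)
    {k n : ℕ} {x : List (List InputSym) × List InputSym} (hx : s[k]? = some x)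
    (h : ∀ p < (joinSections s).length, LineStart (joinSections s) p → hashes (joinSections s) p = k →
      NumLine k (joinSections s) p n) : x = ([], encodeNat n) := by
  obtain ⟨r, l⟩ := x
  have hm := hs _ (List.mem_of_getElem? hx)
  have key : ∀ {p b t}, LineAt (joinSections s) k p (b ++ [t]) → Clean b → IsTerminator t →
      b = encodeNat n ∧ t = .hash := by
    intro p b t hl hb ht
    have hp : p < (joinSections s).length := by
      have := hl.2.2.length_le
      simp only [List.length_append, List.length_singleton, List.length_drop] at this
      omega
    exact lineAt_unique hl (h p hp hl.1 hl.2.1) hb (clean_encodeNat n) ht (Or.inr rfl)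
  obtain ⟨p, hp⟩ := (exists_lineAt_hash hs hm.2).2 ⟨r, hx⟩
  obtain ⟨rfl, -⟩ := key hp hm.2 (Or.inr rfl)
  cases r with
  | nil => rfl
  | cons b r =>
    have hb : Clean b := hm.1 b (by simp)
    obtain ⟨p, hp⟩ := (exists_lineAt_semicolon hs hb).2 ⟨_, hx, by simp⟩
    exact absurd (key hp hb (Or.inl rfl)).2 (by simp)

theorem section_of_edgeLine {s : List (List (List InputSym) × List InputSym)} (hs : CleanSections s)
    {k n : ℕ} {x : List (List InputSym) × List InputSym} (hx : s[k]? = some x)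
    (h : ∀ p < (joinSections s).length, LineStart (joinSections s) p → hashes (joinSections s) p = k →
      EdgeLine k (joinSections s) p n) : ∃ E : List (Fin n × ℕ × Fin n),
      x = (E.map fun e => edgeWord e.1 e.2.1 e.2.2, []) := by
  obtain ⟨r, l⟩ := x
  have hm := hs _ (List.mem_of_getElem? hx)
  have key : ∀ {p b t}, LineAt (joinSections s) k p (b ++ [t]) → Clean b → IsTerminator t →
      At .hash (joinSections s) p ∨ t = .semicolon ∧ ∃ e : Fin n × ℕ × Fin n, True ∧
        edgeWord e.1 e.2.1 e.2.2 = b := by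
    intro p b t hl hb ht
    have hp : p < (joinSections s).length := by
      have := hl.2.2.length_le
      simp only [List.length_append, List.length_singleton, List.length_drop] at this
      omega
    rcases h p hp hl.1 hl.2.1 with h1 | ⟨_, -, u, hu, v, hv, h1⟩
    · exact Or.inl h1
    · obtain ⟨a, -, h2⟩ := edgeAt_iff.1 h1
      obtain ⟨h3, h4⟩ := lineAt_unique hl h2 hb (clean_edgeWord _ _ _) ht (Or.inl rfl)
      exact Or.inr ⟨h4, ⟨⟨u, hu⟩, a, ⟨v, hv⟩⟩, trivial, h3.symm⟩
  have hnot : ∀ {p b t}, LineAt (joinSections s) k p (b ++ [t]) → Clean b → At .hash (joinSections s) p →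
      b = [] ∧ t = .hash := by
    intro p b t hl hb hh
    have h1 := hl.2.2
    cases b with
    | nil =>
      rw [List.nil_append, cons_prefix_drop] at h1
      exact ⟨rfl, at_unique h1.1 hh⟩
    | cons c b =>
      rw [List.cons_append, cons_prefix_drop] at h1
      exact absurd (at_unique h1.1 hh) (hb c (by simp)).2
  have hr : ∀ b ∈ r, ∃ e : Fin n × ℕ × Fin n, True ∧ edgeWord e.1 e.2.1 e.2.2 = b := by
    intro b hb
    have hbc := hm.1 b hb
    obtain ⟨p, hp⟩ := (exists_lineAt_semicolon hs hbc).2 ⟨_, hx, hb⟩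
    rcases key hp hbc (Or.inl rfl) with h1 | ⟨-, h1⟩
    · exact absurd (hnot hp hbc h1).2 (by simp)
    · exact h1
  obtain ⟨E, -, rfl⟩ := exists_map_eq hr
  obtain ⟨p, hp⟩ := (exists_lineAt_hash hs hm.2).2 ⟨_, hx⟩
  rcases key hp hm.2 (Or.inr rfl) with h1 | ⟨h1, -⟩
  · have h2 : l = [] := (hnot hp hm.2 h1).1
    subst h2
    exact ⟨E, rfl⟩
  · simp at h1

/-- A word that ends in `hash` consists of sections, and the conditions on lines determine each of
the six. The trees are then rebuilt from the lists of edges. -/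
theorem exists_of_valid {w : List InputSym} (h : Valid w) : ∃ (G₁ G₂ : PointerGraph) (v₁ : Fin G₁.size)
    (v₂ : Fin G₂.size), w = encodeBisimInstance G₁ G₂ v₁ v₂ ∧ G₁.IsTree ∧ G₂.IsTree := by
  obtain ⟨h6, hlast, n₁, hn₁, n₂, hn₂, v₁, hv₁, v₂, hv₂, hl, hu₁, hu₂, hr₁, hr₂⟩ := h
  obtain ⟨s, hs, rfl⟩ := exists_joinSections (w := w) (Or.inr (by rw [List.getLast?_eq_getElem?]; exact hlast))
  rw [hashes_joinSections hs] at h6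
  obtain ⟨x₀, x₁, x₂, x₃, x₄, x₅, rfl⟩ : ∃ x₀ x₁ x₂ x₃ x₄ x₅, s = [x₀, x₁, x₂, x₃, x₄, x₅] := by
    match s, h6 with
    | [x₀, x₁, x₂, x₃, x₄, x₅], _ => exact ⟨_, _, _, _, _, _, rfl⟩
  obtain rfl := section_of_numLine hs (k := 0) rfl fun p hp h1 h2 => (hl p hp h1).1 h2
  obtain ⟨E₁, rfl⟩ := section_of_edgeLine hs (k := 1) rfl fun p hp h1 h2 => (hl p hp h1).2.1 h2
  obtain rfl := section_of_numLine hs (k := 2) rfl fun p hp h1 h2 => (hl p hp h1).2.2.1 h2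
  obtain ⟨E₂, rfl⟩ := section_of_edgeLine hs (k := 3) rfl fun p hp h1 h2 => (hl p hp h1).2.2.2.1 h2
  obtain rfl := section_of_numLine hs (k := 4) rfl fun p hp h1 h2 => (hl p hp h1).2.2.2.2.1 h2
  obtain rfl := section_of_numLine hs (k := 5) rfl fun p hp h1 h2 => (hl p hp h1).2.2.2.2.2 h2
  -- A repeated edge would be the same target at two positions.
  have hnodup : ∀ {n : ℕ} (E : List (Fin n × ℕ × Fin n)),
      TargetsUnique (E.map fun e => ((e.1 : ℕ), e.2.1, (e.2.2 : ℕ))) → E.Nodup := by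
    intro n E hE
    rw [List.nodup_iff_getElem?_ne_getElem?]
    intro i j hij hj heq
    have h1 := List.getElem?_eq_getElem hj
    exact hij.ne (hE i j _ _ (by rw [List.getElem?_map, heq, h1]; rfl)
      (by rw [List.getElem?_map, h1]; rfl) rfl)
  have hb : ∀ {n : ℕ} (E : List (Fin n × ℕ × Fin n)), ∀ e ∈ E.map fun e => ((e.1 : ℕ), e.2.1, (e.2.2 : ℕ)),
      e.1 < n ∧ e.2.2 < n := by
    intro n E e he
    obtain ⟨x, -, rfl⟩ := List.mem_map.1 he
    exact ⟨x.1.2, x.2.2.2⟩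
  have hS₁ := hasSection_joinSections hs (k := 1) (E := E₁.map fun e => ((e.1 : ℕ), e.2.1, (e.2.2 : ℕ)))
    (l := []) (by simp [List.map_map, Function.comp_def])
  have hS₂ := hasSection_joinSections hs (k := 3) (E := E₂.map fun e => ((e.1 : ℕ), e.2.1, (e.2.2 : ℕ)))
    (l := []) (by simp [List.map_map, Function.comp_def])
  have hT₁ := (uniqueTargets_iff hS₁ fun e he => ⟨(hb E₁ e he).1.trans hn₁, (hb E₁ e he).2.trans hn₁⟩).1 hu₁
  have hT₂ := (uniqueTargets_iff hS₂ fun e he => ⟨(hb E₂ e he).1.trans hn₂, (hb E₂ e he).2.trans hn₂⟩).1 hu₂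
  refine ⟨⟨n₁, E₁, hnodup E₁ hT₁⟩, ⟨n₂, E₂, hnodup E₂ hT₂⟩, ⟨v₁, hv₁⟩, ⟨v₂, hv₂⟩, ?_,
    isTree_of_rooted hS₁ (Nat.lt_succ_iff.1 hn₁) hT₁ hr₁, isTree_of_rooted hS₂ (Nat.lt_succ_iff.1 hn₂) hT₂ hr₂⟩
  rw [encodeBisimInstance_eq]
  simp [instanceSections, natEdges, List.map_map, Function.comp_def]

end TreeGates

end TapeProg

/-- A relation that satisfies the recursion of bisimilarity coincides with bisimilarity if the edges of
the first graph are well-founded. -/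
theorem bisimilar_disjointUnion_iff {V W A : Type} {E : V → A → V → Prop} {F : W → A → W → Prop}
    (hE : WellFounded fun c p => ∃ a, E p a c) {P : V → W → Prop}
    (hP : ∀ u v, P u v ↔ (∀ a u', E u a u' → ∃ v', F v a v' ∧ P u' v') ∧
      (∀ a v', F v a v' → ∃ u', E u a u' ∧ P u' v')) (u : V) (v : W) :
    Bisimilar (disjointUnionEdge E F) (.inl u) (.inr v) ↔ P u v := by
  constructor
  · rintro ⟨R, hR, huv⟩
    -- Descent in the first graph suffices, since each step of the recursion goes down an edge in
    -- both graphs.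
    induction u using hE.induction generalizing v with
    | _ u ih =>
      obtain ⟨h1, h2⟩ := hR _ _ huv
      refine (hP u v).2 ⟨fun a u' h => ?_, fun a v' h => ?_⟩
      · obtain ⟨x | v', h3, h4⟩ := h1 a (.inl u') h
        · exact h3.elim
        · exact ⟨v', h3, ih u' ⟨a, h⟩ v' h4⟩
      · obtain ⟨u' | x, h3, h4⟩ := h2 a (.inr v') h
        · exact ⟨u', h3, ih u' ⟨a, h3⟩ v' h4⟩
        · exact h3.elim
  · intro h
    refine ⟨fun x y => ∃ u v, P u v ∧ x = .inl u ∧ y = .inr v, ?_, u, v, h, rfl, rfl⟩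
    rintro _ _ ⟨u, v, h, rfl, rfl⟩
    obtain ⟨h1, h2⟩ := (hP u v).1 h
    refine ⟨fun a x hx => ?_, fun a x hx => ?_⟩
    · rcases x with u' | v'
      · obtain ⟨v', h3, h4⟩ := h1 a u' hx
        exact ⟨.inr v', h3, u', v', h4, rfl, rfl⟩
      · exact hx.elim
    · rcases x with u' | v'
      · exact hx.elim
      · obtain ⟨u', h3, h4⟩ := h2 a v' hx
        exact ⟨.inl u', h3, u', v', h4, rfl, rfl⟩

namespace TapeProg

open OfflineTM Obj

namespace TreeGates

/-! #### Gate numbers -/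

def kind (w : List InputSym) (g : ℕ) : ℕ := g / (w.length + 1) / (w.length + 1)

def left (w : List InputSym) (g : ℕ) : ℕ := g / (w.length + 1) % (w.length + 1)

def right (w : List InputSym) (g : ℕ) : ℕ := g % (w.length + 1)

def num (w : List InputSym) (t u v : ℕ) : ℕ := (t * (w.length + 1) + u) * (w.length + 1) + v

section

variable {w : List InputSym}

theorem left_lt (g : ℕ) : left w g < w.length + 1 := Nat.mod_lt _ (Nat.succ_pos _)

theorem right_lt (g : ℕ) : right w g < w.length + 1 := Nat.mod_lt _ (Nat.succ_pos _)

theorem num_kind_left_right (g : ℕ) : num w (kind w g) (left w g) (right w g) = g := by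
  rw [num, kind, left, right, Nat.div_add_mod', Nat.div_add_mod']

theorem kind_num {t u v : ℕ} (hu : u < w.length + 1) (hv : v < w.length + 1) : kind w (num w t u v) = t := by
  rw [kind, num, Nat.add_comm _ v, Nat.add_mul_div_right _ _ (Nat.succ_pos _), Nat.div_eq_of_lt hv, zero_add,
    Nat.add_comm _ u, Nat.add_mul_div_right _ _ (Nat.succ_pos _), Nat.div_eq_of_lt hu, zero_add]

theorem left_num {t u v : ℕ} (hu : u < w.length + 1) (hv : v < w.length + 1) : left w (num w t u v) = u := by
  rw [left, num, Nat.add_comm _ v, Nat.add_mul_div_right _ _ (Nat.succ_pos _), Nat.div_eq_of_lt hv, zero_add,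
    Nat.add_comm _ u, Nat.add_mul_mod_self_right, Nat.mod_eq_of_lt hu]

theorem right_num {t u v : ℕ} (hv : v < w.length + 1) : right w (num w t u v) = v := by
  rw [right, num, Nat.add_comm _ v, Nat.add_mul_mod_self_right, Nat.mod_eq_of_lt hv]

theorem eq_of_kind_left_right {x y : ℕ} (h : kind w x = kind w y) (h1 : left w x = left w y)
    (h2 : right w x = right w y) : x = y := by
  rw [← num_kind_left_right (w := w) x, h, h1, h2, num_kind_left_right]

theorem lt_bound {x : ℕ} (h : kind w x < 3) : x < gates.bound w := by
  rw [kind, Nat.div_div_eq_div_mul] at h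
  exact (Nat.div_lt_iff_lt_mul (by positivity)).1 h

theorem in_iff {p c : ℕ} : gates.In w p c ↔
    kind w p = 0 ∧ kind w c = 1 ∧ right w c = right w p ∧ Edge 1 w (left w p) (left w c) ∨
    kind w p = 0 ∧ kind w c = 2 ∧ left w c = left w p ∧ Edge 3 w (right w p) (right w c) ∨
    kind w p = 1 ∧ kind w c = 0 ∧ left w c = left w p ∧ Edge 3 w (right w p) (right w c) ∧
      SameLabel w (left w c) (right w c) ∨
    kind w p = 2 ∧ kind w c = 0 ∧ right w c = right w p ∧ Edge 1 w (left w p) (left w c) ∧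
      SameLabel w (left w c) (right w c) := Iff.rfl

theorem root_iff {g : ℕ} : gates.Root w g ↔ kind w g = 0 := Iff.rfl

end

/-! #### Analysis of the gates -/

section

variable {k : ℕ} {w : List InputSym} {G : PointerGraph}

theorem eq_parent (hE : HasSection k w (natEdges G)) (hn : G.size ≤ w.length) (h : G.IsTree) {u v : ℕ}
    (huv : Edge k w u v) : u = parent k w v := by
  obtain ⟨a, h1⟩ := (edge_iff hE).1 huv
  obtain ⟨b, h2⟩ := (edge_iff hE).1 (edge_parent hE hn huv).1
  exact ((targetsUnique_of_isTree h).eq h1 h2).1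

theorem edge_val_iff (hE : HasSection k w (natEdges G)) (u : Fin G.size) (x : ℕ) : Edge k w u x ↔
    ∃ u' : Fin G.size, (∃ a, G.Edge u a u') ∧ x = u' := by
  rw [edge_natEdges_iff hE]
  constructor
  · rintro ⟨y, u', h, h1, h2⟩
    obtain rfl := Fin.ext h1
    exact ⟨u', h, h2⟩
  · rintro ⟨u', h, h2⟩
    exact ⟨u, u', h, rfl, h2⟩

theorem edge_lt (hE : HasSection k w (natEdges G)) (hn : G.size ≤ w.length) {u v : ℕ} (h : Edge k w u v) :
    u < w.length + 1 ∧ v < w.length + 1 := by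
  obtain ⟨u', v', -, rfl, rfl⟩ := (edge_natEdges_iff hE).1 h
  omega

theorem SameLabel.exists_edge {u v : ℕ} (h : SameLabel w u v) :
    (∃ u', Edge 1 w u' u) ∧ ∃ v', Edge 3 w v' v := by
  obtain ⟨p, hp, p', hp', l, hl, u', -, v', -, h1, h2, -⟩ := h
  exact ⟨⟨u', p, hp, l, hl, h1⟩, v', p', hp', l, hl, h2⟩

end

namespace Encodes

variable {w : List InputSym} {G₁ G₂ : PointerGraph} {v₁ : Fin G₁.size} {v₂ : Fin G₂.size}

theorem sameLabel_iff (h : Encodes w G₁ G₂ v₁ v₂) (h₁ : G₁.IsTree) (h₂ : G₂.IsTree) {u u' : Fin G₁.size}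
    {v v' : Fin G₂.size} {a b : ℕ} (hu : G₁.Edge u a u') (hv : G₂.Edge v b v') :
    SameLabel w u' v' ↔ a = b := by
  have hl₁ := h.le₁
  have hl₂ := h.le₂
  have hu := mem_natEdges.2 ⟨u, u', hu, rfl, rfl⟩
  have hv := mem_natEdges.2 ⟨v, v', hv, rfl, rfl⟩
  rw [TreeGates.sameLabel_iff h.section₁ h.section₂ (fun e he => (natEdges_lt he).1.trans_le (by omega))
    (fun e he => (natEdges_lt he).1.trans_le (by omega))]
  constructor
  · rintro ⟨x, y, c, hx, hy⟩
    exact (((targetsUnique_of_isTree h₁).eq hu hx).2).trans ((targetsUnique_of_isTree h₂).eq hv hy).2.symm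
  · rintro rfl
    exact ⟨u, v, a, hu, hv⟩

/-- From a gate to an input, one of the two nodes moves down an edge of its tree while the other
stays, so the sum of the ranks decreases. -/
theorem wellFounded_in (h : Encodes w G₁ G₂ v₁ v₂) (h₁ : G₁.IsTree) (h₂ : G₂.IsTree) :
    WellFounded fun c p => gates.In w p c := by
  have e₁ : ∀ {u v}, Edge 1 w u v → rankIn (w.length + 1) (fun c p => Edge 1 w p c) v <
      rankIn (w.length + 1) (fun c p => Edge 1 w p c) u := fun e =>
    rankIn_lt_rankIn (wellFounded_edge h.section₁ h₁) e (edge_lt h.section₁ h.le₁ e).2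
  have e₂ : ∀ {u v}, Edge 3 w u v → rankIn (w.length + 1) (fun c p => Edge 3 w p c) v <
      rankIn (w.length + 1) (fun c p => Edge 3 w p c) u := fun e =>
    rankIn_lt_rankIn (wellFounded_edge h.section₂ h₂) e (edge_lt h.section₂ h.le₂ e).2
  refine Subrelation.wf (r := InvImage (· < ·) fun g =>
    rankIn (w.length + 1) (fun c p => Edge 1 w p c) (left w g) +
      rankIn (w.length + 1) (fun c p => Edge 3 w p c) (right w g)) ?_ (InvImage.wf _ wellFounded_lt)
  intro c p hc
  change _ + _ < _ + _
  rcases in_iff.1 hc with ⟨-, -, h3, h4⟩ | ⟨-, -, h3, h4⟩ | ⟨-, -, h3, h4, -⟩ | ⟨-, -, h3, h4, -⟩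
  · have := e₁ h4; rw [h3]; omega
  · have := e₂ h4; rw [h3]; omega
  · have := e₂ h4; rw [h3]; omega
  · have := e₁ h4; rw [h3]; omega

-- A gate `(1, u', v)` belongs to the block of the pair of the parent of `u'` and `v`, and
-- symmetrically for kind `2`. Thus the two gates that may use a pair `(u', v')` both lie in the
-- block of the pair of parents.
open Classical in
theorem spec (h : Encodes w G₁ G₂ v₁ v₂) (h₁ : G₁.IsTree) (h₂ : G₂.IsTree) {val : ℕ → Bool}
    (hval : ∀ g, val g = gates.B w g ↔ ∃ c, gates.In w g c ∧ val c = gates.A w g) :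
    gates.Spec w val where
  in_lt p c hc := by
    refine ⟨lt_bound ?_, lt_bound ?_⟩ <;>
    rcases in_iff.1 hc with ⟨h1, h2, -⟩ | ⟨h1, h2, -⟩ | ⟨h1, h2, -⟩ | ⟨h1, h2, -⟩ <;> omega
  root_lt c hc := lt_bound (by rw [root_iff] at hc; omega)
  start_root := by
    have e : gates.start w = num w 0 v₁ v₂ := by
      change startNode 4 w * (w.length + 1) + startNode 5 w = _
      rw [h.start₁, h.start₂, num, zero_mul, zero_add]
    rw [root_iff, e, kind_num (v₁.2.trans_le (h.le₁.trans (Nat.le_succ _)))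
      (v₂.2.trans_le (h.le₂.trans (Nat.le_succ _)))]
  wf := h.wellFounded_in h₁ h₂
  parent_unique p p' c hc hp hp' := by
    rw [root_iff] at hc
    have e₁ := @eq_parent 1 w G₁ h.section₁ h.le₁ h₁
    have e₂ := @eq_parent 3 w G₂ h.section₂ h.le₂ h₂
    rcases in_iff.1 hp with ⟨a1, a2, a3, a4⟩ | ⟨a1, a2, a3, a4⟩ | ⟨a1, a2, -⟩ | ⟨a1, a2, -⟩ <;>
    rcases in_iff.1 hp' with ⟨b1, b2, b3, b4⟩ | ⟨b1, b2, b3, b4⟩ | ⟨b1, b2, -⟩ | ⟨b1, b2, -⟩ <;> try omega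
    · exact eq_of_kind_left_right (a1.trans b1.symm) ((e₁ a4).trans (e₁ b4).symm) (a3.symm.trans b3)
    · exact eq_of_kind_left_right (a1.trans b1.symm) (a3.symm.trans b3) ((e₂ a4).trans (e₂ b4).symm)
  root_or_in p c hp := by
    rcases in_iff.1 hp with ⟨h1, -⟩ | ⟨h1, -⟩ | ⟨h1, h2, h3, h4, h5⟩ | ⟨h1, h2, h3, h4, h5⟩
    · exact Or.inl h1
    · exact Or.inl h1
    -- A gate of kind `1` with an input satisfies the label condition, which supplies a parent of
    -- its first node; the pair with this parent uses the gate.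
    · obtain ⟨⟨u, hu⟩, -⟩ := h5.exists_edge
      obtain ⟨l, -⟩ := edge_lt h.section₁ h.le₁ hu
      refine Or.inr ⟨num w 0 u (right w p), in_iff.2 (Or.inl ⟨kind_num l (right_lt p), h1,
        (right_num (right_lt p)).symm, ?_⟩)⟩
      rw [left_num l (right_lt p), ← h3]
      exact hu
    · obtain ⟨-, v, hv⟩ := h5.exists_edge
      obtain ⟨l, -⟩ := edge_lt h.section₂ h.le₂ hv
      refine Or.inr ⟨num w 0 (left w p) v, in_iff.2 (Or.inr (Or.inl ⟨kind_num (left_lt p) l, h1,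
        (left_num (left_lt p) l).symm, ?_⟩))⟩
      rw [right_num l, ← h3]
      exact hv
  block := by
    have e₁ := @eq_parent 1 w G₁ h.section₁ h.le₁ h₁
    have e₂ := @eq_parent 3 w G₂ h.section₂ h.le₂ h₂
    let blk : ℕ → ℕ := fun g => num w 0 (if kind w g = 1 then parent 1 w (left w g) else left w g)
      (if kind w g = 2 then parent 3 w (right w g) else right w g)
    have hblk : ∀ p c, kind w c = 0 → gates.In w p c →
        blk p = num w 0 (parent 1 w (left w c)) (parent 3 w (right w c)) := by
      intro p c hc hp
      rcases in_iff.1 hp with ⟨-, a2, -⟩ | ⟨-, a2, -⟩ | ⟨a1, a2, a3, a4, -⟩ | ⟨a1, a2, a3, a4, -⟩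
      · omega
      · omega
      · simp only [blk, a1, a3, ← e₂ a4]; rfl
      · simp only [blk, a1, a3, ← e₁ a4]; rfl
    have h0 : ∀ r, kind w r = 0 → blk r = r := by
      intro r hr
      have e : blk r = num w (kind w r) (left w r) (right w r) := by simp only [blk, hr]; rfl
      rw [e, num_kind_left_right]
    refine ⟨blk, fun p c hp hc => ?_, fun p p' c hc hp hp' => ?_, fun r r' hr hr' he => ?_⟩
    · rw [root_iff] at hc
      rcases in_iff.1 hp with ⟨a1, a2, a3, a4⟩ | ⟨a1, a2, a3, a4⟩ | ⟨-, a2, -⟩ | ⟨-, a2, -⟩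
      · simp only [blk, a1, a2, a3, ← e₁ a4]; rfl
      · simp only [blk, a1, a2, a3, ← e₂ a4]; rfl
      · omega
      · omega
    · rw [hblk p c hc hp, hblk p' c hc hp']
    · rwa [h0 r hr, h0 r' hr'] at he
  val_eq := hval

/-- Only two gates can use a pair: one keeps the first node and takes the parent of the second, the
other does the reverse. -/
theorem index_le (h : Encodes w G₁ G₂ v₁ v₂) (h₁ : G₁.IsTree) (h₂ : G₂.IsTree) {p c : ℕ}
    (hc : gates.Root w c) : gates.index w p c ≤ 2 := by
  classical
  rw [root_iff] at hc
  simp only [Gates.index, countB, Nat.count_eq_card_filter_range]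
  refine (Finset.card_le_card (t := {num w 1 (left w c) (parent 3 w (right w c)),
    num w 2 (parent 1 w (left w c)) (right w c)}) fun q hq => ?_).trans Finset.card_le_two
  have hq := (Finset.mem_filter.1 hq).2
  rw [Finset.mem_insert, Finset.mem_singleton]
  rcases in_iff.1 hq with ⟨-, a2, -⟩ | ⟨-, a2, -⟩ | ⟨a1, a2, a3, a4, -⟩ | ⟨a1, a2, a3, a4, -⟩
  · omega
  · omega
  · rw [a3, ← eq_parent h.section₂ h.le₂ h₂ a4, ← a1, num_kind_left_right]
    exact Or.inl rfl
  · rw [a3, ← eq_parent h.section₁ h.le₁ h₁ a4, ← a1, num_kind_left_right]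
    exact Or.inr rfl

/-- Unfolding the three kinds of gates yields the recursion of bisimilarity, whose solution is
unique because the first tree is well-founded. -/
theorem val_start_iff (h : Encodes w G₁ G₂ v₁ v₂) (h₁ : G₁.IsTree) (h₂ : G₂.IsTree) {val : ℕ → Bool}
    (hval : ∀ g, val g = gates.B w g ↔ ∃ c, gates.In w g c ∧ val c = gates.A w g) :
    val (gates.start w) = true ↔ Bisimilar (disjointUnionEdge G₁.Edge G₂.Edge) (.inl v₁) (.inr v₂) := by
  have l₁ : ∀ u : Fin G₁.size, (u : ℕ) < w.length + 1 := fun u => u.2.trans_le (h.le₁.trans (Nat.le_succ _))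
  have l₂ : ∀ v : Fin G₂.size, (v : ℕ) < w.length + 1 := fun v => v.2.trans_le (h.le₂.trans (Nat.le_succ _))
  have e : gates.start w = num w 0 v₁ v₂ := by
    change startNode 4 w * (w.length + 1) + startNode 5 w = _
    rw [h.start₁, h.start₂, num, zero_mul, zero_add]
  have hall : ∀ g, kind w g = 0 → (val g = true ↔ ∀ c, gates.In w g c → val c = true) := by
    intro g hg
    have hB : gates.B w g = false := decide_eq_false (not_not.2 hg)
    have hA : gates.A w g = false := decide_eq_false (not_not.2 hg)
    have := hval g
    rw [hA, hB] at this
    rw [← not_iff_not, Bool.not_eq_true, this]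
    simp
  have hex : ∀ g, kind w g ≠ 0 → (val g = true ↔ ∃ c, gates.In w g c ∧ val c = true) := by
    intro g hg
    have hB : gates.B w g = true := decide_eq_true hg
    have hA : gates.A w g = true := decide_eq_true hg
    have := hval g
    rwa [hA, hB] at this
  have hv1 : ∀ (u' : Fin G₁.size) (v : Fin G₂.size), val (num w 1 u' v) = true ↔
      ∃ v' : Fin G₂.size, (∃ a, G₂.Edge v a v') ∧ SameLabel w u' v' ∧ val (num w 0 u' v') = true := by
    intro u v
    have hk := kind_num (t := 1) (l₁ u) (l₂ v)
    have hl := left_num (t := 1) (l₁ u) (l₂ v)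
    have hr := right_num (t := 1) (u := u) (l₂ v)
    rw [hex _ (by omega)]
    constructor
    · rintro ⟨c, hc, hvc⟩
      rcases in_iff.1 hc with ⟨a1, -⟩ | ⟨a1, -⟩ | ⟨a1, a2, a3, a4, a5⟩ | ⟨a1, -⟩
      · omega
      · omega
      · rw [hr] at a4
        rw [hl] at a3
        obtain ⟨v', h3, h4⟩ := (edge_val_iff h.section₂ v _).1 a4
        rw [a3, h4] at a5
        rw [← num_kind_left_right (w := w) c, a2, a3, h4] at hvc
        exact ⟨v', h3, a5, hvc⟩
      · omega
    · rintro ⟨v', h3, h4, h5⟩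
      refine ⟨_, in_iff.2 (Or.inr (Or.inr (Or.inl ⟨hk, kind_num (l₁ u) (l₂ v'), ?_, ?_, ?_⟩))), h5⟩
      · rw [left_num (l₁ u) (l₂ v'), hl]
      · rw [hr, right_num (l₂ v')]
        exact (edge_val_iff h.section₂ v _).2 ⟨v', h3, rfl⟩
      · rwa [left_num (l₁ u) (l₂ v'), right_num (l₂ v')]
  have hv2 : ∀ (u : Fin G₁.size) (v' : Fin G₂.size), val (num w 2 u v') = true ↔
      ∃ u' : Fin G₁.size, (∃ a, G₁.Edge u a u') ∧ SameLabel w u' v' ∧ val (num w 0 u' v') = true := by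
    intro u v
    have hk := kind_num (t := 2) (l₁ u) (l₂ v)
    have hl := left_num (t := 2) (l₁ u) (l₂ v)
    have hr := right_num (t := 2) (u := u) (l₂ v)
    rw [hex _ (by omega)]
    constructor
    · rintro ⟨c, hc, hvc⟩
      rcases in_iff.1 hc with ⟨a1, -⟩ | ⟨a1, -⟩ | ⟨a1, -⟩ | ⟨a1, a2, a3, a4, a5⟩
      · omega
      · omega
      · omega
      · rw [hl] at a4
        rw [hr] at a3
        obtain ⟨u', h3, h4⟩ := (edge_val_iff h.section₁ u _).1 a4
        rw [a3, h4] at a5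
        rw [← num_kind_left_right (w := w) c, a2, a3, h4] at hvc
        exact ⟨u', h3, a5, hvc⟩
    · rintro ⟨u', h3, h4, h5⟩
      refine ⟨_, in_iff.2 (Or.inr (Or.inr (Or.inr ⟨hk, kind_num (l₁ u') (l₂ v), ?_, ?_, ?_⟩))), h5⟩
      · rw [right_num (l₂ v), hr]
      · rw [hl, left_num (l₁ u') (l₂ v)]
        exact (edge_val_iff h.section₁ u _).2 ⟨u', h3, rfl⟩
      · rwa [left_num (l₁ u') (l₂ v), right_num (l₂ v)]
  have hv0 : ∀ (u : Fin G₁.size) (v : Fin G₂.size), val (num w 0 u v) = true ↔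
      (∀ u' : Fin G₁.size, (∃ a, G₁.Edge u a u') → val (num w 1 u' v) = true) ∧
      ∀ v' : Fin G₂.size, (∃ a, G₂.Edge v a v') → val (num w 2 u v') = true := by
    intro u v
    have hk := kind_num (t := 0) (l₁ u) (l₂ v)
    have hl := left_num (t := 0) (l₁ u) (l₂ v)
    have hr := right_num (t := 0) (u := u) (l₂ v)
    rw [hall _ hk]
    constructor
    · refine fun hc => ⟨fun u' hu' => hc _ (in_iff.2 (Or.inl ⟨hk, kind_num (l₁ u') (l₂ v), ?_, ?_⟩)),
        fun v' hv' => hc _ (in_iff.2 (Or.inr (Or.inl ⟨hk, kind_num (l₁ u) (l₂ v'), ?_, ?_⟩)))⟩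
      · rw [right_num (l₂ v), hr]
      · rw [hl, left_num (l₁ u') (l₂ v)]
        exact (edge_val_iff h.section₁ u _).2 ⟨u', hu', rfl⟩
      · rw [left_num (l₁ u) (l₂ v'), hl]
      · rw [hr, right_num (l₂ v')]
        exact (edge_val_iff h.section₂ v _).2 ⟨v', hv', rfl⟩
    · rintro ⟨hc1, hc2⟩ c hc
      rcases in_iff.1 hc with ⟨a1, a2, a3, a4⟩ | ⟨a1, a2, a3, a4⟩ | ⟨a1, -⟩ | ⟨a1, -⟩
      · rw [hl] at a4
        obtain ⟨u', h3, h4⟩ := (edge_val_iff h.section₁ u _).1 a4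
        rw [← num_kind_left_right (w := w) c, a2, a3, h4, hr]
        exact hc1 u' h3
      · rw [hr] at a4
        obtain ⟨v', h3, h4⟩ := (edge_val_iff h.section₂ v _).1 a4
        rw [← num_kind_left_right (w := w) c, a2, a3, h4, hl]
        exact hc2 v' h3
      · omega
      · omega
  obtain ⟨r, hr⟩ := h₁.2
  rw [e, bisimilar_disjointUnion_iff hr.wellFounded
    (P := fun (u : Fin G₁.size) (v : Fin G₂.size) => val (num w 0 u v) = true)]
  intro u v
  rw [hv0]
  refine and_congr ⟨fun hc a u' hu' => ?_, fun hc u' ⟨a, hu'⟩ => ?_⟩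
    ⟨fun hc a v' hv' => ?_, fun hc v' ⟨a, hv'⟩ => ?_⟩
  · obtain ⟨v', ⟨b, hb⟩, h3, h4⟩ := (hv1 _ _).1 (hc u' ⟨a, hu'⟩)
    obtain rfl := (h.sameLabel_iff h₁ h₂ hu' hb).1 h3
    exact ⟨v', hb, h4⟩
  · obtain ⟨v', hb, h4⟩ := hc a u' hu'
    exact (hv1 _ _).2 ⟨v', ⟨a, hb⟩, (h.sameLabel_iff h₁ h₂ hu' hb).2 rfl, h4⟩
  · obtain ⟨u', ⟨b, hb⟩, h3, h4⟩ := (hv2 _ _).1 (hc v' ⟨a, hv'⟩)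
    obtain rfl := (h.sameLabel_iff h₁ h₂ hb hv').1 h3
    exact ⟨u', hb, h4⟩
  · obtain ⟨u', hb, h4⟩ := hc a v' hv'
    exact (hv2 _ _).2 ⟨u', ⟨a, hb⟩, (h.sameLabel_iff h₁ h₂ hb hv').2 rfl, h4⟩

end Encodes

end TreeGates

theorem inLogspace_bisimTrees : InLogspace BisimTrees := by
  obtain ⟨M, K, hM⟩ := TreeGates.gates.exists_machine
  refine ⟨M, 168 * K + 128, fun w => ?_⟩
  set N : ℕ := 8 * (3 * ((w.length + 1) * (w.length + 1))) + 8 with hN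
  have hwN : w.length + 2 ≤ N := by nlinarith
  obtain ⟨hno, hyes⟩ := hM w N hwN
  have hle : N ≤ (w.length + 2) ^ 7 := by
    calc N ≤ 2 ^ 5 * (w.length + 2) ^ 2 := by rw [hN]; nlinarith
      _ ≤ (w.length + 2) ^ 5 * (w.length + 2) ^ 2 :=
        Nat.mul_le_mul_right _ (Nat.pow_le_pow_left (by omega) 5)
      _ = (w.length + 2) ^ 7 := by ring
  have hlog : Real.log N ≤ 7 * Real.log (w.length + 2) := by
    have hle : (N : ℝ) ≤ (w.length + 2) ^ 7 := by exact_mod_cast hle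
    refine (Real.log_le_log (by exact_mod_cast (show 0 < N by omega)) hle).trans ?_
    rw [Real.log_pow]
    norm_num
  have hw : 1 / 2 ≤ Real.log (w.length + 2) :=
    half_le_log (by have := Nat.cast_nonneg (α := ℝ) w.length; linarith)
  have hsize : ((N ^ K).size : ℝ) ≤ 14 * K * Real.log (w.length + 2) + 1 := by
    have h1 := size_le_log (N ^ K)
    push_cast at h1
    rw [Real.log_pow] at h1
    have h2 := mul_le_mul_of_nonneg_left hlog (Nat.cast_nonneg (α := ℝ) K)
    linarith
  have hspace : ∀ c ≤ N, (((N ^ K).size + 6 * Nat.log 2 c + 3 : ℕ) : ℝ) ≤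
      (168 * K + 128) * Real.log (w.length + 2) := by
    intro c hc
    have h1 : (Nat.log 2 c : ℝ) ≤ 14 * Real.log (w.length + 2) := by
      have h2 := natLog_two_le N
      have h3 : (Nat.log 2 c : ℝ) ≤ Nat.log 2 N := by exact_mod_cast Nat.log_mono_right hc
      linarith
    have hK : 0 ≤ (K : ℝ) * Real.log (w.length + 2) := by positivity
    push_cast
    nlinarith
  by_cases hv : TreeGates.Valid w
  · obtain ⟨G₁, G₂, v₁, v₂, hw', h₁, h₂⟩ := TreeGates.exists_of_valid hv
    have henc : TreeGates.Encodes w G₁ G₂ v₁ v₂ := hw' ▸ TreeGates.encodes h₁ h₂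
    obtain ⟨val, hval⟩ := Gates.exists_val (henc.wellFounded_in h₁ h₂)
    -- The index is at most `2`, so a frame is at most `8 * 2 + 7 = 23`; it has at most `5` digits
    -- and, with its marker, `6` symbols.
    obtain ⟨hout, hsp⟩ := hyes hv le_rfl val (henc.spec h₁ h₂ hval) 6 fun p c hc _ => by
      have h1 := henc.index_le h₁ h₂ (p := p) hc
      have h2 : (8 * TreeGates.gates.index w p c + 7).size ≤ 5 := Nat.size_le.2 (by omega)
      omega
    refine ⟨fun hL => ?_, fun hL => ?_, hsp.mono (hspace _ ((countB_le _ _).trans ?_))⟩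
    -- The same values `val` are analysed for whichever instance witnesses membership, so
    -- injectivity of the encoding is not needed.
    · obtain ⟨G₁', G₂', v₁', v₂', hw'', h₁', h₂', hb⟩ := hL
      have henc' : TreeGates.Encodes w G₁' G₂' v₁' v₂' := hw'' ▸ TreeGates.encodes h₁' h₂'
      rwa [(henc'.val_start_iff h₁' h₂' hval).2 hb] at hout
    · have hf : val (TreeGates.gates.start w) = false := by
        rw [← Bool.not_eq_true]
        exact fun ht => hL ⟨G₁, G₂, v₁, v₂, hw', h₁, h₂, (henc.val_start_iff h₁ h₂ hval).1 ht⟩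
      rwa [hf] at hout
    · change 3 * ((w.length + 1) * (w.length + 1)) ≤ N
      omega
  · obtain ⟨hout, hsp⟩ := hno hv
    refine ⟨fun hL => ?_, fun _ => hout, hsp.mono ((hspace 0 (Nat.zero_le _)).trans' ?_)⟩
    · obtain ⟨G₁, G₂, v₁, v₂, rfl, h₁, h₂, -⟩ := hL
      exact absurd (TreeGates.valid_of_isTree h₁ h₂) hv
    · exact_mod_cast (by simp : (N ^ K).size + 3 ≤ (N ^ K).size + 6 * Nat.log 2 0 + 3)

end TapeProg

theorem mainTheorem1 :
    (∃ (M : OfflineTM InputSym) (C : ℝ), ∀ S : TreeCircuit, 2 ≤ S.width →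
      M.Outputs S.encode S.value ∧
        M.UsesSpaceAtMost S.encode
          (C * (Real.log S.maxSize + Real.log S.n * Real.log S.width))) ∧
    (∀ m : ℕ, ∃ (M : OfflineTM InputSym) (C : ℝ), ∀ S : TreeCircuit, S.width ≤ m →
      M.Outputs S.encode S.value ∧
        M.UsesSpaceAtMost S.encode (C * Real.log (S.encode.length + 2))) ∧
    InLogspace BisimTrees := by
  exact ⟨TapeProg.exists_machine_treeCircuit, TapeProg.exists_machine_treeCircuit_of_width_le,
    TapeProg.inLogspace_bisimTrees⟩
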